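/- Let $X$ be a finite set with $n$ elements, let $k$ be a positive integer with $k\le n/2$. A permutation group $G$ on $X$ has the \emph{strong $k$-ut property} if $G$ is primitive and, for any pairwise distinct $a_1,\dots,a_{k+1}\in X$ and any partition $P=\{A_1,\dots,A_k\}$ of $X$ into $k$ nonempty parts, there is $g\in G$ such that $\{a_1,\dots,a_k\}g$ is a section for $P$ (it meets each $A_i$ in exactly one point) and $a_1g$, $a_{k+1}g$ lie in the same part of $P$. \textbf{Theorem.} Let $n<11$, let $2\le k\le n/2$, and let $G\le S_n$. Then $G$ has the strong $k$-ut property if and only if $G$ contains the alternating group $A_n$, or one of the following holds, where $\cong$ denotes permutation isomorphism (a bijection of the domains carries one group onto the other): \begin{enumerate} \item $n=5$, $k=2$ and $G\cong \mathrm{AGL}(1,5)$; \item $n=6$, $k=2$ and $G\cong \mathrm{PSL}(2,5)$ or $\mathrm{PGL}(2,5)$; \item $n=7$, $k=2$ and $G\cong 7:3$, $\mathrm{AGL}(1,7)$ or $\mathrm{L}(3,2)$; \item $n=8$, $k=2$ and $G\cong \mathrm{AGL}(1,8)$, $\mathrm{A\Gamma L}(1,8)$, $\mathrm{ASL}(3,2)$,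 $\mathrm{PSL}(2,7)$ or $\mathrm{PGL}(2,7)$; \item $n=8$, $k=3$ and $G\cong \mathrm{A\Gamma L}(1,8)$, $\mathrm{ASL}(3,2)$, $\mathrm{PSL}(2,7)$ or $\mathrm{PGL}(2,7)$; \item $n=9$, $k=2$ and $G\cong \mathrm{M}_9$, $\mathrm{AGL}(1,9)$, $\mathrm{A\Gamma L}(1,9)$, $\mathrm{ASL}(2,3)=3^2:\mathrm{SL}(2,3)$, $\mathrm{AGL}(2,3)$, $\mathrm{PSL}(2,8)$ or $\mathrm{P\Gamma L}(2,8)$; \item $n=9$ and either $k=3$ and $G\cong \mathrm{PSL}(2,8)$, or $k\in\{3,4\}$ and $G\cong \mathrm{P\Gamma L}(2,8)$; \item $n=10$, $k=2$ and $G\cong \mathrm{PSL}(2,9)$, $\mathrm{PGL}(2,9)$, $\mathrm{P\Sigma L}(2,9)$, $\mathrm{M}_{10}$ or $\mathrm{P\Gamma L}(2,9)$; \item $n=10$, $k=3$ and $G\cong \mathrm{PGL}(2,9)$, $\mathrm{M}_{10}$ or $\mathrm{P\Gamma L}(2,9)$. \end{enumerate} Here the groups act naturally: the groups $\mathrm{AGL}(d,q)$,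 $\mathrm{ASL}(d,q)$ on $\mathrm{GF}(q)^d$ and $\mathrm{A\Gamma L}(1,q)$ on $\mathrm{GF}(q)$; $7:3$ is the group of maps $x\mapsto ax+b$ on $\mathrm{GF}(7)$ with $a^3=1$; $\mathrm{L}(3,2)=\mathrm{PSL}(3,2)$ acts on the $7$ points of the projective plane of order $2$; $\mathrm{PSL}(2,q)$, $\mathrm{PGL}(2,q)$, $\mathrm{P\Gamma L}(2,q)$ and $\mathrm{P\Sigma L}(2,q)$ (the extension of $\mathrm{PSL}(2,q)$ by the field automorphisms) act on the projective line $\mathrm{GF}(q)\cup\{\infty\}$. The group $\mathrm{M}_{10}$ consists of the permutations $z\mapsto\frac{az^\sigma+b}{cz^\sigma+d}$ of $\mathrm{GF}(9)\cup\{\infty\}$ with $ad-bc\ne0$, where $z^\sigma=z$ if $ad-bc$ is a square and $z^\sigma=z^3$ otherwise; $\mathrm{M}_9$ is its point stabilizer of $\infty$ acting on $\mathrm{GF}(9)$, i.e. the maps $x\mapsto ax^\sigma+b$, $a\neq0$, with $x^\sigma=x$ if $a$ is a square and $x^\sigma=x^3$ otherwise. -/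

import Mathlib

open Equiv
open scoped LinearAlgebra.Projectivization MatrixGroups

noncomputable section

/-! ### The strong universal transversal property -/

/-- An ordered `k`-partition of `X` is given by a surjection `P : X → Fin k`, whose fibres are the
(nonempty, pairwise disjoint) parts.  The set `S` is a section (transversal) for `P` if it meets
every part in exactly one point. -/
def IsSectionFor {X : Type*} {k : ℕ} (S : Set X) (P : X → Fin k) : Prop :=
  ∀ i : Fin k, ∃! x : X, x ∈ S ∧ P x = i

/-- The strong `k`-universal transversal property of a permutation group `G` on `X`:
`G` is primitive and for all pairwise distinct `a₁, …, aₖ₊₁` in `X` and every `k`-partition `P`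
there is `g ∈ G` such that the image of `{a₁, …, aₖ}` under `g` is a section for `P`
and the images of `a₁` and `aₖ₊₁` lie in the same part of `P`. -/
structure HasStrongUT {X : Type*} (G : Subgroup (Perm X)) (k : ℕ) : Prop where
  primitive : MulAction.IsPreprimitive G X
  exists_section : ∀ a : Fin (k + 1) → X, Function.Injective a →
    ∀ P : X → Fin k, Function.Surjective P →
      ∃ g ∈ G, IsSectionFor (g '' {x | ∃ i : Fin k, x = a i.castSucc}) P ∧
        P (g (a 0)) = P (g (a (Fin.last k)))

/-- Two permutation groups are permutation isomorphic if a bijection between their domains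
carries one onto the other. -/
def PermIso {X Y : Type*} (G : Subgroup (Perm X)) (H : Subgroup (Perm Y)) : Prop :=
  ∃ e : X ≃ Y, G.map e.permCongrHom.toMonoidHom = H

instance factPrimeFive : Fact (Nat.Prime 5) := ⟨by norm_num⟩

instance factPrimeSeven : Fact (Nat.Prime 7) := ⟨by norm_num⟩

/-! ### Affine groups -/

/-- The affine semilinear permutation `x ↦ a σ(x) + b` of the field `K`. -/
def affinePerm {K : Type*} [Field K] (a : Kˣ) (σ : RingAut K) (b : K) : Perm K where
  toFun x := a * σ x + b
  invFun y := σ⁻¹ ((a⁻¹ : Kˣ) * (y - b))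
  left_inv x := by simp
  right_inv y := by simp

theorem affinePerm_apply {K : Type*} [Field K] (a : Kˣ) (σ : RingAut K) (b x : K) :
    affinePerm a σ b x = a * σ x + b := rfl

theorem affinePerm_one {K : Type*} [Field K] :
    affinePerm (1 : Kˣ) (1 : RingAut K) 0 = 1 := by
  ext x; simp [affinePerm_apply]

theorem affinePerm_mul {K : Type*} [Field K] (a c : Kˣ) (σ τ : RingAut K) (b d : K) :
    affinePerm a σ b * affinePerm c τ d =
      affinePerm (a * Units.map σ c) (σ * τ) (a * σ d + b) := by
  ext x; simp [affinePerm_apply]; ring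

theorem affinePerm_inv {K : Type*} [Field K] (a : Kˣ) (σ : RingAut K) (b : K) :
    (affinePerm a σ b)⁻¹ =
      affinePerm (Units.map ((σ⁻¹ : RingAut K) : K →* K) a⁻¹) σ⁻¹
        (-(σ⁻¹ ((a⁻¹ : Kˣ) * b))) := by
  rw [inv_eq_iff_mul_eq_one, affinePerm_mul]
  ext x
  simp [affinePerm_apply]

/-- The group of all `x ↦ a σ(x) + b` for which the pair `(a, σ)` satisfies the condition `C`;
the three proof arguments say that these permutations form a group. -/
def affineLineGroup {K : Type*} [Field K] (C : Kˣ → RingAut K → Prop) (one : C 1 1)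
    (mul : ∀ a c σ τ, C a σ → C c τ → C (a * Units.map σ c) (σ * τ))
    (inv : ∀ a σ, C a σ → C (Units.map ((σ⁻¹ : RingAut K) : K →* K) a⁻¹) σ⁻¹) :
    Subgroup (Perm K) where
  carrier := {f | ∃ a σ b, C a σ ∧ f = affinePerm a σ b}
  one_mem' := ⟨1, 1, 0, one, affinePerm_one.symm⟩
  mul_mem' := by
    rintro _ _ ⟨a, σ, b, h, rfl⟩ ⟨c, τ, d, h', rfl⟩
    exact ⟨_, _, _, mul _ _ _ _ h h', affinePerm_mul ..⟩
  inv_mem' := by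
    rintro _ ⟨a, σ, b, h, rfl⟩
    exact ⟨_, _, _, inv _ _ h, affinePerm_inv ..⟩

/-- `AGL(1, K)`, all `x ↦ a x + b`. -/
def AGL1 (K : Type*) [Field K] : Subgroup (Perm K) :=
  affineLineGroup (fun _ σ => σ = 1) rfl (by rintro _ _ _ _ rfl rfl; simp) (by rintro _ _ rfl; simp)

/-- `AΓL(1, K)`, all `x ↦ a σ(x) + b`. -/
def AGammaL1 (K : Type*) [Field K] : Subgroup (Perm K) :=
  affineLineGroup (fun _ _ => True) trivial (by simp) (by simp)

/-- The Frobenius group `7 : 3` of degree `7`, all `x ↦ a x + b` over the field with `7` elements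
with `a ^ 3 = 1`. -/
def Frobenius21 : Subgroup (Perm (ZMod 7)) :=
  affineLineGroup (fun a σ => a ^ 3 = 1 ∧ σ = 1) (by simp)
    (by rintro a c _ _ ⟨ha, rfl⟩ ⟨hc, rfl⟩
        refine ⟨?_, by simp⟩
        rw [mul_pow, ha, one_mul, ← map_pow, hc, map_one])
    (by rintro a _ ⟨ha, rfl⟩
        refine ⟨?_, by simp⟩
        rw [← map_pow, inv_pow, ha, inv_one]
        exact map_one _)

/-- The group `AGL(V)` of all invertible affine maps of the `K`-vector space `V`. -/
def AGL (K V : Type*) [Field K] [AddCommGroup V] [Module K V] : Subgroup (Perm V) where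
  carrier := {f | ∃ e : V ≃ᵃ[K] V, f = e.toEquiv}
  one_mem' := ⟨1, rfl⟩
  mul_mem' := by
    rintro _ _ ⟨e, rfl⟩ ⟨e', rfl⟩
    exact ⟨e * e', rfl⟩
  inv_mem' := by
    rintro _ ⟨e, rfl⟩
    exact ⟨e⁻¹, rfl⟩

/-- The group `ASL(V)` of all affine maps of `V` whose linear part has determinant `1`. -/
def ASL (K V : Type*) [Field K] [AddCommGroup V] [Module K V] : Subgroup (Perm V) where
  carrier := {f | ∃ e : V ≃ᵃ[K] V, LinearEquiv.det e.linear = 1 ∧ f = e.toEquiv}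
  one_mem' := ⟨1, map_one LinearEquiv.det, rfl⟩
  mul_mem' := by
    rintro _ _ ⟨e, h, rfl⟩ ⟨e', h', rfl⟩
    refine ⟨e * e', ?_, rfl⟩
    have : (e * e').linear = e.linear * e'.linear := rfl
    rw [this, map_mul, h, h', one_mul]
  inv_mem' := by
    rintro _ ⟨e, h, rfl⟩
    refine ⟨e⁻¹, ?_, rfl⟩
    have : (e⁻¹).linear = (e.linear)⁻¹ := rfl
    rw [this, map_inv, h, inv_one]

/-! ### Groups on projective spaces -/

/-- `L(3, 2) = PSL(3, 2)` on the seven points of the projective plane of order `2`. -/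
def L32 : Subgroup (Perm (ℙ (ZMod 2) (Fin 3 → ZMod 2))) :=
  (MulAction.toPermHom SL(3, ZMod 2) (ℙ (ZMod 2) (Fin 3 → ZMod 2))).range

/-- The semilinear fractional permutation `z ↦ (a σ(z) + b) / (c σ(z) + d)` of the projective line
`K ∪ {∞}`, for `A = !![a, b; c, d]`, with `σ ∞ = ∞`. -/
def moebiusPerm {K : Type*} [Field K] [DecidableEq K] (A : GL (Fin 2) K) (σ : RingAut K) :
    Perm (OnePoint K) where
  toFun z := A • OnePoint.map σ z
  invFun z := OnePoint.map (σ⁻¹ : RingAut K) (A⁻¹ • z)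
  left_inv z := by cases z <;> simp
  right_inv z := by
    rw [smul_eq_iff_eq_inv_smul]
    have h : ∀ w : OnePoint K, OnePoint.map σ (OnePoint.map (σ⁻¹ : RingAut K) w) = w := by
      intro w
      cases w <;> simp
    exact h _

theorem moebiusPerm_apply {K : Type*} [Field K] [DecidableEq K] (A : GL (Fin 2) K)
    (σ : RingAut K) (z : OnePoint K) : moebiusPerm A σ z = A • OnePoint.map σ z := rfl

theorem moebiusPerm_one {K : Type*} [Field K] [DecidableEq K] :
    moebiusPerm (1 : GL (Fin 2) K) (1 : RingAut K) = 1 := by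
  ext z; cases z <;> simp [moebiusPerm_apply]

theorem moebiusPerm_mul {K : Type*} [Field K] [DecidableEq K] (A B : GL (Fin 2) K)
    (σ τ : RingAut K) :
    moebiusPerm A σ * moebiusPerm B τ = moebiusPerm (A * B.map (σ : K →+* K)) (σ * τ) := by
  ext1 z
  have h := OnePoint.map_smul (σ : K →+* K) B (OnePoint.map τ z)
  have h2 : OnePoint.map (σ * τ : RingAut K) z =
      OnePoint.map (σ : K →+* K) (OnePoint.map τ z) := by cases z <;> simp
  rw [Perm.mul_apply, moebiusPerm_apply, moebiusPerm_apply, moebiusPerm_apply, h2, mul_smul, ← h]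
  rfl

theorem moebiusPerm_inv {K : Type*} [Field K] [DecidableEq K] (A : GL (Fin 2) K)
    (σ : RingAut K) :
    (moebiusPerm A σ)⁻¹ = moebiusPerm (A⁻¹.map ((σ⁻¹ : RingAut K) : K →+* K)) σ⁻¹ := by
  rw [inv_eq_iff_mul_eq_one, moebiusPerm_mul, mul_inv_cancel, ← moebiusPerm_one]
  have : (A⁻¹.map ((σ⁻¹ : RingAut K) : K →+* K)).map (σ : K →+* K) = A⁻¹ := by
    apply Matrix.GeneralLinearGroup.ext
    intro i j
    have h : ⇑σ ∘ ⇑(σ⁻¹) = id := by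
      ext x
      simp
    simp [h]
  rw [this, mul_inv_cancel]

/-- The group of all `z ↦ (a σ(z) + b) / (c σ(z) + d)` on `K ∪ {∞}` for which the pair
`(a d - b c, σ)` satisfies the condition `C`;
the three proof arguments say that these permutations form a group. -/
def projLineGroup {K : Type*} [Field K] [DecidableEq K] (C : Kˣ → RingAut K → Prop) (one : C 1 1)
    (mul : ∀ a c σ τ, C a σ → C c τ → C (a * Units.map σ c) (σ * τ))
    (inv : ∀ a σ, C a σ → C (Units.map ((σ⁻¹ : RingAut K) : K →* K) a⁻¹) σ⁻¹) :
    Subgroup (Perm (OnePoint K)) where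
  carrier := {f | ∃ A σ, C (Matrix.GeneralLinearGroup.det A) σ ∧ f = moebiusPerm A σ}
  one_mem' := ⟨1, 1, by simpa using one, moebiusPerm_one.symm⟩
  mul_mem' := by
    rintro _ _ ⟨A, σ, h, rfl⟩ ⟨B, τ, h', rfl⟩
    refine ⟨_, _, ?_, moebiusPerm_mul ..⟩
    rw [map_mul, Matrix.GeneralLinearGroup.map_det]
    exact mul _ _ _ _ h h'
  inv_mem' := by
    rintro _ ⟨A, σ, h, rfl⟩
    refine ⟨_, _, ?_, moebiusPerm_inv ..⟩
    rw [Matrix.GeneralLinearGroup.map_det, map_inv]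
    exact inv _ _ h

/-- `PGL(2, K)` on the projective line `K ∪ {∞}`. -/
def PGL2 (K : Type*) [Field K] [DecidableEq K] : Subgroup (Perm (OnePoint K)) :=
  (MulAction.toPermHom (GL (Fin 2) K) (OnePoint K)).range

/-- `PSL(2, K)` on the projective line `K ∪ {∞}`. -/
def PSL2 (K : Type*) [Field K] [DecidableEq K] : Subgroup (Perm (OnePoint K)) :=
  ((MulAction.toPermHom (GL (Fin 2) K) (OnePoint K)).comp
    Matrix.SpecialLinearGroup.toGL).range

/-- `PΓL(2, K)` on the projective line `K ∪ {∞}`. -/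
def PGammaL2 (K : Type*) [Field K] [DecidableEq K] : Subgroup (Perm (OnePoint K)) :=
  projLineGroup (fun _ _ => True) trivial (by simp) (by simp)

/-- `PΣL(2, K)` on the projective line `K ∪ {∞}`, that is,
`PSL(2, K)` extended by the field automorphisms. -/
def PSigmaL2 (K : Type*) [Field K] [DecidableEq K] : Subgroup (Perm (OnePoint K)) :=
  projLineGroup (fun d _ => d = 1) rfl (by rintro _ _ _ _ rfl rfl; simp) (by rintro _ _ rfl; simp)

/-! ### The fields with `8` and `9` elements, and the groups `M₉` and `M₁₀` -/

/-- The field with `8` elements. -/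
abbrev GF8 : Type := GaloisField 2 3

/-- The field with `9` elements. -/
abbrev GF9 : Type := GaloisField 3 2

instance decEqGF8 : DecidableEq GF8 := Classical.decEq _

instance decEqGF9 : DecidableEq GF9 := Classical.decEq _

/-- `a` is a square and `σ` is the identity, or `a` is a nonsquare and `σ` is `x ↦ x ^ 3`. -/
def MathieuTwist (a : GF9ˣ) (σ : RingAut GF9) : Prop :=
  (IsSquare (a : GF9) ∧ σ = 1) ∨ (¬ IsSquare (a : GF9) ∧ ∀ x, σ x = x ^ 3)

theorem MathieuTwist.one : MathieuTwist 1 1 := Or.inl ⟨by simp, rfl⟩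

theorem card_GF9 : Nat.card GF9 = 9 := by
  rw [GaloisField.card 3 2 (by norm_num)]; norm_num

theorem isSquare_ringAut_GF9 (σ : RingAut GF9) (x : GF9) : IsSquare (σ x) ↔ IsSquare x := by
  refine ⟨fun h => ?_, fun h => h.map σ⟩
  have := h.map (σ⁻¹ : RingAut GF9)
  simpa using this

theorem isSquare_mul_GF9 (a c : GF9ˣ) :
    IsSquare ((a : GF9) * c) ↔ (IsSquare (a : GF9) ↔ IsSquare (c : GF9)) := by
  let _ : Fintype GF9 := Fintype.ofFinite _
  have ha := quadraticChar_one_iff_isSquare a.ne_zero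
  have hc := quadraticChar_one_iff_isSquare c.ne_zero
  have hac := quadraticChar_one_iff_isSquare (mul_ne_zero a.ne_zero c.ne_zero)
  rw [← hac, ← ha, ← hc, map_mul]
  rcases quadraticChar_dichotomy a.ne_zero with h | h <;>
  rcases quadraticChar_dichotomy c.ne_zero with h' | h' <;> rw [h, h'] <;> decide

theorem MathieuTwist.mul (a c : GF9ˣ) (σ τ : RingAut GF9) (h : MathieuTwist a σ)
    (h' : MathieuTwist c τ) : MathieuTwist (a * Units.map σ c) (σ * τ) := by
  have key : IsSquare ((a * Units.map (σ : GF9 →* GF9) c : GF9ˣ) : GF9) ↔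
      (IsSquare (a : GF9) ↔ IsSquare (c : GF9)) := by
    rw [Units.val_mul, isSquare_mul_GF9]
    exact iff_congr Iff.rfl (isSquare_ringAut_GF9 σ c)
  unfold MathieuTwist at *
  rw [key]
  rcases h with ⟨h, rfl⟩ | ⟨h, hσ⟩ <;> rcases h' with ⟨h', rfl⟩ | ⟨h', hτ⟩
  · exact Or.inl ⟨by simp [h, h'], rfl⟩
  · exact Or.inr ⟨by simp [h, h'], by simpa using hτ⟩
  · exact Or.inr ⟨by simp [h, h'], by simpa using hσ⟩
  · refine Or.inl ⟨by simp [h, h'], ?_⟩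
    ext x
    let _ : Fintype GF9 := Fintype.ofFinite _
    have := FiniteField.pow_card x
    rw [← Nat.card_eq_fintype_card, card_GF9] at this
    rw [RingAut.mul_apply, hτ, hσ, ← pow_mul, this, RingAut.one_apply]

theorem MathieuTwist.inv (a : GF9ˣ) (σ : RingAut GF9) (h : MathieuTwist a σ) :
    MathieuTwist (Units.map ((σ⁻¹ : RingAut GF9) : GF9 →* GF9) a⁻¹) σ⁻¹ := by
  have key : IsSquare ((Units.map ((σ⁻¹ : RingAut GF9) : GF9 →* GF9) a⁻¹ : GF9ˣ) : GF9) ↔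
      IsSquare (a : GF9) := by
    refine (isSquare_ringAut_GF9 σ⁻¹ _).trans ?_
    rw [Units.val_inv_eq_inv_val, isSquare_inv]
  unfold MathieuTwist at *
  rw [key]
  rcases h with ⟨h, rfl⟩ | ⟨h, hσ⟩
  · exact Or.inl ⟨h, inv_one⟩
  · refine Or.inr ⟨h, fun x => σ.injective ?_⟩
    let _ : Fintype GF9 := Fintype.ofFinite _
    have := FiniteField.pow_card x
    rw [← Nat.card_eq_fintype_card, card_GF9] at this
    rw [hσ (x ^ 3), ← pow_mul, this]
    simp

/-- `M₉`, the sharply `2`-transitive group of all `x ↦ a σ(x) + b` over the field with `9` elements,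
where `σ` is the identity if `a` is a square and `σ` is the cube map otherwise.  It is the
stabilizer of `∞` in `M₁₀`, acting on the other nine points. -/
def M9 : Subgroup (Perm GF9) :=
  affineLineGroup MathieuTwist MathieuTwist.one MathieuTwist.mul MathieuTwist.inv

/-- `M₁₀`, the sharply `3`-transitive group of all `z ↦ (a σ(z) + b) / (c σ(z) + d)` over the field
with `9` elements, where `σ` is the identity if `a d - b c` is a square and `σ` is the cube map
otherwise. -/
def M10 : Subgroup (Perm (OnePoint GF9)) :=
  projLineGroup MathieuTwist MathieuTwist.one MathieuTwist.mul MathieuTwist.inv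

end

/-! The property is invariant under permutation isomorphism and passes to overgroups. A group having
it is shown to contain the alternating group or to be conjugate to one of finitely many groups given
by generators, and each of these is then tested for every admissible `k`.

Invariant graphs. For distinct `x`, `y`, `z` and any `k`-partition, the property gives an element of
`G` moving `x` and `z` into one part and `y` into another (`HasStrongUT.exists_triple`). Hence a
`G`-invariant graph is impossible if some adjacency pattern of triples occurs in it, but never on
triples placed in this way with respect to some partition. It is also impossible if vertices differ
in degree or in the number of triangles. Up to conjugacy `G` contains one fixed permutation of prime
order, so every invariant graph is a union of orbits of that permutation on pairs. There are at most
`2 ^ 12` such unions, and all except the empty and the complete graph are excluded. So `G` is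
transitive on unordered pairs unless it contains the alternating group
(`twoHomogeneous_of_graphTest`, `HasStrongUT.alternatingGroup_le_or_twoHomogeneous`).

Classification of pair-transitive groups. By Jordan's theorem a primitive group containing a
3-cycle, or a cycle of prime length with at least three fixed points, contains the alternating group
(`alternatingGroup_le_of_primeCycle`). Cauchy's theorem gives a first element in standard form. A
second element of restricted shape comes from transitivity, from another prime divisor of the order,
or from a Sylow subgroup: if the group is transitive on a set of prime power size, so is its Sylow
subgroup, which has a central element without fixed points on that set
(`exists_transitive_pSubgroup`, `exists_central_of_isPGroup`). A search runs through all candidates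
for the second element. For each one, either a word in the known elements has a power to which
Jordan's theorem applies, or words generate a conjugate of a smaller known group, and further
elements are added if necessary. Once a listed group `H` lies in `G`, multiplication by `H` brings
every element of `G` into a normal form along a chain of point stabilizers
(`exists_mul_isNormalFor`). The same test applied to normal forms leaves a short list, and the
members of it lying in `G` determine `G` (`IsClassified.of_normal`).

Testing the listed groups. If the property fails, one tuple and one partition witness this: the
orbit of a labelling of the points of the tuple is listed and no member fits the partition
(`not_hasStrongUT_of_orbitCheck`). If it holds, tuples and partitions are checked exhaustively up to
the action of `G`; by the pigeonhole principle some part has `t` points, and these can be moved to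
`0, …, t - 1` (`hasStrongUT_of_sectionCheck`). The alternating group is treated directly.

Identification. Affine and fractional linear groups are generated by `x + 1`, `u x`, `-1 / x` and
some semilinear maps, linear groups by transvections and diagonal matrices. Comparing these with the
lists of codes identifies the listed groups with the named ones. -/

/-! ### Permutations as hexadecimal numbers -/

/-- The `i`-th hexadecimal digit of `c`. -/
def digit (c i : ℕ) : ℕ := Nat.land (Nat.shiftRight c (Nat.mul 4 i)) 15

/-- The number with hexadecimal digits `f 0, …, f (n - 1)`. -/
noncomputable def ofDigits16 (f : ℕ → ℕ) (n : ℕ) : ℕ :=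
  Nat.rec 0 (fun k r => Nat.add r (Nat.mul (f k) (Nat.pow 16 k))) n

theorem digit_eq (c i : ℕ) : digit c i = c / 16 ^ i % 16 := by
  have h1 : digit c i = (c >>> (4 * i)) &&& (2 ^ 4 - 1) := rfl
  rw [h1, Nat.and_two_pow_sub_one_eq_mod, Nat.shiftRight_eq_div_pow, pow_mul]; norm_num

theorem ofDigits16_succ (f : ℕ → ℕ) (n : ℕ) :
    ofDigits16 f (n + 1) = ofDigits16 f n + f n * 16 ^ n := rfl

theorem ofDigits16_lt {f : ℕ → ℕ} {n : ℕ} (hf : ∀ j < n, f j < 16) : ofDigits16 f n < 16 ^ n := by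
  induction n with
  | zero => exact Nat.one_pos
  | succ n ih =>
    have h1 := ih fun j hj => hf j (by omega)
    have h2 := hf n (by omega)
    rw [ofDigits16_succ, pow_succ]
    nlinarith [Nat.mul_le_mul_right (16 ^ n) (show f n ≤ 15 by omega)]

theorem digit_add_mul {a n v : ℕ} (ha : a < 16 ^ n) (hv : v < 16) (i : ℕ) :
    digit (a + v * 16 ^ n) i = if i = n then v else digit a i := by
  simp only [digit_eq]
  split_ifs with h
  · subst h
    rw [Nat.add_mul_div_right _ _ (by positivity), Nat.div_eq_of_lt ha, zero_add, Nat.mod_eq_of_lt hv]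
  · rcases lt_or_gt_of_ne h with h | h
    · obtain ⟨m, rfl⟩ := Nat.exists_eq_add_of_lt h
      have : v * 16 ^ (i + m + 1) = (v * 16 ^ m * 16) * 16 ^ i := by ring
      rw [this, Nat.add_mul_div_right _ _ (by positivity), Nat.add_mul_mod_self_right]
    · obtain ⟨m, rfl⟩ := Nat.exists_eq_add_of_lt h
      have hlt : a + v * 16 ^ n < 16 ^ (n + m + 1) := by
        have : 16 ^ (n + m + 1) = 16 * 16 ^ m * 16 ^ n := by ring
        have h3 : 1 ≤ 16 ^ m := Nat.one_le_pow _ _ (by norm_num)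
        have h4 : 16 * 16 ^ n ≤ 16 * 16 ^ m * 16 ^ n := by nlinarith [Nat.one_le_pow n 16 (by norm_num)]
        nlinarith [Nat.mul_le_mul_right (16 ^ n) (show v ≤ 15 by omega)]
      rw [Nat.div_eq_of_lt hlt, Nat.div_eq_of_lt (by omega)]

theorem digit_ofDigits16 {f : ℕ → ℕ} {n : ℕ} (hf : ∀ j < n, f j < 16) {i : ℕ} (hi : i < n) :
    digit (ofDigits16 f n) i = f i := by
  induction n with
  | zero => omega
  | succ n ih =>
    rw [ofDigits16_succ, digit_add_mul (ofDigits16_lt fun j hj => hf j (by omega)) (hf n (by omega))]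
    split_ifs with h
    · rw [h]
    · exact ih (fun j hj => hf j (by omega)) (by omega)

/-- The number `c` has as digits the values of the permutation `g`. -/
def IsCode {n : ℕ} (g : Perm (Fin n)) (c : ℕ) : Prop := ∀ i : Fin n, digit c i = g i

/-- Composition of permutations on the level of digits. -/
noncomputable def comp (n c d : ℕ) : ℕ := ofDigits16 (fun k => digit c (digit d k)) n

/-- The code of the identity. -/
noncomputable def idCode (n : ℕ) : ℕ := ofDigits16 (fun k => k) n

theorem digit_lt (c i : ℕ) : digit c i < 16 := by
  rw [digit_eq]; exact Nat.mod_lt _ (by norm_num)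

variable {n : ℕ}

theorem IsCode.comp {g h : Perm (Fin n)} {c d : ℕ} (hg : IsCode g c) (hh : IsCode h d) :
    IsCode (g * h) (comp n c d) := by
  intro i
  rw [_root_.comp, digit_ofDigits16 (fun _ _ => digit_lt _ _) i.2, hh, hg, Perm.mul_apply]

theorem IsCode.one (hn : n ≤ 16) : IsCode (1 : Perm (Fin n)) (idCode n) := by
  intro i
  rw [idCode, digit_ofDigits16 (fun _ _ => by omega) i.2, Perm.one_apply]

/-- A code determines the permutation but not conversely, since digits from position `n` on are
ignored. -/
theorem IsCode.unique {g h : Perm (Fin n)} {c : ℕ} (hg : IsCode g c) (hh : IsCode h c) : g = h := by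
  ext i; rw [← hg, ← hh]

/-- `c` is the code of a permutation of `n` points. -/
def validCode (n c : ℕ) : Bool :=
  decide (∀ i : Fin n, digit c i < n) && decide (∀ i j : Fin n, digit c i = digit c j → i = j)

/-- The permutation with code `c`. -/
noncomputable def permOf (n c : ℕ) : Perm (Fin n) :=
  if h : validCode n c = true then
    Equiv.ofBijective (fun i : Fin n => (⟨digit c i, by simp [validCode] at h; exact h.1 i⟩ : Fin n))
      (Finite.injective_iff_bijective.1 fun i j hij => by
        simp [validCode] at h; exact h.2 i j (by simpa using hij))
  else 1

theorem isCode_permOf {c : ℕ} (h : validCode n c = true) : IsCode (permOf n c) c := by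
  intro i
  rw [permOf, dif_pos h]
  rfl

theorem nat_beq_false_of_ne {a b : ℕ} (h : a ≠ b) : Nat.beq a b = false := by
  cases hb : Nat.beq a b
  · rfl
  · exact absurd (Nat.eq_of_beq_eq_true hb) h

/-! ### Enumerating permutations -/

/-- Evaluate the number `m` before handing it to `f`. -/
noncomputable def force {α : Type} (m : ℕ) (f : ℕ → α) : α := Nat.rec (f 0) (fun k _ => f (Nat.succ k)) m

theorem force_eq {α : Type} (m : ℕ) (f : ℕ → α) : force m f = f m := by cases m <;> rfl

/-- `P` holds at all numbers below `m`. -/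
noncomputable def allBelow (m : ℕ) (P : ℕ → Bool) : Bool :=
  Nat.rec true (fun k r => cond (P k) r false) m

theorem allBelow_iff {m : ℕ} {P : ℕ → Bool} : allBelow m P = true ↔ ∀ v < m, P v = true := by
  induction m with
  | zero => simp [allBelow]
  | succ m ih =>
    have : allBelow (m + 1) P = cond (P m) (allBelow m P) false := rfl
    rw [this]
    cases h : P m
    · simp only [cond_false, Bool.false_eq_true, false_iff, not_forall]
      exact ⟨m, by omega, by simp [h]⟩
    · rw [cond_true, ih]
      refine ⟨fun H v hv => ?_, fun H v hv => H v (by omega)⟩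
      rcases Nat.lt_succ_iff_lt_or_eq.1 hv with h' | rfl
      · exact H v h'
      · exact h

/-- Depth first search through all permutations of `n` points: `acc` has the digits of the first
`i` values, `used` is the bit mask of these values, and `k` values are still to be chosen.
Branches violating `prune` are cut, and `test` is applied at the leaves. -/
noncomputable def searchPerm (n : ℕ) (prune : ℕ → ℕ → Bool) (test : ℕ → Bool) (k : ℕ) :
    ℕ → ℕ → ℕ → Bool :=
  Nat.rec (fun _ acc _ => test acc)
    (fun _ r i acc used => force (Nat.succ i) fun i' => force (Nat.pow 16 i) fun w =>
      allBelow n fun v => cond (Nat.testBit used v) true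
        (force (Nat.add acc (Nat.mul v w)) fun acc' =>
          cond (prune i' acc') (force (Nat.lor used (Nat.shiftLeft 1 v)) (r i' acc')) true))
    k

/-- Follow the branch in which each position receives its value under `g`. That value is still
unused because `g` is injective, and by hypothesis the branch is never pruned; so the search reaches
a leaf carrying the first `m` values of `g` and applies the test there. -/
theorem searchPerm_sound_aux {prune : ℕ → ℕ → Bool} {test : ℕ → Bool} (hn : n ≤ 16)
    (g : Perm (Fin n))
    (hg : ∀ i acc, i ≤ n → (∀ j : Fin n, (j : ℕ) < i → digit acc j = g j) → prune i acc = true)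
    {m : ℕ} (hm : m ≤ n) (k : ℕ) : ∀ i acc used, i + k = m → acc < 16 ^ i →
      (∀ j : Fin n, (j : ℕ) < i → digit acc j = g j) →
      (∀ v : Fin n, Nat.testBit used v = true → ∃ j : Fin n, (j : ℕ) < i ∧ g j = v) →
      searchPerm n prune test k i acc used = true →
        ∃ c, (∀ j : Fin n, (j : ℕ) < m → digit c j = g j) ∧ test c = true := by
  induction k with
  | zero =>
    intro i acc used hi _ hacc _ h
    exact ⟨acc, fun j hj => hacc j (by omega), h⟩
  | succ k ih =>
    intro i acc used hi hlt hacc hused h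
    have h0 : searchPerm n prune test (k + 1) i acc used =
      force (Nat.succ i) fun i' => force (Nat.pow 16 i) fun w => allBelow n fun v =>
        cond (Nat.testBit used v) true
          (force (Nat.add acc (Nat.mul v w)) fun acc' =>
            cond (prune i' acc') (force (Nat.lor used (Nat.shiftLeft 1 v))
              (searchPerm n prune test k i' acc')) true) := rfl
    rw [h0, force_eq, force_eq, allBelow_iff] at h
    have hin : i < n := by omega
    have hv := (g ⟨i, hin⟩).2
    have h1 := h (g ⟨i, hin⟩) hv
    have hb : Nat.testBit used (g ⟨i, hin⟩) = false := by
      by_contra hb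
      obtain ⟨j, hj, hj'⟩ := hused _ (by simpa using hb)
      have := g.injective hj'
      simp [this] at hj
    rw [hb, cond_false, force_eq, force_eq] at h1
    have hacc' : ∀ j : Fin n, (j : ℕ) < i + 1 →
        digit (acc + (g ⟨i, hin⟩ : ℕ) * 16 ^ i) j = g j := by
      intro j hj
      rw [digit_add_mul hlt (by omega)]
      split_ifs with hji
      · congr 2; exact Fin.ext hji.symm
      · exact hacc j (by omega)
    have hp := hg (i + 1) (acc + (g ⟨i, hin⟩ : ℕ) * 16 ^ i) (by omega) hacc'
    change cond (prune (i + 1) (acc + (g ⟨i, hin⟩ : ℕ) * 16 ^ i)) _ true = true at h1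
    rw [hp, cond_true] at h1
    refine ih (i + 1) _ _ (by omega) ?_ hacc' ?_ h1
    · rw [pow_succ]
      nlinarith [Nat.mul_le_mul_right (16 ^ i) (show (g ⟨i, hin⟩ : ℕ) ≤ 15 by omega)]
    · intro v hvb
      change Nat.testBit (used ||| (1 <<< (g ⟨i, hin⟩ : ℕ))) v = true at hvb
      rw [Nat.testBit_or, Bool.or_eq_true] at hvb
      rcases hvb with hvb | hvb
      · obtain ⟨j, hj, hj'⟩ := hused v hvb
        exact ⟨j, by omega, hj'⟩
      · rw [Nat.one_shiftLeft, Nat.testBit_two_pow] at hvb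
        exact ⟨⟨i, hin⟩, by simp, Fin.ext (by simpa using hvb)⟩

/-- If the search for the first `m` values succeeds, these values pass the test for every permutation
that is never pruned. -/
theorem searchPerm_sound_of_le {prune : ℕ → ℕ → Bool} {test : ℕ → Bool} (hn : n ≤ 16) {m : ℕ}
    (hm : m ≤ n) (h : searchPerm n prune test m 0 0 0 = true) (g : Perm (Fin n))
    (hg : ∀ i acc, i ≤ n → (∀ j : Fin n, (j : ℕ) < i → digit acc j = g j) → prune i acc = true) :
    ∃ c, (∀ j : Fin n, (j : ℕ) < m → digit c j = g j) ∧ test c = true :=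
  searchPerm_sound_aux hn g hg hm m 0 0 0 (by omega) (by norm_num) (by simp) (by simp) h

/-- If the search succeeds, every permutation that is never pruned passes the test. -/
theorem searchPerm_sound {prune : ℕ → ℕ → Bool} {test : ℕ → Bool} (hn : n ≤ 16)
    (h : searchPerm n prune test n 0 0 0 = true) (g : Perm (Fin n))
    (hg : ∀ i acc, i ≤ n → (∀ j : Fin n, (j : ℕ) < i → digit acc j = g j) → prune i acc = true) :
    ∃ c, IsCode g c ∧ test c = true := by
  obtain ⟨c, hc, ht⟩ := searchPerm_sound_of_le hn le_rfl h g hg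
  exact ⟨c, fun j => hc j j.2, ht⟩


/-! ### Searching the permutations with prescribed fixed points whose other cycles have length
three. -/

theorem digit_lor (a b j : ℕ) : digit (Nat.lor a b) j = Nat.lor (digit a j) (digit b j) := by
  change ((a ||| b) >>> (4 * j)) &&& 15 = (a >>> (4 * j) &&& 15) ||| (b >>> (4 * j) &&& 15)
  apply Nat.eq_of_testBit_eq
  intro t
  simp only [Nat.testBit_and, Nat.testBit_shiftRight, Nat.testBit_or, Bool.and_or_distrib_right]

theorem digit_shiftLeft {v : ℕ} (hv : v < 16) (i j : ℕ) :
    digit (Nat.shiftLeft v (4 * i)) j = if j = i then v else 0 := by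
  have h1 : Nat.shiftLeft v (4 * i) = 0 + v * 16 ^ i := by
    change v <<< (4 * i) = _
    rw [Nat.shiftLeft_eq, pow_mul]; norm_num
  rw [h1, digit_add_mul (by positivity) hv]
  simp [digit_eq]

/-- Set the digits `i ↦ a`, `a ↦ b`, `b ↦ i` in `acc`. -/
noncomputable def addThreeCycle (acc i a b : ℕ) : ℕ :=
  Nat.lor acc (Nat.lor (Nat.shiftLeft a (Nat.mul 4 i))
    (Nat.lor (Nat.shiftLeft b (Nat.mul 4 a)) (Nat.shiftLeft i (Nat.mul 4 b))))

/-- Depth first search through all permutations of `n` points all of whose cycles outside the set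
with bit mask `mask` have length three. -/
noncomputable def searchThreeCycles (n : ℕ) (test : ℕ → Bool) (k : ℕ) : ℕ → ℕ → ℕ → Bool :=
  Nat.rec (fun _ acc _ => test acc)
    (fun _ r i acc mask => force (Nat.succ i) fun i' => cond (Nat.testBit mask i) (r i' acc mask)
      (allBelow n fun a => cond (Nat.testBit mask a) true (cond (Nat.beq a i) true
        (allBelow n fun b => cond (Nat.testBit mask b) true (cond (Nat.beq b i) true
          (cond (Nat.beq b a) true
            (force (addThreeCycle acc i a b) fun acc' =>
              force (Nat.lor mask (Nat.lor (Nat.shiftLeft 1 i)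
                (Nat.lor (Nat.shiftLeft 1 a) (Nat.shiftLeft 1 b)))) (r i' acc'))))))))
    k

/-- Invariants of the search: `mask` is a union of cycles of `g` containing all fixed points and all
points below `i`, and `acc` has the values of `g` on `mask` and zeros elsewhere, so that a bitwise
or can write new digits. A point outside `mask` is moved and `g ^ 3 = 1`, hence it lies in a
three-cycle disjoint from `mask`, which is added as a whole. -/
theorem searchThreeCycles_sound {test : ℕ → Bool} (hn : n ≤ 16) (g : Perm (Fin n))
    (h3 : g ^ 3 = 1) (k : ℕ) : ∀ i acc mask, i + k = n →
      (∀ j : Fin n, (j : ℕ) < i → Nat.testBit mask j = true) →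
      (∀ j : Fin n, Nat.testBit mask j = Nat.testBit mask (g j)) →
      (∀ j : Fin n, Nat.testBit mask j = false → g j ≠ j) →
      (∀ j : Fin n, digit acc j = if Nat.testBit mask j then (g j : ℕ) else 0) →
      searchThreeCycles n test k i acc mask = true → ∃ c, IsCode g c ∧ test c = true := by
  have h3' : ∀ j, g (g (g j)) = j := fun j => by
    have := congrArg (fun f : Perm (Fin n) => f j) h3
    simpa [pow_succ, Perm.mul_apply] using this
  induction k with
  | zero =>
    intro i acc mask hi hlt _ _ hacc h
    refine ⟨acc, fun j => ?_, h⟩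
    rw [hacc, if_pos (hlt j (by omega))]
  | succ k ih =>
    intro i acc mask hi hlt hinv hfix hacc h
    have h0 : searchThreeCycles n test (k + 1) i acc mask =
      force (Nat.succ i) fun i' => cond (Nat.testBit mask i)
        (searchThreeCycles n test k i' acc mask)
        (allBelow n fun a => cond (Nat.testBit mask a) true (cond (Nat.beq a i) true
          (allBelow n fun b => cond (Nat.testBit mask b) true (cond (Nat.beq b i) true
            (cond (Nat.beq b a) true
              (force (addThreeCycle acc i a b) fun acc' =>
                force (Nat.lor mask (Nat.lor (Nat.shiftLeft 1 i)
                  (Nat.lor (Nat.shiftLeft 1 a) (Nat.shiftLeft 1 b))))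
                  (searchThreeCycles n test k i' acc'))))))) := rfl
    rw [h0, force_eq] at h
    have hin : i < n := by omega
    set x : Fin n := ⟨i, hin⟩ with hx
    have hxi : (x : ℕ) = i := rfl
    cases hb : Nat.testBit mask i with
    | true =>
      rw [hb, cond_true] at h
      refine ih (i + 1) acc mask (by omega) (fun j hj => ?_) hinv hfix hacc h
      rcases Nat.lt_succ_iff_lt_or_eq.1 hj with h' | h'
      · exact hlt j h'
      · rw [h', hb]
    | false =>
      rw [hb, cond_false, allBelow_iff] at h
      have hxb : Nat.testBit mask x = false := hb
      have hgb : Nat.testBit mask (g x) = false := by rw [← hinv, hxb]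
      have hggb : Nat.testBit mask (g (g x)) = false := by rw [← hinv, hgb]
      have n1 : g x ≠ x := hfix x hxb
      have n2 : g (g x) ≠ g x := hfix _ hgb
      have n3 : g (g x) ≠ x := fun e => n1 (by
        have := h3' x; rw [e] at this; exact this)
      have h1 := h (g x) (g x).2
      have e1 : Nat.beq (g x) i = false :=
        nat_beq_false_of_ne fun e => n1 (Fin.ext e)
      have e2 : Nat.beq (g (g x)) i = false :=
        nat_beq_false_of_ne fun e => n3 (Fin.ext e)
      have e3 : Nat.beq (g (g x)) (g x) = false :=
        nat_beq_false_of_ne fun e => n2 (Fin.ext e)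
      rw [hgb, cond_false, e1, cond_false, allBelow_iff] at h1
      have h2 := h1 (g (g x)) (g (g x)).2
      rw [hggb, e2, e3, force_eq, force_eq] at h2
      simp only [cond_false] at h2
      have hmask : ∀ j : Fin n, Nat.testBit (Nat.lor mask (Nat.lor (Nat.shiftLeft 1 i)
          (Nat.lor (Nat.shiftLeft 1 (g x)) (Nat.shiftLeft 1 (g (g x)))))) j = true ↔
          (Nat.testBit mask j = true ∨ j = x ∨ j = g x ∨ j = g (g x)) := by
        intro j
        change Nat.testBit (mask ||| ((1 <<< i) ||| ((1 <<< (g x : ℕ)) ||| (1 <<< (g (g x) : ℕ)))))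
          j = true ↔ _
        simp only [Nat.testBit_or, Nat.one_shiftLeft, Nat.testBit_two_pow, Bool.or_eq_true,
          decide_eq_true_eq, Fin.ext_iff, hxi]
        rw [eq_comm (a := i), eq_comm (a := (g x : ℕ)), eq_comm (a := (g (g x) : ℕ))]
      refine ih (i + 1) _ _ (by omega) (fun j hj => ?_) (fun j => ?_) (fun j hj => ?_)
        (fun j => ?_) h2
      · rw [hmask]
        rcases Nat.lt_succ_iff_lt_or_eq.1 hj with h' | h'
        · exact Or.inl (hlt j h')
        · exact Or.inr (Or.inl (Fin.ext h'))
      · rw [Bool.eq_iff_iff, hmask, hmask, ← hinv j]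
        have q1 : ∀ y, g j = g y ↔ j = y := fun y => g.injective.eq_iff
        have q2 : g j = x ↔ j = g (g x) := by
          constructor
          · intro e; rw [← e, h3']
          · intro e; rw [e, h3']
        rw [q1, q1, q2]
        tauto
      · refine hfix j ?_
        by_contra hne
        have := (hmask j).2 (Or.inl (by simpa using hne))
        rw [this] at hj
        cases hj
      · have hd : digit (addThreeCycle acc i (g x) (g (g x))) j =
            Nat.lor (digit acc j) (Nat.lor (if (j : ℕ) = i then (g x : ℕ) else 0)
              (Nat.lor (if (j : ℕ) = g x then (g (g x) : ℕ) else 0)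
                (if (j : ℕ) = g (g x) then i else 0))) := by
          unfold addThreeCycle
          rw [digit_lor, digit_lor, digit_lor]
          have := digit_shiftLeft (v := g x) (by omega) i j
          have t2 := digit_shiftLeft (v := g (g x)) (by omega) (g x) j
          have t3 := digit_shiftLeft (v := i) (by omega) (g (g x)) j
          rw [← this, ← t2, ← t3]
          rfl
        have lor0 : ∀ a : ℕ, Nat.lor a 0 = a := Nat.or_zero
        have zlor : ∀ a : ℕ, Nat.lor 0 a = a := Nat.zero_or
        rw [hd, hacc]
        have hm := hmask j
        have m1 : (g x : ℕ) ≠ i := fun e => n1 (Fin.ext e)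
        have m2 : (g (g x) : ℕ) ≠ g x := fun e => n2 (Fin.ext e)
        have m3 : (g (g x) : ℕ) ≠ i := fun e => n3 (Fin.ext e)
        by_cases c1 : j = x
        · rw [if_pos (hm.2 (Or.inr (Or.inl c1))), c1, hxb, hxi]
          simp only [Bool.false_eq_true, if_false, if_true, m1.symm, m3.symm, lor0, zlor]
        · have d1 : ¬ (j : ℕ) = i := fun e => c1 (Fin.ext e)
          by_cases c2 : j = g x
          · rw [if_pos (hm.2 (Or.inr (Or.inr (Or.inl c2)))), c2, hgb]
            simp only [Bool.false_eq_true, if_false, if_true, m1, m2.symm, lor0, zlor]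
          · by_cases c3 : j = g (g x)
            · rw [if_pos (hm.2 (Or.inr (Or.inr (Or.inr c3)))), c3, hggb, h3', hxi]
              simp only [Bool.false_eq_true, if_false, if_true, m2, m3, zlor]
            · rw [if_neg d1, if_neg (fun e => c2 (Fin.ext e)), if_neg (fun e => c3 (Fin.ext e))]
              simp only [lor0]
              by_cases hj : Nat.testBit mask j = true
              · rw [if_pos hj, if_pos (hm.2 (Or.inl hj))]
              · rw [if_neg hj, if_neg (fun e => by rcases hm.1 e with h | h | h | h <;> tauto)]

/-! ### Recognising powers that are cycles of prime length -/

/-! ### Jordan's theorem on primitive groups containing a cycle of prime length -/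

section Jordan

variable {α : Type*} [Fintype α] [DecidableEq α]

/-- The elements of `G` that fix all fixed points of `g`. -/
def supportedIn (G : Subgroup (Perm α)) (g : Perm α) : Subgroup (Perm α) where
  carrier := {k | k ∈ G ∧ ∀ z, g z = z → k z = z}
  one_mem' := ⟨G.one_mem, fun _ _ => rfl⟩
  mul_mem' := fun {a b} ha hb => ⟨G.mul_mem ha.1 hb.1, fun z hz => by
    rw [Perm.mul_apply, hb.2 z hz, ha.2 z hz]⟩
  inv_mem' := fun {a} ha => ⟨G.inv_mem ha.1, fun z hz => by
    rw [Perm.inv_eq_iff_eq, ha.2 z hz]⟩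

/-- An element fixing every fixed point of `g` preserves the support of `g` and is determined by its
restriction to it, so the group embeds into the symmetric group on the support. -/
theorem card_supportedIn_dvd (G : Subgroup (Perm α)) (g : Perm α) :
    Nat.card (supportedIn G g) ∣ (g.support.card).factorial := by
  have hmem : ∀ k ∈ supportedIn G g, ∀ z, g z ≠ z ↔ g (k z) ≠ k z := by
    intro k hk z
    constructor
    · intro h1 h2
      have := hk.2 _ h2
      rw [k.injective.eq_iff] at this
      rw [this] at h2
      exact h1 h2
    · intro h1 h2
      rw [hk.2 z h2] at h1
      exact h1 h2
  let f : supportedIn G g →* Perm {z // g z ≠ z} := MonoidHom.mk'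
    (fun k => (k : Perm α).subtypePerm fun z => (hmem k k.2 z).symm) (by intro a b; ext z; rfl)
  have hf : Function.Injective f := by
    intro a b hab
    ext z
    by_cases hz : g z = z
    · rw [a.2.2 z hz, b.2.2 z hz]
    · have := congrArg (fun q : Perm {z // g z ≠ z} => (q ⟨z, hz⟩ : α)) hab
      exact this
  have h1 := Subgroup.card_dvd_of_injective f hf
  have h2 : Nat.card (Perm {z // g z ≠ z}) = (g.support.card).factorial := by
    rw [Nat.card_eq_fintype_card, Fintype.card_perm, Fintype.card_subtype]
    rfl
  rwa [h2] at h1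

/-- Two subgroups of order `p` of a finite group whose order is not divisible by `p ^ 2` are
conjugate. -/
theorem exists_conj_mem_zpowers {K : Type*} [Group K] [Finite K] {p : ℕ} [hp : Fact p.Prime]
    (hK : ¬ p ^ 2 ∣ Nat.card K) {x y : K} (hx : orderOf x = p) (hy : orderOf y = p) :
    ∃ r : K, r * x * r⁻¹ ∈ Subgroup.zpowers y := by
  -- As `p ^ 2` does not divide the order of `K`, a Sylow subgroup containing `z` has order `p` and
  -- is the cyclic group of `z`; Sylow conjugacy does the rest.
  have key : ∀ z : K, orderOf z = p → ∃ S : Sylow p K, (S : Subgroup K) = Subgroup.zpowers z := by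
    intro z hz
    have hcard : Nat.card (Subgroup.zpowers z) = p := by rw [Nat.card_zpowers, hz]
    have hpg : IsPGroup p (Subgroup.zpowers z) := IsPGroup.of_card (n := 1) (by rw [hcard, pow_one])
    obtain ⟨S, hS⟩ := hpg.exists_le_sylow
    refine ⟨S, ?_⟩
    obtain ⟨m, hm⟩ := IsPGroup.iff_card.1 S.2
    have hm1 : m ≤ 1 := by
      by_contra hlt
      refine hK (dvd_trans ?_ (Subgroup.card_subgroup_dvd_card (S : Subgroup K)))
      rw [hm]
      exact pow_dvd_pow p (by omega)
    refine (Subgroup.eq_of_le_of_card_ge hS ?_).symm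
    rw [hcard, hm]
    calc p ^ m ≤ p ^ 1 := Nat.pow_le_pow_right hp.out.pos hm1
      _ = p := pow_one p
  obtain ⟨S, hS⟩ := key x hx
  obtain ⟨T, hT⟩ := key y hy
  obtain ⟨r, hr⟩ := MulAction.exists_smul_eq K S T
  refine ⟨r, ?_⟩
  rw [← hT, ← hr]
  have hxS : x ∈ (S : Subgroup K) := hS ▸ Subgroup.mem_zpowers x
  exact ⟨x, hxS, rfl⟩

theorem sq_not_dvd_factorial_prime {p : ℕ} (hp : p.Prime) : ¬ p ^ 2 ∣ p.factorial := by
  intro h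
  have h1 : p.factorial = p * (p - 1).factorial := (Nat.mul_factorial_pred hp.ne_zero).symm
  rw [h1, pow_two] at h
  have h2 := Nat.dvd_of_mul_dvd_mul_left hp.pos h
  rw [hp.dvd_factorial] at h2
  have := hp.pos
  omega

/-- The pointwise stabilizer of the `m + 1` fixed points contains the cycle, so it is transitive of
prime degree on the support and therefore primitive there. Jordan's theorem on multiple primitivity
then gives `(m + 2)`-fold transitivity, of which `m + 1` is needed. -/
theorem isMultiplyPretransitive_of_primeCycle {G : Subgroup (Perm α)}
    (hG : MulAction.IsPreprimitive G α) {g : Perm α} (hg : g ∈ G) (hc : g.IsCycle)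
    (hp : g.support.card.Prime) {m : ℕ} (hm : g.support.card + (m + 1) = Fintype.card α) :
    MulAction.IsMultiplyPretransitive G α (m + 1) := by
  have hs : ((g.support : Set α)ᶜ).ncard = m + 1 := by
    have h1 := Set.ncard_add_ncard_compl (g.support : Set α)
    rw [Set.ncard_coe_finset, Nat.card_eq_fintype_card] at h1
    omega
  have := Perm.isPretransitive_of_isCycle_mem hc hg
  have hcard : Nat.card (SubMulAction.ofFixingSubgroup G ((g.support : Set α)ᶜ)) =
      g.support.card := by
    have : Nat.card (SubMulAction.ofFixingSubgroup G ((g.support : Set α)ᶜ)) =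
        Nat.card ((g.support : Set α)) := by
      refine Nat.card_congr (Equiv.subtypeEquivRight fun x => ?_)
      rw [SubMulAction.mem_ofFixingSubgroup_iff, Set.mem_compl_iff, not_not]
    rw [this, Nat.card_coe_set_eq, Set.ncard_coe_finset]
  have hprim : MulAction.IsPreprimitive (fixingSubgroup G ((g.support : Set α)ᶜ))
      (SubMulAction.ofFixingSubgroup G ((g.support : Set α)ᶜ)) :=
    MulAction.IsPreprimitive.of_prime_card (by rw [hcard]; exact hp)
  have h2 := hp.two_le
  have h3 : MulAction.IsMultiplyPreprimitive G α (m + 2) :=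
    hG.isMultiplyPreprimitive hs (by rw [Nat.card_eq_fintype_card]; omega) hprim
  have h4 : MulAction.IsMultiplyPretransitive G α (m + 2) := inferInstance
  exact MulAction.isMultiplyPretransitive_of_le (n := m + 2) (by omega)
    (by rw [Nat.card_eq_fintype_card]; omega)

/-- In a primitive group containing a cycle `g` of prime length, every permutation of the fixed
points of `g` is induced by an element of the group normalizing the cyclic group of `g`. -/
theorem exists_normalizing_extension {G : Subgroup (Perm α)}
    (hG : MulAction.IsPreprimitive G α) {g : Perm α} (hg : g ∈ G) (hc : g.IsCycle)
    (hp : g.support.card.Prime) (hlt : g.support.card < Fintype.card α)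
    (t : Perm α) (ht : ∀ z, g z = z → g (t z) = t z) :
    ∃ a ∈ G, (∀ z, g z = z → a z = t z) ∧ a * g * a⁻¹ ∈ Subgroup.zpowers g := by
  obtain ⟨m, hm⟩ : ∃ m, g.support.card + (m + 1) = Fintype.card α :=
    ⟨Fintype.card α - g.support.card - 1, by omega⟩
  have htrans := isMultiplyPretransitive_of_primeCycle hG hg hc hp hm
  have hcard : Fintype.card {z // g z = z} = m + 1 := by
    have h1 := Fintype.card_subtype_compl (fun z => g z = z)
    have h2 : Fintype.card {z // ¬ g z = z} = g.support.card := by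
      rw [Fintype.card_subtype]; rfl
    have h3 := Fintype.card_subtype_le (fun z => g z = z)
    omega
  let e : Fin (m + 1) ≃ {z // g z = z} := (Fintype.equivFinOfCardEq hcard).symm
  let u : Fin (m + 1) ↪ α := ⟨fun i => e i, fun i j h => e.injective (Subtype.ext h)⟩
  let v : Fin (m + 1) ↪ α := ⟨fun i => t (e i), fun i j h =>
    e.injective (Subtype.ext (t.injective h))⟩
  -- The element `k` acts on the fixed points as prescribed, but need not normalize the cyclic group
  -- of `g`; a Frattini argument corrects this below.
  obtain ⟨⟨k, hk⟩, hkuv⟩ := htrans.exists_smul_eq u v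
  have hkz : ∀ z, g z = z → k z = t z := by
    intro z hz
    have := congrArg (fun f : Fin (m + 1) ↪ α => f (e.symm ⟨z, hz⟩)) hkuv
    have h5 : k (e (e.symm ⟨z, hz⟩)) = t (e (e.symm ⟨z, hz⟩)) := this
    simpa using h5
  have hfact : Fact g.support.card.Prime := ⟨hp⟩
  have hord : orderOf g = g.support.card := hc.orderOf
  -- the fixed points of `k g k⁻¹` are those of `g`
  have hinv : ∀ z, g z = z → g (k⁻¹ z) = k⁻¹ z := by
    have hmaps : Set.MapsTo k {z | g z = z} {z | g z = z} := fun z hz => by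
      have hz' : g z = z := hz
      change g (k z) = k z
      rw [hkz z hz']
      exact ht z hz'
    have hsurj := Finset.surjOn_of_injOn_of_card_le (s := Finset.univ.filter fun z => g z = z)
      (t := Finset.univ.filter fun z => g z = z) k (by simpa using hmaps) k.injective.injOn le_rfl
    intro z hz
    obtain ⟨w, hw, hwz⟩ := hsurj (show z ∈ _ by simpa using hz)
    rw [← hwz]
    simpa using hw
  let x : supportedIn G g := ⟨k * g * k⁻¹, G.mul_mem (G.mul_mem hk hg) (G.inv_mem hk), fun z hz => by
    rw [Perm.mul_apply, Perm.mul_apply, hinv z hz]; simp⟩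
  let y : supportedIn G g := ⟨g, hg, fun z hz => hz⟩
  have hy : orderOf y = g.support.card := by rw [← Subgroup.orderOf_coe, hord]
  have hx : orderOf x = g.support.card := by
    rw [← Subgroup.orderOf_coe]
    change orderOf (k * g * k⁻¹) = _
    rw [← hord]
    exact orderOf_injective (MulAut.conj k).toMonoidHom (MulAut.conj k).injective g
  -- Both `g` and `k * g * k⁻¹` lie in `supportedIn G g`, whose order divides `p!` and is thus not
  -- divisible by `p ^ 2`. The conjugating element `r` fixes the fixed points of `g`, so `r * k`
  -- acts on them as `k` does.
  obtain ⟨r, hr⟩ := exists_conj_mem_zpowers (p := g.support.card) (fun h =>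
    sq_not_dvd_factorial_prime hp (h.trans (card_supportedIn_dvd G g))) hx hy
  refine ⟨r * k, G.mul_mem r.2.1 hk, fun z hz => ?_, ?_⟩
  · rw [Perm.mul_apply, hkz z hz]
    exact r.2.2 _ (ht z hz)
  · obtain ⟨j, hj⟩ := hr
    refine ⟨j, ?_⟩
    have := congrArg (Subtype.val) hj
    change g ^ j = (r : Perm α) * (k * g * k⁻¹) * (r : Perm α)⁻¹ at this
    rw [mul_inv_rev]
    simpa [mul_assoc] using this

/-- **Jordan's theorem**: a primitive group containing a cycle of prime length with at least three
fixed points contains the alternating group. -/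
theorem alternatingGroup_le_of_primeCycle {G : Subgroup (Perm α)}
    (hG : MulAction.IsPreprimitive G α) {g : Perm α} (hg : g ∈ G) (hc : g.IsCycle)
    (hp : g.support.card.Prime) (h3 : g.support.card + 3 ≤ Fintype.card α) :
    alternatingGroup α ≤ G := by
  have hcard : 3 ≤ (g.supportᶜ).card := by rw [Finset.card_compl]; omega
  obtain ⟨x, hx, y, hy, w, hw, hxy, hxw, hyw⟩ := Finset.two_lt_card.1 hcard
  simp only [Finset.mem_compl, Perm.mem_support, not_not] at hx hy hw
  have hsw : ∀ u v, g u = u → g v = v → ∀ z, g z = z → g (swap u v z) = swap u v z := by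
    intro u v hu hv z hz
    by_cases h : z = u
    · rw [h, swap_apply_left, hv]
    · by_cases h' : z = v
      · rw [h', swap_apply_right, hu]
      · rw [swap_apply_of_ne_of_ne h h', hz]
  -- Two transpositions of fixed points sharing the point `y` are extended to elements `a`, `b`
  -- normalizing the cyclic group of `g`. Automorphisms of a cyclic group commute, so the commutator
  -- of `a` and `b` centralizes `g`.
  obtain ⟨a, haG, ha, ⟨i, hi⟩⟩ := exists_normalizing_extension hG hg hc hp (by omega) (swap x y)
    (hsw x y hx hy)
  obtain ⟨b, hbG, hb, ⟨j, hj⟩⟩ := exists_normalizing_extension hG hg hc hp (by omega) (swap y w)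
    (hsw y w hy hw)
  have hi : a * g * a⁻¹ = g ^ i := hi.symm
  have hj : b * g * b⁻¹ = g ^ j := hj.symm
  have h1 : (a * b) * g * (a * b)⁻¹ = g ^ (i * j) := by
    calc (a * b) * g * (a * b)⁻¹ = a * (b * g * b⁻¹) * a⁻¹ := by group
      _ = a * g ^ j * a⁻¹ := by rw [hj]
      _ = (a * g * a⁻¹) ^ j := by rw [conj_zpow]
      _ = g ^ (i * j) := by rw [hi, zpow_mul]
  have h2 : (b * a) * g * (b * a)⁻¹ = g ^ (i * j) := by
    calc (b * a) * g * (b * a)⁻¹ = b * (a * g * a⁻¹) * b⁻¹ := by group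
      _ = b * g ^ i * b⁻¹ := by rw [hi]
      _ = (b * g * b⁻¹) ^ i := by rw [conj_zpow]
      _ = g ^ (i * j) := by rw [hj, mul_comm, zpow_mul]
  set c := (b * a)⁻¹ * (a * b) with hcdef
  have hcg : c * g = g * c := by
    have : (a * b) * g * (a * b)⁻¹ = (b * a) * g * (b * a)⁻¹ := by rw [h1, h2]
    rw [hcdef]
    calc (b * a)⁻¹ * (a * b) * g = (b * a)⁻¹ * ((a * b) * g * (a * b)⁻¹) * (a * b) := by group
      _ = (b * a)⁻¹ * ((b * a) * g * (b * a)⁻¹) * (a * b) := by rw [this]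
      _ = g * ((b * a)⁻¹ * (a * b)) := by group
  have hcG : c ∈ G := G.mul_mem (G.inv_mem (G.mul_mem hbG haG)) (G.mul_mem haG hbG)
  -- the action of `c` on the fixed points of `g`
  have hcz : ∀ z, g z = z → c z = (swap y w * swap x y)⁻¹ ((swap x y * swap y w) z) := by
    intro z hz
    have e1 := hb z hz
    have e2 : (a * b) z = swap x y (swap y w z) := by
      rw [Perm.mul_apply, e1, ha _ (hsw y w hy hw z hz)]
    have hbase : ∀ v, g v = v → (b * a) v = (swap y w * swap x y) v := by
      intro v hv
      rw [Perm.mul_apply, ha v hv, hb _ (hsw x y hx hy v hv), Perm.mul_apply]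
    have hv : g ((swap y w * swap x y)⁻¹ ((swap x y * swap y w) z)) =
        (swap y w * swap x y)⁻¹ ((swap x y * swap y w) z) := by
      rw [mul_inv_rev, swap_inv, swap_inv]
      simp only [Perm.mul_apply]
      exact hsw x y hx hy _ (hsw y w hy hw _ (hsw x y hx hy _ (hsw y w hy hw z hz)))
    rw [hcdef, Perm.mul_apply, e2, Perm.inv_eq_iff_eq, hbase _ hv]
    simp
  clear_value c
  clear hcdef
  -- the action of `c` on the support of `g`
  obtain ⟨d, hd, hcyc⟩ := hc
  have hcd : g (c d) ≠ c d := by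
    intro h
    have : c (g d) = c d := by
      have := congrArg (fun f : Perm α => f d) hcg
      simpa [Perm.mul_apply, h] using this
    exact hd (c.injective this)
  obtain ⟨e, he⟩ := hcyc hcd
  have hcz' : ∀ z, g z ≠ z → c z = (g ^ e) z := by
    intro z hz
    obtain ⟨l, hl⟩ := hcyc hz
    have hcomm : Commute c (g ^ l) := (show Commute c g from hcg).zpow_right l
    calc c z = (c * g ^ l) d := by rw [Perm.mul_apply, hl]
      _ = (g ^ l * c) d := by rw [hcomm.eq]
      _ = (g ^ l * g ^ e) d := by rw [Perm.mul_apply, Perm.mul_apply, he]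
      _ = (g ^ e * g ^ l) d := by rw [← zpow_add, ← zpow_add, add_comm]
      _ = (g ^ e) z := by rw [Perm.mul_apply, hl]
  -- A permutation commuting with `g` acts on its support as a power `g ^ e`. Dividing by this power
  -- leaves only the action of `c` on the fixed points, a commutator of two transpositions sharing a
  -- point, which is a three-cycle.
  have hfinal : (g ^ e)⁻¹ * c = (swap y w * swap x y)⁻¹ * (swap x y * swap y w) := by
    ext z
    by_cases hz : g z = z
    · rw [Perm.mul_apply, hcz z hz, Perm.mul_apply, Perm.inv_eq_iff_eq]
      have hv : g ((swap y w * swap x y)⁻¹ ((swap x y * swap y w) z)) =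
          (swap y w * swap x y)⁻¹ ((swap x y * swap y w) z) := by
        rw [mul_inv_rev, swap_inv, swap_inv]
        simp only [Perm.mul_apply]
        exact hsw x y hx hy _ (hsw y w hy hw _ (hsw x y hx hy _ (hsw y w hy hw z hz)))
      exact (Perm.zpow_apply_eq_self_of_apply_eq_self hv e).symm
    · rw [Perm.mul_apply, hcz' z hz, Perm.inv_eq_iff_eq.2 rfl]
      have n1 : z ≠ x := fun h => hz (h ▸ hx)
      have n2 : z ≠ y := fun h => hz (h ▸ hy)
      have n3 : z ≠ w := fun h => hz (h ▸ hw)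
      rw [mul_inv_rev, swap_inv, swap_inv]
      simp [Perm.mul_apply, swap_apply_of_ne_of_ne n1 n2, swap_apply_of_ne_of_ne n2 n3]
  have hthree : ((swap y w * swap x y)⁻¹ * (swap x y * swap y w)).IsThreeCycle := by
    have h5 : (swap y w * swap x y)⁻¹ * (swap x y * swap y w) =
        swap y w * swap y x := by
      rw [mul_inv_rev, swap_inv, swap_inv]
      ext z
      by_cases z1 : z = x
      · subst z1; simp [Perm.mul_apply, swap_apply_def, hxy, hxw, hyw, hxy.symm, hxw.symm, hyw.symm]
      by_cases z2 : z = y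
      · subst z2; simp [Perm.mul_apply, swap_apply_def, hxy, hxw, hyw, hxy.symm, hxw.symm, hyw.symm]
      by_cases z3 : z = w
      · subst z3; simp [Perm.mul_apply, swap_apply_def, hxy, hxw, hyw, hxy.symm, hxw.symm, hyw.symm]
      simp [Perm.mul_apply, swap_apply_of_ne_of_ne, z1, z2, z3]
    rw [h5]
    exact Perm.isThreeCycle_swap_mul_swap_same hyw hxy.symm hxw.symm
  exact Perm.alternatingGroup_le_of_isPreprimitive_of_isThreeCycle_mem hG hthree
    (hfinal ▸ G.mul_mem (G.inv_mem (G.zpow_mem hg e)) hcG)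

end Jordan

/-! ### Reading cycle lengths off the digits, and powers that are cycles of prime length. -/

/-- The least number `l'` with `l ≤ l' < l + k` such that the iterates of `j` under the permutation
with code `c` reach `i` after `l' - l` steps; zero if there is none. -/
noncomputable def periodAux (c i k : ℕ) : ℕ → ℕ → ℕ :=
  Nat.rec (fun _ _ => 0) (fun _ r j l => cond (Nat.beq j i) l
    (force (Nat.succ l) fun l' => force (digit c j) fun j' => r j' l')) k

/-- The least positive number `l ≤ n` such that the `l`-th power of the permutation with code `c`
fixes `i`. -/
noncomputable def period (n c i : ℕ) : ℕ := force (digit c i) fun j => periodAux c i n j 1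

/-- The number of digits `p` among the first `n` digits of `c`. -/
noncomputable def digitCount (n c p : ℕ) : ℕ :=
  Nat.rec 0 (fun k r => cond (Nat.beq (digit c k) p) (Nat.succ r) r) n

/-- Exactly `p` of the first `n` digits of `P` are `p`, and the others divide `m`. -/
noncomputable def isolatesPrime (n P p m : ℕ) : Bool :=
  cond (Nat.beq (digitCount n P p) p)
    (allBelow n fun i => force (digit P i) fun d =>
      cond (Nat.beq d p) true (Nat.beq (Nat.mod m d) 0)) false

/-- Some power of the permutation with code `c` is a cycle of length `3`, `5` or `7`, fixing at
least three points if the length is not `3`. -/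
noncomputable def hasJordanPower (n c : ℕ) : Bool :=
  force (ofDigits16 (fun i => period n c i) n) fun P =>
    cond (cond (Nat.ble 10 n) (isolatesPrime n P 7 360) false) true <|
    cond (cond (Nat.ble 8 n) (isolatesPrime n P 5 504) false) true <| isolatesPrime n P 3 280

section

variable {n : ℕ}

theorem digitCount_eq (c p : ℕ) :
    digitCount n c p = (Finset.univ.filter fun i : Fin n => digit c i = p).card := by
  induction n with
  | zero => rfl
  | succ n ih =>
    have h : digitCount (n + 1) c p =
      cond (Nat.beq (digit c n) p) (digitCount n c p + 1) (digitCount n c p) := rfl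
    rw [h, Fin.univ_castSuccEmb, Finset.filter_cons, ih]
    have e : (Finset.filter (fun i : Fin (n + 1) => digit c i = p)
        (Finset.map Fin.castSuccEmb Finset.univ)).card =
        (Finset.univ.filter fun i : Fin n => digit c i = p).card := by
      rw [Finset.filter_map, Finset.card_map]; rfl
    split_ifs with h1
    · have : Nat.beq (digit c n) p = true := by simpa using h1
      rw [this, cond_true, Finset.card_cons, e]
    · rw [nat_beq_false_of_ne (by simpa using h1), cond_false, e]

/-- These three properties suffice later; that the period is the least possible is not needed. The
value zero signals that the iteration did not return within `n` steps. -/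
theorem period_spec {g : Perm (Fin n)} {c : ℕ} (hg : IsCode g c) (i : Fin n) :
    period n c i ≤ n ∧ (period n c i ≠ 0 → (g ^ period n c i) i = i) ∧
      (2 ≤ period n c i → g i ≠ i) := by
  have aux : ∀ k (j : Fin n) l, j = (g ^ l) i → 0 < l →
      periodAux c i k j l ≤ l + k - 1 ∧
        (periodAux c i k j l ≠ 0 → (g ^ periodAux c i k j l) i = i) ∧
        (periodAux c i k j l ≠ 0 → periodAux c i k j l ≠ l → j ≠ i) := by
    intro k
    induction k with
    | zero => intro j l _ _; simp [periodAux]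
    | succ k ih =>
      intro j l hj hl
      have h0 : periodAux c i (k + 1) j l = cond (Nat.beq j i) l
        (force (Nat.succ l) fun l' => force (digit c j) fun j' => periodAux c i k j' l') := rfl
      by_cases h : j = i
      · rw [h0, show Nat.beq j i = true by simp [h], cond_true]
        exact ⟨by omega, fun _ => by rw [← hj, h], fun _ h => absurd rfl h⟩
      · rw [h0, nat_beq_false_of_ne (fun e => h (Fin.ext e)), cond_false, force_eq, force_eq, hg]
        obtain ⟨h1, h2, -⟩ := ih (g j) (l + 1) (by rw [hj, pow_succ', Perm.mul_apply]) (by omega)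
        exact ⟨by rw [Nat.succ_eq_add_one]; omega, h2, fun _ _ => h⟩
  have h0 : period n c i = periodAux c i n (g i) 1 := by rw [period, force_eq, hg]
  obtain ⟨h1, h2, h3⟩ := aux n (g i) 1 (by simp) one_pos
  rw [h0]
  exact ⟨by omega, h2, fun h => h3 (by omega) (by omega)⟩

/-- The power `g ^ m` fixes all points whose period is not `p`, and its `p`-th power is trivial. It
is not the identity because `p` is prime to `m`. So it has order `p` and moves at most `p` points,
which makes it a single cycle. -/
theorem exists_primeCycle_of_isolatesPrime {g : Perm (Fin n)} {c p m : ℕ} (hn : n < 16)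
    (hg : IsCode g c) (hp : p.Prime) (hm : m ≠ 0) (hpm : p.Coprime m)
    (h : isolatesPrime n (ofDigits16 (fun i => period n c i) n) p m = true) :
    (g ^ m).IsCycle ∧ (g ^ m).support.card = p := by
  rw [isolatesPrime, Bool.cond_false_right, Bool.and_eq_true, allBelow_iff] at h
  obtain ⟨h1, h2⟩ := h
  have hdig : ∀ i : Fin n, digit (ofDigits16 (fun i => period n c i) n) i = period n c i :=
    fun i => digit_ofDigits16 (fun j hj => by
      have := (period_spec hg ⟨j, hj⟩).1; simp at this; omega) i.2
  have hcount := Nat.eq_of_beq_eq_true h1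
  rw [digitCount_eq] at hcount
  simp only [hdig] at hcount
  have hfix : ∀ i : Fin n, period n c i ≠ p → (g ^ m) i = i := by
    intro i hi
    have := h2 i i.2
    rw [force_eq, hdig, nat_beq_false_of_ne hi, cond_false] at this
    have hdvd : period n c i ∣ m := Nat.dvd_of_mod_eq_zero (Nat.eq_of_beq_eq_true this)
    obtain ⟨q, hq⟩ := hdvd
    have h0 : period n c i ≠ 0 := by rintro h0; rw [h0, zero_mul] at hq; exact hm hq
    rw [hq, pow_mul]
    exact Perm.pow_apply_eq_self_of_apply_eq_self ((period_spec hg i).2.1 h0) q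
  have hpow : (g ^ m) ^ p = 1 := by
    ext i
    by_cases hi : period n c i = p
    · have h3 := (period_spec hg i).2.1 (by rw [hi]; exact hp.ne_zero)
      rw [hi] at h3
      rw [← pow_mul, mul_comm, pow_mul, Perm.pow_apply_eq_self_of_apply_eq_self h3, Perm.one_apply]
    · rw [Perm.pow_apply_eq_self_of_apply_eq_self (hfix i hi), Perm.one_apply]
  have hne : g ^ m ≠ 1 := by
    intro h1
    obtain ⟨i, hi⟩ : (Finset.univ.filter fun i : Fin n => period n c i = p).Nonempty := by
      rw [← Finset.card_pos, hcount]; exact hp.pos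
    rw [Finset.mem_filter] at hi
    have h3 := (period_spec hg i).2.1 (by rw [hi.2]; exact hp.ne_zero)
    refine (period_spec hg i).2.2 (by rw [hi.2]; exact hp.two_le) ?_
    rw [hi.2] at h3
    have h4 : (g ^ m) i = i := by rw [h1, Perm.one_apply]
    -- If `g ^ p` and `g ^ m` both fix `i`, so does `g` to the power of the greatest common divisor,
    -- which is `g` itself; but a point of period `p` is moved.
    have key : (g ^ (p.gcd m)) i = i := by
      have e : ∀ k : ℕ, Function.IsPeriodicPt g k i ↔ (g ^ k) i = i := fun k => by
        rw [Function.IsPeriodicPt, Function.IsFixedPt, Perm.iterate_eq_pow]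
      rw [← e] at *
      exact h3.gcd h4
    rwa [hpm.gcd_eq_one, pow_one] at key
  have hord : orderOf (g ^ m) = p := by
    have := Fact.mk hp
    exact orderOf_eq_prime hpow hne
  have hsupp : (g ^ m).support.card ≤ p := by
    rw [← hcount]
    refine Finset.card_le_card fun i hi => ?_
    rw [Finset.mem_filter]
    refine ⟨Finset.mem_univ _, ?_⟩
    by_contra h5
    exact Perm.mem_support.1 hi (hfix i h5)
  have hc : (g ^ m).IsCycle := Perm.isCycle_of_prime_order (by rw [hord]; exact hp)
    (by rw [hord]; have := hp.pos; omega)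
  exact ⟨hc, by rw [← hc.orderOf, hord]⟩

/-- The group `G` contains the permutation with code `c`. -/
def HasCode (G : Subgroup (Perm (Fin n))) (c : ℕ) : Prop := ∃ g ∈ G, IsCode g c

/-- The exponents `360`, `504` and `280` are the least common multiples of the cycle lengths up to
`10` not divisible by `7`, `5` and `3`. The bounds `10 ≤ n` and `8 ≤ n` leave three fixed points for
a cycle of length `7` or `5`; a three-cycle needs none. -/
theorem HasCode.alternatingGroup_le {G : Subgroup (Perm (Fin n))}
    (hG : MulAction.IsPreprimitive G (Fin n)) (hn : n < 16) {c : ℕ} (hc : HasCode G c)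
    (h : hasJordanPower n c = true) : alternatingGroup (Fin n) ≤ G := by
  obtain ⟨g, hg, hgc⟩ := hc
  have key : ∀ p m : ℕ, p.Prime → m ≠ 0 → p.Coprime m → p + 3 ≤ n →
      isolatesPrime n (ofDigits16 (fun i => period n c i) n) p m = true →
      alternatingGroup (Fin n) ≤ G := by
    intro p m hp hm hpm hpn h
    obtain ⟨h1, h2⟩ := exists_primeCycle_of_isolatesPrime hn hgc hp hm hpm h
    exact alternatingGroup_le_of_primeCycle hG (G.pow_mem hg m) h1 (h2 ▸ hp)
      (by rw [h2, Fintype.card_fin]; exact hpn)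
  rw [hasJordanPower, force_eq] at h
  cases h7 : cond (Nat.ble 10 n)
    (isolatesPrime n (ofDigits16 (fun i => period n c i) n) 7 360) false with
  | true =>
    rw [Bool.cond_false_right, Bool.and_eq_true] at h7
    exact key 7 360 (by norm_num) (by norm_num) (by norm_num) (Nat.le_of_ble_eq_true h7.1) h7.2
  | false =>
    rw [h7, cond_false] at h
    cases h5 : cond (Nat.ble 8 n)
      (isolatesPrime n (ofDigits16 (fun i => period n c i) n) 5 504) false with
    | true =>
      rw [Bool.cond_false_right, Bool.and_eq_true] at h5
      exact key 5 504 (by norm_num) (by norm_num) (by norm_num) (Nat.le_of_ble_eq_true h5.1) h5.2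
    | false =>
      rw [h5, cond_false] at h
      obtain ⟨h1, h2⟩ := exists_primeCycle_of_isolatesPrime hn hgc (by norm_num) (by norm_num)
        (by norm_num) h
      exact Perm.alternatingGroup_le_of_isPreprimitive_of_isThreeCycle_mem hG
        (_root_.card_support_eq_three_iff.1 h2) (G.pow_mem hg _)

/-! ### Words -/

/-- The `i`-th entry of a list, with default value `d`. -/
noncomputable def lookup (d : ℕ) (l : List ℕ) : ℕ → ℕ :=
  List.rec (fun _ => d) (fun a _ r i => Nat.rec a (fun j _ => r j) i) l

theorem lookup_mem (d : ℕ) (l : List ℕ) (i : ℕ) : lookup d l i = d ∨ lookup d l i ∈ l := by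
  induction l generalizing i with
  | nil => exact Or.inl rfl
  | cons a l ih =>
    cases i with
    | zero => exact Or.inr (List.mem_cons_self ..)
    | succ i =>
      rcases ih i with h | h
      · exact Or.inl h
      · exact Or.inr (List.mem_cons_of_mem _ h)

/-- The value of a word in the generators with codes `gens`. -/
noncomputable def wordCode (n : ℕ) (gens : List ℕ) (w : List ℕ) : ℕ :=
  List.rec (idCode n)
    (fun i _ r => force r fun r' => force (lookup (idCode n) gens i) fun x => comp n x r') w

theorem HasCode.comp {G : Subgroup (Perm (Fin n))} {c d : ℕ} (hc : HasCode G c)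
    (hd : HasCode G d) : HasCode G (comp n c d) := by
  obtain ⟨g, hg, hgc⟩ := hc
  obtain ⟨h, hh, hhd⟩ := hd
  exact ⟨g * h, G.mul_mem hg hh, hgc.comp hhd⟩

theorem HasCode.one (G : Subgroup (Perm (Fin n))) (hn : n ≤ 16) : HasCode G (idCode n) :=
  ⟨1, G.one_mem, IsCode.one hn⟩

/-- Letters beyond the end of the list of generators stand for the identity, so no condition on the
word is necessary. -/
theorem HasCode.word {G : Subgroup (Perm (Fin n))} (hn : n ≤ 16) {gens : List ℕ}
    (hgens : ∀ c ∈ gens, HasCode G c) (w : List ℕ) : HasCode G (wordCode n gens w) := by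
  induction w with
  | nil => exact HasCode.one G hn
  | cons i w ih =>
    have : wordCode n gens (i :: w) =
      _root_.comp n (lookup (idCode n) gens i) (wordCode n gens w) := by
      have h0 : wordCode n gens (i :: w) = force (wordCode n gens w) fun r' =>
        force (lookup (idCode n) gens i) fun x => _root_.comp n x r' := rfl
      rw [h0, force_eq, force_eq]
    rw [this]
    refine HasCode.comp ?_ ih
    rcases lookup_mem (idCode n) gens i with h | h
    · rw [h]; exact HasCode.one G hn
    · exact hgens _ h

theorem HasCode.mem {G : Subgroup (Perm (Fin n))} {g : Perm (Fin n)} {c : ℕ} (hc : HasCode G c)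
    (hg : IsCode g c) : g ∈ G := by
  obtain ⟨h, hh, hhc⟩ := hc
  rwa [hg.unique hhc]

/-- Membership in a list of numbers. -/
noncomputable def listMem (c : ℕ) (l : List ℕ) : Bool :=
  List.rec false (fun a _ r => cond (Nat.beq a c) true r) l

theorem listMem_iff {c : ℕ} {l : List ℕ} : listMem c l = true ↔ c ∈ l := by
  induction l with
  | nil => simp [listMem]
  | cons a l ih =>
    have : listMem c (a :: l) = cond (Nat.beq a c) true (listMem c l) := rfl
    rw [this, Bool.cond_true_left, Bool.or_eq_true, ih, List.mem_cons, eq_comm (a := c)]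
    simp

/-- One of the words in `gens` has a power that is a cycle of suitable prime length. -/
noncomputable def anyJordan (n : ℕ) (gens : List ℕ) (words : List (List ℕ)) : Bool :=
  List.rec false (fun w _ r => cond (force (wordCode n gens w) fun c => hasJordanPower n c) true r)
    words

/-- The permutation with code `c` is in the list `specials`, or one of the words in `c :: gens`
has a power that is a cycle of suitable prime length. -/
noncomputable def jordanTest (n : ℕ) (gens : List ℕ) (words : List (List ℕ)) (specials : List ℕ)
    (c : ℕ) : Bool :=
  cond (listMem c specials) true (anyJordan n (c :: gens) words)

theorem alternatingGroup_le_of_anyJordan {G : Subgroup (Perm (Fin n))}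
    (hG : MulAction.IsPreprimitive G (Fin n)) (hn : n < 16) {gens : List ℕ}
    (hgens : ∀ c ∈ gens, HasCode G c) {words : List (List ℕ)}
    (h : anyJordan n gens words = true) : alternatingGroup (Fin n) ≤ G := by
  induction words with
  | nil => simp [anyJordan] at h
  | cons w words ih =>
    have : anyJordan n gens (w :: words) =
      cond (force (wordCode n gens w) fun c => hasJordanPower n c) true
        (anyJordan n gens words) := rfl
    rw [this, force_eq, Bool.cond_true_left, Bool.or_eq_true] at h
    rcases h with h | h
    · exact (HasCode.word (by omega) hgens w).alternatingGroup_le hG hn h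
    · exact ih h

theorem alternatingGroup_le_or_mem_of_jordanTest {G : Subgroup (Perm (Fin n))}
    (hG : MulAction.IsPreprimitive G (Fin n)) (hn : n < 16) {gens : List ℕ}
    (hgens : ∀ c ∈ gens, HasCode G c) {words : List (List ℕ)} {specials : List ℕ} {c : ℕ}
    (hc : HasCode G c) (h : jordanTest n gens words specials c = true) :
    alternatingGroup (Fin n) ≤ G ∨ c ∈ specials := by
  rw [jordanTest, Bool.cond_true_left, Bool.or_eq_true, listMem_iff] at h
  rcases h with h | h
  · exact Or.inr h
  · exact Or.inl (alternatingGroup_le_of_anyJordan hG hn (by simpa [hc] using hgens) h)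

/-! ### Conjugation -/

/-- The group `σ⁻¹ G σ`. -/
def conjGroup (σ : Perm (Fin n)) (G : Subgroup (Perm (Fin n))) : Subgroup (Perm (Fin n)) :=
  G.comap (MulAut.conj σ).toMonoidHom

theorem mem_conjGroup {σ : Perm (Fin n)} {G : Subgroup (Perm (Fin n))} {g : Perm (Fin n)} :
    g ∈ conjGroup σ G ↔ σ * g * σ⁻¹ ∈ G := Iff.rfl

/-- Every word in `ws` is the conjugate under `σ` of the corresponding code in `targets`. -/
noncomputable def conjCheck (n σ : ℕ) (gens : List ℕ) (ws : List (List ℕ)) (targets : List ℕ) :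
    Bool :=
  List.rec (fun ts => List.rec true (fun _ _ _ => false) ts)
    (fun w _ r ts => List.rec true
      (fun t ts' _ => cond (Nat.beq (comp n σ t) (comp n (wordCode n gens w) σ)) (r ts') false) ts)
    ws targets

/-- The check compares `σ t` with `w σ`, so that no inverse has to be computed. Equality says that
the value of `w`, an element of `G`, is `σ t σ⁻¹`. -/
theorem hasCode_conjGroup_of_conjCheck {G : Subgroup (Perm (Fin n))} (hn : n ≤ 16) {gens : List ℕ}
    (hgens : ∀ c ∈ gens, HasCode G c) {σ : ℕ} (hσ : validCode n σ = true) {ws : List (List ℕ)}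
    {targets : List ℕ} (hv : ∀ t ∈ targets, validCode n t = true)
    (h : conjCheck n σ gens ws targets = true) :
    ∀ t ∈ targets, HasCode (conjGroup (permOf n σ) G) t := by
  induction ws generalizing targets with
  | nil =>
    cases targets with
    | nil => simp
    | cons t ts => simp [conjCheck] at h
  | cons w ws ih =>
    cases targets with
    | nil => simp
    | cons t ts =>
      have h0 : conjCheck n σ gens (w :: ws) (t :: ts) =
        cond (Nat.beq (comp n σ t) (comp n (wordCode n gens w) σ)) (conjCheck n σ gens ws ts)
          false := rfl
      rw [h0, Bool.cond_false_right, Bool.and_eq_true] at h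
      have ht := isCode_permOf (hv t (by simp))
      intro t' ht'
      rcases List.mem_cons.1 ht' with rfl | ht'
      · refine ⟨permOf n t', ?_, ht⟩
        obtain ⟨g, hg, hgc⟩ := HasCode.word hn hgens w
        have e : permOf n σ * permOf n t' = g * permOf n σ := by
          refine ((isCode_permOf hσ).comp ht).unique ?_
          rw [Nat.eq_of_beq_eq_true h.1]
          exact hgc.comp (isCode_permOf hσ)
        rw [mem_conjGroup, e]
        simpa using hg
      · exact ih (fun t ht => hv t (by simp [ht])) h.2 t' ht'

theorem isPreprimitive_conjGroup {σ : Perm (Fin n)} {G : Subgroup (Perm (Fin n))}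
    (hG : MulAction.IsPreprimitive G (Fin n)) :
    MulAction.IsPreprimitive (conjGroup σ G) (Fin n) := by
  let φ : G → conjGroup σ G := fun g => ⟨σ⁻¹ * g * σ, by
    rw [mem_conjGroup]
    simp [mul_assoc]⟩
  let f : Fin n →ₑ[φ] Fin n := ⟨fun x => σ⁻¹ x, fun g x => by
    change σ⁻¹ ((g : Perm (Fin n)) x) = (σ⁻¹ * (g : Perm (Fin n)) * σ) (σ⁻¹ x)
    simp [Perm.mul_apply]⟩
  exact hG.of_surjective (f := f) (σ⁻¹).surjective

theorem alternatingGroup_le_conjGroup {σ : Perm (Fin n)} {G : Subgroup (Perm (Fin n))} :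
    alternatingGroup (Fin n) ≤ conjGroup σ G ↔ alternatingGroup (Fin n) ≤ G := by
  constructor
  · intro h g hg
    have : σ⁻¹ * g * σ ∈ conjGroup σ G := h (by
      rw [Perm.mem_alternatingGroup] at hg ⊢
      simp [hg, mul_comm])
    rw [mem_conjGroup] at this
    simpa [mul_assoc] using this
  · intro h g hg
    rw [mem_conjGroup]
    refine h ?_
    rw [Perm.mem_alternatingGroup] at hg ⊢
    simp [hg]

theorem permIso_of_conjGroup {Y : Type*} {σ : Perm (Fin n)} {G : Subgroup (Perm (Fin n))}
    {H : Subgroup (Perm Y)} (h : PermIso (conjGroup σ G) H) : PermIso G H := by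
  obtain ⟨e, rfl⟩ := h
  refine ⟨(Equiv.symm σ).trans e, ?_⟩
  ext y
  simp only [Subgroup.mem_map]
  constructor
  · rintro ⟨g, hg, rfl⟩
    refine ⟨σ⁻¹ * g * σ, by rw [mem_conjGroup]; simpa [mul_assoc] using hg, ?_⟩
    ext x
    simp [Equiv.permCongrHom, Equiv.permCongr_apply]
  · rintro ⟨g, hg, rfl⟩
    refine ⟨_, mem_conjGroup.1 hg, ?_⟩
    ext x
    simp [Equiv.permCongrHom, Equiv.permCongr_apply]

end

/-! ### Invariant graphs and the strong universal transversal property -/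

/-- Adjacency of the points `i` and `j` in the graph given by the bit mask `m`, where `tbl` has the
bit belonging to `i` and `j` as digit in position `n * i + j`. -/
noncomputable def maskAdj (n tbl m i j : ℕ) : Bool :=
  force (Nat.add (Nat.mul n i) j) fun q => force (digit tbl q) fun o => Nat.testBit m o

/-- There are no points `x ≠ z ≠ y` satisfying `R x z` and `S x y` for which `xz`, `xy`, `zy` have
the adjacencies prescribed by the tests `t`, `u`, `v`. -/
noncomputable def noTriple (n tbl m : ℕ) (t u v : Bool → Bool) (R S : ℕ → ℕ → Bool) : Bool :=
  allBelow n fun x => allBelow n fun z =>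
    cond (Nat.beq x z) true (cond (R x z) (cond (t (maskAdj n tbl m x z))
      (allBelow n fun y => cond (Nat.beq z y) true (cond (S x y) (cond (u (maskAdj n tbl m x y))
        (cond (v (maskAdj n tbl m z y)) false true) true) true)) true) true)

/-- Some type of triples is realized in the graph, but not by a triple whose first and last point
are in one part and whose second point is in another part of the partition with code `P`. -/
noncomputable def separates (n tbl m P : ℕ) (t u v : Bool → Bool) : Bool :=
  cond (noTriple n tbl m t u v
      (fun x z => Nat.beq (digit P x) (digit P z)) fun x y => not (Nat.beq (digit P x) (digit P y)))
    (not (noTriple n tbl m t u v (fun _ _ => true) fun x y => not (Nat.beq x y))) false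

/-- The degree of the point `i`. -/
noncomputable def maskDegree (n tbl m i : ℕ) : ℕ :=
  Nat.rec 0 (fun j r => cond (maskAdj n tbl m i j) (Nat.succ r) r) n

/-- The number of ordered triangles at the point `i`. -/
noncomputable def maskTriangles (n tbl m i : ℕ) : ℕ :=
  Nat.rec 0 (fun j r => Nat.rec r (fun l r => cond (maskAdj n tbl m i j) (cond (maskAdj n tbl m i l)
    (cond (maskAdj n tbl m j l) (Nat.succ r) r) r) r) n) n

/-- The Boolean functions used in prescribing adjacency. -/
noncomputable def boolTest (b : ℕ) : Bool → Bool := fun x => cond (Nat.beq b 0) (not x) x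

/-- A separating partition from the list `certs` exists. -/
noncomputable def anySeparates (n tbl m : ℕ) (certs : List (ℕ × ℕ × ℕ × ℕ)) : Bool :=
  List.rec false (fun e _ r => cond
    (separates n tbl m e.1 (boolTest e.2.1) (boolTest e.2.2.1) (boolTest e.2.2.2)) true r) certs

/-- The graph with mask `m` is excluded as an invariant graph of a group with the strong
universal transversal property. -/
noncomputable def graphTest (n r tbl q : ℕ) (certs : List (ℕ × ℕ × ℕ × ℕ)) (m : ℕ) : Bool :=
  cond (Nat.beq m 0) true <| cond (Nat.beq (Nat.succ m) (Nat.pow 2 r)) true <|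
  cond (not (Nat.beq (maskDegree n tbl m 0) (maskDegree n tbl m q))) true <|
  cond (anySeparates n tbl m certs) true <|
  not (Nat.beq (maskTriangles n tbl m 0) (maskTriangles n tbl m q))

/-- The table `tbl` describes the orbits on pairs of the permutation with code `h`, where the digits
of `A` and `B` are representatives. -/
def tableCheck (n h r tbl A B : ℕ) : Bool :=
  decide (∀ i j : Fin n, i ≠ j → digit tbl (n * i + j) < r ∧ ∃ t : Fin 7,
    ((digit h)^[t] (digit A (digit tbl (n * i + j))) = i ∧
      (digit h)^[t] (digit B (digit tbl (n * i + j))) = j) ∨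
    ((digit h)^[t] (digit A (digit tbl (n * i + j))) = j ∧
      (digit h)^[t] (digit B (digit tbl (n * i + j))) = i)) &&
  decide (∀ i : Fin n, digit tbl (n * i + i) = 15) &&
  decide (∀ o : Fin r, digit A o < n ∧ digit B o < n ∧ digit A o ≠ digit B o)

section

variable {n k : ℕ}

/-- `G` is transitive on the unordered pairs of points. -/
def TwoHomogeneous (G : Subgroup (Perm (Fin n))) : Prop :=
  ∀ a b c d : Fin n, a ≠ b → c ≠ d → ∃ g ∈ G, (g a = c ∧ g b = d) ∨ (g a = d ∧ g b = c)

theorem exists_injective_extension {x y z : Fin n} (hxy : x ≠ y) (hxz : x ≠ z) (hyz : y ≠ z)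
    (hk : 2 ≤ k) (hkn : k + 1 ≤ n) :
    ∃ a : Fin (k + 1) → Fin n, Function.Injective a ∧ a 0 = x ∧ a 1 = y ∧ a (Fin.last k) = z := by
  let s : Finset (Fin (k + 1)) := {0, 1, Fin.last k}
  let f : Fin (k + 1) → Fin n := fun i => if i = 0 then x else if i = 1 then y else z
  have h01 : (0 : Fin (k + 1)) ≠ 1 := by simp [Fin.ext_iff]; omega
  have h0k : (0 : Fin (k + 1)) ≠ Fin.last k := by simp [Fin.ext_iff]; omega
  have h1k : (1 : Fin (k + 1)) ≠ Fin.last k := by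
    simp [Fin.ext_iff, Nat.mod_eq_of_lt (show 1 < k + 1 by omega)]; omega
  have f0 : f 0 = x := by simp [f]
  have f1 : f 1 = y := by simp [f, h01.symm]
  have fk : f (Fin.last k) = z := by simp [f, h0k.symm, h1k.symm]
  have hf : Set.InjOn f s := by
    intro i hi j hj hij
    simp only [s, Finset.coe_insert, Finset.coe_singleton, Set.mem_insert_iff,
      Set.mem_singleton_iff] at hi hj
    rcases hi with rfl | rfl | rfl <;> rcases hj with rfl | rfl | rfl <;>
      simp only [f0, f1, fk] at hij <;> first | rfl | (exfalso; first
        | exact hxy hij | exact hxz hij | exact hyz hij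
        | exact hxy hij.symm | exact hxz hij.symm | exact hyz hij.symm)
  obtain ⟨t, ht, htc⟩ := Finset.exists_superset_card_eq (s := ({x, y, z} : Finset (Fin n)))
    (n := k + 1) (Finset.card_le_three.trans (by omega)) (by rw [Fintype.card_fin]; exact hkn)
  obtain ⟨g, hg⟩ := Finset.exists_equiv_extend_of_card_eq (α := Fin (k + 1)) (t := t)
    (by rw [Fintype.card_fin, htc]) (s := s) (f := f) (by
      refine subset_trans ?_ ht
      simp [s, f0, f1, fk, Finset.image_insert]) hf
  refine ⟨fun i => g i, fun i j h => g.injective (Subtype.ext h), ?_, ?_, ?_⟩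
  · exact (hg 0 (by simp [s])).trans f0
  · exact (hg 1 (by simp [s])).trans f1
  · exact (hg (Fin.last k) (by simp [s])).trans fk

/-- Extend `x`, `y`, `z` to a tuple in which they are the entries `0`, `1` and `k`. Entries `0` and
`k` end up in one part, while entries `0` and `1` both belong to the section and hence end up in
different parts. -/
theorem HasStrongUT.exists_triple {G : Subgroup (Perm (Fin n))} (hG : HasStrongUT G k) (hk : 2 ≤ k)
    (hkn : k + 1 ≤ n) {x y z : Fin n} (hxy : x ≠ y) (hxz : x ≠ z) (hyz : y ≠ z)
    (P : Fin n → Fin k) (hP : Function.Surjective P) :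
    ∃ g ∈ G, P (g x) = P (g z) ∧ P (g x) ≠ P (g y) := by
  obtain ⟨a, ha, rfl, rfl, rfl⟩ := exists_injective_extension hxy hxz hyz hk hkn
  obtain ⟨g, hg, hs, he⟩ := hG.exists_section a ha P hP
  refine ⟨g, hg, he, fun h => hxy ?_⟩
  obtain ⟨w, -, hw⟩ := hs (P (g (a 0)))
  have h0 := hw (g (a 0)) ⟨⟨a 0, ⟨⟨0, by omega⟩, rfl⟩, rfl⟩, rfl⟩
  have h1 := hw (g (a 1)) ⟨⟨a 1, ⟨⟨1, by omega⟩, by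
    congr 1; ext; simp [Nat.mod_eq_of_lt (show 1 < k + 1 by omega)]⟩, rfl⟩, h.symm⟩
  exact g.injective (h0.trans h1.symm)

theorem exists_mem_apply_eq {G : Subgroup (Perm (Fin n))} (hG : MulAction.IsPreprimitive G (Fin n))
    (a b : Fin n) : ∃ g ∈ G, g a = b := by
  obtain ⟨g, hg⟩ := MulAction.exists_smul_eq G a b
  exact ⟨g, g.2, hg⟩

theorem noTriple_iff {tbl m : ℕ} {t u v : Bool → Bool} {R S : ℕ → ℕ → Bool} :
    noTriple n tbl m t u v R S = true ↔ ∀ x y z : Fin n, x ≠ z → y ≠ z → R x z = true →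
      S x y = true → t (maskAdj n tbl m x z) = true → u (maskAdj n tbl m x y) = true →
      v (maskAdj n tbl m z y) = true → False := by
  have hc : ∀ a b : Bool, cond a b true = true ↔ (a = true → b = true) := by decide
  have hc' : ∀ a b : Bool, cond a true b = true ↔ (a = false → b = true) := by decide
  have hb : ∀ a b : Fin n, Nat.beq a b = false ↔ a ≠ b := fun a b => by
    constructor
    · rintro h rfl; simp at h
    · intro h; exact nat_beq_false_of_ne fun e => h (Fin.ext e)
  simp only [noTriple, allBelow_iff, hc, hc', Bool.false_eq_true, imp_false]
  constructor
  · intro h x y z h1 h2 h3 h4 h5 h6 h7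
    exact h x x.2 z z.2 ((hb _ _).2 h1) h3 h5 y y.2 ((hb _ _).2 h2.symm) h4 h6 h7
  · intro h x hx z hz h1 h2 h3 y hy h4 h5 h6 h7
    exact h ⟨x, hx⟩ ⟨y, hy⟩ ⟨z, hz⟩ ((hb ⟨x, hx⟩ ⟨z, hz⟩).1 h1)
      (Ne.symm ((hb ⟨z, hz⟩ ⟨y, hy⟩).1 h4)) h2 h5 h3 h6 h7

theorem maskDegree_eq (tbl m : ℕ) (i : ℕ) :
    maskDegree n tbl m i = (Finset.univ.filter fun j : Fin n => maskAdj n tbl m i j = true).card := by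
  have key : ∀ l, (Nat.rec 0 (fun j r => cond (maskAdj n tbl m i j) (Nat.succ r) r) l : ℕ) =
      ((Finset.range l).filter fun j => maskAdj n tbl m i j = true).card := by
    intro l
    induction l with
    | zero => rfl
    | succ l ih =>
      rw [Finset.range_add_one, Finset.filter_insert]
      simp only [ih]
      cases maskAdj n tbl m i l <;> simp
  rw [maskDegree, key, Finset.card_filter, Finset.card_filter,
    Finset.sum_range fun j => if maskAdj n tbl m i j = true then 1 else 0]

theorem maskTriangles_eq (tbl m : ℕ) (i : ℕ) :
    maskTriangles n tbl m i = ∑ j : Fin n, (Finset.univ.filter fun l : Fin n =>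
      maskAdj n tbl m i j = true ∧ maskAdj n tbl m i l = true ∧
        maskAdj n tbl m j l = true).card := by
  have key1 : ∀ (j s l : ℕ), (Nat.rec s (fun l r => cond (maskAdj n tbl m i j)
      (cond (maskAdj n tbl m i l) (cond (maskAdj n tbl m j l) (Nat.succ r) r) r) r) l : ℕ) =
      s + ((Finset.range l).filter fun l => maskAdj n tbl m i j = true ∧
        maskAdj n tbl m i l = true ∧ maskAdj n tbl m j l = true).card := by
    intro j s l
    induction l with
    | zero => rfl
    | succ l ih =>
      rw [Finset.range_add_one, Finset.filter_insert]
      simp only [ih]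
      cases maskAdj n tbl m i j <;> cases maskAdj n tbl m i l <;> cases maskAdj n tbl m j l <;>
        simp <;> omega
  have key2 : ∀ l', (Nat.rec 0 (fun j r => Nat.rec r (fun l r => cond (maskAdj n tbl m i j)
      (cond (maskAdj n tbl m i l) (cond (maskAdj n tbl m j l) (Nat.succ r) r) r) r) n) l' : ℕ) =
      ∑ j ∈ Finset.range l', ((Finset.range n).filter fun l => maskAdj n tbl m i j = true ∧
        maskAdj n tbl m i l = true ∧ maskAdj n tbl m j l = true).card := by
    intro l'
    induction l' with
    | zero => rfl
    | succ l' ih => rw [Finset.sum_range_succ, ← ih, ← key1]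
  rw [maskTriangles, key2, Finset.sum_range]
  refine Finset.sum_congr rfl fun j _ => ?_
  rw [Finset.card_filter, Finset.card_filter, Finset.sum_range fun l =>
    if maskAdj n tbl m i j = true ∧ maskAdj n tbl m i l = true ∧ maskAdj n tbl m j l = true
      then 1 else 0]

/-- The bit mask with bits `e 0, …, e (r - 1)`. -/
theorem exists_mask (e : ℕ → Bool) (r : ℕ) :
    ∃ m < 2 ^ r, ∀ o, Nat.testBit m o = (decide (o < r) && e o) := by
  induction r with
  | zero => exact ⟨0, by norm_num, by simp⟩
  | succ r ih =>
    obtain ⟨m, hm, h⟩ := ih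
    refine ⟨m + (if e r then 2 ^ r else 0), by split_ifs <;> rw [pow_succ] <;> omega, fun o => ?_⟩
    have hor : m + (if e r then 2 ^ r else 0) = m ||| (if e r then 2 ^ r else 0) := by
      split_ifs
      · rw [Nat.or_comm, add_comm]
        simpa using Nat.two_pow_add_eq_or_of_lt hm 1
      · simp
    rw [hor, Nat.testBit_or, h]
    rcases lt_trichotomy o r with h1 | rfl | h1
    · split_ifs <;> simp [Nat.testBit_two_pow, h1, h1.ne', Nat.lt_succ_of_lt h1]
    · cases he : e o <;> simp [Nat.testBit_two_pow]
    · split_ifs <;> simp [Nat.testBit_two_pow, h1.ne, Nat.not_lt.2 h1.le, show ¬ o < r + 1 by omega]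

/-- A group with the strong universal transversal property is transitive on pairs, if all
invariant graphs of a given element are excluded. -/
theorem twoHomogeneous_of_graphTest {G : Subgroup (Perm (Fin n))} (hG : HasStrongUT G k)
    (hk : 2 ≤ k) (hkn : k + 1 ≤ n) {h r tbl A B q : ℕ} (hh : HasCode G h) (hq : q < n)
    (ht : tableCheck n h r tbl A B = true) (hr : r ≤ 15) {certs : List (ℕ × ℕ × ℕ × ℕ)}
    (hcerts : ∀ c ∈ certs, (∀ i : Fin n, digit c.1 i < k) ∧
      ∀ j : Fin k, ∃ i : Fin n, digit c.1 i = j)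
    (hm : allBelow (2 ^ r) (graphTest n r tbl q certs) = true) : TwoHomogeneous G := by
  classical
  intro a b c d hab hcd
  by_contra hno
  obtain ⟨f, hf, hfh⟩ := hh
  simp only [tableCheck, Bool.and_eq_true, decide_eq_true_eq] at ht
  obtain ⟨⟨ht1, ht2⟩, ht3⟩ := ht
  -- The graph whose edges are the images of the pair `a`, `b`. It is `G`-invariant, and by `hno`
  -- the pair `c`, `d` is not an edge.
  let E : Fin n → Fin n → Prop := fun i j => ∃ g ∈ G, (g a = i ∧ g b = j) ∨ (g a = j ∧ g b = i)
  have hsymm : ∀ i j, E i j → E j i := fun i j ⟨g, hg, h⟩ => ⟨g, hg, h.symm⟩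
  have hinv : ∀ g ∈ G, ∀ i j, E i j → E (g i) (g j) := by
    rintro g hg i j ⟨g', hg', h⟩
    exact ⟨g * g', G.mul_mem hg hg', by
      rcases h with ⟨rfl, rfl⟩ | ⟨rfl, rfl⟩ <;> simp [Perm.mul_apply]⟩
  have hinv' : ∀ g ∈ G, ∀ i j, E (g i) (g j) ↔ E i j := fun g hg i j =>
    ⟨fun h => by simpa using hinv g⁻¹ (G.inv_mem hg) _ _ h, hinv g hg i j⟩
  have hirr : ∀ i, ¬ E i i := by
    rintro i ⟨g, -, ⟨h1, h2⟩ | ⟨h1, h2⟩⟩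
    · exact hab (g.injective (h1.trans h2.symm))
    · exact hab (g.injective (h1.trans h2.symm))
  have hiter : ∀ (t : ℕ) (i : Fin n), (digit h)^[t] i = ((f ^ t) i : Fin n) := by
    intro t
    induction t with
    | zero => intro i; rfl
    | succ t ih =>
      intro i
      rw [Function.iterate_succ_apply, hfh i, ih, pow_succ, Perm.mul_apply]
  -- A `G`-invariant graph is a union of orbits on pairs of the single permutation with code `h`, so
  -- `r` bits describe it. Diagonal entries of the table are `15`, a bit that is never set since `r
  -- ≤ 15`.
  obtain ⟨m, hmlt, hmb⟩ := exists_mask (fun o => decide (∃ i j : Fin n, digit A o = i ∧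
    digit B o = j ∧ E i j)) r
  have hadj : ∀ i j : Fin n, maskAdj n tbl m i j = true ↔ E i j := by
    intro i j
    have h0 : maskAdj n tbl m i j = Nat.testBit m (digit tbl (n * i + j)) := by
      rw [maskAdj, force_eq, force_eq]; rfl
    rw [h0, hmb]
    by_cases hij : i = j
    · subst hij
      rw [ht2, show decide (15 < r) = false by simpa using hr]
      simp [hirr]
    · obtain ⟨hlt, t, htt⟩ := ht1 i j hij
      obtain ⟨hA, hB, -⟩ := ht3 ⟨_, hlt⟩
      rw [show decide (digit tbl (n * i + j) < r) = true by simpa using hlt, Bool.true_and,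
        decide_eq_true_eq]
      have e1 := hiter t ⟨_, hA⟩
      have e2 := hiter t ⟨_, hB⟩
      simp only at e1 e2
      rw [e1, e2] at htt
      have hpow : f ^ (t : ℕ) ∈ G := G.pow_mem hf t
      have hEAB : (∃ i' j' : Fin n, digit A (digit tbl (n * i + j)) = i' ∧
          digit B (digit tbl (n * i + j)) = j' ∧ E i' j') ↔ E ⟨_, hA⟩ ⟨_, hB⟩ := by
        constructor
        · rintro ⟨i', j', h1, h2, h3⟩
          rwa [show (⟨_, hA⟩ : Fin n) = i' from Fin.ext h1,
            show (⟨_, hB⟩ : Fin n) = j' from Fin.ext h2]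
        · intro h; exact ⟨_, _, rfl, rfl, h⟩
      rw [hEAB, ← hinv' _ hpow]
      rcases htt with ⟨h1, h2⟩ | ⟨h1, h2⟩
      · rw [Fin.ext h1, Fin.ext h2]
      · rw [Fin.ext h1, Fin.ext h2]
        exact ⟨hsymm _ _, hsymm _ _⟩
  have hadjg : ∀ g ∈ G, ∀ i j : Fin n, maskAdj n tbl m (g i) (g j) = maskAdj n tbl m i j :=
    fun g hg i j => by rw [Bool.eq_iff_iff, hadj, hadj, hinv' g hg]
  have hprim := hG.primitive
  have h0n : 0 < n := by omega
  -- Transitivity on points forces equal degrees and equally many triangles at `0` and at `q`. This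
  -- excludes graphs only if `q` lies outside the orbit of `0` under the permutation with code `h`.
  obtain ⟨g, hg, hg0⟩ := exists_mem_apply_eq hprim ⟨0, h0n⟩ ⟨q, hq⟩
  have htest := allBelow_iff.1 hm m hmlt
  have hdeg : maskDegree n tbl m 0 = maskDegree n tbl m q := by
    rw [maskDegree_eq, maskDegree_eq]
    refine Finset.card_bij' (fun i _ => g i) (fun i _ => g⁻¹ i) ?_ ?_ (by simp) (by simp)
    · intro i hi
      rw [Finset.mem_filter] at hi ⊢
      have := hadjg g hg ⟨0, h0n⟩ i
      rw [hg0] at this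
      exact ⟨Finset.mem_univ _, this.trans hi.2⟩
    · intro i hi
      rw [Finset.mem_filter] at hi ⊢
      have := hadjg g hg ⟨0, h0n⟩ (g⁻¹ i)
      rw [hg0] at this
      refine ⟨Finset.mem_univ _, this.symm.trans ?_⟩
      simpa using hi.2
  have htri : maskTriangles n tbl m 0 = maskTriangles n tbl m q := by
    rw [maskTriangles_eq, maskTriangles_eq]
    refine Fintype.sum_equiv g _ _ fun j => ?_
    refine Finset.card_bij' (fun i _ => g i) (fun i _ => g⁻¹ i) ?_ ?_ (by simp) (by simp)
    · intro i hi
      rw [Finset.mem_filter] at hi ⊢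
      have e1 := hadjg g hg ⟨0, h0n⟩ i
      have e2 := hadjg g hg ⟨0, h0n⟩ j
      rw [hg0] at e1 e2
      exact ⟨Finset.mem_univ _, e2.trans hi.2.1, e1.trans hi.2.2.1, (hadjg g hg j i).trans hi.2.2.2⟩
    · intro i hi
      rw [Finset.mem_filter] at hi ⊢
      have e1 := hadjg g hg ⟨0, h0n⟩ (g⁻¹ i)
      have e2 := hadjg g hg ⟨0, h0n⟩ j
      have e3 := hadjg g hg j (g⁻¹ i)
      rw [hg0] at e1 e2
      rw [show g (g⁻¹ i) = i by simp] at e1 e3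
      exact ⟨Finset.mem_univ _, e2.symm.trans hi.2.1, e1.symm.trans hi.2.2.1,
        e3.symm.trans hi.2.2.2⟩
  rw [graphTest] at htest
  have hc' : ∀ a b : Bool, cond a true b = true ↔ (a = true ∨ b = true) := by decide
  rw [hc', hc', hc', hc'] at htest
  rcases htest with h1 | h1 | h1 | h1 | h1
  -- The graph is not empty because `a`, `b` is an edge, and not complete because `c`, `d` is no
  -- edge.
  · have hm0 := Nat.eq_of_beq_eq_true h1
    have := (hadj a b).2 ⟨1, G.one_mem, Or.inl ⟨rfl, rfl⟩⟩
    rw [maskAdj, force_eq, force_eq, hm0] at this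
    simp at this
  · have hm1 := Nat.eq_of_beq_eq_true h1
    have := (not_congr (hadj c d)).2 fun ⟨g, hg, h⟩ => hno ⟨g, hg, h⟩
    rw [maskAdj, force_eq, force_eq] at this
    obtain ⟨hlt, -⟩ := ht1 c d hcd
    have e : m = 2 ^ r - 1 := by
      change m + 1 = 2 ^ r at hm1
      omega
    refine this ?_
    rw [e, Nat.testBit_two_pow_sub_one]
    simpa using hlt
  · rw [hdeg] at h1; simp at h1
  · clear hm
    induction certs with
    | nil => simp [anySeparates] at h1
    | cons e certs ih =>
      have hs : anySeparates n tbl m (e :: certs) = cond (separates n tbl m e.1 (boolTest e.2.1)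
        (boolTest e.2.2.1) (boolTest e.2.2.2)) true (anySeparates n tbl m certs) := rfl
      rw [hs, hc'] at h1
      rcases h1 with h1 | h1
      · have hc := hcerts e (by simp)
        rw [separates, Bool.cond_false_right, Bool.and_eq_true, noTriple_iff, Bool.not_eq_true',
          ← Bool.not_eq_true, noTriple_iff] at h1
        obtain ⟨h2, h3⟩ := h1
        -- A triple of the prescribed adjacency type exists. The strong property moves it into the
        -- position that the partition rules out, and adjacencies are preserved.
        refine h3 fun x y z hxz hyz _ hxy h5 h6 h7 => ?_
        have hxy' : x ≠ y := by rintro rfl; simp at hxy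
        obtain ⟨g, hg, hg1, hg2⟩ := hG.exists_triple hk hkn hxy' hxz hyz
          (fun i => ⟨digit e.1 i, hc.1 i⟩) fun j => by
            obtain ⟨i, hi⟩ := hc.2 j
            exact ⟨i, Fin.ext hi⟩
        refine h2 (g x) (g y) (g z) (g.injective.ne hxz) (g.injective.ne hyz)
          (by simpa using hg1) ?_ ?_ ?_ ?_
        · rw [nat_beq_false_of_ne fun e => hg2 (Fin.ext e)]; rfl
        · rwa [hadjg g hg]
        · rwa [hadjg g hg]
        · rwa [hadjg g hg]
      · exact ih (fun c hc => hcerts c (by simp [hc])) h1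
  · rw [htri] at h1; simp at h1

end

/-! ### Excluding the invariant graphs in each degree. -/

theorem tableCheck_four :
    tableCheck 4 0x2301 4
      0xf3123f2112f0210f 0x3221 0x2100 = true := by
  decide +kernel

/-- A certificate is the code of a partition followed by bits prescribing whether `xz`, `xy` and
`zy` are edges, where `1` stands for an edge. -/
theorem twoHomogeneous_four_2 {G : Subgroup (Perm (Fin 4))} (hG : HasStrongUT G 2)
    (hh : HasCode G 0x2301) : TwoHomogeneous G :=
  twoHomogeneous_of_graphTest hG (by norm_num) (by norm_num) hh (q := 3) (by norm_num)
    tableCheck_four (by norm_num)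
    (certs := [(0x110, 1, 0, 0), (0x110, 0, 1, 1), (0x1010, 1, 0, 0), (0x1100, 0, 1, 1)])
    (by decide +kernel) (by decide +kernel)

theorem tableCheck_five :
    tableCheck 5 0x4321 2
      0xf01100f01110f01110f00110f 0x21 0x0 = true := by
  decide +kernel

/-- A five-cycle is transitive, so degrees give nothing here. The graphs to exclude are the two
pentagons, one partition for each. -/
theorem twoHomogeneous_five_2 {G : Subgroup (Perm (Fin 5))} (hG : HasStrongUT G 2)
    (hh : HasCode G 0x4321) : TwoHomogeneous G :=
  twoHomogeneous_of_graphTest hG (by norm_num) (by norm_num) hh (q := 1) (by norm_num)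
    tableCheck_five (by norm_num)
    (certs := [(0x10110, 1, 0, 0), (0x1100, 1, 0, 0)])
    (by decide +kernel) (by decide +kernel)

theorem tableCheck_six :
    tableCheck 6 0x354021 5
      0xf441324f421344f321123f003120f023100f 0x43331 0x32100 = true := by
  decide +kernel

theorem twoHomogeneous_six_2 {G : Subgroup (Perm (Fin 6))} (hG : HasStrongUT G 2)
    (hh : HasCode G 0x354021) : TwoHomogeneous G :=
  twoHomogeneous_of_graphTest hG (by norm_num) (by norm_num) hh (q := 5) (by norm_num)
    tableCheck_six (by norm_num)
    (certs := [(0x111000, 1, 0, 0), (0x111000, 0, 1, 1), (0x111000, 0, 0, 0), (0x111000, 0, 1, 0)])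
    (by decide +kernel) (by decide +kernel)

theorem twoHomogeneous_six_3 {G : Subgroup (Perm (Fin 6))} (hG : HasStrongUT G 3)
    (hh : HasCode G 0x354021) : TwoHomogeneous G :=
  twoHomogeneous_of_graphTest hG (by norm_num) (by norm_num) hh (q := 5) (by norm_num)
    tableCheck_six (by norm_num)
    (certs := [(0x102210, 1, 0, 0), (0x210210, 0, 1, 1), (0x200010, 0, 0, 1), (0x21100, 0, 1, 1)])
    (by decide +kernel) (by decide +kernel)

theorem tableCheck_seven :
    tableCheck 7 0x654321 3
      0xf0122100f0122110f0122210f0122210f0112210f0012210f 0x321 0x0 = true := by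
  decide +kernel

theorem twoHomogeneous_seven_2 {G : Subgroup (Perm (Fin 7))} (hG : HasStrongUT G 2)
    (hh : HasCode G 0x654321) : TwoHomogeneous G :=
  twoHomogeneous_of_graphTest hG (by norm_num) (by norm_num) hh (q := 1) (by norm_num)
    tableCheck_seven (by norm_num)
    (certs := [(0x1110, 0, 1, 1), (0x1101010, 0, 1, 1), (0x1100100, 1, 0, 0), (0x100100, 0, 1, 1),
      (0x1010000, 1, 0, 0), (0x111000, 1, 0, 0)])
    (by decide +kernel) (by decide +kernel)

theorem twoHomogeneous_seven_3 {G : Subgroup (Perm (Fin 7))} (hG : HasStrongUT G 3)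
    (hh : HasCode G 0x654321) : TwoHomogeneous G :=
  twoHomogeneous_of_graphTest hG (by norm_num) (by norm_num) hh (q := 1) (by norm_num)
    tableCheck_seven (by norm_num)
    (certs := [(0x2102210, 0, 1, 1), (0x120110, 1, 0, 0)])
    (by decide +kernel) (by decide +kernel)

theorem tableCheck_eight :
    tableCheck 8 0x76354021 10
      0xf98887779f66655586f44132864f42138644f32175123f00753120f07523100f 0x7776643331 0x6303032100 = true := by
  decide +kernel

theorem twoHomogeneous_eight_2 {G : Subgroup (Perm (Fin 8))} (hG : HasStrongUT G 2)
    (hh : HasCode G 0x76354021) : TwoHomogeneous G :=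
  twoHomogeneous_of_graphTest hG (by norm_num) (by norm_num) hh (q := 7) (by norm_num)
    tableCheck_eight (by norm_num)
    (certs := [(0x1000000, 1, 0, 0), (0x1000000, 0, 1, 1), (0x1000000, 1, 1, 1), (0x1111000, 0, 0, 0),
      (0x10111000, 1, 0, 0), (0x1111000, 0, 1, 1), (0x10111000, 0, 0, 1), (0x1111000, 0, 1, 0),
      (0x111000, 0, 0, 0), (0x10000000, 0, 1, 1), (0x111000, 0, 0, 1), (0x10111000, 0, 0, 0)])
    (by decide +kernel) (by decide +kernel)

theorem twoHomogeneous_eight_3 {G : Subgroup (Perm (Fin 8))} (hG : HasStrongUT G 3)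
    (hh : HasCode G 0x76354021) : TwoHomogeneous G :=
  twoHomogeneous_of_graphTest hG (by norm_num) (by norm_num) hh (q := 7) (by norm_num)
    tableCheck_eight (by norm_num)
    (certs := [(0x21111000, 0, 1, 1), (0x21111000, 1, 0, 0), (0x21000000, 1, 1, 1), (0x10211000, 1, 0,
      0), (0x12111000, 0, 0, 1), (0x2111000, 1, 0, 1), (0x210000, 1, 1, 1), (0x21000000, 0, 0,
      0), (0x12222110, 0, 1, 0), (0x20221000, 1, 0, 1)])
    (by decide +kernel) (by decide +kernel)

theorem twoHomogeneous_eight_4 {G : Subgroup (Perm (Fin 8))} (hG : HasStrongUT G 4)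
    (hh : HasCode G 0x76354021) : TwoHomogeneous G :=
  twoHomogeneous_of_graphTest hG (by norm_num) (by norm_num) hh (q := 7) (by norm_num)
    tableCheck_eight (by norm_num)
    (certs := [(0x321000, 1, 1, 1), (0x33210210, 0, 0, 0), (0x33210210, 1, 0, 0), (0x33021210, 0, 1, 1),
      (0x2333210, 0, 1, 1), (0x10233210, 1, 0, 0), (0x13222010, 1, 0, 1), (0x32001110, 0, 0, 1)])
    (by decide +kernel) (by decide +kernel)

theorem tableCheck_eightSeven :
    tableCheck 8 0x70654321 4
      0xf33333333f01221030f01221310f01223210f01232210f01312210f03012210f 0x7321 0x0 = true := by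
  decide +kernel

/-- No partitions are required. Invariant under a seven-cycle fixing `7`, a graph has degree `0` or
`7` at the point `7`, and degree `2 j` or `2 j + 1` respectively at the others with `j ≤ 3`; it is
regular only if it is empty or complete. -/
theorem twoHomogeneous_eightSeven_2 {G : Subgroup (Perm (Fin 8))} (hG : HasStrongUT G 2)
    (hh : HasCode G 0x70654321) : TwoHomogeneous G :=
  twoHomogeneous_of_graphTest hG (by norm_num) (by norm_num) hh (q := 7) (by norm_num)
    tableCheck_eightSeven (by norm_num)
    (certs := [])
    (by decide +kernel) (by decide +kernel)

theorem twoHomogeneous_eightSeven_3 {G : Subgroup (Perm (Fin 8))} (hG : HasStrongUT G 3)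
    (hh : HasCode G 0x70654321) : TwoHomogeneous G :=
  twoHomogeneous_of_graphTest hG (by norm_num) (by norm_num) hh (q := 7) (by norm_num)
    tableCheck_eightSeven (by norm_num)
    (certs := [])
    (by decide +kernel) (by decide +kernel)

theorem twoHomogeneous_eightSeven_4 {G : Subgroup (Perm (Fin 8))} (hG : HasStrongUT G 4)
    (hh : HasCode G 0x70654321) : TwoHomogeneous G :=
  twoHomogeneous_of_graphTest hG (by norm_num) (by norm_num) hh (q := 7) (by norm_num)
    tableCheck_eightSeven (by norm_num)
    (certs := [])
    (by decide +kernel) (by decide +kernel)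

theorem tableCheck_nine :
    tableCheck 9 0x687354021 12
      0xfbb8a9576bfb98a657bbfa9876589af44132a894f42139a844f321567123f007563120f067523100f 0x766666643331 0x654321032100 = true := by
  decide +kernel

theorem twoHomogeneous_nine_2 {G : Subgroup (Perm (Fin 9))} (hG : HasStrongUT G 2)
    (hh : HasCode G 0x687354021) : TwoHomogeneous G :=
  twoHomogeneous_of_graphTest hG (by norm_num) (by norm_num) hh (q := 8) (by norm_num)
    tableCheck_nine (by norm_num)
    (certs := [(0x111000, 1, 1, 1), (0x111000, 0, 0, 0), (0x111000, 0, 1, 1), (0x111000, 1, 0, 0),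
      (0x111111000, 1, 0, 0), (0x111111000, 0, 1, 1), (0x111000000, 1, 0, 0), (0x111000000, 0,
      1, 1), (0x100100000, 0, 1, 1), (0x100001000, 0, 1, 1), (0x1100000, 0, 1, 1), (0x1100010,
      1, 0, 0), (0x1010100, 1, 0, 0), (0x100100100, 1, 0, 0), (0x110110110, 1, 1, 1),
      (0x10010100, 0, 1, 0), (0x101101110, 1, 1, 1), (0x100001100, 0, 0, 1), (0x10100100, 0, 0,
      1), (0x1010100, 0, 1, 0), (0x100010100, 0, 1, 0), (0x1100010, 0, 1, 0), (0x1100100, 0, 0,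
      1), (0x101110110, 0, 0, 0), (0x10001100, 0, 0, 0), (0x10001010, 0, 0, 0), (0x101011110, 1,
      0, 1), (0x10100100, 1, 0, 1), (0x10100010, 1, 0, 1), (0x1001100, 1, 1, 0), (0x1001010, 1,
      1, 0), (0x110110110, 0, 0, 0)])
    (by decide +kernel) (by decide +kernel)

theorem twoHomogeneous_nine_3 {G : Subgroup (Perm (Fin 9))} (hG : HasStrongUT G 3)
    (hh : HasCode G 0x687354021) : TwoHomogeneous G :=
  twoHomogeneous_of_graphTest hG (by norm_num) (by norm_num) hh (q := 8) (by norm_num)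
    tableCheck_nine (by norm_num)
    (certs := [(0x222111000, 1, 1, 1), (0x222111000, 0, 0, 0), (0x222111000, 1, 0, 0), (0x222111000, 0,
      1, 1), (0x201000, 1, 1, 1), (0x21000, 0, 0, 0), (0x102021210, 0, 1, 1), (0x102021210, 1,
      0, 0), (0x102210210, 1, 0, 0), (0x102210210, 0, 1, 1), (0x102102210, 1, 1, 0),
      (0x102102210, 0, 1, 0)])
    (by decide +kernel) (by decide +kernel)

theorem twoHomogeneous_nine_4 {G : Subgroup (Perm (Fin 9))} (hG : HasStrongUT G 4)
    (hh : HasCode G 0x687354021) : TwoHomogeneous G :=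
  twoHomogeneous_of_graphTest hG (by norm_num) (by norm_num) hh (q := 8) (by norm_num)
    tableCheck_nine (by norm_num)
    (certs := [(0x21333210, 1, 0, 0), (0x21333210, 0, 1, 1), (0x333021210, 1, 1, 1), (0x333021210, 0, 0,
      0), (0x102333210, 1, 0, 0), (0x210333210, 0, 1, 1), (0x321000, 0, 0, 0), (0x321000, 1, 1,
      1)])
    (by decide +kernel) (by decide +kernel)

theorem tableCheck_ten :
    tableCheck 10 0x5987604321 9
      0xf7887265437f7883265487f7843265887f7543267887f6543223456f0110623450f0115623410f0145623110f0345620110f 0x765555521 0x554321000 = true := by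
  decide +kernel

theorem twoHomogeneous_ten_2 {G : Subgroup (Perm (Fin 10))} (hG : HasStrongUT G 2)
    (hh : HasCode G 0x5987604321) : TwoHomogeneous G :=
  twoHomogeneous_of_graphTest hG (by norm_num) (by norm_num) hh (q := 9) (by norm_num)
    tableCheck_ten (by norm_num)
    (certs := [(0x1111100000, 1, 0, 0), (0x1111100000, 0, 1, 1), (0x110110010, 1, 0, 0), (0x111011000,
      0, 1, 1), (0x1010110100, 1, 0, 0), (0x1110001100, 0, 1, 1), (0x1001111000, 1, 0, 0),
      (0x101110010, 0, 1, 1), (0x11100110, 1, 0, 0), (0x1101001010, 0, 1, 1), (0x1111100000, 0,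
      0, 0), (0x1011010100, 1, 0, 0), (0x1110000110, 0, 1, 1), (0x11011000, 1, 0, 0),
      (0x110110110, 0, 1, 1), (0x1111100000, 0, 1, 0)])
    (by decide +kernel) (by decide +kernel)

theorem twoHomogeneous_ten_3 {G : Subgroup (Perm (Fin 10))} (hG : HasStrongUT G 3)
    (hh : HasCode G 0x5987604321) : TwoHomogeneous G :=
  twoHomogeneous_of_graphTest hG (by norm_num) (by norm_num) hh (q := 9) (by norm_num)
    tableCheck_ten (by norm_num)
    (certs := [(0x1221100000, 1, 0, 0), (0x2222201110, 0, 1, 1), (0x2222210110, 0, 1, 1), (0x1212100000,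
      1, 0, 0), (0x202120210, 1, 0, 0), (0x211021100, 0, 1, 1), (0x21121100, 1, 0, 0),
      (0x210121010, 0, 1, 1), (0x2201120010, 0, 1, 1), (0x100222110, 1, 0, 0), (0x2102021110, 1,
      0, 0), (0x2111020210, 0, 1, 1), (0x2021020010, 1, 0, 0), (0x2212002110, 1, 0, 0),
      (0x1122020010, 0, 1, 1), (0x2011220010, 0, 1, 1), (0x1012122100, 1, 0, 0), (0x1110220210,
      0, 1, 1), (0x1021022210, 1, 0, 0), (0x2110002110, 0, 1, 1), (0x2212021100, 0, 1, 1),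
      (0x212102100, 0, 1, 1), (0x2022102110, 0, 1, 1), (0x2210002110, 1, 0, 0), (0x12211210, 1,
      0, 0), (0x202121110, 0, 1, 1), (0x2220112010, 1, 0, 0), (0x1021010010, 0, 1, 1),
      (0x2102210210, 1, 0, 0), (0x210122210, 0, 1, 1), (0x1010222210, 0, 1, 1), (0x1021120210,
      1, 0, 0), (0x2112100000, 1, 0, 1), (0x2222201100, 0, 0, 1)])
    (by decide +kernel) (by decide +kernel)

theorem twoHomogeneous_ten_4 {G : Subgroup (Perm (Fin 10))} (hG : HasStrongUT G 4)
    (hh : HasCode G 0x5987604321) : TwoHomogeneous G :=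
  twoHomogeneous_of_graphTest hG (by norm_num) (by norm_num) hh (q := 9) (by norm_num)
    tableCheck_ten (by norm_num)
    (certs := [(0x3333321100, 1, 0, 0), (0x3322100000, 0, 1, 1), (0x3333320210, 1, 0, 0), (0x3212100000,
      0, 1, 1), (0x2312100000, 1, 1, 1), (0x3333310210, 0, 0, 0), (0x3333321100, 0, 1, 1),
      (0x3322100000, 1, 0, 0), (0x123232010, 1, 0, 1), (0x3210032210, 0, 1, 0), (0x1003232210,
      1, 1, 0), (0x3210221010, 0, 1, 0), (0x23122100, 0, 0, 1), (0x331003210, 1, 1, 0),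
      (0x3132100000, 1, 1, 0), (0x3333302100, 0, 0, 1)])
    (by decide +kernel) (by decide +kernel)

theorem twoHomogeneous_ten_5 {G : Subgroup (Perm (Fin 10))} (hG : HasStrongUT G 5)
    (hh : HasCode G 0x5987604321) : TwoHomogeneous G :=
  twoHomogeneous_of_graphTest hG (by norm_num) (by norm_num) hh (q := 9) (by norm_num)
    tableCheck_ten (by norm_num)
    (certs := [(0x3210443210, 1, 0, 0), (0x3210443210, 0, 1, 1), (0x14232100, 1, 0, 0), (0x104322210, 0,
      1, 1)])
    (by decide +kernel) (by decide +kernel)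

/-! ### Permutation isomorphism -/

theorem PermIso.symm {X Y : Type*} {G : Subgroup (Perm X)} {H : Subgroup (Perm Y)}
    (h : PermIso G H) : PermIso H G := by
  obtain ⟨e, rfl⟩ := h
  refine ⟨e.symm, ?_⟩
  ext g
  simp only [Subgroup.mem_map]
  constructor
  · rintro ⟨_, ⟨f, hf, rfl⟩, rfl⟩
    convert hf using 1
    ext x
    simp [Equiv.permCongrHom, Equiv.permCongr_apply]
  · intro hg
    refine ⟨_, ⟨g, hg, rfl⟩, ?_⟩
    ext x
    simp [Equiv.permCongrHom, Equiv.permCongr_apply]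

theorem PermIso.trans {X Y Z : Type*} {G : Subgroup (Perm X)} {H : Subgroup (Perm Y)}
    {K : Subgroup (Perm Z)} (h : PermIso G H) (h' : PermIso H K) : PermIso G K := by
  obtain ⟨e, rfl⟩ := h
  obtain ⟨f, rfl⟩ := h'
  refine ⟨e.trans f, ?_⟩
  rw [Subgroup.map_map]
  congr 1

theorem HasStrongUT.of_permIso {X Y : Type*} {G : Subgroup (Perm X)} {H : Subgroup (Perm Y)}
    {k : ℕ} (h : PermIso G H) (hG : HasStrongUT G k) : HasStrongUT H k := by
  obtain ⟨e, rfl⟩ := h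
  constructor
  · let φ : G → G.map e.permCongrHom.toMonoidHom := fun g => ⟨e.permCongrHom g, g, g.2, rfl⟩
    let f : X →ₑ[φ] Y := ⟨e, fun g x => by
      change e ((g : Perm X) x) = e ((g : Perm X) (e.symm (e x)))
      rw [e.symm_apply_apply]⟩
    exact hG.primitive.of_surjective (f := f) e.surjective
  · intro a ha P hP
    obtain ⟨g, hg, hs, he⟩ := hG.exists_section (fun i => e.symm (a i))
      (e.symm.injective.comp ha) (fun x => P (e x)) (hP.comp e.surjective)
    refine ⟨e.permCongrHom g, ⟨g, hg, rfl⟩, ?_, he⟩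
    intro i
    obtain ⟨x, ⟨⟨y, ⟨j, rfl⟩, rfl⟩, hx⟩, hu⟩ := hs i
    refine ⟨_, ⟨⟨a j.castSucc, ⟨j, rfl⟩, rfl⟩, hx⟩, ?_⟩
    rintro _ ⟨⟨_, ⟨l, rfl⟩, rfl⟩, hz⟩
    have := hu (g (e.symm (a l.castSucc))) ⟨⟨_, ⟨l, rfl⟩, rfl⟩, hz⟩
    exact congrArg e this

section

variable {n k : ℕ}

theorem permIso_conjGroup (σ : Perm (Fin n)) (G : Subgroup (Perm (Fin n))) :
    PermIso G (conjGroup σ G) := permIso_of_conjGroup (σ := σ) ⟨Equiv.refl _, by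
  ext g
  simp only [Subgroup.mem_map]
  constructor
  · rintro ⟨f, hf, rfl⟩; exact hf
  · intro hg; exact ⟨g, hg, rfl⟩⟩

theorem TwoHomogeneous.conjGroup {G : Subgroup (Perm (Fin n))} (hG : TwoHomogeneous G)
    (σ : Perm (Fin n)) : TwoHomogeneous (conjGroup σ G) := by
  intro a b c d hab hcd
  obtain ⟨g, hg, h⟩ := hG (σ a) (σ b) (σ c) (σ d) (σ.injective.ne hab) (σ.injective.ne hcd)
  refine ⟨σ⁻¹ * g * σ, by rw [mem_conjGroup]; simpa [mul_assoc] using hg, ?_⟩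
  rw [Perm.mul_apply, Perm.mul_apply, Perm.mul_apply, Perm.mul_apply]
  rcases h with ⟨h1, h2⟩ | ⟨h1, h2⟩ <;> rw [h1, h2] <;> simp

theorem TwoHomogeneous.of_conjGroup {G : Subgroup (Perm (Fin n))} {σ : Perm (Fin n)}
    (hG : TwoHomogeneous (_root_.conjGroup σ G)) : TwoHomogeneous G := by
  have := hG.conjGroup σ⁻¹
  have e : _root_.conjGroup σ⁻¹ (_root_.conjGroup σ G) = G := by
    ext g
    rw [mem_conjGroup, mem_conjGroup]
    simp [mul_assoc]
  rwa [e] at this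

/-! ### Orders and elements of prime order -/

theorem dvd_card_of_isPreprimitive {G : Subgroup (Perm (Fin n))}
    (hG : MulAction.IsPreprimitive G (Fin n)) (hn : n ≠ 0) : n ∣ Nat.card G := by
  have := MulAction.index_stabilizer_of_transitive G (⟨0, by omega⟩ : Fin n)
  rw [Nat.card_eq_fintype_card, Fintype.card_fin] at this
  have h := Subgroup.index_dvd_card (MulAction.stabilizer G (⟨0, by omega⟩ : Fin n))
  rwa [this] at h

open Pointwise in
-- Orbit-stabilizer for the action on two-element subsets, which form a single orbit.
theorem TwoHomogeneous.choose_dvd_card {G : Subgroup (Perm (Fin n))} (hG : TwoHomogeneous G)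
    (hn : 2 ≤ n) : n.choose 2 ∣ Nat.card G := by
  let s : Finset (Fin n) := {⟨0, by omega⟩, ⟨1, by omega⟩}
  have hcoe : ∀ (g : G) (t : Finset (Fin n)), g • t = t.image (g : Perm (Fin n)) := fun g t => rfl
  have horb : MulAction.orbit G s = ((Finset.univ : Finset (Fin n)).powersetCard 2 : Set _) := by
    ext t
    simp only [MulAction.mem_orbit_iff, hcoe, s,
      Finset.image_insert, Finset.image_singleton, Finset.mem_coe, Finset.mem_powersetCard]
    constructor
    · rintro ⟨g, rfl⟩
      refine ⟨Finset.subset_univ _, Finset.card_pair ?_⟩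
      rw [(g : Perm (Fin n)).injective.ne_iff]
      simp
    · rintro ⟨-, ht⟩
      obtain ⟨c, d, hcd, rfl⟩ := Finset.card_eq_two.1 ht
      obtain ⟨g, hg, h⟩ := hG ⟨0, by omega⟩ ⟨1, by omega⟩ c d (by simp) hcd
      refine ⟨⟨g, hg⟩, ?_⟩
      rcases h with ⟨h1, h2⟩ | ⟨h1, h2⟩
      · rw [← h1, ← h2]
      · rw [← h1, ← h2]; exact Finset.pair_comm _ _
  have h1 := MulAction.index_stabilizer G s
  rw [horb, Set.ncard_coe_finset, Finset.card_powersetCard, Finset.card_univ, Fintype.card_fin] at h1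
  rw [← h1]
  exact Subgroup.index_dvd_card _

theorem exists_orderOf_eq_prime {G : Subgroup (Perm (Fin n))} {p : ℕ} (hp : p.Prime)
    (h : p ∣ Nat.card G) : ∃ g ∈ G, orderOf g = p := by
  have := Fact.mk hp
  obtain ⟨g, hg⟩ := exists_prime_orderOf_dvd_card' p h
  exact ⟨g, g.2, by rw [← hg, Subgroup.orderOf_coe]⟩

theorem cycleType_eq_replicate {g : Perm (Fin n)} {p : ℕ} (hp : p.Prime) (hg : orderOf g = p) :
    ∃ m, g.cycleType = Multiset.replicate (m + 1) p ∧ g.support.card = (m + 1) * p := by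
  obtain ⟨m, hm⟩ := Perm.cycleType_prime_order (σ := g) (by rw [hg]; exact hp)
  rw [hg] at hm
  refine ⟨m, hm, ?_⟩
  rw [← Perm.sum_cycleType, hm, Multiset.sum_replicate, smul_eq_mul]

theorem alternatingGroup_le_of_prime_cycle_support {G : Subgroup (Perm (Fin n))}
    (hG : MulAction.IsPreprimitive G (Fin n)) {g : Perm (Fin n)} (hg : g ∈ G) {p : ℕ}
    (hp : p.Prime) (ho : orderOf g = p) (hs : g.support.card = p) (h3 : p = 3 ∨ p + 3 ≤ n) :
    alternatingGroup (Fin n) ≤ G := by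
  have hc : g.IsCycle := Perm.isCycle_of_prime_order (by rw [ho]; exact hp)
    (by rw [ho, hs]; have := hp.pos; omega)
  rcases h3 with rfl | h3
  · exact Perm.alternatingGroup_le_of_isPreprimitive_of_isThreeCycle_mem hG
      (card_support_eq_three_iff.1 hs) hg
  · exact alternatingGroup_le_of_primeCycle hG hg hc (by rw [hs]; exact hp)
      (by rw [hs, Fintype.card_fin]; exact h3)

/-- The permutation with code `h` has order `p` and moves exactly `s` points. -/
noncomputable def primeCheck (n h p s : ℕ) : Bool :=
  validCode n h && decide (wordCode n [h] (List.replicate p 0) = idCode n) &&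
  decide ((Finset.univ.filter fun i : Fin n => digit h i ≠ i).card = s) && decide (s ≠ 0)

theorem isCode_word_replicate (hn : n ≤ 16) {g : Perm (Fin n)} {h : ℕ} (hg : IsCode g h) (p : ℕ) :
    IsCode (g ^ p) (wordCode n [h] (List.replicate p 0)) := by
  induction p with
  | zero => exact IsCode.one hn
  | succ p ih =>
    have : wordCode n [h] (List.replicate (p + 1) 0) =
        comp n h (wordCode n [h] (List.replicate p 0)) := by
      have h0 : wordCode n [h] (List.replicate (p + 1) 0) =
        force (wordCode n [h] (List.replicate p 0)) fun r' => force h fun x => comp n x r' := rfl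
      rw [h0, force_eq, force_eq]
    rw [this, pow_succ']
    exact hg.comp ih

/-- An element of prime order `p` is a product of `p`-cycles, so its cycle type is determined by the
number of points it moves, and equal cycle types are conjugate in the symmetric group. -/
theorem exists_conj_hasCode {G : Subgroup (Perm (Fin n))} (hn : n ≤ 16) {g : Perm (Fin n)}
    (hg : g ∈ G) {h p s : ℕ} (hp : p.Prime) (ho : orderOf g = p) (hs : g.support.card = s)
    (hc : primeCheck n h p s = true) : ∃ σ, HasCode (conjGroup σ G) h := by
  simp only [primeCheck, Bool.and_eq_true, decide_eq_true_eq] at hc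
  obtain ⟨⟨⟨hv, hw⟩, hsupp⟩, hs0⟩ := hc
  have hcode := isCode_permOf hv
  have hsupp' : (permOf n h).support.card = s := by
    rw [← hsupp]
    congr 1
    ext i
    rw [Perm.mem_support, Finset.mem_filter, hcode i]
    simp [Fin.ext_iff]
  have hpow : permOf n h ^ p = 1 := by
    have := isCode_word_replicate hn hcode p
    rw [hw] at this
    exact this.unique (IsCode.one hn)
  have ho' : orderOf (permOf n h) = p := by
    have := Fact.mk hp
    refine orderOf_eq_prime hpow fun h1 => ?_
    rw [h1, Perm.support_one, Finset.card_empty] at hsupp'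
    exact hs0 hsupp'.symm
  obtain ⟨m, hm, hm'⟩ := cycleType_eq_replicate hp ho
  obtain ⟨l, hl, hl'⟩ := cycleType_eq_replicate hp ho'
  have : m = l := by
    have : (m + 1) * p = (l + 1) * p := by rw [← hm', ← hl', hs, hsupp']
    have := Nat.eq_of_mul_eq_mul_right hp.pos this
    omega
  obtain ⟨c, hc⟩ := isConj_iff.1 (Perm.isConj_iff_cycleType_eq.2 (hm.trans (this ▸ hl.symm)))
  refine ⟨c⁻¹, permOf n h, ?_, hcode⟩
  rw [mem_conjGroup, ← hc]
  simpa [mul_assoc] using hg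

/-! ### Transitive subgroups of prime power order -/

/-- Let `p ^ ν` be the order of a Sylow subgroup `S` and `p ^ j` that of the stabilizer of `a` in
`S`. The latter divides the order of the stabilizer in `H`, whose index is `p ^ m`, so `m + j ≤ ν`,
and the orbit of `a` under `S` has at least `p ^ m` points. -/
theorem exists_transitive_pSubgroup {H : Subgroup (Perm (Fin n))} {s : Finset (Fin n)} {p m : ℕ}
    (hp : p.Prime) (hs : s.card = p ^ m) (hH : ∀ a ∈ s, ∀ b, b ∈ s ↔ ∃ h ∈ H, h a = b) :
    ∃ P ≤ H, IsPGroup p P ∧ ∀ a ∈ s, ∀ b ∈ s, ∃ h ∈ P, h a = b := by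
  have := Fact.mk hp
  let S : Sylow p H := default
  refine ⟨(S : Subgroup H).map H.subtype, Subgroup.map_subtype_le _, S.2.map _, ?_⟩
  intro a ha
  have horbH : MulAction.orbit H a = (s : Set (Fin n)) := by
    ext b
    rw [Finset.mem_coe, hH a ha b, MulAction.mem_orbit_iff]
    exact ⟨fun ⟨h, hb⟩ => ⟨h, h.2, hb⟩, fun ⟨h, hh, hb⟩ => ⟨⟨h, hh⟩, hb⟩⟩
  have h1 : p ^ m * Nat.card (MulAction.stabilizer H a) = Nat.card H := by
    rw [← Subgroup.index_mul_card (MulAction.stabilizer H a), MulAction.index_stabilizer, horbH,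
      Set.ncard_coe_finset, hs]
  have hsub : MulAction.orbit S a ⊆ (s : Set (Fin n)) := by
    rw [← horbH]
    rintro b ⟨h, rfl⟩
    exact ⟨(h : H), rfl⟩
  have h2 : (MulAction.orbit S a).ncard * Nat.card (MulAction.stabilizer S a) = Nat.card S := by
    rw [← Subgroup.index_mul_card (MulAction.stabilizer S a), MulAction.index_stabilizer]
  -- the stabilizer in `S` embeds into the stabilizer in `H`
  have h3 : Nat.card (MulAction.stabilizer S a) ∣ Nat.card (MulAction.stabilizer H a) := by
    let f : MulAction.stabilizer S a →* MulAction.stabilizer H a := MonoidHom.mk'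
      (fun x => ⟨((x : S) : H), x.2⟩) (fun _ _ => rfl)
    refine Subgroup.card_dvd_of_injective f fun x y hxy => ?_
    have := congrArg (fun z : MulAction.stabilizer H a => (z : H)) hxy
    exact Subtype.ext (Subtype.ext this)
  have h4 : Nat.card S = p ^ (Nat.card H).factorization p := S.card_eq_multiplicity
  have hle : p ^ m ≤ (MulAction.orbit S a).ncard := by
    have hpos : 0 < Nat.card (MulAction.stabilizer S a) := Nat.card_pos
    obtain ⟨j, hj, hj'⟩ := (Nat.dvd_prime_pow hp).1 (h4 ▸ Subgroup.card_subgroup_dvd_card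
      (MulAction.stabilizer S a))
    have hdvd : p ^ (m + j) ∣ Nat.card H := by
      rw [← h1, pow_add, ← hj']
      exact mul_dvd_mul_left _ h3
    have hle := (hp.pow_dvd_iff_le_factorization Nat.card_pos.ne').1 hdvd
    have : p ^ m * p ^ j ≤ (MulAction.orbit S a).ncard * p ^ j := by
      rw [← hj', h2, h4, hj', ← pow_add]
      exact Nat.pow_le_pow_right hp.pos hle
    exact Nat.le_of_mul_le_mul_right this (pow_pos hp.pos j)
  have heq : MulAction.orbit S a = (s : Set (Fin n)) :=
    Set.eq_of_subset_of_ncard_le hsub (by rw [Set.ncard_coe_finset, hs]; exact hle)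
      (Set.toFinite _)
  intro b hb
  have : b ∈ MulAction.orbit S a := heq ▸ hb
  obtain ⟨h, hh⟩ := this
  exact ⟨_, ⟨h, h.2, rfl⟩, hh⟩

/-- A nontrivial `p`-group has a central element of order `p`. The fixed points of a central element
are permuted by the whole group, so by transitivity it fixes all points of `s` or none; fixing all
would make it the identity. -/
theorem exists_central_of_isPGroup {P : Subgroup (Perm (Fin n))} {s : Finset (Fin n)} {p : ℕ}
    (hp : p.Prime) (hP : IsPGroup p P) (hs : 1 < s.card)
    (ht : ∀ a ∈ s, ∀ b ∈ s, ∃ h ∈ P, h a = b) (hfix : ∀ h ∈ P, ∀ a, a ∉ s → h a = a) :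
    ∃ z ∈ P, orderOf z = p ∧ z.support = s ∧ ∀ y ∈ P, z * y = y * z := by
  have := Fact.mk hp
  obtain ⟨a, ha, b, hb, hab⟩ := Finset.one_lt_card.1 hs
  obtain ⟨h, hh, hhab⟩ := ht a ha b hb
  have hnt : Nontrivial P := ⟨⟨h, hh⟩, 1, fun e => hab (by
    have := congrArg (fun x : P => (x : Perm (Fin n)) a) e
    simpa [hhab, eq_comm] using this)⟩
  have hc := hP.center_nontrivial
  have hcp : IsPGroup p (Subgroup.center P) := hP.to_subgroup _
  have hdvd : p ∣ Nat.card (Subgroup.center P) := by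
    obtain ⟨m, hm⟩ := IsPGroup.iff_card.1 hcp
    rw [hm]
    refine dvd_pow_self p ?_
    rintro rfl
    rw [pow_zero, Nat.card_eq_one_iff_unique] at hm
    exact not_subsingleton _ hm.1
  obtain ⟨z, hz⟩ := exists_prime_orderOf_dvd_card' p hdvd
  have hzo : orderOf ((z : P) : Perm (Fin n)) = p := by
    rw [Subgroup.orderOf_coe, Subgroup.orderOf_coe, hz]
  have hcomm : ∀ y ∈ P, ((z : P) : Perm (Fin n)) * y = y * ((z : P) : Perm (Fin n)) := by
    intro y hy
    have := Subgroup.mem_center_iff.1 z.2 ⟨y, hy⟩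
    exact (congrArg Subtype.val this).symm
  refine ⟨((z : P) : Perm (Fin n)), (z : P).2, hzo, ?_, hcomm⟩
  ext c
  rw [Perm.mem_support]
  constructor
  · intro h; by_contra hcs; exact h (hfix _ (z : P).2 _ hcs)
  · intro hcs hzc
    have h1 : ((z : P) : Perm (Fin n)) = 1 := by
      ext d
      rw [Perm.one_apply]
      by_cases hd : d ∈ s
      · obtain ⟨y, hy, rfl⟩ := ht c hcs d hd
        have := congrArg (fun f : Perm (Fin n) => f c) (hcomm y hy)
        simp only [Perm.mul_apply, hzc] at this
        rw [this]
      · rw [hfix _ (z : P).2 _ hd]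
    rw [h1, orderOf_one] at hzo
    exact hp.one_lt.ne hzo

/-- A transitive group of prime power degree has a transitive subgroup of prime power order with
a fixed point free central element of prime order. -/
theorem exists_transitive_pSubgroup_of_card {G : Subgroup (Perm (Fin n))} {p m : ℕ} (hp : p.Prime)
    (hn : n = p ^ (m + 1)) (hG : MulAction.IsPreprimitive G (Fin n)) :
    ∃ P ≤ G, IsPGroup p P ∧ (∀ a b : Fin n, ∃ h ∈ P, h a = b) ∧
      ∃ z ∈ P, orderOf z = p ∧ z.support = Finset.univ ∧ ∀ y ∈ P, z * y = y * z := by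
  obtain ⟨P, hPG, hP, ht⟩ := exists_transitive_pSubgroup (H := G) (s := Finset.univ) hp
    (by rw [Finset.card_univ, Fintype.card_fin, hn])
    (fun a _ b => ⟨fun _ => exists_mem_apply_eq hG a b, fun _ => Finset.mem_univ _⟩)
  refine ⟨P, hPG, hP, fun a b => ht a (Finset.mem_univ _) b (Finset.mem_univ _), ?_⟩
  refine exists_central_of_isPGroup hp hP ?_ ht fun _ _ a ha => absurd (Finset.mem_univ a) ha
  rw [Finset.card_univ, Fintype.card_fin, hn]
  exact Nat.one_lt_pow (by omega) hp.one_lt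

end

/-! ### Standard elements of prime order -/

section

variable {n k : ℕ}

/-- An element of order `p` is a product of `p`-cycles. If there is only one, Jordan's theorem
applies. -/
theorem alternatingGroup_le_or_exists_support {G : Subgroup (Perm (Fin n))}
    (hG : MulAction.IsPreprimitive G (Fin n)) {p : ℕ} (hp : p.Prime) (h3 : p = 3 ∨ p + 3 ≤ n)
    (hd : p ∣ Nat.card G) : alternatingGroup (Fin n) ≤ G ∨
      ∃ g ∈ G, orderOf g = p ∧ ∃ m, 2 ≤ m ∧ g.support.card = m * p ∧ m * p ≤ n := by
  obtain ⟨g, hg, ho⟩ := exists_orderOf_eq_prime hp hd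
  obtain ⟨m, -, hm⟩ := cycleType_eq_replicate hp ho
  have hle := Finset.card_le_univ g.support
  rw [Fintype.card_fin] at hle
  rcases Nat.eq_zero_or_pos m with rfl | hpos
  · exact Or.inl (alternatingGroup_le_of_prime_cycle_support hG hg hp ho (by simpa using hm) h3)
  · exact Or.inr ⟨g, hg, ho, m + 1, by omega, hm, by omega⟩

/-- Since `n < 2 p`, there is room for only one `p`-cycle. -/
theorem exists_conj_hasCode_cycle {G : Subgroup (Perm (Fin n))} (hn : n ≤ 16) {p h : ℕ}
    (hp : p.Prime) (hpn : n < 2 * p) (hd : p ∣ Nat.card G)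
    (hc : primeCheck n h p p = true) : ∃ σ, HasCode (conjGroup σ G) h := by
  obtain ⟨g, hg, ho⟩ := exists_orderOf_eq_prime hp hd
  obtain ⟨m, -, hm⟩ := cycleType_eq_replicate hp ho
  have hle := Finset.card_le_univ g.support
  rw [Fintype.card_fin] at hle
  have hm0 : m = 0 := by
    by_contra h0
    have : 2 * p ≤ (m + 1) * p := Nat.mul_le_mul_right p (by omega)
    omega
  subst hm0
  exact exists_conj_hasCode hn hg hp ho (by simpa using hm) hc

theorem exists_conj_hasCode_of_prime_pow {G : Subgroup (Perm (Fin n))} {p m h : ℕ} (hn : n ≤ 16)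
    (hp : p.Prime) (hpn : n = p ^ (m + 1)) (hG : MulAction.IsPreprimitive G (Fin n))
    (hc : primeCheck n h p n = true) : ∃ σ, HasCode (conjGroup σ G) h := by
  obtain ⟨P, hP, -, -, z, hz, ho, hs, -⟩ := exists_transitive_pSubgroup_of_card hp hpn hG
  exact exists_conj_hasCode hn (hP hz) hp ho (by rw [hs, Finset.card_univ, Fintype.card_fin]) hc

/-- The hypothesis `hs` says that a product of at least two disjoint `p`-cycles can move only `s`
points, so the element is determined up to conjugacy unless Jordan's theorem applies. -/
theorem exists_conj_hasCode_of_prime {G : Subgroup (Perm (Fin n))} (hn : n ≤ 16)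
    (hG : MulAction.IsPreprimitive G (Fin n)) {p h s : ℕ} (hp : p.Prime) (h3 : p = 3 ∨ p + 3 ≤ n)
    (hd : p ∣ Nat.card G) (hs : ∀ m, 2 ≤ m → m * p ≤ n → m * p = s)
    (hc : primeCheck n h p s = true) :
    alternatingGroup (Fin n) ≤ G ∨ ∃ σ, HasCode (conjGroup σ G) h := by
  rcases alternatingGroup_le_or_exists_support hG hp h3 hd with h | ⟨g, hg, ho, m, hm, hgs, hle⟩
  · exact Or.inl h
  · exact Or.inr (exists_conj_hasCode hn hg hp ho (hgs.trans (hs m hm hle)) hc)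

/-- A primitive group whose degree is not a prime is not a group of prime power order. -/
theorem not_isPGroup_of_isPreprimitive {G : Subgroup (Perm (Fin n))} {p : ℕ} (hp : p.Prime)
    (hG : MulAction.IsPreprimitive G (Fin n)) (hn : p < n) : ¬ IsPGroup p G := by
  intro hP
  obtain ⟨z, hz, ho, -, hcomm⟩ := exists_central_of_isPGroup (s := Finset.univ) hp hP
    (by rw [Finset.card_univ, Fintype.card_fin]; have := hp.two_le; omega)
    (fun a _ b _ => exists_mem_apply_eq hG a b) fun _ _ a ha => absurd (Finset.mem_univ a) ha
  let N : Subgroup G := Subgroup.zpowers ⟨z, hz⟩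
  have hN : N.Normal := by
    refine ⟨fun x hx g => ?_⟩
    obtain ⟨i, rfl⟩ := Subgroup.mem_zpowers_iff.1 hx
    have : Commute (⟨z, hz⟩ : G) g := Subtype.ext (hcomm g g.2)
    have h2 : g * (⟨z, hz⟩ : G) ^ i * g⁻¹ = (⟨z, hz⟩ : G) ^ i := by
      rw [← (this.zpow_left i).eq, mul_inv_cancel_right]
    rw [h2]
    exact hx
  have hcardN : Nat.card N = p := by
    rw [Nat.card_zpowers, ← ho, ← Subgroup.orderOf_coe]
  -- A nontrivial normal subgroup of a primitive group is transitive, so the group of order `p`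
  -- generated by the central element would be transitive on more than `p` points.
  have htr : MulAction.IsPretransitive N (Fin n) := by
    refine MulAction.IsQuasiPreprimitive.isPretransitive_of_normal fun h => ?_
    have hz1 : z = 1 := by
      ext x
      have : x ∈ MulAction.fixedPoints N (Fin n) := h ▸ Set.mem_univ x
      have := this ⟨⟨z, hz⟩, Subgroup.mem_zpowers _⟩
      exact congrArg Fin.val this
    rw [hz1, orderOf_one] at ho
    exact hp.one_lt.ne ho
  have h1 := MulAction.index_stabilizer_of_transitive N (⟨0, by omega⟩ : Fin n)
  rw [Nat.card_eq_fintype_card, Fintype.card_fin] at h1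
  have h2 := Nat.le_of_dvd Nat.card_pos
    (Subgroup.index_dvd_card (MulAction.stabilizer N (⟨0, by omega⟩ : Fin n)))
  rw [h1, hcardN] at h2
  omega

theorem prime_le_of_dvd_card {G : Subgroup (Perm (Fin n))} {p : ℕ} (hp : p.Prime)
    (h : p ∣ Nat.card G) : p ≤ n := by
  have := h.trans (Subgroup.card_subgroup_dvd_card G)
  rw [Nat.card_eq_fintype_card, Fintype.card_perm, Fintype.card_fin] at this
  exact (Nat.Prime.dvd_factorial hp).1 this

theorem hasStrongUT_conjGroup {G : Subgroup (Perm (Fin n))} (hG : HasStrongUT G k)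
    (σ : Perm (Fin n)) : HasStrongUT (conjGroup σ G) k := hG.of_permIso (permIso_conjGroup σ G)

end

/-- A primitive group of degree eight is not a `2`-group, so `3`, `5` or `7` divides its order.
Order three gives a three-cycle or two disjoint ones, order five a cycle with three fixed points,
and order seven a seven-cycle. -/
theorem alternatingGroup_le_or_exists_eight {G : Subgroup (Perm (Fin 8))}
    (hG : MulAction.IsPreprimitive G (Fin 8)) : alternatingGroup (Fin 8) ≤ G ∨
      (∃ σ, HasCode (conjGroup σ G) 0x76354021) ∨ ∃ σ, HasCode (conjGroup σ G) 0x70654321 := by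
  have hcard : ∃ p, p.Prime ∧ p ∣ Nat.card G ∧ p ≠ 2 := by
    by_contra! hno
    refine not_isPGroup_of_isPreprimitive Nat.prime_two hG (by norm_num) ?_
    rw [IsPGroup.iff_card]
    exact ⟨_, Nat.eq_prime_pow_of_unique_prime_dvd Nat.card_pos.ne' fun {d} hd hdvd =>
      hno d hd hdvd⟩
  obtain ⟨p, hp, hdvd, hp2⟩ := hcard
  have hle := prime_le_of_dvd_card hp hdvd
  interval_cases p
  · exact absurd hp (by norm_num)
  · exact absurd hp (by norm_num)
  · exact absurd rfl hp2
  · rcases exists_conj_hasCode_of_prime (h := 0x76354021) (s := 6) (by norm_num) hG hp (by norm_num)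
      hdvd (by omega) (by decide +kernel) with h | h
    · exact Or.inl h
    · exact Or.inr (Or.inl h)
  · exact absurd hp (by norm_num)
  · rcases alternatingGroup_le_or_exists_support hG hp (by norm_num) hdvd with h | ⟨_, _, _, m, _, _, _⟩
    · exact Or.inl h
    · omega
  · exact absurd hp (by norm_num)
  · exact Or.inr (Or.inr (exists_conj_hasCode_cycle (by norm_num) hp (by norm_num) hdvd
      (by decide +kernel)))
  · exact absurd hp (by norm_num)

/-- For small degrees, the strong universal transversal property implies transitivity on pairs, or
the group contains the alternating group. -/
theorem HasStrongUT.alternatingGroup_le_or_twoHomogeneous {n k : ℕ} (hn : n < 11) (hk : 2 ≤ k)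
    (hkn : 2 * k ≤ n) {G : Subgroup (Perm (Fin n))} (hG : HasStrongUT G k) :
    alternatingGroup (Fin n) ≤ G ∨ TwoHomogeneous G := by
  have hp := hG.primitive
  have hdvd := dvd_card_of_isPreprimitive hp (by omega)
  have h4 : 4 ≤ n := by omega
  -- Degrees four and nine use a central element of a transitive Sylow subgroup, degrees five and
  -- seven a cycle through all points. In degrees six and ten an element of order three or five is
  -- either a single cycle, settled by Jordan's theorem, or moves all points.
  interval_cases n
  · obtain ⟨σ, hσ⟩ := exists_conj_hasCode_of_prime_pow (h := 0x2301) (by norm_num) Nat.prime_two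
      (m := 1) (by norm_num) hp (by decide +kernel)
    have hk2 : k ≤ 2 := by omega
    interval_cases k
    exact Or.inr (twoHomogeneous_four_2 (hasStrongUT_conjGroup hG σ) hσ).of_conjGroup
  · obtain ⟨σ, hσ⟩ := exists_conj_hasCode_cycle (h := 0x4321) (p := 5) (by norm_num) (by norm_num)
      (by norm_num) hdvd (by decide +kernel)
    have hk2 : k ≤ 2 := by omega
    interval_cases k
    exact Or.inr (twoHomogeneous_five_2 (hasStrongUT_conjGroup hG σ) hσ).of_conjGroup
  · rcases exists_conj_hasCode_of_prime (h := 0x354021) (p := 3) (s := 6) (by norm_num) hp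
      (by norm_num) (by norm_num) (dvd_trans (by norm_num) hdvd) (by omega) (by decide +kernel)
      with h | ⟨σ, hσ⟩
    · exact Or.inl h
    refine Or.inr (TwoHomogeneous.of_conjGroup (σ := σ) ?_)
    have hG' := hasStrongUT_conjGroup hG σ
    have hk2 : k ≤ 3 := by omega
    interval_cases k
    exacts [twoHomogeneous_six_2 hG' hσ, twoHomogeneous_six_3 hG' hσ]
  · obtain ⟨σ, hσ⟩ := exists_conj_hasCode_cycle (h := 0x654321) (p := 7) (by norm_num)
      (by norm_num) (by norm_num) hdvd (by decide +kernel)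
    refine Or.inr (TwoHomogeneous.of_conjGroup (σ := σ) ?_)
    have hG' := hasStrongUT_conjGroup hG σ
    have hk2 : k ≤ 3 := by omega
    interval_cases k
    exacts [twoHomogeneous_seven_2 hG' hσ, twoHomogeneous_seven_3 hG' hσ]
  · rcases alternatingGroup_le_or_exists_eight hp with h | ⟨σ, hσ⟩ | ⟨σ, hσ⟩
    · exact Or.inl h
    · refine Or.inr (TwoHomogeneous.of_conjGroup (σ := σ) ?_)
      have hG' := hasStrongUT_conjGroup hG σ
      have hk2 : k ≤ 4 := by omega
      interval_cases k
      exacts [twoHomogeneous_eight_2 hG' hσ, twoHomogeneous_eight_3 hG' hσ,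
        twoHomogeneous_eight_4 hG' hσ]
    · refine Or.inr (TwoHomogeneous.of_conjGroup (σ := σ) ?_)
      have hG' := hasStrongUT_conjGroup hG σ
      have hk2 : k ≤ 4 := by omega
      interval_cases k
      exacts [twoHomogeneous_eightSeven_2 hG' hσ, twoHomogeneous_eightSeven_3 hG' hσ,
        twoHomogeneous_eightSeven_4 hG' hσ]
  · obtain ⟨σ, hσ⟩ := exists_conj_hasCode_of_prime_pow (h := 0x687354021) (by norm_num)
      Nat.prime_three (m := 1) (by norm_num) hp (by decide +kernel)
    refine Or.inr (TwoHomogeneous.of_conjGroup (σ := σ) ?_)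
    have hG' := hasStrongUT_conjGroup hG σ
    have hk2 : k ≤ 4 := by omega
    interval_cases k
    exacts [twoHomogeneous_nine_2 hG' hσ, twoHomogeneous_nine_3 hG' hσ,
      twoHomogeneous_nine_4 hG' hσ]
  · rcases exists_conj_hasCode_of_prime (h := 0x5987604321) (p := 5) (s := 10) (by norm_num) hp
      (by norm_num) (by norm_num) (dvd_trans (by norm_num) hdvd) (by omega) (by decide +kernel)
      with h | ⟨σ, hσ⟩
    · exact Or.inl h
    refine Or.inr (TwoHomogeneous.of_conjGroup (σ := σ) ?_)
    have hG' := hasStrongUT_conjGroup hG σ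
    have hk2 : k ≤ 5 := by omega
    interval_cases k
    exacts [twoHomogeneous_ten_2 hG' hσ, twoHomogeneous_ten_3 hG' hσ,
      twoHomogeneous_ten_4 hG' hσ, twoHomogeneous_ten_5 hG' hσ]

/-! ### Normal forms with respect to a known subgroup -/

/-- A sequence of base points, each with the bit mask of the permitted images and with words moving
every other image to a permitted one. -/
abbrev Stages : Type := List (ℕ × ℕ × List (List ℕ))

/-- The words in `gens` reduce every permutation to normal form. -/
noncomputable def stagesCheck (n : ℕ) (gens : List ℕ) : List ℕ → Stages → Bool
  | _, [] => true
  | fixed, s :: rest =>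
    (Nat.blt s.1 n && !listMem s.1 fixed) && ((List.range n).all fun i => listMem i fixed || s.2.2.any fun w =>
      force (wordCode n gens w) fun u =>
        (fixed.all fun f => Nat.beq (digit u f) f) && Nat.testBit s.2.1 (digit u i)) &&
    (rest.isEmpty || Nat.beq s.2.1 (Nat.pow 2 s.1)) && stagesCheck n gens (s.1 :: fixed) rest

/-- Cut a search at images that are not permitted. -/
noncomputable def maskPrune (stages : Stages) (i acc : ℕ) : Bool :=
  Nat.rec true (fun j _ => List.rec true (fun s _ r =>
    cond (Nat.beq s.1 j) (cond (Nat.testBit s.2.1 (digit acc j)) r false) r) stages) i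

/-- Cut a search at permutations that are not involutions. -/
noncomputable def involutionPrune (i acc : ℕ) : Bool :=
  Nat.rec true (fun j _ => force (digit acc j) fun v =>
    cond (Nat.ble v j) (Nat.beq (digit acc v) j) true) i

/-- Cut a search at permutations that do not commute with the one with code `z` and inverse `z'`. -/
noncomputable def commutePrune (z z' i acc : ℕ) : Bool :=
  Nat.rec true (fun j _ => force (digit acc j) fun v =>
    cond (force (digit z j) fun w => cond (Nat.ble w j) (Nat.beq (digit acc w) (digit z v)) true)
      (force (digit z' j) fun w => cond (Nat.ble w j) (Nat.beq (digit acc w) (digit z' v)) true)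
      false) i

/-- Cut a search at permutations violating one of two conditions. -/
noncomputable def andPrune (p q : ℕ → ℕ → Bool) (i acc : ℕ) : Bool := cond (p i acc) (q i acc) false

/-- The `2 ^ m`-th power, for `e = 2`, or the `3 ^ m`-th power, for `e = 3`. -/
noncomputable def iterPower (n e m c : ℕ) : ℕ :=
  Nat.rec c (fun _ r => force r fun r' => wordCode n [r'] (List.replicate e 0)) m

/-- Restrict a test to the permutations whose `e ^ m`-th power is trivial. -/
noncomputable def powerTest (n e m : ℕ) (test : ℕ → Bool) (c : ℕ) : Bool :=
  force (iterPower n e m c) fun p => cond (allBelow n fun i => Nat.beq (digit p i) i) (test c) true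

section

variable {n : ℕ}

/-- The group generated by the permutations with codes in `gens`. -/
def codeGroup (n : ℕ) (gens : List ℕ) : Subgroup (Perm (Fin n)) :=
  Subgroup.closure {g | ∃ c ∈ gens, IsCode g c}

theorem codeGroup_le {gens : List ℕ} {G : Subgroup (Perm (Fin n))} (h : ∀ c ∈ gens, HasCode G c) :
    codeGroup n gens ≤ G := by
  refine (Subgroup.closure_le _).2 ?_
  rintro g ⟨c, hc, hg⟩
  exact (h c hc).mem hg

theorem hasCode_codeGroup {gens : List ℕ} (hv : ∀ c ∈ gens, validCode n c = true) :
    ∀ c ∈ gens, HasCode (codeGroup n gens) c := fun c hc =>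
  ⟨permOf n c, Subgroup.subset_closure ⟨c, hc, isCode_permOf (hv c hc)⟩, isCode_permOf (hv c hc)⟩

theorem HasCode.mono {G H : Subgroup (Perm (Fin n))} (hGH : G ≤ H) {c : ℕ} (h : HasCode G c) :
    HasCode H c := by
  obtain ⟨g, hg, hc⟩ := h
  exact ⟨g, hGH hg, hc⟩

/-- The permutation maps the base points to permitted points. -/
def IsNormalFor (stages : Stages) (x : Perm (Fin n)) : Prop :=
  ∀ s ∈ stages, ∀ i : Fin n, (i : ℕ) = s.1 → Nat.testBit s.2.1 (x i) = true

theorem maskPrune_of_isNormalFor {stages : Stages} {x : Perm (Fin n)} (hx : IsNormalFor stages x)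
    (i acc : ℕ) (hi : i ≤ n) (h : ∀ j : Fin n, (j : ℕ) < i → digit acc j = x j) :
    maskPrune stages i acc = true := by
  cases i with
  | zero => rfl
  | succ i =>
    have hd := h ⟨i, by omega⟩ (Nat.lt_succ_self i)
    induction stages with
    | nil => rfl
    | cons s stages ih =>
      have h0 : maskPrune (s :: stages) (i + 1) acc = cond (Nat.beq s.1 i)
        (cond (Nat.testBit s.2.1 (digit acc i)) (maskPrune stages (i + 1) acc) false)
        (maskPrune stages (i + 1) acc) := rfl
      have ih' := ih fun t ht => hx t (List.mem_cons_of_mem _ ht)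
      rw [h0, ih']
      cases hb : Nat.beq s.1 i with
      | false => rfl
      | true =>
        have := hx s (List.mem_cons_self ..) ⟨i, by omega⟩ (Nat.eq_of_beq_eq_true hb).symm
        simp only at hd
        rw [hd, this]
        rfl

theorem involutionPrune_of_mul_self {x : Perm (Fin n)} (hx : x * x = 1) (i acc : ℕ) (hi : i ≤ n)
    (h : ∀ j : Fin n, (j : ℕ) < i → digit acc j = x j) : involutionPrune i acc = true := by
  cases i with
  | zero => rfl
  | succ i =>
    have hd := h ⟨i, by omega⟩ (Nat.lt_succ_self i)
    simp only at hd
    have h0 : involutionPrune (i + 1) acc = force (digit acc i) fun v =>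
      cond (Nat.ble v i) (Nat.beq (digit acc v) i) true := rfl
    rw [h0, force_eq, hd]
    cases hb : Nat.ble (x ⟨i, by omega⟩) i with
    | false => rfl
    | true =>
      rw [cond_true, h (x ⟨i, by omega⟩) (Nat.lt_succ_of_le (Nat.le_of_ble_eq_true hb)),
        ← Perm.mul_apply, hx]
      simp

/-- The relation `x (ζ i) = ζ (x i)` can be tested as soon as `i` and `ζ i` have values. Which of
the two is assigned last is unknown, so both `ζ` and its inverse are tested at each new position,
whenever the image is not a later point. -/
theorem commutePrune_of_commute {x ζ : Perm (Fin n)} {z z' : ℕ} (hz : IsCode ζ z)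
    (hz' : IsCode ζ⁻¹ z') (hx : ζ * x = x * ζ) (i acc : ℕ) (hi : i ≤ n)
    (h : ∀ j : Fin n, (j : ℕ) < i → digit acc j = x j) : commutePrune z z' i acc = true := by
  cases i with
  | zero => rfl
  | succ i =>
    have key : ∀ (ζ : Perm (Fin n)) z, IsCode ζ z → ζ * x = x * ζ →
        (force (digit z i) fun w => cond (Nat.ble w i)
          (Nat.beq (digit acc w) (digit z (digit acc i))) true) = true := by
      intro ζ z hz hx
      have hd := h ⟨i, by omega⟩ (Nat.lt_succ_self i)
      have hzd := hz ⟨i, by omega⟩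
      simp only at hd hzd
      rw [force_eq, hzd, hd, hz]
      cases hb : Nat.ble (ζ ⟨i, by omega⟩) i with
      | false => rfl
      | true =>
        rw [cond_true, h (ζ ⟨i, by omega⟩) (Nat.lt_succ_of_le (Nat.le_of_ble_eq_true hb)),
          ← Perm.mul_apply, ← hx, Perm.mul_apply]
        simp
    have h0 : commutePrune z z' (i + 1) acc = force (digit acc i) fun v =>
      cond (force (digit z i) fun w => cond (Nat.ble w i) (Nat.beq (digit acc w) (digit z v)) true)
      (force (digit z' i) fun w => cond (Nat.ble w i) (Nat.beq (digit acc w) (digit z' v)) true)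
      false := rfl
    rw [h0, force_eq, key ζ z hz hx, cond_true]
    refine key ζ⁻¹ z' hz' ?_
    calc ζ⁻¹ * x = ζ⁻¹ * (x * ζ) * ζ⁻¹ := by group
      _ = ζ⁻¹ * (ζ * x) * ζ⁻¹ := by rw [hx]
      _ = x * ζ⁻¹ := by group

theorem isCode_iterPower (hn : n ≤ 16) {x : Perm (Fin n)} {c : ℕ} (hx : IsCode x c) (e m : ℕ) :
    IsCode (x ^ e ^ m) (iterPower n e m c) := by
  induction m with
  | zero => rw [pow_zero, pow_one]; exact hx
  | succ m ih =>
    have h0 : iterPower n e (m + 1) c =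
        wordCode n [iterPower n e m c] (List.replicate e 0) := by
      have : iterPower n e (m + 1) c =
        force (iterPower n e m c) fun r' => wordCode n [r'] (List.replicate e 0) := rfl
      rw [this, force_eq]
    rw [h0, pow_succ, pow_mul]
    exact isCode_word_replicate hn ih e

theorem of_powerTest (hn : n ≤ 16) {x : Perm (Fin n)} {c e m : ℕ} (hc : IsCode x c)
    (hx : x ^ e ^ m = 1) {test : ℕ → Bool} (h : powerTest n e m test c = true) :
    test c = true := by
  have h1 : (allBelow n fun i => Nat.beq (digit (iterPower n e m c) i) i) = true := by
    rw [allBelow_iff]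
    intro i hi
    have h2 := isCode_iterPower hn hc e m ⟨i, hi⟩
    rw [hx, Perm.one_apply] at h2
    simp only at h2
    rw [h2]
    simp
  rwa [powerTest, force_eq, h1, cond_true] at h

/-- Sifting along a chain of pointwise stabilizers: after earlier base points are fixed, the image
of the next one is not among them, and some word fixing them moves this image to a permitted point.
Then continue with the product. -/
theorem exists_mul_isNormalFor {H : Subgroup (Perm (Fin n))} (hn : n ≤ 16) {gens : List ℕ}
    (hgens : ∀ c ∈ gens, HasCode H c) {stages : Stages} {fixed : List ℕ}
    (h : stagesCheck n gens fixed stages = true) (g : Perm (Fin n))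
    (hg : ∀ i : Fin n, (i : ℕ) ∈ fixed → g i = i) :
    ∃ x ∈ H, (∀ i : Fin n, (i : ℕ) ∈ fixed → (x * g) i = i) ∧ IsNormalFor stages (x * g) := by
  induction stages generalizing fixed g with
  | nil => exact ⟨1, H.one_mem, by simpa using hg, by simp [IsNormalFor]⟩
  | cons s rest ih =>
    simp only [stagesCheck, Bool.and_eq_true, Bool.or_eq_true, List.all_eq_true, List.mem_range,
      listMem_iff, List.any_eq_true, force_eq, List.isEmpty_iff, Bool.not_eq_true',
      ← Bool.not_eq_true (listMem _ _)] at h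
    obtain ⟨⟨⟨⟨hb, hbf⟩, h1⟩, h2⟩, h3⟩ := h
    have hb' : s.1 < n := by simpa [Nat.blt_eq] using hb
    have hgb : ((g ⟨s.1, hb'⟩ : Fin n) : ℕ) ∉ fixed := by
      intro hmem
      have := g.injective (hg _ hmem)
      rw [this] at hmem
      exact hbf hmem
    obtain ⟨w, -, hw, hwb⟩ := (h1 _ (g ⟨s.1, hb'⟩).2).resolve_left hgb
    obtain ⟨u, hu, huc⟩ := HasCode.word hn hgens w
    have hfix : ∀ i : Fin n, (i : ℕ) ∈ fixed → (u * g) i = i := by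
      intro i hi
      have := Nat.eq_of_beq_eq_true (hw i hi)
      rw [Perm.mul_apply, hg i hi]
      exact Fin.ext ((huc i).symm.trans this)
    have hmask : Nat.testBit s.2.1 ((u * g) ⟨s.1, hb'⟩) = true := by
      rw [Perm.mul_apply, ← huc]; exact hwb
    -- Only the last stage may permit several images, which allows for a last stabilizer that is not
    -- transitive; at every other stage the base point itself is the only permitted image, so it
    -- gets fixed.
    rcases h2 with rfl | h2
    · refine ⟨u, hu, hfix, ?_⟩
      intro t ht i hi
      rw [List.mem_singleton] at ht
      subst ht
      rw [show i = ⟨t.1, hb'⟩ from Fin.ext hi]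
      exact hmask
    · have h2' : s.2.1 = 2 ^ s.1 := Nat.eq_of_beq_eq_true h2
      have hgb' : (u * g) ⟨s.1, hb'⟩ = ⟨s.1, hb'⟩ := by
        rw [h2', Nat.testBit_two_pow, decide_eq_true_eq] at hmask
        exact Fin.ext hmask.symm
      obtain ⟨x, hx, hxf, hxn⟩ := ih h3 (u * g) (by
        intro i hi
        rcases List.mem_cons.1 hi with hi | hi
        · rw [show i = ⟨s.1, hb'⟩ from Fin.ext hi, hgb']
        · exact hfix i hi)
      refine ⟨x * u, H.mul_mem hx hu, fun i hi => ?_, ?_⟩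
      · rw [mul_assoc]; exact hxf i (List.mem_cons_of_mem _ hi)
      · intro t ht i hi
        rw [mul_assoc]
        rcases List.mem_cons.1 ht with rfl | ht
        · rw [hxf i (by rw [hi]; exact List.mem_cons_self ..), h2', hi, Nat.testBit_two_pow]
          simp
        · exact hxn t ht i hi

/-- The elements in normal form of a primitive group are among those found by a search, if the
group does not contain the alternating group. -/
theorem alternatingGroup_le_or_forall_isNormalFor {G : Subgroup (Perm (Fin n))}
    (hG : MulAction.IsPreprimitive G (Fin n)) (hn : n < 16) {gens : List ℕ}
    (hgens : ∀ c ∈ gens, HasCode G c) {stages : Stages} {words : List (List ℕ)}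
    {specials : List ℕ}
    (h : searchPerm n (maskPrune stages) (jordanTest n gens words specials) n 0 0 0 = true) :
    alternatingGroup (Fin n) ≤ G ∨
      ∀ x ∈ G, IsNormalFor stages x → ∃ c ∈ specials, IsCode x c := by
  by_cases ha : alternatingGroup (Fin n) ≤ G
  · exact Or.inl ha
  · refine Or.inr fun x hx hxn => ?_
    obtain ⟨c, hc, ht⟩ := searchPerm_sound (by omega) h x (maskPrune_of_isNormalFor hxn)
    rcases alternatingGroup_le_or_mem_of_jordanTest hG hn hgens ⟨x, hx, hc⟩ ht with h | h
    · exact absurd h ha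
    · exact ⟨c, h, hc⟩

/-- A group containing a known subgroup is determined by its elements in normal form. -/
theorem eq_codeGroup {G : Subgroup (Perm (Fin n))} (hn : n ≤ 16) {gens gens' : List ℕ}
    (hgens' : ∀ c ∈ gens', HasCode G c)
    (hgens : ∀ c ∈ gens, HasCode (codeGroup n gens') c)
    {stages : Stages} (hs : stagesCheck n gens [] stages = true)
    (hx : ∀ x ∈ G, IsNormalFor stages x → x ∈ codeGroup n gens') : G = codeGroup n gens' := by
  refine le_antisymm (fun g hg => ?_) (codeGroup_le hgens')
  obtain ⟨x, hxH, -, hxn⟩ := exists_mul_isNormalFor hn hgens hs g (by simp)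
  have h1 := hx (x * g) (G.mul_mem (codeGroup_le hgens' hxH) hg) hxn
  simpa using (codeGroup n gens').mul_mem ((codeGroup n gens').inv_mem hxH) h1

end

/-! ### Classification of the groups transitive on pairs: general tools -/

section

variable {n : ℕ}

/-- `G` is transitive on the ordered pairs of points. -/
def TwoTransitive (G : Subgroup (Perm (Fin n))) : Prop :=
  ∀ a b c d : Fin n, a ≠ b → c ≠ d → ∃ g ∈ G, g a = c ∧ g b = d

/-- Primitive and transitive on unordered pairs. -/
structure IsGood (G : Subgroup (Perm (Fin n))) : Prop where
  primitive : MulAction.IsPreprimitive G (Fin n)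
  twoHomogeneous : TwoHomogeneous G

theorem IsGood.conjGroup {G : Subgroup (Perm (Fin n))} (hG : IsGood G) (σ : Perm (Fin n)) :
    IsGood (conjGroup σ G) :=
  ⟨isPreprimitive_conjGroup hG.primitive, hG.twoHomogeneous.conjGroup σ⟩

/-- `G` contains the alternating group or is conjugate to a group generated by a list of codes
in `L`. -/
def IsClassified (L : List (List ℕ)) (G : Subgroup (Perm (Fin n))) : Prop :=
  alternatingGroup (Fin n) ≤ G ∨ ∃ gens ∈ L, PermIso G (codeGroup n gens)

theorem IsClassified.of_conjGroup {L : List (List ℕ)} {G : Subgroup (Perm (Fin n))}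
    {σ : Perm (Fin n)} (h : IsClassified L (conjGroup σ G)) : IsClassified L G := by
  rcases h with h | ⟨gens, hg, h⟩
  · exact Or.inl (alternatingGroup_le_conjGroup.1 h)
  · exact Or.inr ⟨gens, hg, (permIso_conjGroup σ G).trans h⟩

theorem PermIso.refl {X : Type*} (G : Subgroup (Perm X)) : PermIso G G :=
  ⟨Equiv.refl X, by
    ext g
    simp only [Subgroup.mem_map]
    constructor
    · rintro ⟨f, hf, rfl⟩; exact hf
    · intro hg; exact ⟨g, hg, rfl⟩⟩

theorem IsClassified.of_eq {L : List (List ℕ)} {G : Subgroup (Perm (Fin n))} {gens : List ℕ}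
    (hL : gens ∈ L) (h : G = codeGroup n gens) : IsClassified L G :=
  Or.inr ⟨gens, hL, h ▸ PermIso.refl _⟩

/-- The certificates `(c, σ, ws)` show that the group generated by `c` and `gens` contains a
conjugate of the group generated by `targets`. -/
noncomputable def certsCheck (n : ℕ) (gens targets : List ℕ)
    (certs : List (ℕ × ℕ × List (List ℕ))) : Bool :=
  (targets.all fun t => validCode n t) &&
  certs.all fun e => validCode n e.2.1 && conjCheck n e.2.1 (e.1 :: gens) e.2.2 targets

/-- Being classified is invariant under conjugation. The certificate for `c` conjugates `G` to a
group containing all of `targets`, for which the claim is assumed. -/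
theorem IsClassified.of_certs {L : List (List ℕ)} {G : Subgroup (Perm (Fin n))} (hG : IsGood G)
    (hn : n ≤ 16) {gens targets : List ℕ} (hgens : ∀ c ∈ gens, HasCode G c)
    {certs : List (ℕ × ℕ × List (List ℕ))} (h : certsCheck n gens targets certs = true) {c : ℕ}
    (hc : HasCode G c) (hmem : c ∈ certs.map Prod.fst)
    (H : ∀ G' : Subgroup (Perm (Fin n)), IsGood G' → (∀ t ∈ targets, HasCode G' t) →
      IsClassified L G') : IsClassified L G := by
  simp only [certsCheck, Bool.and_eq_true, List.all_eq_true] at h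
  obtain ⟨e, he, rfl⟩ := List.mem_map.1 hmem
  obtain ⟨h1, h2⟩ := h.2 e he
  exact (H _ (hG.conjGroup _) (hasCode_conjGroup_of_conjCheck hn (by simpa [hc] using hgens) h1
    h.1 h2)).of_conjGroup

/-- The entries `(c, w)` of the list express codes as words in `gens`. -/
noncomputable def wordsCheck (n : ℕ) (gens : List ℕ) (M : List (ℕ × List ℕ)) : Bool :=
  (gens.all fun t => validCode n t) && M.all fun e => Nat.beq (wordCode n gens e.2) e.1

theorem hasCode_of_wordsCheck (hn : n ≤ 16) {gens : List ℕ} {M : List (ℕ × List ℕ)}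
    (h : wordsCheck n gens M = true) {c : ℕ} (hc : c ∈ M.map Prod.fst) :
    HasCode (codeGroup n gens) c := by
  simp only [wordsCheck, Bool.and_eq_true, List.all_eq_true] at h
  obtain ⟨e, he, rfl⟩ := List.mem_map.1 hc
  rw [← Nat.eq_of_beq_eq_true (h.2 e he)]
  exact HasCode.word hn (hasCode_codeGroup h.1) e.2

theorem hasCode_of_subset {G : Subgroup (Perm (Fin n))} {gens gens' : List ℕ} {d : ℕ}
    (hgens : ∀ c ∈ gens, HasCode G c) (hd : HasCode G d) (h : ∀ c ∈ gens', c ∈ d :: gens) :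
    ∀ c ∈ gens', HasCode G c := by
  intro c hc
  rcases List.mem_cons.1 (h c hc) with rfl | h
  · exact hd
  · exact hgens c h

/-- Normal forms are taken with respect to the group of `gens`, while `gens'` generates the
candidate for `G`. Every possible normal form is in the candidate, through a word in `M`, or is
known not to be in `G`; so `G` is the candidate. -/
theorem IsClassified.of_normal {L : List (List ℕ)} {G : Subgroup (Perm (Fin n))} (hn : n ≤ 16)
    (gens : List ℕ) {gens' : List ℕ} (hL : gens' ∈ L) (hgens' : ∀ c ∈ gens', HasCode G c) {stages : Stages}
    {M : List (ℕ × List ℕ)} (hM : wordsCheck n gens' M = true)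
    (hgens : ∀ c ∈ gens, c ∈ M.map Prod.fst) (hs : stagesCheck n gens [] stages = true)
    {specials : List ℕ}
    (hN : ∀ x ∈ G, IsNormalFor stages x → ∃ c ∈ specials, IsCode x c)
    {bad : List ℕ} (hspec : ∀ c ∈ specials, c ∈ M.map Prod.fst ∨ c ∈ bad)
    (hbad : ∀ c ∈ bad, ¬ HasCode G c) : IsClassified L G := by
  refine IsClassified.of_eq hL (eq_codeGroup hn hgens'
    (fun c hc => hasCode_of_wordsCheck hn hM (hgens c hc)) hs fun x hx hxn => ?_)
  obtain ⟨c, hc, hxc⟩ := hN x hx hxn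
  exact (hasCode_of_wordsCheck hn hM ((hspec c hc).resolve_right fun h =>
    hbad c h ⟨x, hx, hxc⟩)).mem hxc

theorem isNormalFor_nil (x : Perm (Fin n)) : IsNormalFor [] x := by simp [IsNormalFor]

theorem isNormalFor_cons {b m : ℕ} {W : List (List ℕ)} {l : Stages} {x : Perm (Fin n)} (hb : b < n)
    (h : Nat.testBit m (x ⟨b, hb⟩) = true) (hl : IsNormalFor l x) :
    IsNormalFor ((b, m, W) :: l) x := by
  intro s hs i hi
  rcases List.mem_cons.1 hs with rfl | hs
  · rw [show i = ⟨b, hb⟩ from Fin.ext hi]; exact h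
  · exact hl s hs i hi

/-- An involution in `G` interchanges some `x` and `t x`. Moving this pair onto `{a, b}`, with or
without applying the involution first, produces both orderings. -/
theorem TwoHomogeneous.twoTransitive {G : Subgroup (Perm (Fin n))} (hG : TwoHomogeneous G)
    (h2 : 2 ∣ Nat.card G) : TwoTransitive G := by
  obtain ⟨t, ht, ho⟩ := exists_orderOf_eq_prime Nat.prime_two h2
  have htt : t * t = 1 := by rw [← pow_two, ← ho, pow_orderOf_eq_one]
  obtain ⟨x, hx⟩ : ∃ x, t x ≠ x := by
    by_contra! hall
    have : t = 1 := by ext i; rw [hall, Perm.one_apply]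
    rw [this, orderOf_one] at ho
    norm_num at ho
  have htx : t (t x) = x := by rw [← Perm.mul_apply, htt, Perm.one_apply]
  have key : ∀ a b : Fin n, a ≠ b → ∃ g ∈ G, g x = a ∧ g (t x) = b := by
    intro a b hab
    obtain ⟨g, hg, ⟨h1, h2⟩ | ⟨h1, h2⟩⟩ := hG x (t x) a b hx.symm hab
    · exact ⟨g, hg, h1, h2⟩
    · exact ⟨g * t, G.mul_mem hg ht, by rw [Perm.mul_apply, h2], by rw [Perm.mul_apply, htx, h1]⟩
  intro a b c d hab hcd
  obtain ⟨g, hg, rfl, rfl⟩ := key a b hab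
  obtain ⟨h, hh, rfl, rfl⟩ := key c d hcd
  exact ⟨h * g⁻¹, G.mul_mem hh (G.inv_mem hg), by simp, by simp⟩

/-- In a group transitive on ordered pairs whose degree exceeds a prime power by one, a point
stabilizer has a subgroup of prime power order that is transitive on the remaining points and has
a central element of prime order. -/
theorem TwoTransitive.exists_pSubgroup {G : Subgroup (Perm (Fin n))} (hG : TwoTransitive G)
    {p m : ℕ} (hp : p.Prime) (hn : n = p ^ (m + 1) + 1) (a : Fin n) :
    ∃ P ≤ G, IsPGroup p P ∧ (∀ h ∈ P, h a = a) ∧ (∀ b c, b ≠ a → c ≠ a → ∃ h ∈ P, h b = c) ∧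
      ∃ z ∈ P, orderOf z = p ∧ z.support = Finset.univ.erase a ∧ ∀ y ∈ P, z * y = y * z := by
  let H : Subgroup (Perm (Fin n)) := G ⊓ (MulAction.stabilizer (Perm (Fin n)) a)
  have hH : ∀ g, g ∈ H ↔ g ∈ G ∧ g a = a := fun g => Iff.rfl
  have hcard : (Finset.univ.erase a).card = p ^ (m + 1) := by
    rw [Finset.card_erase_of_mem (Finset.mem_univ a), Finset.card_univ, Fintype.card_fin]; omega
  obtain ⟨P, hPH, hP, ht⟩ := exists_transitive_pSubgroup (H := H) (s := Finset.univ.erase a) hp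
    hcard (by
      intro b hb c
      rw [Finset.mem_erase] at hb ⊢
      constructor
      · intro hc
        obtain ⟨g, hg, h1, h2⟩ := hG a b a c hb.1.symm hc.1.symm
        exact ⟨g, ⟨hg, h1⟩, h2⟩
      · rintro ⟨h, hh, rfl⟩
        refine ⟨fun e => hb.1 (h.injective (e.trans hh.2.symm)), Finset.mem_univ _⟩)
  have hfix : ∀ h ∈ P, h a = a := fun h hh => (hPH hh).2
  refine ⟨P, fun h hh => (hPH hh).1, hP, hfix, fun b c hb hc => ht b (by simp [hb]) c
    (by simp [hc]), ?_⟩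
  refine exists_central_of_isPGroup hp hP ?_ ht fun h hh b hb => ?_
  · rw [hcard]; exact Nat.one_lt_pow (by omega) hp.one_lt
  · have : b = a := by simpa using hb
    rw [this, hfix h hh]

/-- Elements of groups of prime power order have small order. -/
theorem pow_eq_one_of_isPGroup {P : Subgroup (Perm (Fin n))} {p m : ℕ} (hp : p.Prime)
    (hP : IsPGroup p P) (hm : ¬ p ^ (m + 1) ∣ n.factorial) {g : Perm (Fin n)} (hg : g ∈ P) :
    g ^ p ^ m = 1 := by
  obtain ⟨k, hk⟩ := hP ⟨g, hg⟩
  have hk' : g ^ p ^ k = 1 := congrArg Subtype.val hk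
  obtain ⟨j, -, hj⟩ := (Nat.dvd_prime_pow hp).1 (orderOf_dvd_of_pow_eq_one hk')
  have h1 : orderOf g ∣ n.factorial := by
    have := orderOf_dvd_card (x := g)
    rwa [Fintype.card_perm, Fintype.card_fin] at this
  have hjm : j ≤ m := by
    by_contra hlt
    exact hm (dvd_trans (pow_dvd_pow p (by omega)) (hj ▸ h1))
  exact orderOf_dvd_iff_pow_eq_one.1 (hj ▸ pow_dvd_pow p hjm)

end

/-- Cut a search at permutations fixing a point other than `a`. -/
noncomputable def fixedPrune (a i acc : ℕ) : Bool :=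
  Nat.rec true (fun j _ => cond (Nat.beq (digit acc j) j) (Nat.beq j a) true) i

/-- Apply a test only to codes with digit `b` in position `a`. -/
noncomputable def digitTest (a b : ℕ) (test : ℕ → Bool) (c : ℕ) : Bool :=
  cond (Nat.beq (digit c a) b) (test c) true

section

variable {n : ℕ}

theorem andPrune_of {p q : ℕ → ℕ → Bool} {x : Perm (Fin n)}
    (hp : ∀ i acc, i ≤ n → (∀ j : Fin n, (j : ℕ) < i → digit acc j = x j) → p i acc = true)
    (hq : ∀ i acc, i ≤ n → (∀ j : Fin n, (j : ℕ) < i → digit acc j = x j) → q i acc = true)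
    (i acc : ℕ) (hi : i ≤ n) (h : ∀ j : Fin n, (j : ℕ) < i → digit acc j = x j) :
    andPrune p q i acc = true := by
  rw [andPrune, hp i acc hi h, hq i acc hi h]; rfl

theorem fixedPrune_of {x : Perm (Fin n)} {a : ℕ} (hx : ∀ j : Fin n, x j = j → (j : ℕ) = a)
    (i acc : ℕ) (hi : i ≤ n) (h : ∀ j : Fin n, (j : ℕ) < i → digit acc j = x j) :
    fixedPrune a i acc = true := by
  cases i with
  | zero => rfl
  | succ i =>
    have h0 : fixedPrune a (i + 1) acc = cond (Nat.beq (digit acc i) i) (Nat.beq i a) true := rfl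
    have hd := h ⟨i, by omega⟩ (Nat.lt_succ_self i)
    simp only at hd
    rw [h0, hd]
    cases hb : Nat.beq (x ⟨i, by omega⟩) i with
    | false => rfl
    | true =>
      have := hx ⟨i, by omega⟩ (Fin.ext (Nat.eq_of_beq_eq_true hb))
      simp only at this
      simp [this]

theorem of_digitTest {x : Perm (Fin n)} {c : ℕ} (hc : IsCode x c) {a b : Fin n} (hx : x a = b)
    {test : ℕ → Bool} (h : digitTest a b test c = true) : test c = true := by
  rw [digitTest, hc, hx] at h
  simpa using h

/-- The mask marks the fixed points: none, or the point `0` alone. The starting value `0` of the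
accumulator already has the right digit at a fixed point `0`. -/
theorem searchThreeCycles_sound_of_fixed {test : ℕ → Bool} (hn : n ≤ 16) {g : Perm (Fin n)}
    (h3 : g ^ 3 = 1) {mask : ℕ} (hmask : mask = 0 ∨ mask = 1)
    (hfix : ∀ j : Fin n, g j = j ↔ Nat.testBit mask j = true)
    (h : searchThreeCycles n test n 0 0 mask = true) : ∃ c, IsCode g c ∧ test c = true := by
  refine searchThreeCycles_sound hn g h3 n 0 0 mask (by omega) (by simp) (fun j => ?_)
    (fun j hj => ?_) (fun j => ?_) h
  · rw [Bool.eq_iff_iff, ← hfix, ← hfix, g.injective.eq_iff]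
  · rw [Ne, hfix, hj]; simp
  · have h0 : digit 0 j = 0 := by simp [digit_eq]
    rw [h0]
    split_ifs with hb
    · rw [(hfix j).2 hb]
      rcases hmask with rfl | rfl
      · simp at hb
      · by_contra hne
        rw [Nat.testBit_one_eq_true_iff_self_eq_zero] at hb
        exact hne hb.symm
    · rfl

/-- The element with code `c` fixes `a` and its powers carry `b` to every other point. Conjugating
by a suitable power therefore moves the image of `a` under `z` to `b`. -/
theorem exists_conj_apply {K : Subgroup (Perm (Fin n))} {c : ℕ} (hc : HasCode K c) {a b : Fin n}
    (ha : digit c a = a) (hb : ∀ y : Fin n, y ≠ a → ∃ i : Fin n, (digit c)^[i] b = y)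
    {z : Perm (Fin n)} (hz : z a ≠ a) : ∃ g ∈ K, (g * z * g⁻¹) a = b := by
  obtain ⟨f, hf, hfc⟩ := hc
  obtain ⟨i, hi⟩ := hb _ hz
  have hiter : ∀ (t : ℕ) (y : Fin n), (digit c)^[t] y = ((f ^ t) y : Fin n) := by
    intro t
    induction t with
    | zero => intro y; rfl
    | succ t ih =>
      intro y
      rw [Function.iterate_succ_apply, hfc y, ih, pow_succ, Perm.mul_apply]
  rw [hiter] at hi
  refine ⟨(f ^ (i : ℕ))⁻¹, K.inv_mem (K.pow_mem hf _), ?_⟩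
  have hfa : f a = a := Fin.ext ((hfc a).symm.trans ha)
  rw [inv_inv, Perm.mul_apply, Perm.mul_apply, Perm.pow_apply_eq_self_of_apply_eq_self hfa,
    Perm.inv_eq_iff_eq]
  exact (Fin.ext hi).symm

theorem pow_conj_eq_one {g z : Perm (Fin n)} {p : ℕ} (h : orderOf z = p) :
    (g * z * g⁻¹) ^ p = 1 := by
  rw [conj_pow, ← h, pow_orderOf_eq_one]; simp

theorem conj_apply_eq_self_iff {g z : Perm (Fin n)} {j : Fin n} :
    (g * z * g⁻¹) j = j ↔ z (g⁻¹ j) = g⁻¹ j := by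
  rw [Perm.mul_apply, Perm.mul_apply]
  constructor
  · intro h; rw [eq_comm, Perm.inv_eq_iff_eq, h]
  · intro h; rw [h]; simp

end

/-! ### Degrees at most seven -/

/-- Codes of generators. -/
def gensAGL15 : List ℕ := [0x4321, 0x31420]

/-- Codes of generators. -/
def gensPSL25 : List ℕ := [0x504321, 0x512340, 0x13245]

/-- Codes of generators. -/
def gensPGL25 : List ℕ := [0x504321, 0x531420, 0x13245]

/-- Codes of generators. -/
def gensF21 : List ℕ := [0x654321, 0x5316420]

/-- Codes of generators. -/
def gensAGL17 : List ℕ := [0x654321, 0x4152630]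

/-- Codes of generators. -/
def gensL32 : List ℕ := [0x6420531, 0x5643120]

/-- The order is divisible by `4` and by `6`, hence by `12`, so the index in the symmetric group is
at most two. -/
theorem isClassified_four {G : Subgroup (Perm (Fin 4))} (hG : IsGood G) : IsClassified [] G := by
  refine Or.inl (Perm.alternatingGroup_le_of_index_le_two ?_)
  have h1 := dvd_card_of_isPreprimitive hG.primitive (by norm_num)
  have h2 := hG.twoHomogeneous.choose_dvd_card (by norm_num)
  have h3 : 12 ∣ Nat.card G := by
    have := Nat.lcm_dvd h1 h2
    rwa [show Nat.lcm 4 (Nat.choose 4 2) = 12 by decide] at this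
  have h4 := Subgroup.card_mul_index G
  rw [Nat.card_eq_fintype_card (α := Perm (Fin 4)), Fintype.card_perm, Fintype.card_fin,
    show Nat.factorial 4 = 24 from rfl] at h4
  obtain ⟨m, hm⟩ := h3
  have hpos : 0 < Nat.card G := Nat.card_pos
  by_contra hlt
  have : 12 * 3 ≤ Nat.card G * G.index := Nat.mul_le_mul (by omega) (by omega)
  omega

/-- Words for finding cycles of prime length. -/
def wordsFiveStart : List (List ℕ) :=
  [[0, 1, 0, 1, 1, 1]]

/-- Words for finding cycles of prime length. -/
def wordsAGL15 : List (List ℕ) :=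
  [[0, 1, 0, 1, 2], [0]]

/-- Base points, permitted images and reducing words. -/
def stagesAGL15 : Stages :=
  [(0, 1, [[], [0], [0, 0], [0, 1], [0, 1, 0]]), (1, 2, [[], [1], [1, 1], [1, 1, 1]])]

/-- Some elements as words in the generators. -/
def elementsAGL15 : List (ℕ × List ℕ) :=
  [(0x4321, [0]), (0x31420, [1]), (0x43210, [])]

theorem isClassified_five {G : Subgroup (Perm (Fin 5))} (hG : IsGood G) :
    IsClassified [gensAGL15] G := by
  have h1 := hG.twoHomogeneous.choose_dvd_card (by norm_num)
  obtain ⟨σ, hσ⟩ := exists_conj_hasCode_cycle (h := 0x4321) (p := 5) (by norm_num) (by norm_num)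
    (by norm_num) (dvd_trans (by decide) h1) (by decide +kernel)
  refine IsClassified.of_conjGroup (σ := σ) ?_
  have hG' := hG.conjGroup σ
  generalize conjGroup σ G = K at hσ hG'
  -- The order is divisible by `10`, so `G` is transitive on ordered pairs and has an element fixing
  -- `0` and mapping `1` to `2`. By the search it is `x ↦ 2 x` unless Jordan's theorem applies.
  obtain ⟨s, hs, hs0, hs1⟩ := hG'.twoHomogeneous.twoTransitive
    (dvd_trans (by decide) (hG'.twoHomogeneous.choose_dvd_card (by norm_num))) 0 1 0 2
    (by decide) (by decide)
  rcases alternatingGroup_le_or_forall_isNormalFor hG'.primitive (by norm_num) (gens := [0x4321])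
    (by simpa using hσ) (stages := [(0, 1, []), (1, 4, [])]) (words := wordsFiveStart)
    (specials := [0x31420]) (by decide +kernel) with h | h
  · exact Or.inl h
  obtain ⟨c, hc, hsc⟩ := h s hs (isNormalFor_cons (by norm_num)
    (by change Nat.testBit 1 (s 0 : Fin 5) = true; rw [hs0]; rfl) (isNormalFor_cons (by norm_num)
      (by change Nat.testBit 4 (s 1 : Fin 5) = true; rw [hs1]; rfl) (isNormalFor_nil s)))
  have hgens : ∀ c ∈ gensAGL15, HasCode K c :=
    hasCode_of_subset (gens := [0x4321]) (by simpa using hσ) ⟨s, hs, hsc⟩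
      (by rw [List.mem_singleton.1 hc]; decide)
  rcases alternatingGroup_le_or_forall_isNormalFor hG'.primitive (by norm_num) hgens
    (stages := stagesAGL15) (words := wordsAGL15) (specials := [0x43210]) (by decide +kernel)
    with h | h
  · exact Or.inl h
  exact IsClassified.of_normal (by norm_num) gensAGL15 (by decide) hgens (M := elementsAGL15)
    (by decide +kernel) (by decide) (by decide +kernel) h (bad := []) (by decide) (by simp)

/-! ### Degree six. -/

/-- Words for finding cycles of prime length. -/
def wordsSixStart : List (List ℕ) :=
  [[0, 1], [0, 0, 1], [0, 1, 1], [0, 0, 1, 1]]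

/-- Words for finding cycles of prime length. -/
def wordsPSL25 : List (List ℕ) :=
  [[0, 1, 0, 2, 0], [0, 2, 1, 1], [0]]

/-- Base points, permitted images and reducing words. -/
def stagesPSL25 : Stages :=
  [(5, 32, [[], [2], [2, 0], [2, 0, 0], [2, 0, 1], [2, 0, 0, 0]]), (0, 1, [[], [0], [0, 0], [0, 1],
  [0, 0, 0]]), (1, 6, [[], [1]])]

/-- Some elements as words in the generators. -/
def elementsPSL25 : List (ℕ × List ℕ) :=
  [(0x504321, [0]), (0x512340, [1]), (0x13245, [2]), (0x543210, [])]

/-- Some elements as words in the generators. -/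
def elementsPGL25 : List (ℕ × List ℕ) :=
  [(0x504321, [0]), (0x512340, [1, 1]), (0x13245, [2]), (0x543210, []), (0x531420, [1])]

/-- Certificates for conjugate subgroups. -/
def certsSixStart : List (ℕ × ℕ × List (List ℕ)) :=
  [(0x32451, 0x341025, [[1, 0, 0, 1], [1, 0, 0, 1, 1, 0, 0, 1, 1, 0], [1, 1, 0, 0, 1, 1]]),
  (0x31542, 0x341025, [[1, 0, 1, 0, 0], [1, 0, 0, 1, 0, 1, 0], [1, 1, 1, 1, 0, 1, 0]]), (0x15423,
  0x341025, [[1, 0, 1, 0, 0], [0, 1, 0, 0, 1, 0, 0], [1, 1, 0, 1, 0, 0, 1]]), (0x51324, 0x341025,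
  [[1, 1, 0], [0, 1, 0, 1, 1, 0], [1, 1, 1, 0, 1]])]

/-- The stabilizer of `0` and `5 = ∞` in `PSL(2,5)` has the orbits `{1, 4}` and `{2, 3}`, hence the
permitted images `1` and `2` of the last base point. The surviving normal forms are the identity and
`x ↦ 2 x`, which decides between `PSL` and `PGL`. -/
theorem isClassified_six_of_PSL25 {G : Subgroup (Perm (Fin 6))} (hG : IsGood G)
    (hgens : ∀ c ∈ gensPSL25, HasCode G c) : IsClassified [gensPSL25, gensPGL25] G := by
  rcases alternatingGroup_le_or_forall_isNormalFor hG.primitive (by norm_num) hgens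
    (stages := stagesPSL25) (words := wordsPSL25) (specials := [0x543210, 0x531420])
    (by decide +kernel) with h | h
  · exact Or.inl h
  by_cases hd : HasCode G 0x531420
  · exact IsClassified.of_normal (by norm_num) gensPSL25 (by decide)
      (hasCode_of_subset (gens' := gensPGL25) hgens hd (by decide)) (M := elementsPGL25)
      (by decide +kernel) (by decide) (by decide +kernel) h (bad := []) (by decide) (by simp)
  · exact IsClassified.of_normal (by norm_num) gensPSL25 (by decide) hgens (M := elementsPSL25)
      (by decide +kernel) (by decide) (by decide +kernel) h (bad := [0x531420]) (by decide)
      (by simpa using hd)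

/-- Codes of exceptional elements of a search. -/
def specialsSix : List ℕ :=
  [0x32451, 0x31542, 0x15423, 0x51324]

/-- The order is divisible by `15`. A five-cycle is put in standard form; an element of order three
that is not a three-cycle moves all points, and conjugation by the five-cycle makes it map `5` to
`0`. Every surviving candidate yields `PSL(2,5)` up to conjugacy. -/
theorem isClassified_six {G : Subgroup (Perm (Fin 6))} (hG : IsGood G) :
    IsClassified [gensPSL25, gensPGL25] G := by
  have h1 := hG.twoHomogeneous.choose_dvd_card (by norm_num)
  obtain ⟨σ, hσ⟩ := exists_conj_hasCode_cycle (h := 0x504321) (p := 5) (by norm_num) (by norm_num)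
    (by norm_num) (dvd_trans (by decide) h1) (by decide +kernel)
  refine IsClassified.of_conjGroup (σ := σ) ?_
  have hG' := hG.conjGroup σ
  generalize conjGroup σ G = K at hσ hG'
  rcases alternatingGroup_le_or_exists_support hG'.primitive Nat.prime_three (Or.inl rfl)
    (dvd_trans (by decide) (hG'.twoHomogeneous.choose_dvd_card (by norm_num)))
    with h | ⟨z, hz, ho, m, hm, hs, hle⟩
  · exact Or.inl h
  have hs6 : z.support = Finset.univ := by
    rw [← Finset.card_eq_iff_eq_univ, hs, Fintype.card_fin]; omega
  have hnf : ∀ j, z j ≠ j := fun j => Perm.mem_support.1 (hs6 ▸ Finset.mem_univ j)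
  obtain ⟨g, hg, hgz⟩ := exists_conj_apply hσ (a := 5) (b := 0) (by decide +kernel)
    (by decide +kernel) (hnf 5)
  have hz' : g * z * g⁻¹ ∈ K := K.mul_mem (K.mul_mem hg hz) (K.inv_mem hg)
  obtain ⟨c, hc, ht⟩ := searchThreeCycles_sound_of_fixed (by norm_num) (g := g * z * g⁻¹)
    (pow_conj_eq_one ho) (mask := 0) (Or.inl rfl)
    (fun j => by rw [conj_apply_eq_self_iff]; simp [hnf])
    (test := digitTest 5 0 (jordanTest 6 [0x504321] wordsSixStart specialsSix))
    (by decide +kernel)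
  replace ht := of_digitTest (a := 5) (b := 0) hc hgz ht
  rcases alternatingGroup_le_or_mem_of_jordanTest hG'.primitive (by norm_num) (by simpa using hσ)
    ⟨_, hz', hc⟩ ht with h | h
  · exact Or.inl h
  · exact IsClassified.of_certs hG' (by norm_num) (gens := [0x504321]) (by simpa using hσ)
      (certs := certsSixStart) (targets := gensPSL25) (by decide +kernel) ⟨_, hz', hc⟩
      ((by decide : ∀ c ∈ specialsSix, c ∈ certsSixStart.map Prod.fst) c h)
      fun G' hG' h => isClassified_six_of_PSL25 hG' h

/-! ### Degree seven. -/

/-- Words for finding cycles of prime length. -/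
def wordsSevenStart : List (List ℕ) :=
  [[0, 1], [0, 0, 1], [0, 1, 1], [0, 0, 1, 1], [0, 1, 1, 1], [0, 0, 1, 0, 1], [0, 0, 1, 1, 1], [0,
  0, 1, 0, 1, 1], [0, 0, 1, 1, 0, 1], [0, 1, 1, 1, 0, 1, 0, 1], [1, 1, 1, 0, 1, 1, 0, 1, 1]]

/-- Words for finding cycles of prime length. -/
def wordsF21 : List (List ℕ) :=
  [[0], [0, 1, 2], [0, 1, 1], [2, 1, 0, 0, 1, 0], [2, 1, 1, 0, 0, 0], [0, 0, 0, 1, 1], [0, 1, 1, 1,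
  1], [0, 1, 2, 1], [0, 1, 2, 1, 1], [0, 2, 0, 2, 1], [1, 0, 2, 0, 1, 2], [0, 2, 1, 2], [2, 1, 2,
  0, 2, 1], [0, 1, 0, 2, 1, 2]]

/-- Words for finding cycles of prime length. -/
def wordsL32 : List (List ℕ) :=
  [[0], [0, 0, 1, 0, 1], [0, 1, 2, 1, 1], [0, 0, 0, 1, 2], [1, 0, 1, 0, 0, 2], [0, 0, 0, 2, 1, 2],
  [0, 1, 1, 2, 1], [0, 1, 2, 1, 2], [0, 2, 1, 2, 1], [0, 1, 1, 2], [0, 1, 1, 2, 0, 1], [0, 0, 2,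
  1], [0, 1, 0, 1, 2]]

/-- Base points, permitted images and reducing words. -/
def stagesF21 : Stages :=
  [(0, 1, [[], [0], [0, 0], [0, 1], [0, 0, 0], [0, 1, 0], [0, 1, 0, 0]]), (1, 10, [[], [1], [1,
  1]])]

/-- Base points, permitted images and reducing words. -/
def stagesL32 : Stages :=
  [(0, 1, [[], [0], [0, 0], [0, 0, 1], [0, 0, 1, 0], [0, 0, 1, 0, 0], [0, 0, 1, 0, 0, 1]]), (1, 2,
  [[], [1], [0, 0, 1, 0, 1, 0, 0, 1, 0], [1, 0, 0, 1, 0, 1, 0, 0, 1, 0], [0, 0, 1, 0, 0, 1, 0, 1,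
  0, 1, 0], [1, 0, 0, 1, 0, 0, 1, 0, 1, 0, 1, 0]])]

/-- Some elements as words in the generators. -/
def elementsF21 : List (ℕ × List ℕ) :=
  [(0x654321, [0]), (0x5316420, [1]), (0x6543210, [])]

/-- Some elements as words in the generators. -/
def elementsAGL17 : List (ℕ × List ℕ) :=
  [(0x654321, [0]), (0x5316420, [1, 1]), (0x6543210, []), (0x4152630, [1])]

/-- Some elements as words in the generators. -/
def elementsL32 : List (ℕ × List ℕ) :=
  [(0x6420531, [0]), (0x5643120, [1]), (0x6543210, []), (0x5634210, [1, 0, 1, 0, 0, 1, 0, 1, 0,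
  0]), (0x4365210, [0, 1, 0, 0]), (0x3456210, [1, 0, 1, 0, 0, 1])]

/-- Codes of exceptional elements of a search. -/
def specialsSeven : List ℕ :=
  [0x5316420, 0x4136520, 0x1354620, 0x1256430, 0x5214630, 0x3625140, 0x1265340, 0x2631540,
  0x3264150, 0x1624350, 0x2435160, 0x5132460, 0x3421560, 0x4312560]

/-- Codes of exceptional elements of a search. -/
def specialsF21 : List ℕ :=
  [0x6543210, 0x4562310, 0x5623410, 0x3526410, 0x4263510, 0x2453610, 0x2534610, 0x4265130,
  0x6451230, 0x5261430, 0x1256430, 0x4621530, 0x6241530, 0x2541630, 0x4152630, 0x5214630]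

/-- Codes of exceptional elements of a search. -/
def specialsL32 : List ℕ :=
  [0x6543210, 0x5634210, 0x4365210, 0x3456210]

/-- Certificates for conjugate subgroups. -/
def certsSevenStartF21 : List (ℕ × ℕ × List (List ℕ)) :=
  [(0x5316420, 0x4205316, [[1, 1], [1, 0]]), (0x3625140, 0x4205316, [[1, 1], [1, 0, 0]])]

/-- Certificates for conjugate subgroups. -/
def certsSevenStartL32 : List (ℕ × ℕ × List (List ℕ)) :=
  [(0x4136520, 0x1453062, [[1, 1, 0, 1, 0], [1, 0, 0, 1, 0, 0]]), (0x1354620, 0x5062431, [[1, 1, 1,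
  1, 0, 1], [1, 1, 0, 1, 1, 1, 0, 1]]), (0x1256430, 0x5062431, [[1, 0, 1, 0, 1], [0, 0, 1, 1]]),
  (0x5214630, 0x5062431, [[1, 0, 0, 1, 1, 0, 0], [1, 1, 1, 0, 1, 0, 0, 1]]), (0x1265340, 0x1453062,
  [[0, 0, 1, 1, 0, 1, 0], [0, 0, 1, 1, 1, 1, 0, 1, 0]]), (0x2631540, 0x5062431, [[1, 0, 1, 1, 0],
  [0, 1, 0, 1, 1, 1, 0, 0]]), (0x3264150, 0x1453062, [[1, 1, 0, 0, 1, 0, 0], [1, 0, 1, 0]]),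
  (0x1624350, 0x1453062, [[1, 1, 0, 1, 0, 1, 1], [0, 0, 1]]), (0x2435160, 0x5062431, [[1, 1, 1, 1,
  0, 0, 1], [1, 1, 0, 0, 1, 1, 1, 0, 0, 1]]), (0x5132460, 0x1453062, [[1, 1, 0, 0, 1, 0, 0, 1, 1],
  [0, 1]]), (0x3421560, 0x5062431, [[1, 0, 0, 1, 0, 0, 1], [0, 1, 1]]), (0x4312560, 0x1453062, [[0,
  1, 1, 0, 0, 1, 0, 0], [1, 0, 0, 1, 1, 1, 1, 0, 1]])]

/-- Certificates for conjugate subgroups. -/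
def certsF21L32 : List (ℕ × ℕ × List (List ℕ)) :=
  [(0x4562310, 0x5062431, [[2, 1, 1, 0, 1], [2, 0, 2, 1, 1]]), (0x5623410, 0x1453062, [[2, 2, 1,
  0], [1, 0, 2, 1, 2, 1, 0]]), (0x3526410, 0x5062431, [[2, 1, 2, 1, 0], [1, 1, 1, 1, 0, 1, 0]]),
  (0x4263510, 0x1453062, [[1, 1, 1, 0, 1], [0, 2, 2, 0, 1]]), (0x2453610, 0x1453062, [[2, 1, 0, 1,
  2, 0], [0, 2, 0, 1]]), (0x2534610, 0x5062431, [[2, 0, 1, 1, 1, 1, 0], [2, 0, 1, 1, 0]]),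
  (0x4265130, 0x5062431, [[1, 0, 1, 2, 1], [0, 1, 2, 1, 0]]), (0x6451230, 0x1453062, [[0, 1, 2, 2,
  1, 0], [2, 0, 1]]), (0x5261430, 0x1453062, [[0, 1, 1], [0, 0, 1, 1, 0]]), (0x1256430, 0x5062431,
  [[1, 0, 1, 0, 1], [0, 0, 1, 1]]), (0x4621530, 0x1453062, [[0, 0, 0, 1, 1], [0, 2, 2, 0, 1]]),
  (0x6241530, 0x5062431, [[1, 0, 1, 1, 0], [2, 0, 1, 0, 2, 1, 0]]), (0x2541630, 0x1453062, [[0, 2,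
  1, 1, 0], [0, 2, 1]]), (0x5214630, 0x5062431, [[2, 0, 1, 0, 2, 0], [2, 0, 1, 1]])]

/-- The surviving normal forms are the four elements of `L(3,2)` fixing the line `{0, 1, 2}`
pointwise, so an overgroup is `L(3,2)` itself or contains the alternating group. -/
theorem isClassified_seven_of_L32 {G : Subgroup (Perm (Fin 7))} (hG : IsGood G)
    (hgens : ∀ c ∈ gensL32, HasCode G c) : IsClassified [gensF21, gensAGL17, gensL32] G := by
  rcases alternatingGroup_le_or_forall_isNormalFor hG.primitive (by norm_num) hgens
    (stages := stagesL32) (words := wordsL32) (specials := specialsL32) (by decide +kernel) with h | h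
  · exact Or.inl h
  exact IsClassified.of_normal (by norm_num) gensL32 (by decide) hgens (M := elementsL32)
    (by decide +kernel) (by decide) (by decide +kernel) h (bad := []) (by decide) (by simp)

/-- Normal forms fix `0` and map `1` to `1` or `3`, representatives of the squares and the
nonsquares. Of the survivors besides the identity, `x ↦ 3 x` leads to `AGL(1,7)`, and each of the
others to a conjugate of `L(3,2)`. -/
theorem isClassified_seven_of_F21 {G : Subgroup (Perm (Fin 7))} (hG : IsGood G)
    (hgens : ∀ c ∈ gensF21, HasCode G c) : IsClassified [gensF21, gensAGL17, gensL32] G := by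
  rcases alternatingGroup_le_or_forall_isNormalFor hG.primitive (by norm_num) hgens
    (stages := stagesF21) (words := wordsF21) (specials := specialsF21) (by decide +kernel) with h | h
  · exact Or.inl h
  by_cases hL : ∃ c ∈ certsF21L32.map Prod.fst, HasCode G c
  · obtain ⟨c, hc, hcG⟩ := hL
    exact IsClassified.of_certs hG (by norm_num) hgens (certs := certsF21L32) (targets := gensL32)
      (by decide +kernel) hcG hc fun G' hG' h => isClassified_seven_of_L32 hG' h
  push Not at hL
  by_cases hd : HasCode G 0x4152630
  · exact IsClassified.of_normal (by norm_num) gensF21 (by decide)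
      (hasCode_of_subset (gens' := gensAGL17) hgens hd (by decide)) (M := elementsAGL17)
      (by decide +kernel) (by decide) (by decide +kernel) h (bad := certsF21L32.map Prod.fst)
      (by decide) hL
  · exact IsClassified.of_normal (by norm_num) gensF21 (by decide) hgens (M := elementsF21)
      (by decide +kernel) (by decide) (by decide +kernel) h
      (bad := 0x4152630 :: certsF21L32.map Prod.fst) (by decide)
      (List.forall_mem_cons.2 ⟨hd, hL⟩)

/-- The order is divisible by `21`. An element of order three other than a three-cycle has a single
fixed point, which is moved to `0` by an element of the group, leaving the seven-cycle in place.
Surviving candidates give `7:3` or `L(3,2)`. -/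
theorem isClassified_seven {G : Subgroup (Perm (Fin 7))} (hG : IsGood G) :
    IsClassified [gensF21, gensAGL17, gensL32] G := by
  have h1 := hG.twoHomogeneous.choose_dvd_card (by norm_num)
  obtain ⟨σ, hσ⟩ := exists_conj_hasCode_cycle (h := 0x654321) (p := 7) (by norm_num) (by norm_num)
    (by norm_num) (dvd_trans (by decide) h1) (by decide +kernel)
  refine IsClassified.of_conjGroup (σ := σ) ?_
  have hG' := hG.conjGroup σ
  generalize conjGroup σ G = K at hσ hG'
  rcases alternatingGroup_le_or_exists_support hG'.primitive Nat.prime_three (Or.inl rfl)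
    (dvd_trans (by decide) (hG'.twoHomogeneous.choose_dvd_card (by norm_num)))
    with h | ⟨z, hz, ho, m, hm, hs, hle⟩
  · exact Or.inl h
  obtain ⟨y, hy⟩ := Finset.card_eq_one.1 (show (z.supportᶜ).card = 1 by
    rw [Finset.card_compl, hs, Fintype.card_fin]; omega)
  have hfix : ∀ j, z j = j ↔ j = y := fun j => by
    rw [← Finset.mem_singleton (a := y), ← hy, Finset.mem_compl, Perm.mem_support, not_not]
  obtain ⟨g, hg, hgy⟩ := exists_mem_apply_eq hG'.primitive y 0
  have hz' : g * z * g⁻¹ ∈ K := K.mul_mem (K.mul_mem hg hz) (K.inv_mem hg)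
  obtain ⟨c, hc, ht⟩ := searchThreeCycles_sound_of_fixed (by norm_num) (g := g * z * g⁻¹)
    (pow_conj_eq_one ho) (mask := 1) (Or.inr rfl)
    (fun j => by
      rw [conj_apply_eq_self_iff, hfix, Perm.inv_eq_iff_eq, hgy,
        Nat.testBit_one_eq_true_iff_self_eq_zero, Fin.ext_iff]; rfl)
    (test := jordanTest 7 [0x654321] wordsSevenStart specialsSeven) (by decide +kernel)
  rcases alternatingGroup_le_or_mem_of_jordanTest hG'.primitive (by norm_num) (by simpa using hσ)
    ⟨_, hz', hc⟩ ht with h | h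
  · exact Or.inl h
  rcases (by decide : ∀ c ∈ specialsSeven, c ∈ certsSevenStartL32.map Prod.fst ∨
    c ∈ certsSevenStartF21.map Prod.fst) c h with h | h
  · exact IsClassified.of_certs hG' (by norm_num) (gens := [0x654321]) (by simpa using hσ)
      (certs := certsSevenStartL32) (targets := gensL32) (by decide +kernel) ⟨_, hz', hc⟩ h
      fun G' hG' h => isClassified_seven_of_L32 hG' h
  · exact IsClassified.of_certs hG' (by norm_num) (gens := [0x654321]) (by simpa using hσ)
      (certs := certsSevenStartF21) (targets := gensF21) (by decide +kernel) ⟨_, hz', hc⟩ h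
      fun G' hG' h => isClassified_seven_of_F21 hG' h

/-! ### Degree eight -/

/-- Codes of generators. -/
def gensAGL18 : List ℕ := [0x67452301, 0x57136420]

/-- Codes of generators. -/
def gensAGaL18 : List ℕ := [0x67452301, 0x57136420, 0x32765410]

/-- Codes of generators. -/
def gensASL32 : List ℕ := [0x67452301, 0x75316420, 0x67542310]

/-- Codes of generators. -/
def gensPSL27 : List ℕ := [0x70654321, 0x75316420, 0x1452367]

/-- Codes of generators. -/
def gensPGL27 : List ℕ := [0x70654321, 0x74152630, 0x1452367]

/-- Words for finding cycles of prime length. -/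
def wordsAGL18 : List (List ℕ) :=
  [[0], [0, 2], [0, 2, 2], [0, 1], [1, 0, 0, 0, 2, 0], [0, 2, 2, 2, 2], [0, 0, 2, 0, 1], [0, 0, 1,
  2, 0, 2], [1, 0, 2, 2, 2, 2], [0, 1, 0, 2, 1]]

/-- Codes of exceptional elements of a search. -/
def specialsAGL18 : List ℕ :=
  [0x76543210, 0x67453210, 0x54763210, 0x45673210, 0x67542310, 0x76452310, 0x45762310, 0x54672310,
  0x76325410, 0x67235410, 0x32765410, 0x23675410, 0x67324510, 0x76234510, 0x23764510, 0x32674510,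
  0x54327610, 0x45237610, 0x32547610, 0x23457610, 0x45326710, 0x54236710, 0x23546710, 0x32456710]

/-- Words for finding cycles of prime length. -/
def wordsASL32 : List (List ℕ) :=
  [[0], [0, 1, 3], [0, 1, 2, 3], [0, 2, 2, 3, 2, 3], [0, 2]]

/-- Codes of exceptional elements of a search. -/
def specialsASL32 : List ℕ :=
  [0x76543210, 0x67453210, 0x54763210, 0x45673210]

/-- Words for finding cycles of prime length. -/
def wordsPSL27 : List (List ℕ) :=
  [[0], [0, 1, 1], [0, 1, 2], [0, 1, 1, 1, 1], [1, 3, 1, 1, 0, 1], [0, 2]]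

/-- Codes of exceptional elements of a search. -/
def specialsPSL27 : List ℕ :=
  [0x76543210, 0x74562310, 0x75623410, 0x73526410, 0x74263510, 0x72453610, 0x72534610, 0x74265130,
  0x76451230, 0x75261430, 0x71256430, 0x74621530, 0x76241530, 0x72541630, 0x74152630, 0x75214630]

/-- Words for finding cycles of prime length. -/
def wordsEightStart : List (List ℕ) :=
  [[0, 1]]

/-- Codes of exceptional elements of a search. -/
def specialsEight : List ℕ :=
  [0x67452301, 0x54762301, 0x45672301, 0x67325401, 0x35627401, 0x67234501, 0x52734601, 0x32457601,
  0x25634701, 0x24365701, 0x23456701]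

/-- Base points, permitted images and reducing words. -/
def stagesAGL18 : Stages :=
  [(0, 1, [[], [0], [0, 1], [0, 1, 0], [0, 1, 1], [0, 1, 1, 0], [0, 1, 0, 1], [0, 1, 0, 1, 0]]),
  (1, 2, [[], [1], [1, 1], [1, 1, 1], [1, 1, 1, 1], [1, 1, 1, 1, 1], [1, 1, 1, 1, 1, 1]])]

/-- Base points, permitted images and reducing words. -/
def stagesASL32 : Stages :=
  [(0, 1, [[], [0], [0, 1], [0, 1, 0], [0, 1, 1], [0, 1, 1, 0], [0, 1, 0, 1], [0, 1, 0, 1, 0]]),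
  (1, 2, [[], [1], [1, 1], [1, 1, 2], [1, 1, 2, 1], [1, 1, 2, 1, 1], [1, 1, 2, 1, 1, 2]]), (2, 4,
  [[], [2], [1, 1, 2, 1, 2, 1, 1, 2, 1], [2, 1, 1, 2, 1, 2, 1, 1, 2, 1], [1, 1, 2, 1, 1, 2, 1, 2,
  1, 2, 1], [2, 1, 1, 2, 1, 1, 2, 1, 2, 1, 2, 1]])]

/-- Base points, permitted images and reducing words. -/
def stagesPSL27 : Stages :=
  [(7, 128, [[], [2], [2, 0], [2, 0, 0], [2, 0, 1], [2, 0, 2], [2, 0, 0, 0], [2, 0, 1, 0]]), (0, 1,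
  [[], [0], [0, 0], [0, 1], [0, 0, 0], [0, 1, 0], [0, 1, 0, 0]]), (1, 10, [[], [1], [1, 1]])]

/-- Some elements as words in the generators. -/
def elementsAGL18 : List (ℕ × List ℕ) :=
  [(0x67452301, [0]), (0x57136420, [1]), (0x76543210, [])]

/-- Some elements as words in the generators. -/
def elementsAGaL18 : List (ℕ × List ℕ) :=
  [(0x67452301, [0]), (0x57136420, [1]), (0x76543210, []), (0x32765410, [2]), (0x54327610, [2, 2])]

/-- Some elements as words in the generators. -/
def elementsASL32 : List (ℕ × List ℕ) :=
  [(0x67452301, [0]), (0x75316420, [1]), (0x67542310, [2]), (0x76543210, []), (0x67453210, [2, 1,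
  2, 1, 1, 2, 1, 2, 1, 1]), (0x54763210, [1, 2, 1, 1]), (0x45673210, [2, 1, 2, 1, 1, 2])]

/-- Some elements as words in the generators. -/
def elementsPSL27 : List (ℕ × List ℕ) :=
  [(0x70654321, [0]), (0x75316420, [1]), (0x1452367, [2]), (0x76543210, [])]

/-- Some elements as words in the generators. -/
def elementsPGL27 : List (ℕ × List ℕ) :=
  [(0x70654321, [0]), (0x75316420, [1, 1]), (0x1452367, [2]), (0x76543210, []), (0x74152630, [1])]

/-- Certificates for conjugate subgroups. -/
def certsEightStartAGL18 : List (ℕ × ℕ × List (List ℕ)) :=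
  [(0x67452301, 0x70613425, [[1, 1, 1, 1, 1, 0, 1, 1], [0, 1, 0, 1, 0]]), (0x25634701, 0x50371624,
  [[1, 1, 1, 1, 1, 1, 0, 1], [1, 1, 1, 1, 1, 1, 0]])]

/-- Certificates for conjugate subgroups. -/
def certsEightStartASL32 : List (ℕ × ℕ × List (List ℕ)) :=
  [(0x54762301, 0x26734015, [[0, 1, 1, 1, 0, 1, 1, 1, 0, 1, 1, 1], [0, 1, 1, 0, 1, 1, 0, 1, 0, 1,
  1, 1], [1, 0, 1, 0, 1, 1, 0, 1, 1, 1, 1, 0]]), (0x67325401, 0x26734015, [[1, 1, 1, 0, 1, 1, 0, 1,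
  1, 1, 0, 1, 0, 1, 0], [0, 1, 1, 0, 1, 1, 1, 0, 1, 0, 1, 1], [0, 1, 1, 1, 1, 0, 1, 0, 1, 1, 1, 0,
  1, 0]]), (0x35627401, 0x54631702, [[0, 1, 0, 1, 1, 1, 0, 1, 1, 1, 0, 1, 1, 0], [0, 1, 1, 1, 0, 1,
  1, 1], [1, 0, 1, 0, 1, 1, 1, 1, 0, 1, 1, 1, 1]]), (0x52734601, 0x54631702, [[1, 1, 0, 1, 1, 0, 1,
  1, 0], [0, 1, 1, 0, 1, 1, 1, 1, 0, 1, 0], [1, 1, 0, 1, 0, 1, 1, 1, 1, 0, 1, 1, 1, 1, 0]]),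
  (0x32457601, 0x26734015, [[1, 1, 1, 1, 1, 1, 0, 1, 0, 1, 0, 1, 1], [1, 1, 0, 1, 0, 1, 1, 1, 1, 1,
  0, 1], [1, 0, 1, 1, 1, 1, 0, 1, 1, 1]]), (0x24365701, 0x54631702, [[1, 0, 1, 0, 1, 1, 0, 1, 0,
  1], [0, 1, 1, 0, 1, 1, 1, 0, 1, 1, 1, 1, 1], [0, 1, 0, 1, 1, 1, 1, 1, 1, 0, 1, 1, 0, 1]])]

/-- Certificates for conjugate subgroups. -/
def certsEightStartPSL27 : List (ℕ × ℕ × List (List ℕ)) :=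
  [(0x45672301, 0x21764305, [[1, 1, 1, 0, 1], [1, 1, 0, 1, 1, 1, 0, 1, 1], [1, 0, 1, 1, 1, 1, 0,
  1]]), (0x67234501, 0x21764305, [[1, 0, 1, 1, 1, 1, 0, 1, 0], [1, 1, 1, 0, 1, 1, 1], [0]]),
  (0x23456701, 0x21764305, [[1, 1, 0, 1, 0, 1, 0, 1, 0, 1, 0], [1, 0, 1, 0, 1, 0, 1], [1, 0, 1, 1,
  0, 1]])]

/-- Certificates for conjugate subgroups. -/
def certsAGL18ASL32 : List (ℕ × ℕ × List (List ℕ)) :=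
  [(0x67453210, 0x26734015, [[2, 0, 2, 1, 0, 2, 0], [0, 2, 2, 2, 2, 0, 2, 2, 1], [2, 2, 2, 0, 2, 2,
  1, 2, 0]]), (0x54763210, 0x26734015, [[2, 2, 1, 2, 2, 2, 2, 2], [2, 0, 2, 2, 2, 2, 1], [2, 2, 1,
  0, 2, 0, 2, 0]]), (0x45673210, 0x26734015, [[2, 2, 1, 2, 2, 2, 2, 2], [2, 2, 0, 2, 1, 0], [2, 2,
  1, 0, 2, 0, 2, 2]]), (0x67542310, 0x26734015, [[2, 2, 1, 2, 2, 2, 2, 2], [2, 2, 0, 2, 2, 2, 1],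
  [2, 2, 1, 2, 2, 0, 2, 2, 0]]), (0x76452310, 0x26734015, [[2, 2, 1, 2, 2, 2, 2, 2], [2, 0, 2, 2,
  2, 2, 2, 2, 1, 0], [0, 2, 2, 2, 2, 2, 2, 1, 0, 2, 0]]), (0x45762310, 0x26734015, [[2, 1, 0, 2, 1,
  0, 2, 0], [2, 2, 0, 0, 2, 1, 0], [2, 0, 0, 2, 1, 2, 2, 2, 0]]), (0x54672310, 0x26734015, [[2, 2,
  1, 0, 2, 2, 0], [2, 0, 2, 0, 0, 0, 2, 1], [1, 0, 0, 0, 2, 0, 2, 1, 0]]), (0x76325410, 0x26734015,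
  [[0, 2, 1, 0, 2, 0, 2], [0, 2, 0, 2, 2, 2, 2, 0, 2, 2, 1], [0, 2, 1, 2, 2, 2, 0, 2, 2, 2, 0]]),
  (0x67235410, 0x26734015, [[0, 2, 1, 0, 2, 0, 2], [2, 0, 2, 1, 0], [1, 0, 0, 0, 2, 1]]),
  (0x23675410, 0x26734015, [[0, 2, 1, 0, 2, 0, 2], [0, 0, 2, 0, 2, 2, 1], [0, 2, 1, 2, 2, 0]]),
  (0x67324510, 0x26734015, [[0, 2, 1, 0, 2, 1], [0, 0, 2, 1, 0], [1, 0, 2, 1]]), (0x76234510,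
  0x26734015, [[2, 2, 1, 2, 2, 2, 2, 2], [2, 2, 2, 2, 0, 2, 1], [2, 2, 1, 2, 2, 0, 2, 2, 2]]),
  (0x23764510, 0x26734015, [[0, 2, 1, 0, 2, 1], [0, 0, 2, 2, 1, 0, 0], [0, 0, 2, 2, 0, 0, 2, 1, 2,
  1]]), (0x32674510, 0x26734015, [[2, 2, 1, 0, 2, 2, 0], [2, 2, 2, 1, 0, 0], [2, 2, 1, 2, 0, 0, 2,
  2]]), (0x45237610, 0x26734015, [[2, 2, 1, 2, 2, 2, 2, 2], [2, 2, 2, 1, 0], [2, 2, 1, 2, 0, 2,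
  2]]), (0x32547610, 0x26734015, [[2, 2, 1, 2, 2, 2, 2, 2], [0, 2, 2, 0, 2, 2, 0, 2, 0, 2, 1, 0],
  [2, 2, 1, 2, 0, 2, 0, 2]]), (0x23457610, 0x26734015, [[2, 2, 1, 2, 2, 2, 2, 2], [2, 2, 0, 0, 2,
  2, 2, 1], [0, 0, 2, 2, 1, 0, 2, 0]]), (0x45326710, 0x26734015, [[2, 2, 1, 2, 2, 2, 2, 2], [0, 2,
  0, 0, 2, 2, 1], [0, 0, 2, 1, 2, 2, 0, 0]]), (0x54236710, 0x26734015, [[0, 0, 2, 1, 0, 0, 2, 1],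
  [0, 2, 2, 1, 0], [0, 2, 2, 0, 2, 1, 2, 1]]), (0x23546710, 0x26734015, [[2, 0, 2, 1, 0, 2, 1, 0],
  [2, 0, 2, 2, 2, 2, 0, 2, 1], [0, 2, 2, 1, 2, 0, 2, 2, 2, 2, 0]]), (0x32456710, 0x26734015, [[2,
  2, 1, 2, 2, 2, 2, 2], [2, 2, 0, 0, 2, 2, 2, 1], [2, 2, 2, 2, 0, 2, 1, 0, 2, 0]])]

/-- Certificates for conjugate subgroups. -/
def certsPSL27ASL32 : List (ℕ × ℕ × List (List ℕ)) :=
  [(0x74562310, 0x46157032, [[3, 1, 2, 1, 1, 0, 1], [3, 1, 0, 3, 1, 2, 1, 0], [3, 1, 2, 0, 2, 1,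
  0]]), (0x75623410, 0x63051247, [[2, 2, 1, 3, 0, 1, 1, 1], [1, 2], [2, 0]]), (0x73526410,
  0x46157032, [[2, 3, 0], [3, 1, 0, 3, 1, 0], [3, 1, 0, 1, 2, 1, 0]]), (0x74263510, 0x63051247,
  [[2, 1, 1, 0, 3, 0, 1, 0], [1, 2], [0, 3, 0, 3, 0]]), (0x72453610, 0x63051247, [[1, 3, 1, 1, 3,
  2, 0, 1, 0], [1, 2], [0, 1, 0, 2, 1, 0]]), (0x72534610, 0x46157032, [[3, 0, 3, 0, 3, 0], [0, 1,
  1, 3, 1, 0, 1], [3, 0, 2]]), (0x74265130, 0x46157032, [[3, 0, 2, 2, 0, 0], [3, 1, 2, 3, 1, 0, 1],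
  [3, 0, 2, 2]]), (0x76451230, 0x63051247, [[2, 2, 1, 3, 1, 0, 1, 1], [1, 2], [1, 0, 2, 1, 2, 1]]),
  (0x75261430, 0x63051247, [[0, 2, 1, 3, 1, 1, 1], [1, 2], [0, 0, 2, 0]]), (0x71256430, 0x46157032,
  [[1, 0, 0, 1, 2, 3, 0], [3, 1, 3, 2, 1, 0], [3, 1, 0, 1, 1, 1]]), (0x74621530, 0x63051247, [[3,
  0, 2, 1, 3, 0, 1, 0], [1, 2], [0, 2, 2, 0, 0]]), (0x76241530, 0x46157032, [[3, 0, 3, 0, 3, 0],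
  [0, 3, 1, 3, 0, 1, 2], [3, 2, 0]]), (0x72541630, 0x63051247, [[2, 1, 1, 3, 1, 1, 0, 1], [1, 2],
  [1, 2, 0, 1, 0]]), (0x75214630, 0x46157032, [[2, 0, 3, 1, 2, 0, 1, 0], [3, 1, 3, 1, 1, 0, 2], [2,
  3, 0, 1, 2, 0, 1]])]

/-- The survivors are the four elements of the group fixing the affine plane `{0, 1, 2, 3}`
pointwise. -/
theorem isClassified_eight_of_ASL32 {G : Subgroup (Perm (Fin 8))} (hG : IsGood G)
    (hgens : ∀ c ∈ gensASL32, HasCode G c) :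
    IsClassified [gensAGL18, gensAGaL18, gensASL32, gensPSL27, gensPGL27] G := by
  rcases alternatingGroup_le_or_forall_isNormalFor hG.primitive (by norm_num) hgens
    (stages := stagesASL32) (words := wordsASL32) (specials := specialsASL32) (by decide +kernel)
    with h | h
  · exact Or.inl h
  exact IsClassified.of_normal (by norm_num) gensASL32 (by decide) hgens (M := elementsASL32)
    (by decide +kernel) (by decide) (by decide +kernel) h (bad := []) (by decide) (by simp)

/-- The survivors besides the identity are `x ↦ 3 x`, leading to `PGL(2,7)`, and elements that
generate with `PSL(2,7)` a group containing a conjugate of `ASL(3,2)`. -/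
theorem isClassified_eight_of_PSL27 {G : Subgroup (Perm (Fin 8))} (hG : IsGood G)
    (hgens : ∀ c ∈ gensPSL27, HasCode G c) :
    IsClassified [gensAGL18, gensAGaL18, gensASL32, gensPSL27, gensPGL27] G := by
  rcases alternatingGroup_le_or_forall_isNormalFor hG.primitive (by norm_num) hgens
    (stages := stagesPSL27) (words := wordsPSL27) (specials := specialsPSL27) (by decide +kernel)
    with h | h
  · exact Or.inl h
  by_cases hL : ∃ c ∈ certsPSL27ASL32.map Prod.fst, HasCode G c
  · obtain ⟨c, hc, hcG⟩ := hL
    exact IsClassified.of_certs hG (by norm_num) hgens (certs := certsPSL27ASL32)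
      (targets := gensASL32) (by decide +kernel) hcG hc
      fun G' hG' h => isClassified_eight_of_ASL32 hG' h
  push Not at hL
  by_cases hd : HasCode G 0x74152630
  · exact IsClassified.of_normal (by norm_num) gensPSL27 (by decide)
      (hasCode_of_subset (gens' := gensPGL27) hgens hd (by decide)) (M := elementsPGL27)
      (by decide +kernel) (by decide) (by decide +kernel) h (bad := certsPSL27ASL32.map Prod.fst)
      (by decide) hL
  · exact IsClassified.of_normal (by norm_num) gensPSL27 (by decide) hgens (M := elementsPSL27)
      (by decide +kernel) (by decide) (by decide +kernel) h
      (bad := 0x74152630 :: certsPSL27ASL32.map Prod.fst) (by decide)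
      (List.forall_mem_cons.2 ⟨hd, hL⟩)

/-- The survivors fix `0` and `1`. Besides the identity they are the two nontrivial automorphisms of
the field, leading to `AΓL(1,8)`, and elements that lead to `ASL(3,2)`. -/
theorem isClassified_eight_of_AGL18 {G : Subgroup (Perm (Fin 8))} (hG : IsGood G)
    (hgens : ∀ c ∈ gensAGL18, HasCode G c) :
    IsClassified [gensAGL18, gensAGaL18, gensASL32, gensPSL27, gensPGL27] G := by
  have hsearch : searchPerm 8 (maskPrune stagesAGL18)
    (jordanTest 8 gensAGL18 wordsAGL18 specialsAGL18) 8 0 0 0 = true := by decide +kernel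
  rcases alternatingGroup_le_or_forall_isNormalFor hG.primitive (by norm_num) hgens hsearch with h | h
  · exact Or.inl h
  by_cases hL : ∃ c ∈ certsAGL18ASL32.map Prod.fst, HasCode G c
  · obtain ⟨c, hc, hcG⟩ := hL
    exact IsClassified.of_certs hG (by norm_num) hgens (certs := certsAGL18ASL32)
      (targets := gensASL32) (by decide +kernel) hcG hc
      fun G' hG' h => isClassified_eight_of_ASL32 hG' h
  push Not at hL
  by_cases hd : HasCode G 0x32765410
  · exact IsClassified.of_normal (by norm_num) gensAGL18 (by decide)
      (hasCode_of_subset (gens' := gensAGaL18) hgens hd (by decide)) (M := elementsAGaL18)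
      (by decide +kernel) (by decide) (by decide +kernel) h (bad := certsAGL18ASL32.map Prod.fst)
      (by decide) hL
  -- The code belongs to `x ↦ x ^ 4`, whose square is `x ↦ x ^ 16 = x ^ 2`.
  have hd' : ¬ HasCode G 0x54327610 := by
    intro h2
    have h3 := h2.comp h2
    rw [show comp 8 _ _ = 0x32765410 by decide +kernel] at h3
    exact hd h3
  exact IsClassified.of_normal (by norm_num) gensAGL18 (by decide) hgens (M := elementsAGL18)
      (by decide +kernel) (by decide) (by decide +kernel) h
      (bad := 0x32765410 :: 0x54327610 ::
        certsAGL18ASL32.map Prod.fst) (by decide)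
      (List.forall_mem_cons.2 ⟨hd, List.forall_mem_cons.2 ⟨hd', hL⟩⟩)

/-- The order is divisible by `28`. A seven-cycle is put in the form of multiplication by a
primitive element of the field, and a transitive Sylow `2`-subgroup has a central involution without
fixed points, which after conjugation by the seven-cycle maps `0` to `1`. -/
theorem isClassified_eight {G : Subgroup (Perm (Fin 8))} (hG : IsGood G) :
    IsClassified [gensAGL18, gensAGaL18, gensASL32, gensPSL27, gensPGL27] G := by
  have h1 := hG.twoHomogeneous.choose_dvd_card (by norm_num)
  obtain ⟨σ, hσ⟩ := exists_conj_hasCode_cycle (h := 0x57136420) (p := 7) (by norm_num)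
    (by norm_num) (by norm_num) (dvd_trans (by decide) h1) (by decide +kernel)
  refine IsClassified.of_conjGroup (σ := σ) ?_
  have hG' := hG.conjGroup σ
  generalize conjGroup σ G = K at hσ hG'
  obtain ⟨P, hP, -, -, z, hz, ho, hs, -⟩ := exists_transitive_pSubgroup_of_card Nat.prime_two
    (m := 2) (by norm_num) hG'.primitive
  have hnf : ∀ j, z j ≠ j := fun j => Perm.mem_support.1 (hs ▸ Finset.mem_univ j)
  obtain ⟨g, hg, hgz⟩ := exists_conj_apply hσ (a := 0) (b := 1) (by decide +kernel)
    (by decide +kernel) (hnf 0)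
  have hz' : g * z * g⁻¹ ∈ K := K.mul_mem (K.mul_mem hg (hP hz)) (K.inv_mem hg)
  -- As `8` is not a point, `fixedPrune 8` forbids all fixed points; the mask `2` requires that `0`
  -- is mapped to `1`.
  obtain ⟨c, hc, ht⟩ := searchPerm_sound (by norm_num)
    (prune := andPrune (maskPrune [(0, 2, [])]) (andPrune involutionPrune (fixedPrune 8)))
    (test := jordanTest 8 [0x57136420] wordsEightStart specialsEight) (by decide +kernel)
    (g * z * g⁻¹) (andPrune_of (maskPrune_of_isNormalFor (isNormalFor_cons (by norm_num)
        (by change Nat.testBit 2 ((g * z * g⁻¹) 0 : Fin 8) = true; rw [hgz]; rfl)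
        (isNormalFor_nil _)))
      (andPrune_of (involutionPrune_of_mul_self (by rw [← pow_two]; exact pow_conj_eq_one ho))
        (fixedPrune_of fun j hj => absurd (conj_apply_eq_self_iff.1 hj) (hnf _))))
  rcases alternatingGroup_le_or_mem_of_jordanTest hG'.primitive (by norm_num) (by simpa using hσ)
    ⟨_, hz', hc⟩ ht with h | h
  · exact Or.inl h
  rcases (by decide : ∀ c ∈ specialsEight, c ∈ certsEightStartAGL18.map Prod.fst ∨
    c ∈ certsEightStartASL32.map Prod.fst ∨ c ∈ certsEightStartPSL27.map Prod.fst) c h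
    with h | h | h
  · exact IsClassified.of_certs hG' (by norm_num) (gens := [0x57136420]) (by simpa using hσ)
      (certs := certsEightStartAGL18) (targets := gensAGL18) (by decide +kernel) ⟨_, hz', hc⟩ h
      fun G' hG' h => isClassified_eight_of_AGL18 hG' h
  · exact IsClassified.of_certs hG' (by norm_num) (gens := [0x57136420]) (by simpa using hσ)
      (certs := certsEightStartASL32) (targets := gensASL32) (by decide +kernel) ⟨_, hz', hc⟩ h
      fun G' hG' h => isClassified_eight_of_ASL32 hG' h
  · exact IsClassified.of_certs hG' (by norm_num) (gens := [0x57136420]) (by simpa using hσ)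
      (certs := certsEightStartPSL27) (targets := gensPSL27) (by decide +kernel) ⟨_, hz', hc⟩ h
      fun G' hG' h => isClassified_eight_of_PSL27 hG' h

/-! ### Degree nine -/

section

variable {n : ℕ}

/-- `P` is a `p`-subgroup of `G`, transitive on `s`, fixing the points outside `s`, with `ζ` in its
centre. -/
structure IsCentralIn (G P : Subgroup (Perm (Fin n))) (p : ℕ) (s : Finset (Fin n))
    (ζ : Perm (Fin n)) : Prop where
  le : P ≤ G
  isPGroup : IsPGroup p P
  apply_eq : ∀ h ∈ P, ∀ a ∉ s, h a = a
  transitive : ∀ a ∈ s, ∀ b ∈ s, ∃ h ∈ P, h a = b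
  mem : ζ ∈ P
  comm : ∀ y ∈ P, ζ * y = y * ζ

/-- The permutation `σ` has to preserve `s`, so that the conjugate acts on the same set, and carries
the new central element `ξ` to `ζ`. -/
theorem IsCentralIn.conjGroup {G P : Subgroup (Perm (Fin n))} {p : ℕ} {s : Finset (Fin n)}
    {ζ ξ σ : Perm (Fin n)} (h : IsCentralIn G P p s ζ) (hσ : ∀ a, σ a ∈ s ↔ a ∈ s)
    (hξ : σ * ξ = ζ * σ) : IsCentralIn (conjGroup σ G) (conjGroup σ P) p s ξ where
  le := fun g hg => h.le hg
  isPGroup := IsPGroup.comap_of_injective h.isPGroup _ (MulAut.conj σ).injective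
  apply_eq := fun g hg a ha => by
    have := h.apply_eq _ (mem_conjGroup.1 hg) (σ a) (by rwa [hσ])
    simpa using this
  transitive := fun a ha b hb => by
    obtain ⟨g, hg, hgab⟩ := h.transitive (σ a) ((hσ a).2 ha) (σ b) ((hσ b).2 hb)
    refine ⟨σ⁻¹ * g * σ, ?_, by simp [hgab]⟩
    rw [mem_conjGroup]
    simpa [mul_assoc] using hg
  mem := by
    rw [mem_conjGroup, hξ, mul_inv_cancel_right]
    exact h.mem
  comm := fun y hy => by
    have h1 := h.comm _ (mem_conjGroup.1 hy)
    have h2 : ξ = σ⁻¹ * ζ * σ := by rw [mul_assoc, ← hξ, inv_mul_cancel_left]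
    have h3 : y = σ⁻¹ * (σ * y * σ⁻¹) * σ := by simp [mul_assoc]
    rw [h2, h3]
    calc _ = σ⁻¹ * (ζ * (σ * y * σ⁻¹)) * σ := by group
      _ = σ⁻¹ * ((σ * y * σ⁻¹) * ζ) * σ := by rw [h1]
      _ = _ := by group

theorem hasCode_of_words {G : Subgroup (Perm (Fin n))} (hn : n ≤ 16) {gens : List ℕ}
    (hgens : ∀ c ∈ gens, HasCode G c) {M : List (ℕ × List ℕ)} (h : wordsCheck n gens M = true)
    {gens' : List ℕ} (hsub : ∀ c ∈ gens', c ∈ M.map Prod.fst) : ∀ c ∈ gens', HasCode G c :=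
  fun c hc => (hasCode_of_wordsCheck hn h (hsub c hc)).mono (codeGroup_le hgens)

end

/-- Codes of generators. -/
def gensAGL19 : List ℕ := [0x687354021, 0x327165840]

/-- Codes of generators. -/
def gensAGaL19 : List ℕ := [0x687354021, 0x327165840, 0x543876210]

/-- Codes of generators. -/
def gensM9 : List ℕ := [0x687354021, 0x582471360, 0x165327840]

/-- Codes of generators. -/
def gensASL23 : List ℕ := [0x687354021, 0x768354210, 0x741852630]

/-- Codes of generators. -/
def gensAGL23 : List ℕ := [0x687354021, 0x768354210, 0x741852630, 0x786453120]

/-- Codes of generators. -/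
def gensPSL28 : List ℕ := [0x867452301, 0x857136420, 0x43276518]

/-- Codes of generators. -/
def gensPGaL28 : List ℕ := [0x867452301, 0x857136420, 0x43276518, 0x832765410]

/-- Words for finding cycles of prime length. -/
def wordsE36 : List (List ℕ) :=
  [[0, 0, 1, 2, 2], [0, 1, 2, 2], [0], [0, 1, 0, 1, 2], [0, 0, 1], [1, 0, 0, 2, 0, 2], [0, 0, 1,
  2], [0, 2, 1, 2, 1], [0, 1, 2], [0, 2, 1, 2], [2, 0, 1, 1, 0, 1], [0, 0, 0, 1, 2, 0], [0, 0, 2,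
  1]]

/-- Codes of generators. -/
def gensE36 : List ℕ :=
  [0x687354021, 0x582471360]

/-- Codes of exceptional elements of a search. -/
def specialsE36 : List ℕ :=
  [0x876543210, 0x768354210, 0x687435210, 0x543876210, 0x435687210, 0x354768210]

/-- Base points, permitted images and reducing words. -/
def stagesAGL19 : Stages :=
  [(0, 1, [[], [0], [0, 0], [0, 1], [0, 1, 0], [0, 0, 1], [0, 1, 0, 0], [0, 0, 1, 0], [0, 0, 1,
  1]]), (1, 2, [[], [1], [1, 1], [1, 1, 1], [1, 1, 1, 1], [1, 1, 1, 1, 1], [1, 1, 1, 1, 1, 1], [1,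
  1, 1, 1, 1, 1, 1]])]

/-- Base points, permitted images and reducing words. -/
def stagesM9 : Stages :=
  [(0, 1, [[], [0], [0, 0], [0, 1], [0, 2], [0, 1, 0], [0, 2, 0], [0, 2, 1], [0, 1, 2]]), (1, 2,
  [[], [1], [2], [1, 1], [2, 1], [1, 2], [1, 1, 1], [2, 1, 1]])]

/-- Some elements as words in the generators. -/
def elementsAGL19 : List (ℕ × List ℕ) :=
  [(0x687354021, [0]), (0x327165840, [1]), (0x876543210, []), (0x687354021, [0]), (0x582471360, [1,
  1])]

/-- Some elements as words in the generators. -/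
def elementsM9 : List (ℕ × List ℕ) :=
  [(0x687354021, [0]), (0x582471360, [1]), (0x165327840, [2]), (0x876543210, []), (0x687354021,
  [0]), (0x582471360, [1])]

/-- Some elements as words in the generators. -/
def elementsAGaL19 : List (ℕ × List ℕ) :=
  [(0x687354021, [0]), (0x327165840, [1]), (0x543876210, [2]), (0x876543210, []), (0x543876210,
  [2]), (0x582471360, [1, 1]), (0x165327840, [1, 2])]

/-- Some elements as words in the generators. -/
def elementsASL23 : List (ℕ × List ℕ) :=
  [(0x687354021, [0]), (0x768354210, [1]), (0x741852630, [2]), (0x876543210, []), (0x768354210,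
  [1]), (0x687435210, [1, 1]), (0x582471360, [2, 2, 2]), (0x165327840, [1, 2, 1, 1])]

/-- Some elements as words in the generators. -/
def elementsAGL23 : List (ℕ × List ℕ) :=
  [(0x687354021, [0]), (0x768354210, [1]), (0x741852630, [2]), (0x786453120, [3]), (0x876543210,
  []), (0x768354210, [1]), (0x687435210, [1, 1]), (0x543876210, [3, 2, 2]), (0x435687210, [3, 2, 2,
  1]), (0x354768210, [1, 3, 2, 2]), (0x582471360, [2, 2, 2]), (0x165327840, [1, 2, 1, 1])]

/-- Some elements as words in the generators. -/
def elementsM9ASL23 : List (ℕ × List ℕ) :=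
  [(0x687354021, [1]), (0x768354210, [0]), (0x741852630, [2, 2, 2])]

/-- Some elements as words in the generators. -/
def elementsM9AGL23 : List (ℕ × List ℕ) :=
  [(0x687354021, [2]), (0x768354210, [1]), (0x741852630, [0, 3, 0]), (0x786453120, [3, 3, 0])]

/-- Some elements as words in the generators. -/
def elementsAGaL19M9 : List (ℕ × List ℕ) :=
  [(0x687354021, [0]), (0x582471360, [1, 1]), (0x165327840, [1, 2])]

/-- Some elements as words in the generators. -/
def elementsAGL19M9 : List (ℕ × List ℕ) :=
  [(0x687354021, [1]), (0x582471360, [2, 2]), (0x165327840, [0, 0, 2, 0, 0, 2])]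

/-- Certificates for conjugate subgroups. -/
def certsM9AGaL19 : List (ℕ × ℕ × List (List ℕ)) :=
  [(0x543876210, 0x327840165, [[3, 1, 3, 2, 2], [1, 0, 3, 1], [2, 3, 1, 3, 0]]), (0x435687210,
  0x825360147, [[2, 1, 2, 2, 2], [1, 0, 2, 1], [3, 2, 1, 2, 0]]), (0x354768210, 0x528630174, [[2,
  2, 2, 1, 2], [2, 1, 2, 3, 0], [3, 1, 1, 2, 0]])]

/-- Certificates for conjugate subgroups. -/
def certsAGL19AGaL19 : List (ℕ × ℕ × List (List ℕ)) :=
  [(0x543876210, 0x327840165, [[2, 1, 2, 0, 2, 2, 0], [1, 0, 2, 1, 0], [0, 2, 1, 2]]),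
  (0x435687210, 0x825360147, [[2, 2, 1, 2, 2, 2, 2, 2, 2], [1, 0, 2, 2, 1], [0, 2, 2, 1, 0, 2, 2,
  0]]), (0x354768210, 0x723480156, [[2, 0, 2, 1, 0, 2, 1, 0], [2, 1, 2, 2, 2, 2, 2, 0], [2, 1, 2,
  0, 2, 1, 2]])]

/-- The list of the generating sets for degree nine. -/
def gensNine : List (List ℕ) :=
  [gensAGL19, gensAGaL19, gensM9, gensASL23, gensAGL23, gensPSL28, gensPGaL28]

/-- All affine overgroups in degree nine contain `3²:4`, so one search over elements fixing `0` and
`1` serves them all. The six survivors are the elements of `AGL(2,3)` fixing `0` and `1`: the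
identity, two elements of order three and three involutions. -/
theorem alternatingGroup_le_or_specials_nine {G : Subgroup (Perm (Fin 9))} (hG : IsGood G)
    (hgens : ∀ c ∈ gensE36, HasCode G c) : alternatingGroup (Fin 9) ≤ G ∨
      ∀ x ∈ G, IsNormalFor [(0, 1, []), (1, 2, [])] x → ∃ c ∈ specialsE36, IsCode x c :=
  alternatingGroup_le_or_forall_isNormalFor hG.primitive (by norm_num) hgens (words := wordsE36)
    (by decide +kernel)

/-- Only base points and masks enter, not the reducing words, so stages for different groups with a
common base can be exchanged. -/
theorem IsNormalFor.of_map {n : ℕ} {s t : Stages} {x : Perm (Fin n)} (h : IsNormalFor s x)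
    (hst : ∀ e ∈ t, ∃ e' ∈ s, e'.1 = e.1 ∧ e'.2.1 = e.2.1) : IsNormalFor t x := by
  intro e he i hi
  obtain ⟨e', he', h1, h2⟩ := hst e he
  rw [← h2]
  exact h e' he' i (by rw [h1, hi])

/-- With an element of order three, `M₉` generates `ASL(2,3)`. One of the three involutions then
brings in all of them and `AGL(2,3)`; otherwise none is present. -/
theorem isClassified_nine_of_M9_of_order_three {G : Subgroup (Perm (Fin 9))} (hG : IsGood G)
    (hgens : ∀ c ∈ gensM9, HasCode G c) (ha : HasCode G 0x768354210) :
    IsClassified gensNine G := by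
  have hE : ∀ c ∈ gensE36, HasCode G c :=
    hasCode_of_words (by norm_num) hgens (M := elementsM9) (by decide +kernel) (by decide)
  rcases alternatingGroup_le_or_specials_nine hG hE with h | h
  · exact Or.inl h
  have hgens' : ∀ c ∈ 0x768354210 :: gensM9, HasCode G c := List.forall_mem_cons.2 ⟨ha, hgens⟩
  have ha2 : HasCode G 0x687435210 := by
    have := ha.comp ha
    rwa [show comp 9 _ _ = 0x687435210 by decide +kernel] at this
  by_cases hf : HasCode G 0x543876210
  · have hgA : ∀ c ∈ gensAGL23, HasCode G c :=
      hasCode_of_words (by norm_num) (gens := 0x543876210 :: 0x768354210 :: gensM9)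
        (List.forall_mem_cons.2 ⟨hf, hgens'⟩) (M := elementsM9AGL23) (by decide +kernel) (by decide)
    exact IsClassified.of_normal (by norm_num) gensM9 (gens' := gensAGL23) (by decide)
      hgA (M := elementsAGL23) (by decide +kernel) (by decide) (stages := stagesM9)
      (by decide +kernel) (fun x hx hn => h x hx (hn.of_map (by decide)))
      (bad := []) (by decide) (by simp)
  · have h2 : ¬ HasCode G 0x435687210 := fun h2 => hf (by
      have := h2.comp ha2
      rwa [show comp 9 _ _ = 0x543876210 by decide +kernel] at this)
    have h3 : ¬ HasCode G 0x354768210 := fun h3 => hf (by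
      have := h3.comp ha
      rwa [show comp 9 _ _ = 0x543876210 by decide +kernel] at this)
    have hgA : ∀ c ∈ gensASL23, HasCode G c :=
      hasCode_of_words (by norm_num) (gens := 0x768354210 :: gensM9) hgens' (M := elementsM9ASL23)
        (by decide +kernel) (by decide)
    exact IsClassified.of_normal (by norm_num) gensM9 (gens' := gensASL23) (by decide)
      hgA (M := elementsASL23) (by decide +kernel) (by decide) (stages := stagesM9)
      (by decide +kernel) (fun x hx hn => h x hx (hn.of_map (by decide)))
      (bad := [0x543876210, 0x435687210, 0x354768210]) (by decide) (by simp [hf, h2, h3])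

theorem not_hasCode_order_three {G : Subgroup (Perm (Fin 9))} (ha : ¬ HasCode G 0x768354210) :
    ¬ HasCode G 0x687435210 := fun h => ha (by
  have := h.comp h
  rwa [show comp 9 _ _ = 0x768354210 by decide +kernel] at this)

/-- `AΓL(1,9)` contains `M₉` and one of the three involutions, the cube map. Multiplied by it, a
further involution gives an element of order three, so without such elements nothing else is
possible. -/
theorem isClassified_nine_of_AGaL19 {G : Subgroup (Perm (Fin 9))} (hG : IsGood G)
    (hgens : ∀ c ∈ gensAGaL19, HasCode G c) : IsClassified gensNine G := by
  have hM : ∀ c ∈ gensM9, HasCode G c :=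
    hasCode_of_words (by norm_num) hgens (M := elementsAGaL19M9) (by decide +kernel) (by decide)
  have hE : ∀ c ∈ gensE36, HasCode G c :=
    hasCode_of_words (by norm_num) hM (M := elementsM9) (by decide +kernel) (by decide)
  rcases alternatingGroup_le_or_specials_nine hG hE with h | h
  · exact Or.inl h
  by_cases ha : HasCode G 0x768354210
  · exact isClassified_nine_of_M9_of_order_three hG hM ha
  have ha2 := not_hasCode_order_three ha
  have hf : HasCode G 0x543876210 := hgens _ (by decide)
  have h2 : ¬ HasCode G 0x435687210 := fun h2 => ha (by
    have := hf.comp h2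
    rwa [show comp 9 _ _ = 0x768354210 by decide +kernel] at this)
  have h3 : ¬ HasCode G 0x354768210 := fun h3 => ha2 (by
    have := hf.comp h3
    rwa [show comp 9 _ _ = 0x687435210 by decide +kernel] at this)
  exact IsClassified.of_normal (by norm_num) gensM9 (gens' := gensAGaL19) (by decide)
    hgens (M := elementsAGaL19) (by decide +kernel) (by decide) (stages := stagesM9)
    (by decide +kernel) (fun x hx hn => h x hx (hn.of_map (by decide)))
    (bad := [0x768354210, 0x687435210, 0x435687210, 0x354768210]) (by decide) (by simp [ha, ha2, h2, h3])

/-- Elements of order three are settled by the previous case, and each of the three involutions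
generates with `M₉` a group containing a conjugate of `AΓL(1,9)`. If none of them occurs, `G` is
`M₉`. -/
theorem isClassified_nine_of_M9 {G : Subgroup (Perm (Fin 9))} (hG : IsGood G)
    (hgens : ∀ c ∈ gensM9, HasCode G c) : IsClassified gensNine G := by
  have hE : ∀ c ∈ gensE36, HasCode G c :=
    hasCode_of_words (by norm_num) hgens (M := elementsM9) (by decide +kernel) (by decide)
  rcases alternatingGroup_le_or_specials_nine hG hE with h | h
  · exact Or.inl h
  by_cases ha : HasCode G 0x768354210
  · exact isClassified_nine_of_M9_of_order_three hG hgens ha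
  by_cases hr : ∃ c ∈ certsM9AGaL19.map Prod.fst, HasCode G c
  · obtain ⟨c, hc, hcG⟩ := hr
    exact IsClassified.of_certs hG (by norm_num) hgens (certs := certsM9AGaL19)
      (targets := gensAGaL19) (by decide +kernel) hcG hc
      fun G' hG' h => isClassified_nine_of_AGaL19 hG' h
  push Not at hr
  exact IsClassified.of_normal (by norm_num) gensM9 (gens' := gensM9) (by decide)
    hgens (M := elementsM9) (by decide +kernel) (by decide) (stages := stagesM9)
    (by decide +kernel) (fun x hx hn => h x hx (hn.of_map (by decide)))
    (bad := 0x768354210 :: 0x687435210 :: certsM9AGaL19.map Prod.fst) (by decide) (List.forall_mem_cons.2 ⟨ha, List.forall_mem_cons.2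
    ⟨not_hasCode_order_three ha, hr⟩⟩)

/-- If an element of order three is present, words in it and `AGL(1,9)` give generators of `M₉`. An
involution among the six elements gives a conjugate of `AΓL(1,9)`. -/
theorem isClassified_nine_of_AGL19 {G : Subgroup (Perm (Fin 9))} (hG : IsGood G)
    (hgens : ∀ c ∈ gensAGL19, HasCode G c) : IsClassified gensNine G := by
  have hE : ∀ c ∈ gensE36, HasCode G c :=
    hasCode_of_words (by norm_num) hgens (M := elementsAGL19) (by decide +kernel) (by decide)
  rcases alternatingGroup_le_or_specials_nine hG hE with h | h
  · exact Or.inl h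
  by_cases ha : HasCode G 0x768354210
  · exact isClassified_nine_of_M9_of_order_three hG (hasCode_of_words (by norm_num)
      (gens := 0x768354210 :: gensAGL19) (List.forall_mem_cons.2 ⟨ha, hgens⟩) (M := elementsAGL19M9)
      (by decide +kernel) (by decide)) ha
  by_cases hr : ∃ c ∈ certsAGL19AGaL19.map Prod.fst, HasCode G c
  · obtain ⟨c, hc, hcG⟩ := hr
    exact IsClassified.of_certs hG (by norm_num) hgens (certs := certsAGL19AGaL19)
      (targets := gensAGaL19) (by decide +kernel) hcG hc
      fun G' hG' h => isClassified_nine_of_AGaL19 hG' h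
  push Not at hr
  exact IsClassified.of_normal (by norm_num) gensAGL19 (gens' := gensAGL19) (by decide)
    hgens (M := elementsAGL19) (by decide +kernel) (by decide) (stages := stagesAGL19)
    (by decide +kernel) (fun x hx hn => h x hx (hn.of_map (by decide)))
    (bad := 0x768354210 :: 0x687435210 :: certsAGL19AGaL19.map Prod.fst) (by decide) (List.forall_mem_cons.2 ⟨ha, List.forall_mem_cons.2
    ⟨not_hasCode_order_three ha, hr⟩⟩)

/-! ### Overgroups of `PSL(2,8)`. -/

/-- Words for finding cycles of prime length. -/
def wordsPSL28 : List (List ℕ) :=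
  [[0, 1, 0, 3], [0, 1, 3], [0, 2], [0, 2, 0, 0, 0, 3], [3, 2, 0, 2, 0], [0, 1, 2, 1], [0, 2, 2]]

/-- Codes of exceptional elements of a search. -/
def specialsPSL28 : List ℕ :=
  [0x876543210, 0x832765410, 0x854327610]

/-- Base points, permitted images and reducing words. -/
def stagesPSL28 : Stages :=
  [(8, 256, [[], [2], [2, 0], [2, 0, 1], [2, 0, 1, 0], [2, 0, 1, 1], [2, 0, 1, 2], [2, 0, 1, 1, 0],
  [2, 0, 1, 2, 0]]), (0, 1, [[], [0], [0, 1], [0, 1, 0], [0, 1, 1], [0, 1, 1, 0], [0, 1, 0, 1], [0,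
  1, 0, 1, 0]]), (1, 2, [[], [1], [1, 1], [1, 1, 1], [2, 1, 2], [1, 1, 1, 1], [2, 1, 1, 2]])]

/-- Some elements as words in the generators. -/
def elementsPSL28 : List (ℕ × List ℕ) :=
  [(0x867452301, [0]), (0x857136420, [1]), (0x43276518, [2]), (0x876543210, [])]

/-- Some elements as words in the generators. -/
def elementsPGaL28 : List (ℕ × List ℕ) :=
  [(0x867452301, [0]), (0x857136420, [1]), (0x43276518, [2]), (0x876543210, []), (0x832765410,
  [3]), (0x854327610, [3, 3])]

/-- Normal forms fix `8 = ∞`, `0` and `1`. The survivors are the three automorphisms of the field,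
of which the two nontrivial ones are squares of each other. -/
theorem isClassified_nine_of_PSL28 {G : Subgroup (Perm (Fin 9))} (hG : IsGood G)
    (hgens : ∀ c ∈ gensPSL28, HasCode G c) : IsClassified gensNine G := by
  rcases alternatingGroup_le_or_forall_isNormalFor hG.primitive (by norm_num) hgens
    (stages := stagesPSL28) (words := wordsPSL28) (specials := specialsPSL28) (by decide +kernel)
    with h | h
  · exact Or.inl h
  by_cases hd : HasCode G 0x832765410
  · exact IsClassified.of_normal (by norm_num) gensPSL28 (by decide)
      (hasCode_of_subset (gens' := gensPGaL28) hgens hd (by decide)) (M := elementsPGaL28)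
      (by decide +kernel) (by decide) (by decide +kernel) h (bad := []) (by decide) (by simp)
  · have hd2 : ¬ HasCode G 0x854327610 := fun h2 => hd (by
      have := h2.comp h2
      rwa [show comp 9 _ _ = 0x832765410 by decide +kernel] at this)
    exact IsClassified.of_normal (by norm_num) gensPSL28 (by decide) hgens (M := elementsPSL28)
      (by decide +kernel) (by decide) (by decide +kernel) h
      (bad := [0x832765410, 0x854327610]) (by decide) (by simp [hd, hd2])

/-! ### Degree nine, starting from a transitive Sylow `3`-subgroup. -/

/-- Codes of generators. -/
def gensC9 : List ℕ :=
  [0x21876543]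

/-- Codes of generators. -/
def gensE9 : List ℕ :=
  [0x687354021, 0x210876543]

/-- Codes of generators. -/
def gensE18 : List ℕ :=
  [0x687354021, 0x210876543, 0x453786120]

/-- Words for finding cycles of prime length. -/
def wordsC9 : List (List ℕ) :=
  [[0, 1], [0, 1, 1], [0, 1, 1, 1, 1], [0, 1, 1, 1]]

/-- Words for finding cycles of prime length. -/
def wordsE9 : List (List ℕ) :=
  [[0, 1], [0, 2], [0, 1, 2], [0, 1, 0, 2], [0, 1, 1, 2, 0, 1], [0, 1, 0, 1, 2]]

/-- Certificates for conjugate subgroups. -/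
def certsC9PSL28 : List (ℕ × ℕ × List (List ℕ)) :=
  [(0x782451630, 0x643217058, [[0, 1, 1, 0, 1, 1, 0, 1, 1, 1, 0, 1, 1, 0], [0, 1, 0, 1, 1, 1, 0, 1,
  1, 0], [1, 1, 0, 1, 0, 1, 1, 1, 1, 0, 1, 0, 1, 0]]), (0x628451730, 0x146507283, [[1, 0, 1, 0, 1,
  0, 1, 1, 0, 1, 0], [0, 1, 1, 1, 1, 0, 1, 1, 0, 1, 1, 0, 1, 0], [1, 0, 1, 0, 1, 1, 0, 1, 0, 1,
  0]]), (0x267451830, 0x247061385, [[1, 1, 1, 1, 0, 1, 0, 1], [1, 1, 1, 1, 0, 1, 1, 0, 1, 1, 0],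
  [0, 1, 0, 1, 1, 0, 1, 1, 0, 1, 0, 1, 1]]), (0x782315640, 0x146507283, [[1, 1, 0, 1, 1, 1, 1, 0,
  1, 1, 1, 1, 1, 0, 1, 0], [1, 1, 0, 1, 1, 1, 1], [1, 0, 1, 1, 0, 1, 0, 1, 0, 1, 0]]),
  (0x628315740, 0x247061385, [[0, 1, 1, 1, 1, 1, 0, 1, 1, 1, 1, 0], [1, 1, 1, 1, 0, 1, 1, 1, 0],
  [0, 1, 1, 1, 1, 1, 0, 1, 0, 1, 0]]), (0x267315840, 0x643217058, [[1, 1, 1, 1, 1, 1, 0, 1, 0, 1,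
  1, 0], [1, 1, 1, 0, 1, 1, 0, 1], [1, 0, 1, 1, 0, 1, 1, 0, 1]]), (0x782134650, 0x247061385, [[1,
  1, 1, 0, 1, 1, 1, 1, 1, 0], [0, 1, 1, 1, 1, 1], [1, 1, 0, 1, 1, 1, 1, 0, 1, 1, 1, 1]]),
  (0x628134750, 0x643217058, [[1, 1, 0, 1, 1, 1, 1, 1, 1, 1], [0, 1, 0, 1, 0, 1, 0, 1, 1, 1, 1, 1,
  0, 1], [1, 1, 1, 1, 1, 1, 1, 0, 1, 1]]), (0x267134850, 0x146507283, [[0, 1, 0, 1, 1, 1, 0, 1, 0,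
  1], [0, 1, 1, 0, 1, 0, 1, 1, 1, 1, 1, 1, 0], [1, 0, 1, 0, 1, 1, 0, 1, 1, 1, 1, 0, 1, 0]]),
  (0x541872360, 0x643217058, [[0, 1, 1, 1, 0, 1, 1, 1, 1, 1, 1, 0], [1, 1, 1, 1, 1, 0, 1, 1, 1, 1,
  1, 0, 1, 1], [1, 0, 1, 1, 1, 1, 0, 1, 1, 1, 0, 1]]), (0x351728460, 0x146507283, [[1, 1, 1, 0, 1,
  1, 1, 1, 1, 1], [1, 0, 1, 1, 0, 1, 1, 1, 1, 1, 1, 0], [1, 1, 0, 1, 1, 1, 1, 1, 1, 0, 1, 1, 1, 1,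
  0]]), (0x431287560, 0x247061385, [[1, 1, 1, 0, 1, 1, 1, 1, 0], [1, 1, 1, 0, 1, 1, 1, 1, 0, 1, 1,
  0, 1, 0], [1, 0, 1, 1, 1, 0, 1, 1, 0, 1]]), (0x415682370, 0x146507283, [[0, 1, 1, 0, 1, 1, 0, 1,
  1], [1, 1, 0, 1, 0, 1, 0, 1, 1, 0], [1, 1, 1, 0, 1, 1, 1, 1, 0, 1, 0, 1, 0]]), (0x513826470,
  0x247061385, [[1, 1, 1, 1, 1, 1, 0, 1, 1, 1], [1, 1, 1, 1, 1, 0, 1, 1, 1, 0, 1], [1, 1, 1, 1, 1,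
  1, 1, 1, 0, 1]]), (0x314268570, 0x643217058, [[1, 0, 1, 1, 1, 0, 1, 1, 0, 1, 0, 1, 0, 1], [1, 1,
  0, 1, 0, 1, 1, 1, 1, 1, 1, 0], [1, 0, 1, 1, 1, 1, 1, 0, 1, 1, 1, 1, 1, 1]]), (0x154762380,
  0x247061385, [[0, 1, 0, 1, 1, 1, 1, 1, 1, 1, 1, 0], [0, 1, 0, 1, 1, 0, 1, 1, 1, 1, 0], [1, 0, 1,
  0, 1, 1, 1]]), (0x135627480, 0x643217058, [[0, 1, 1, 1, 0, 1, 1, 0, 1, 0, 1, 1, 1, 0], [0, 1, 1,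
  0, 1, 1, 0, 1, 1, 1, 0, 1, 0, 1], [0, 1, 1, 0, 1, 1, 1, 1, 1, 1, 1, 0]]), (0x143276580,
  0x146507283, [[1, 1, 1, 1, 0, 1, 1, 1, 1, 0, 1, 1, 1, 0, 1, 0], [1, 0, 1, 1, 1, 0, 1, 1, 1, 1, 1,
  0, 1, 1, 0, 1, 0], [0, 1, 1, 0, 1, 1, 1, 0, 1, 1, 1, 1]])]

/-- Words for finding cycles of prime length. -/
def wordsC9A : List (List ℕ) :=
  [[1, 0, 1, 1, 1, 0], [0, 1, 1, 2, 1], [0, 1, 2], [0, 1, 1, 1], [0, 0, 0, 1, 2]]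

/-- Certificates for conjugate subgroups. -/
def certsC9APSL28 : List (ℕ × ℕ × List (List ℕ)) :=
  [(0x782451630, 0x127630458, [[1, 1, 1, 0, 1, 1, 1, 2], [1, 2, 0, 1, 2, 1, 1, 0, 1, 1], [1, 1, 1,
  1, 0, 1, 2, 1, 2, 0]]), (0x278514630, 0x127630458, [[1, 1, 1, 0, 1, 2, 1], [1, 2, 1, 2, 1, 0, 1,
  0], [2, 1, 1, 1, 0, 1, 2, 0]]), (0x827145630, 0x127630458, [[0, 0, 1, 2, 1, 2, 0, 1], [2, 1, 1,
  1, 0, 1, 1, 1, 1], [2, 0, 0, 1, 1, 1, 0]])]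

/-- Words for finding cycles of prime length. -/
def wordsC9B : List (List ℕ) :=
  [[1, 1, 1, 1, 0, 0], [0, 1], [0, 1, 1, 0, 1, 0], [0, 0, 0, 1, 1], [0, 1, 2]]

/-- Certificates for conjugate subgroups. -/
def certsC9BPSL28 : List (ℕ × ℕ × List (List ℕ)) :=
  [(0x628451730, 0x413870256, [[0, 1, 0, 1, 2, 0, 1, 0], [2, 1, 1, 0, 1, 2, 0], [2, 1, 1, 0, 1,
  0]]), (0x862514730, 0x413870256, [[2, 0, 1, 2, 0, 1, 1, 0], [1, 0, 1, 2, 1, 0, 1, 1], [0, 1, 2,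
  0, 0, 1, 1, 1, 0]]), (0x286145730, 0x413870256, [[0, 0, 1, 2, 1, 1, 0], [1, 1, 1, 0, 1, 2, 0],
  [1, 1, 1, 0, 1, 0]])]

/-- Words for finding cycles of prime length. -/
def wordsC9C : List (List ℕ) :=
  [[0, 2, 1, 0, 1, 1], [1, 1, 0, 1, 2, 0], [0, 1, 1, 2], [0, 1, 1], [0, 1, 0, 1, 2]]

/-- Certificates for conjugate subgroups. -/
def certsC9CPSL28 : List (ℕ × ℕ × List (List ℕ)) :=
  [(0x267451830, 0x732045816, [[1, 1, 0, 1, 1, 0, 1], [2, 1, 1, 2, 0, 1, 1, 0], [1, 0, 1, 0, 1,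
  2]]), (0x726514830, 0x732045816, [[0, 0, 1, 1, 1, 2, 0], [2, 1, 1, 0, 1, 2, 0, 0], [2, 0, 1, 0,
  1, 1, 2, 0]]), (0x672145830, 0x732045816, [[1, 1, 2, 0, 1, 1, 1, 0, 1, 0], [2, 0, 1, 1, 2, 0, 1,
  1, 0, 1], [0, 0, 1, 1, 2, 0]])]

/-- Certificates for conjugate subgroups. -/
def certsE9E18 : List (ℕ × ℕ × List (List ℕ)) :=
  [(0x453786120, 0x876543210, [[1], [2], [0]]), (0x534867120, 0x687543210, [[1], [0, 2, 0, 2, 2],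
  [0]]), (0x345678120, 0x768543210, [[1], [0, 2, 0, 2, 2], [0]]), (0x467281530, 0x475682310, [[2,
  0, 2, 2, 0], [1, 0, 2, 0], [0]]), (0x658712340, 0x563872410, [[2, 2, 0, 1, 0], [1, 0, 2, 1, 0],
  [0]]), (0x783126450, 0x384762510, [[0, 1, 0, 1, 1], [0, 1, 1, 0, 1], [0]]), (0x251734860,
  0x748352610, [[2, 1, 0, 1, 0], [2, 0, 1, 1, 0], [0]]), (0x412385670, 0x836542710, [[2, 0, 1, 0],
  [2, 2, 0, 2, 0], [0]]), (0x123456780, 0x657432810, [[0, 1, 0, 1, 1], [0, 1, 1, 0, 1], [0]])]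

/-- Certificates for conjugate subgroups. -/
def certsNineStartC9 : List (ℕ × ℕ × List (List ℕ)) :=
  [(0x21876543, 0x534786120, [[0, 0]]), (0x102876543, 0x435876210, [[0, 0]]), (0x210687543,
  0x345786120, [[1, 1, 0, 0]]), (0x21687543, 0x786534120, [[1, 0]]), (0x210768543, 0x678453120,
  [[0]]), (0x102768543, 0x687354210, [[1, 0]])]

/-- Certificates for conjugate subgroups. -/
def certsNineStartE9 : List (ℕ × ℕ × List (List ℕ)) :=
  [(0x210876543, 0x237615480, [[1, 1, 0, 0], [1, 1, 0]]), (0x102687543, 0x768435210, [[1], [1, 1,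
  0]]), (0x21768543, 0x435876210, [[1], [1, 0, 0]])]

/-- Words for finding cycles of prime length. -/
def wordsE18 : List (List ℕ) :=
  [[0, 1, 0, 2], [0, 2, 2, 3, 0, 1], [0, 1, 0, 2, 3, 1], [2, 0, 2, 3, 0, 1]]

/-- Certificates for conjugate subgroups. -/
def certsE18AGL19 : List (ℕ × ℕ × List (List ℕ)) :=
  [(0x528174630, 0x876435021, [[1], [3, 0, 2, 0, 0]]), (0x285417630, 0x435210687, [[1], [1, 1,
  0]])]

/-- Words for finding cycles of prime length. -/
def wordsE36A : List (List ℕ) :=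
  [[0, 2], [0, 2, 4], [0, 2, 4, 0, 2], [0, 0, 1], [0, 1, 0, 2]]

/-- Certificates for conjugate subgroups. -/
def certsE36AM9 : List (ℕ × ℕ × List (List ℕ)) :=
  [(0x327165840, 0x507264831, [[2, 1, 1], [4, 3, 0, 2], [3, 0, 2, 0]]), (0x165327840, 0x507264831,
  [[2, 1, 1], [3, 0, 2], [0, 4, 1, 0, 4]])]

/-- Words for finding cycles of prime length. -/
def wordsE36B : List (List ℕ) :=
  [[0, 2], [0, 2, 3, 4], [0, 1], [0, 3, 0, 2, 4, 1], [1, 0, 1, 0, 2, 1]]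

/-- Certificates for conjugate subgroups. -/
def certsE36BM9 : List (ℕ × ℕ × List (List ℕ)) :=
  [(0x732651840, 0x507264831, [[2, 1, 1], [4, 0, 1, 0], [1, 4, 1, 1]]), (0x273516840, 0x507264831,
  [[2, 1, 1], [4, 0, 1, 4, 0], [1, 4, 1, 1]]), (0x165327840, 0x507264831, [[2, 1, 1], [3, 0, 2],
  [0, 4, 1, 0]])]

/-- Certificates for conjugate subgroups. -/
def certsE36BAGL19 : List (ℕ × ℕ × List (List ℕ)) :=
  [(0x327165840, 0x543876210, [[1], [0, 0, 0]])]

/-- The involutions fixing only the point `0` in a group of degree nine. -/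
theorem exists_isCentralIn_nine {G : Subgroup (Perm (Fin 9))} (hG : IsGood G)
    {test : ℕ → Bool} (h : searchPerm 9 (andPrune (maskPrune [(0, 1, [])])
      (andPrune involutionPrune (fixedPrune 0))) test 9 0 0 0 = true) :
    ∃ P ζ c, IsCentralIn G P 2 (Finset.univ.erase 0) ζ ∧ ζ * ζ = 1 ∧ IsCode ζ c ∧
      test c = true := by
  obtain ⟨P, hP, hPp, hfix, htr, ζ, hζ, ho, hs, hcomm⟩ :=
    (hG.twoHomogeneous.twoTransitive (dvd_trans (by decide)
      (hG.twoHomogeneous.choose_dvd_card (by norm_num)))).exists_pSubgroup (p := 2) (m := 2)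
      Nat.prime_two (by norm_num) 0
  have hζ2 : ζ * ζ = 1 := by rw [← pow_two, ← ho, pow_orderOf_eq_one]
  have hζ0 : ζ 0 = 0 := hfix ζ hζ
  obtain ⟨c, hc, ht⟩ := searchPerm_sound (by norm_num) h ζ
    (andPrune_of (maskPrune_of_isNormalFor (isNormalFor_cons (by norm_num)
        (by change Nat.testBit 1 (ζ 0 : Fin 9) = true; rw [hζ0]; rfl) (isNormalFor_nil _)))
      (andPrune_of (involutionPrune_of_mul_self hζ2) (fixedPrune_of fun j hj => by
        by_contra hne
        have hmem : j ∈ ζ.support := by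
          rw [hs]; exact Finset.mem_erase.2 ⟨fun e => hne (by simp [e]), Finset.mem_univ j⟩
        exact Perm.mem_support.1 hmem hj)))
  refine ⟨P, ζ, c, ⟨hP, hPp, fun h hh a ha => ?_, fun a ha b hb => ?_, hζ, hcomm⟩, hζ2, hc, ht⟩
  · rw [show a = 0 by simpa using ha, hfix h hh]
  · exact htr a b (Finset.ne_of_mem_erase ha) (Finset.ne_of_mem_erase hb)

/-- An element of a `2`-group fixing `0`, moving `1` to `b` and commuting with `ζ`. -/
theorem IsCentralIn.exists_nine {G P : Subgroup (Perm (Fin 9))} {ζ : Perm (Fin 9)}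
    (hP : IsCentralIn G P 2 (Finset.univ.erase 0) ζ) (hζ : ζ * ζ = 1) {z : ℕ} (hz : IsCode ζ z)
    {b : Fin 9} (hb : b ≠ 0) {test : ℕ → Bool}
    (h : searchPerm 9 (andPrune (maskPrune [(0, 1, []), (1, 2 ^ (b : ℕ), [])]) (commutePrune z z))
      test 9 0 0 0 = true) :
    ∃ t ∈ P, ∃ c, IsCode t c ∧ test c = true := by
  obtain ⟨t, ht, htb⟩ := hP.transitive 1 (by decide) b (by simp [hb])
  have ht0 : t 0 = 0 := hP.apply_eq t ht 0 (by simp)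
  have hz' : IsCode ζ⁻¹ z := by rwa [inv_eq_of_mul_eq_one_left hζ]
  obtain ⟨c, hc, hct⟩ := searchPerm_sound (by norm_num) h t
    (andPrune_of (maskPrune_of_isNormalFor (isNormalFor_cons (by norm_num)
        (by change Nat.testBit 1 (t 0 : Fin 9) = true; rw [ht0]; rfl)
        (isNormalFor_cons (by norm_num)
          (by change Nat.testBit (2 ^ (b : ℕ)) (t 1 : Fin 9) = true
              rw [htb, Nat.testBit_two_pow_self]) (isNormalFor_nil _))))
      (commutePrune_of_commute hz hz' (hP.comm t ht)))
  exact ⟨t, ht, c, hc, hct⟩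

/-- When the nine-cycle and the central involution do not suffice, an element of `P` mapping `1` to
`3` is added; it commutes with the involution, which keeps the search small. -/
theorem isClassified_nine_of_C9_aux {G P : Subgroup (Perm (Fin 9))} (hG : IsGood G)
    (hgens : ∀ c ∈ gensC9, HasCode G c) {ζ : Perm (Fin 9)}
    (hP : IsCentralIn G P 2 (Finset.univ.erase 0) ζ) (hζ : ζ * ζ = 1) {z : ℕ} (hz : IsCode ζ z)
    {words : List (List ℕ)} {certs : List (ℕ × ℕ × List (List ℕ))}
    (h1 : searchPerm 9 (andPrune (maskPrune [(0, 1, []), (1, 8, [])]) (commutePrune z z))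
      (jordanTest 9 [0x21876543, z] words (certs.map Prod.fst)) 9 0 0 0 = true)
    (h2 : certsCheck 9 [0x21876543, z] gensPSL28 certs = true) : IsClassified gensNine G := by
  have hg : ∀ c ∈ [0x21876543, z], HasCode G c :=
    List.forall_mem_cons.2 ⟨hgens _ (by decide), by simpa using ⟨ζ, hP.le hP.mem, hz⟩⟩
  obtain ⟨t, ht, c, hc, hct⟩ := hP.exists_nine hζ hz (b := 3) (by decide) h1
  rcases alternatingGroup_le_or_mem_of_jordanTest hG.primitive (by norm_num) hg
    ⟨t, hP.le ht, hc⟩ hct with h | h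
  · exact Or.inl h
  · exact IsClassified.of_certs hG (by norm_num) hg h2 ⟨t, hP.le ht, hc⟩ h
      fun G' hG' h => isClassified_nine_of_PSL28 hG' h

/-- Of the involutions fixing only `0` that do not lead to the alternating group, three need a
further element of the `2`-group; each of the others generates with the nine-cycle a group
containing a conjugate of `PSL(2,8)`. -/
theorem isClassified_nine_of_C9 {G : Subgroup (Perm (Fin 9))} (hG : IsGood G)
    (hgens : ∀ c ∈ gensC9, HasCode G c) : IsClassified gensNine G := by
  obtain ⟨P, ζ, c, hP, hζ, hc, ht⟩ := exists_isCentralIn_nine hG (test := jordanTest 9 gensC9 wordsC9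
    (0x453786120 :: 0x534867120 :: 0x345678120 :: certsC9PSL28.map Prod.fst)) (by decide +kernel)
  rcases alternatingGroup_le_or_mem_of_jordanTest hG.primitive (by norm_num) hgens
    ⟨ζ, hP.le hP.mem, hc⟩ ht with h | h
  · exact Or.inl h
  simp only [List.mem_cons] at h
  rcases h with rfl | rfl | rfl | h
  · exact isClassified_nine_of_C9_aux hG hgens hP hζ hc (words := wordsC9A)
      (certs := certsC9APSL28) (by decide +kernel) (by decide +kernel)
  · exact isClassified_nine_of_C9_aux hG hgens hP hζ hc (words := wordsC9B)
      (certs := certsC9BPSL28) (by decide +kernel) (by decide +kernel)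
  · exact isClassified_nine_of_C9_aux hG hgens hP hζ hc (words := wordsC9C)
      (certs := certsC9CPSL28) (by decide +kernel) (by decide +kernel)
  · exact IsClassified.of_certs hG (by norm_num) hgens (certs := certsC9PSL28)
      (targets := gensPSL28) (by decide +kernel) ⟨ζ, hP.le hP.mem, hc⟩ h
      fun G' hG' h => isClassified_nine_of_PSL28 hG' h

/-- Restrict a test to permutations of two-power order whose product with that of code `t` has
two-power order. -/
noncomputable def productTest (t : ℕ) (test : ℕ → Bool) (c : ℕ) : Bool :=
  powerTest 9 2 7 (fun c => powerTest 9 2 7 (fun _ => test c) (comp 9 t c)) c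

/-- The elements `τ` and `υ` of the `2`-group `P` map `1` to `3` and to `4`. Not only `υ` but also
`τ * υ` lies in `P`, so both must have two-power order, which removes many candidates. -/
theorem isClassified_nine_of_E18_aux {G P : Subgroup (Perm (Fin 9))} (hG : IsGood G)
    (hgens : ∀ c ∈ gensE18, HasCode G c) {ζ : Perm (Fin 9)}
    (hP : IsCentralIn G P 2 (Finset.univ.erase 0) ζ) (hζ : ζ * ζ = 1)
    (hz : IsCode ζ 0x453786120) {t : ℕ} {τ : Perm (Fin 9)} (hτ : τ ∈ P) (ht : IsCode τ t)
    {words : List (List ℕ)} {certs certs' : List (ℕ × ℕ × List (List ℕ))}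
    (h1 : searchPerm 9 (andPrune (maskPrune [(0, 1, []), (1, 16, [])])
      (commutePrune 0x453786120 0x453786120)) (productTest t (jordanTest 9 (gensE18 ++ [t]) words
        (certs.map Prod.fst ++ certs'.map Prod.fst))) 9 0 0 0 = true)
    (h2 : certsCheck 9 (gensE18 ++ [t]) gensM9 certs = true)
    (h3 : certsCheck 9 (gensE18 ++ [t]) gensAGL19 certs' = true) : IsClassified gensNine G := by
  have hg : ∀ c ∈ gensE18 ++ [t], HasCode G c := by
    intro c hc
    rcases List.mem_append.1 hc with hc | hc
    · exact hgens c hc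
    · rw [List.mem_singleton.1 hc]; exact ⟨τ, hP.le hτ, ht⟩
  obtain ⟨υ, hυ, c, hc, hct⟩ := hP.exists_nine hζ hz (b := 4) (by decide) h1
  -- The exponent comes from the fact that `2 ^ 8` does not divide `9!`.
  have hpow : ∀ g ∈ P, g ^ 2 ^ 7 = 1 := fun g hg =>
    pow_eq_one_of_isPGroup Nat.prime_two hP.isPGroup (by decide) hg
  have hct' := of_powerTest (by norm_num) hc (hpow υ hυ) hct
  have hct'' := of_powerTest (by norm_num) (ht.comp hc) (hpow _ (P.mul_mem hτ hυ)) hct'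
  rcases alternatingGroup_le_or_mem_of_jordanTest hG.primitive (by norm_num) hg
    ⟨υ, hP.le hυ, hc⟩ hct'' with h | h
  · exact Or.inl h
  rcases List.mem_append.1 h with h | h
  · exact IsClassified.of_certs hG (by norm_num) hg h2 ⟨υ, hP.le hυ, hc⟩ h
      fun G' hG' h => isClassified_nine_of_M9 hG' h
  · exact IsClassified.of_certs hG (by norm_num) hg h3 ⟨υ, hP.le hυ, hc⟩ h
      fun G' hG' h => isClassified_nine_of_AGL19 hG' h

/-- Here `ζ` is the map `x ↦ -x`. An element `τ` of `P` mapping `1` to `3` commutes with it; two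
candidates for `τ` need a third element of `P`, the others lead to `AGL(1,9)` or to the alternating
group. -/
theorem isClassified_nine_of_E18 {G P : Subgroup (Perm (Fin 9))} (hG : IsGood G)
    (hgens : ∀ c ∈ gensE18, HasCode G c) {ζ : Perm (Fin 9)}
    (hP : IsCentralIn G P 2 (Finset.univ.erase 0) ζ) (hζ : ζ * ζ = 1)
    (hz : IsCode ζ 0x453786120) : IsClassified gensNine G := by
  obtain ⟨τ, hτ, c, hc, hct⟩ := hP.exists_nine hζ hz (b := 3) (by decide)
    (test := powerTest 9 2 7 (jordanTest 9 gensE18 wordsE18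
      (0x852741630 :: 0x741852630 :: certsE18AGL19.map Prod.fst))) (by decide +kernel)
  replace hct := of_powerTest (by norm_num) hc
    (pow_eq_one_of_isPGroup Nat.prime_two hP.isPGroup (by decide) hτ) hct
  rcases alternatingGroup_le_or_mem_of_jordanTest hG.primitive (by norm_num) hgens
    ⟨τ, hP.le hτ, hc⟩ hct with h | h
  · exact Or.inl h
  simp only [List.mem_cons] at h
  rcases h with rfl | rfl | h
  · exact isClassified_nine_of_E18_aux hG hgens hP hζ hz hτ hc (words := wordsE36A)
      (certs := certsE36AM9) (certs' := []) (by decide +kernel) (by decide +kernel)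
      (by decide +kernel)
  · exact isClassified_nine_of_E18_aux hG hgens hP hζ hz hτ hc (words := wordsE36B)
      (certs := certsE36BM9) (certs' := certsE36BAGL19) (by decide +kernel) (by decide +kernel)
      (by decide +kernel)
  · exact IsClassified.of_certs hG (by norm_num) hgens (certs := certsE18AGL19)
      (targets := gensAGL19) (by decide +kernel) ⟨τ, hP.le hτ, hc⟩ h
      fun G' hG' h => isClassified_nine_of_AGL19 hG' h

/-- Each surviving involution is carried to `x ↦ -x` by a permutation fixing `0` that also yields
the standard generators of `3²:2`. Fixing `0` is essential, because then the `2`-group `P` keeps its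
properties under the conjugation. -/
theorem isClassified_nine_of_E9 {G : Subgroup (Perm (Fin 9))} (hG : IsGood G)
    (hgens : ∀ c ∈ gensE9, HasCode G c) : IsClassified gensNine G := by
  obtain ⟨P, ζ, c, hP, hζ, hc, ht⟩ := exists_isCentralIn_nine hG (test := jordanTest 9 gensE9 wordsE9
    (certsE9E18.map Prod.fst)) (by decide +kernel)
  rcases alternatingGroup_le_or_mem_of_jordanTest hG.primitive (by norm_num) hgens
    ⟨ζ, hP.le hP.mem, hc⟩ ht with h | h
  · exact Or.inl h
  obtain ⟨e, he, rfl⟩ := List.mem_map.1 h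
  have hcheck : certsCheck 9 gensE9 gensE18 certsE9E18 = true := by decide +kernel
  simp only [certsCheck, Bool.and_eq_true, List.all_eq_true] at hcheck
  have hcheck' : ∀ e ∈ certsE9E18, digit e.2.1 0 = 0 ∧ comp 9 e.2.1 0x453786120 = comp 9 e.1 e.2.1 := by
    decide +kernel
  obtain ⟨hv, hconj⟩ := hcheck.2 e he
  obtain ⟨h0, hcomm⟩ := hcheck' e he
  have hσ := isCode_permOf hv
  have hσ0 : permOf 9 e.2.1 0 = 0 := Fin.ext ((hσ 0).symm.trans h0)
  have hξ := isCode_permOf (n := 9) (c := 0x453786120) (by decide +kernel)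
  have hmul : permOf 9 e.2.1 * permOf 9 0x453786120 = ζ * permOf 9 e.2.1 := by
    have h1 := hσ.comp hξ
    rw [hcomm] at h1
    exact h1.unique (hc.comp hσ)
  refine IsClassified.of_conjGroup (σ := permOf 9 e.2.1) (isClassified_nine_of_E18 (hG.conjGroup _)
    (hasCode_conjGroup_of_conjCheck (by norm_num) (gens := e.1 :: gensE9)
      (List.forall_mem_cons.2 ⟨⟨ζ, hP.le hP.mem, hc⟩, hgens⟩) hv hcheck.1 hconj)
    (hP.conjGroup (fun a => ?_) hmul) ?_ hξ)
  · rw [Finset.mem_erase, Finset.mem_erase]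
    simp only [Finset.mem_univ, and_true, ne_eq]
    rw [not_iff_not]
    constructor
    · intro h; exact (permOf 9 e.2.1).injective (h.trans hσ0.symm)
    · rintro rfl; exact hσ0
  · have h2 : permOf 9 0x453786120 = (permOf 9 e.2.1)⁻¹ * ζ * permOf 9 e.2.1 := by
      rw [mul_assoc, ← hmul, inv_mul_cancel_left]
    rw [h2]
    calc _ = (permOf 9 e.2.1)⁻¹ * (ζ * ζ) * permOf 9 e.2.1 := by group
      _ = 1 := by rw [hζ]; group

/-- A transitive Sylow `3`-subgroup has a central element `g` consisting of three three-cycles. An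
element `u` of it mapping `0` to `3` commutes with `g`, and every candidate gives a conjugate of the
nine-cycle `gensC9` or of the elementary abelian group `gensE9`. -/
theorem isClassified_nine {G : Subgroup (Perm (Fin 9))} (hG : IsGood G) :
    IsClassified gensNine G := by
  obtain ⟨P, hP, hPp, htr, ζ, hζ, ho, hs, hcomm⟩ := exists_transitive_pSubgroup_of_card
    Nat.prime_three (m := 1) (by norm_num) hG.primitive
  -- Applied to the cyclic group of `ζ` instead of `G`, this makes the standard element `g` a
  -- conjugate of a power of `ζ`, hence central in the conjugate of `P`.
  obtain ⟨σ, g, hg, hgc⟩ := exists_conj_hasCode (by norm_num) (Subgroup.mem_zpowers ζ)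
    Nat.prime_three ho (s := 9) (by rw [hs]; rfl) (h := 0x687354021) (by decide +kernel)
  refine IsClassified.of_conjGroup (σ := σ) ?_
  obtain ⟨i, hi⟩ := Subgroup.mem_zpowers_iff.1 (mem_conjGroup.1 hg)
  have hC : IsCentralIn G P 3 Finset.univ (σ * g * σ⁻¹) :=
    ⟨hP, hPp, fun _ _ a ha => absurd (Finset.mem_univ a) ha, fun a _ b _ => htr a b,
      hi ▸ P.zpow_mem hζ i, fun y hy => hi ▸ ((show Commute ζ y from hcomm y hy).zpow_left i).eq⟩
  replace hC := hC.conjGroup (σ := σ) (ξ := g) (by simp) (by group)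
  have hG' := hG.conjGroup σ
  generalize conjGroup σ G = K at hC hG'
  generalize conjGroup σ P = Q at hC
  obtain ⟨u, hu, hu0⟩ := hC.transitive 0 (Finset.mem_univ _) 3 (Finset.mem_univ _)
  have hgi : IsCode g⁻¹ 0x768435102 := by
    have h1 := hgc.comp (isCode_permOf (n := 9) (c := 0x768435102) (by decide +kernel))
    rw [show comp 9 _ _ = idCode 9 by decide +kernel] at h1
    rw [inv_eq_of_mul_eq_one_right (h1.unique (IsCode.one (by norm_num)))]
    exact isCode_permOf (by decide +kernel)
  obtain ⟨c, hc, ht⟩ := searchPerm_sound (by norm_num)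
    (prune := andPrune (maskPrune [(0, 8, [])]) (commutePrune 0x687354021 0x768435102))
    (test := powerTest 9 3 4 (jordanTest 9 [0x687354021] []
      (certsNineStartC9.map Prod.fst ++ certsNineStartE9.map Prod.fst))) (by decide +kernel) u
    (andPrune_of (maskPrune_of_isNormalFor (isNormalFor_cons (by norm_num)
        (by change Nat.testBit 8 (u 0 : Fin 9) = true; rw [hu0]; rfl) (isNormalFor_nil _)))
      (commutePrune_of_commute hgc hgi (hC.comm u hu)))
  -- Elements of a `3`-group of degree nine have order dividing `3 ^ 4`, as `3 ^ 5` does not divide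
  -- `9!`.
  replace ht := of_powerTest (by norm_num) hc
    (pow_eq_one_of_isPGroup Nat.prime_three hC.isPGroup (by decide) hu) ht
  have hgens : ∀ c ∈ [0x687354021], HasCode K c := by simpa using ⟨g, hC.le hC.mem, hgc⟩
  rcases alternatingGroup_le_or_mem_of_jordanTest hG'.primitive (by norm_num) hgens
    ⟨u, hC.le hu, hc⟩ ht with h | h
  · exact Or.inl h
  rcases List.mem_append.1 h with h | h
  · exact IsClassified.of_certs hG' (by norm_num) hgens (certs := certsNineStartC9)
      (targets := gensC9) (by decide +kernel) ⟨u, hC.le hu, hc⟩ h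
      fun G' hG' h => isClassified_nine_of_C9 hG' h
  · exact IsClassified.of_certs hG' (by norm_num) hgens (certs := certsNineStartE9)
      (targets := gensE9) (by decide +kernel) ⟨u, hC.le hu, hc⟩ h
      fun G' hG' h => isClassified_nine_of_E9 hG' h

/-! ### Degree ten -/

/-- Codes of generators. -/
def gensPSL29 : List ℕ := [0x9687354021, 0x9582471360, 0x546873129]

/-- Codes of generators. -/
def gensPGL29 : List ℕ := [0x9687354021, 0x9582471360, 0x546873129, 0x9327165840]

/-- Codes of generators. -/
def gensPSiL29 : List ℕ := [0x9687354021, 0x9582471360, 0x546873129, 0x9543876210]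

/-- Codes of generators. -/
def gensM10 : List ℕ := [0x9687354021, 0x9582471360, 0x546873129, 0x9165327840]

/-- Codes of generators. -/
def gensPGaL29 : List ℕ := [0x9687354021, 0x9582471360, 0x546873129, 0x9327165840, 0x9543876210]

/-- Words for finding cycles of prime length. -/
def wordsPSL29 : List (List ℕ) :=
  [[0], [0, 2, 3], [0, 0, 1, 3], [0, 1, 0, 2], [0, 2, 1], [0, 1, 2, 2], [0, 2], [0, 1, 1, 2], [0,
  3, 1, 3], [0, 3, 2, 1, 3, 0], [3, 1, 1, 0, 1, 2]]

/-- Codes of exceptional elements of a search. -/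
def specialsPSL29 : List ℕ :=
  [0x9876543210, 0x9543876210, 0x9327165840, 0x9165327840]

/-- Base points, permitted images and reducing words. -/
def stagesPSL29 : Stages :=
  [(9, 512, [[], [2], [2, 0], [2, 0, 0], [2, 0, 1], [2, 0, 1, 0], [2, 0, 0, 1], [2, 0, 1, 0, 0],
  [2, 0, 0, 1, 0], [2, 0, 0, 1, 0, 0]]), (0, 1, [[], [0], [0, 0], [0, 1], [0, 1, 0], [0, 0, 1], [0,
  1, 0, 0], [0, 0, 1, 0], [0, 0, 1, 0, 0]]), (1, 18, [[], [1], [1, 1], [1, 1, 1]])]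

/-- Some elements as words in the generators. -/
def elementsPSL29 : List (ℕ × List ℕ) :=
  [(0x9687354021, [0]), (0x9582471360, [1]), (0x546873129, [2]), (0x9876543210, [])]

/-- Some elements as words in the generators. -/
def elementsPGL29 : List (ℕ × List ℕ) :=
  [(0x9687354021, [0]), (0x9582471360, [1]), (0x546873129, [2]), (0x9876543210, []), (0x9327165840,
  [3])]

/-- Some elements as words in the generators. -/
def elementsPSiL29 : List (ℕ × List ℕ) :=
  [(0x9687354021, [0]), (0x9582471360, [1]), (0x546873129, [2]), (0x9876543210, []), (0x9543876210,
  [3])]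

/-- Some elements as words in the generators. -/
def elementsM10 : List (ℕ × List ℕ) :=
  [(0x9687354021, [0]), (0x9582471360, [1]), (0x546873129, [2]), (0x9876543210, []), (0x9165327840,
  [3])]

/-- Some elements as words in the generators. -/
def elementsPGaL29 : List (ℕ × List ℕ) :=
  [(0x9687354021, [0]), (0x9582471360, [1]), (0x546873129, [2]), (0x9876543210, []), (0x9327165840,
  [3]), (0x9543876210, [4]), (0x9165327840, [3, 4])]

/-- The list of the generating sets for degree ten. -/
def gensTen : List (List ℕ) :=
  [gensPSL29, gensPGL29, gensPSiL29, gensM10, gensPGaL29]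

/-- Some elements as words in the generators. -/
def elementsPGL29M10 : List (ℕ × List ℕ) :=
  [(0x9687354021, [1]), (0x9582471360, [2]), (0x546873129, [3]), (0x9327165840, [4]),
  (0x9543876210, [4, 0, 2])]

/-- Some elements as words in the generators. -/
def elementsPSiL29M10 : List (ℕ × List ℕ) :=
  [(0x9687354021, [1]), (0x9582471360, [2]), (0x546873129, [3]), (0x9327165840, [0, 4]),
  (0x9543876210, [4])]

/-- Cut a search at permutations moving the point `v`, except for the image of `v` itself. -/
noncomputable def avoidPrune (v i acc : ℕ) : Bool :=
  Nat.rec true (fun j _ => cond (Nat.beq (digit acc j) v) (Nat.beq j v) true) i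

theorem avoidPrune_of {n : ℕ} {x : Perm (Fin n)} {v : Fin n} (hx : x v = v) (i acc : ℕ)
    (hi : i ≤ n) (h : ∀ j : Fin n, (j : ℕ) < i → digit acc j = x j) :
    avoidPrune v i acc = true := by
  cases i with
  | zero => rfl
  | succ i =>
    have h0 : avoidPrune v (i + 1) acc =
      cond (Nat.beq (digit acc i) v) (Nat.beq i v) true := rfl
    have hd := h ⟨i, by omega⟩ (Nat.lt_succ_self i)
    simp only at hd
    rw [h0, hd]
    cases hb : Nat.beq (x ⟨i, by omega⟩) v with
    | false => rfl
    | true =>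
      have h1 : x ⟨i, by omega⟩ = x v := hx.symm ▸ Fin.ext (Nat.eq_of_beq_eq_true hb)
      have h2 : i = v := congrArg Fin.val (x.injective h1)
      simp [h2]

/-- A version of `alternatingGroup_le_or_forall_isNormalFor` for elements fixing a given point. -/
theorem alternatingGroup_le_or_forall_isNormalFor_of_fixed {n : ℕ} {G : Subgroup (Perm (Fin n))}
    (hG : MulAction.IsPreprimitive G (Fin n)) (hn : n < 16) {gens : List ℕ}
    (hgens : ∀ c ∈ gens, HasCode G c) {stages : Stages} {words : List (List ℕ)}
    {specials : List ℕ} (v : Fin n) (hv : ∃ s ∈ stages, s.1 = v ∧ s.2.1 = 2 ^ (v : ℕ))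
    (h : searchPerm n (andPrune (avoidPrune v) (maskPrune stages))
      (jordanTest n gens words specials) n 0 0 0 = true) :
    alternatingGroup (Fin n) ≤ G ∨
      ∀ x ∈ G, IsNormalFor stages x → ∃ c ∈ specials, IsCode x c := by
  by_cases ha : alternatingGroup (Fin n) ≤ G
  · exact Or.inl ha
  · refine Or.inr fun x hx hxn => ?_
    obtain ⟨s, hs, h1, h2⟩ := hv
    have hxv : x v = v := by
      have := hxn s hs v h1.symm
      rw [h2, Nat.testBit_two_pow] at this
      exact (Fin.ext (of_decide_eq_true this)).symm
    obtain ⟨c, hc, ht⟩ := searchPerm_sound (by omega) h x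
      (andPrune_of (avoidPrune_of hxv) (maskPrune_of_isNormalFor hxn))
    rcases alternatingGroup_le_or_mem_of_jordanTest hG hn hgens ⟨x, hx, hc⟩ ht with h | h
    · exact absurd h ha
    · exact ⟨c, h, hc⟩

/-- The base point `9` is the last position to receive a value, so its mask alone would prune only
at the end. That no other point may be mapped to `9` cuts branches early. -/
theorem search_PSL29 : searchPerm 10 (andPrune (avoidPrune (9 : Fin 10)) (maskPrune stagesPSL29))
    (jordanTest 10 gensPSL29 wordsPSL29 specialsPSL29) 10 0 0 0 = true := by decide +kernel

/-- `PSL(2,9)` has index four in `PΓL(2,9)`, with a Klein four-group as quotient. The survivors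
represent its elements: the identity, `4 x` with `4` a nonsquare, `x ^ 3`, and `4 x ^ 3`. The five
subgroups of the quotient give the five groups of the list. -/
theorem isClassified_ten_of_PSL29 {G : Subgroup (Perm (Fin 10))} (hG : IsGood G)
    (hgens : ∀ c ∈ gensPSL29, HasCode G c) : IsClassified gensTen G := by
  rcases alternatingGroup_le_or_forall_isNormalFor_of_fixed hG.primitive (by norm_num) hgens 9
    (by decide) search_PSL29 with h | h
  · exact Or.inl h
  have hall : ∀ {gens : List ℕ} {M : List (ℕ × List ℕ)}, (∀ c ∈ gens, HasCode G c) →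
      wordsCheck 10 gens M = true → (∀ c ∈ gensPGaL29, c ∈ M.map Prod.fst) →
      IsClassified gensTen G := by
    intro gens M hgens hM hsub
    have hg := hasCode_of_words (by norm_num) hgens hM hsub
    exact IsClassified.of_normal (by norm_num) gensPSL29 (gens' := gensPGaL29) (by decide)
      hg (M := elementsPGaL29) (by decide +kernel) (by decide) (by decide +kernel) h
      (bad := []) (by decide) (by simp)
  by_cases ho : HasCode G 0x9327165840
  · have hg : ∀ c ∈ gensPGL29, HasCode G c := hasCode_of_subset hgens ho (by decide)
    by_cases hf : HasCode G 0x9543876210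
    · exact hall (gens := 0x9543876210 :: gensPGL29) (List.forall_mem_cons.2 ⟨hf, hg⟩)
        (M := [(0x9687354021, [1]), (0x9582471360, [2]), (0x546873129, [3]), (0x9327165840, [4]), (0x9543876210, [0])])
        (by decide +kernel) (by decide)
    by_cases hof : HasCode G 0x9165327840
    · exact hall (gens := 0x9165327840 :: gensPGL29) (List.forall_mem_cons.2 ⟨hof, hg⟩)
        (M := elementsPGL29M10) (by decide +kernel) (by decide)
    exact IsClassified.of_normal (by norm_num) gensPSL29 (gens' := gensPGL29) (by decide)
      hg (M := elementsPGL29) (by decide +kernel) (by decide) (by decide +kernel) h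
      (bad := [0x9543876210, 0x9165327840]) (by decide) (by simp [hf, hof])
  by_cases hf : HasCode G 0x9543876210
  · have hg : ∀ c ∈ gensPSiL29, HasCode G c := hasCode_of_subset hgens hf (by decide)
    by_cases hof : HasCode G 0x9165327840
    · exact hall (gens := 0x9165327840 :: gensPSiL29) (List.forall_mem_cons.2 ⟨hof, hg⟩)
        (M := elementsPSiL29M10) (by decide +kernel) (by decide)
    exact IsClassified.of_normal (by norm_num) gensPSL29 (gens' := gensPSiL29) (by decide)
      hg (M := elementsPSiL29) (by decide +kernel) (by decide) (by decide +kernel) h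
      (bad := [0x9327165840, 0x9165327840]) (by decide) (by simp [ho, hof])
  by_cases hof : HasCode G 0x9165327840
  · have hg : ∀ c ∈ gensM10, HasCode G c := hasCode_of_subset hgens hof (by decide)
    exact IsClassified.of_normal (by norm_num) gensPSL29 (gens' := gensM10) (by decide)
      hg (M := elementsM10) (by decide +kernel) (by decide) (by decide +kernel) h
      (bad := [0x9327165840, 0x9543876210]) (by decide) (by simp [ho, hf])
  · exact IsClassified.of_normal (by norm_num) gensPSL29 (by decide) hgens (M := elementsPSL29)
      (by decide +kernel) (by decide) (by decide +kernel) h (bad := [0x9327165840, 0x9543876210, 0x9165327840]) (by decide)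
      (by simp [ho, hf, hof])

/-! ### Degree ten, reaching `PSL(2,9)`. -/

/-- Words for finding cycles of prime length. -/
def wordsTenStart : List (List ℕ) :=
  [[0, 1], [0, 0, 1], [0, 0, 1, 0, 1], [0, 0, 1, 1, 0, 1], [0, 1, 0, 1, 1, 1], [0, 1, 0, 1, 1], [0,
  0, 1, 1], [0, 0, 1, 0, 1, 1], [0, 1, 1], [0, 1, 0, 1, 1, 0, 0, 1, 0, 0, 1, 1], [0, 1, 1, 0, 0, 1,
  0]]

/-- Words for finding cycles of prime length. -/
def wordsTenCommuting : List (List ℕ) :=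
  [[1, 1, 1, 0, 1, 0], [1, 1, 1, 0, 0], [1, 0, 2, 0]]

/-- Codes of exceptional elements of a search. -/
def specialsTenStart : List ℕ :=
  [0x8263157940, 0x2731968540, 0x8315279640, 0x3162985740, 0x1725396840, 0x2937416850,
  0x6314792850, 0x7142896350, 0x5384217960, 0x3148752960, 0x1429857360, 0x3942618570, 0x4259168370,
  0x1498362570, 0x5427319680, 0x4593172680, 0x2651479380, 0x4283615790, 0x6531482790, 0x7614285390]

/-- Certificates for conjugate subgroups. -/
def certsTenStart : List (ℕ × ℕ × List (List ℕ)) :=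
  [(0x7369184520, 0x5196382407, [[1, 0, 0, 1, 1, 0, 1, 0], [1, 1, 1, 0, 1, 1, 1, 1], [1, 0, 0, 1,
  0, 1, 1, 1, 0, 0, 1, 0]]), (0x3751894620, 0x2980731546, [[0, 1, 0, 0, 1, 0, 1], [1, 1, 0, 1, 0,
  0, 1, 1, 1, 0], [1, 0, 1, 1, 0, 0, 1, 1, 0]]), (0x8619354720, 0x1702948563, [[1, 1, 0, 0, 1, 1,
  1, 0, 0], [0, 0, 1], [1, 0, 0, 1, 0, 1, 1, 1, 0, 0, 1, 0]]), (0x7153964820, 0x4126805397, [[0, 1,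
  0, 0, 1, 1, 0], [0, 1, 0, 0, 1, 1, 1, 0, 1, 0], [0, 1, 1, 0, 1, 1, 1, 0]]), (0x1635874920,
  0x1036742598, [[0, 1, 1, 1, 1, 0, 1, 1, 0, 0], [0, 1, 0, 1, 1, 1, 0, 0, 1, 0], [1, 1, 1, 0, 1, 1,
  0, 0]]), (0x2687195430, 0x4126805397, [[1, 1, 1, 0, 0, 1, 0, 0], [1, 1, 1, 0, 1, 0, 0, 1, 1, 1],
  [0, 1, 1, 0, 1, 0, 0, 1, 0]]), (0x7981256430, 0x1036742598, [[1, 0, 1, 1, 1, 1], [1, 1, 1, 0, 0,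
  1, 0, 1, 1, 1], [1, 0, 0, 1, 1, 1, 0, 1, 0]]), (0x5912867430, 0x5196382407, [[1, 0, 1, 1, 1, 0,
  1, 0], [1, 1, 0, 1, 0, 1, 1, 1], [1, 0, 1, 0, 0, 1, 1, 0, 1, 0]]), (0x5129678430, 0x2980731546,
  [[0, 1, 0, 0, 1, 0, 1], [1, 1, 0, 0, 1, 0], [1, 1, 0, 1, 1, 1, 0, 1]]), (0x1257689430,
  0x1702948563, [[0, 1, 1, 0, 0, 1, 0, 0], [1, 1, 0, 1, 0, 1, 0, 1, 1, 1], [1, 0, 1, 0, 0, 1, 1, 0,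
  1, 0]]), (0x6497238150, 0x5196382407, [[1, 0, 1, 0, 1, 1, 1, 1], [1, 1, 1, 1, 0, 1, 0, 1, 0], [0,
  1, 1, 1, 0, 0, 1, 0, 1, 1, 0]]), (0x4768321950, 0x4126805397, [[1, 1, 1, 0, 1, 0], [0, 1, 1, 0,
  1, 1, 1, 1, 0, 0], [1, 1, 1, 1, 0, 1, 0, 1, 1]]), (0x4582739160, 0x2980731546, [[0, 0, 1, 0, 1,
  0, 0, 1], [0, 1, 1, 1, 0, 0, 1, 0, 1], [0, 1, 0, 0, 1, 1, 0, 1, 1]]), (0x8793421560,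
  0x1036742598, [[1, 1, 0, 1, 0, 1, 0], [1, 1, 1, 1, 0, 0, 1, 0, 1, 0], [1, 0, 1, 1, 1, 0, 0, 1, 0,
  0]]), (0x6928435170, 0x1702948563, [[1, 1, 0, 1, 1, 1, 0], [0, 1], [0, 1, 1, 1, 0, 0, 1, 0, 1, 1,
  0]]), (0x8534921670, 0x5196382407, [[1, 1, 0, 1, 0, 0, 1, 0], [1, 0, 0, 1, 0, 1, 1, 0, 1], [0, 1,
  0, 0, 1, 0, 1, 1, 0, 1, 0]]), (0x5294736180, 0x4126805397, [[0, 0, 1, 0, 1, 1, 0, 0], [0, 1, 0,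
  1, 0, 0, 1, 1, 0, 1], [0, 1, 1, 0, 1, 1, 1, 0]]), (0x6345921780, 0x2980731546, [[0, 1, 1, 1, 0,
  0, 1, 0], [1, 1, 0, 1, 0, 0], [0, 1, 1, 1, 0, 1, 0, 0, 1]]), (0x2548637190, 0x1036742598, [[1, 0,
  1, 0, 1, 1, 1, 0], [1, 0, 1, 1, 0, 0, 1, 0, 1, 0], [1, 1, 1, 0, 0, 1, 1, 0]]), (0x3465721890,
  0x1702948563, [[0, 0, 1, 1, 0, 1, 0], [1, 1, 0, 1, 0, 1, 1, 0, 1], [0, 1, 0, 0, 1, 0, 1, 1, 0, 1,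
  0]])]

/-- The first element is a product of two five-cycles. The degree is even, so `G` is transitive on
ordered pairs, and the stabilizer of `0` has a `3`-subgroup transitive on the other nine points,
with a central element `ζ` of order three fixing only `0`. -/
theorem isClassified_ten {G : Subgroup (Perm (Fin 10))} (hG : IsGood G) :
    IsClassified gensTen G := by
  have hd := hG.twoHomogeneous.choose_dvd_card (by norm_num)
  have hd' := dvd_card_of_isPreprimitive hG.primitive (by norm_num)
  rcases exists_conj_hasCode_of_prime (h := 0x5987604321) (p := 5) (s := 10) (by norm_num) hG.primitive
    (by norm_num) (by norm_num) (dvd_trans (by norm_num) hd') (by omega) (by decide +kernel)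
    with h | ⟨σ, hσ⟩
  · exact Or.inl h
  refine IsClassified.of_conjGroup (σ := σ) ?_
  have hG' := hG.conjGroup σ
  generalize conjGroup σ G = K at hσ hG'
  have hg : ∀ c ∈ [0x5987604321], HasCode K c := by simpa using hσ
  obtain ⟨P, hP, hPp, hfix, htr, ζ, hζ, ho, hs, hcomm⟩ :=
    (hG'.twoHomogeneous.twoTransitive (dvd_trans (by norm_num)
      (dvd_card_of_isPreprimitive hG'.primitive (by norm_num)))).exists_pSubgroup (p := 3) (m := 1)
      Nat.prime_three (by norm_num) 0
  have hζ3 : ζ ^ 3 = 1 := by rw [← ho, pow_orderOf_eq_one]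
  have hiff : ∀ j : Fin 10, ζ j = j ↔ Nat.testBit 1 j = true := by
    intro j
    rw [Nat.testBit_one_eq_true_iff_self_eq_zero, ← not_iff_not, ← ne_eq, ← Perm.mem_support, hs,
      Finset.mem_erase, Ne, Fin.ext_iff]
    simp
  obtain ⟨c, hc, ht⟩ := searchThreeCycles_sound_of_fixed (by norm_num) hζ3 (mask := 1)
    (Or.inr rfl) hiff (test := jordanTest 10 [0x5987604321] wordsTenStart
      (specialsTenStart ++ certsTenStart.map Prod.fst)) (by decide +kernel)
  have hend : ∀ {c}, HasCode K c → c ∈ certsTenStart.map Prod.fst → IsClassified gensTen K :=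
    fun hc h => IsClassified.of_certs hG' (by norm_num) hg (certs := certsTenStart)
      (targets := gensPSL29) (by decide +kernel) hc h fun G' hG' h => isClassified_ten_of_PSL29 hG' h
  rcases alternatingGroup_le_or_mem_of_jordanTest hG'.primitive (by norm_num) hg
    ⟨ζ, hP hζ, hc⟩ ht with h | h
  · exact Or.inl h
  rcases List.mem_append.1 h with h | h
  -- For these `ζ` an element of the `3`-group mapping `1` to `2` is used in addition; it commutes
  -- with `ζ` and has order dividing `3 ^ 4`. Powers of `ζ` being central, `comp 10 c c` is the code
  -- of `ζ⁻¹ = ζ ^ 2`.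
  · obtain ⟨u, hu, hu1⟩ := htr 1 2 (by decide) (by decide)
    have hcheck : ∀ c ∈ specialsTenStart,
        searchPerm 10 (andPrune (maskPrune [(0, 1, []), (1, 4, [])]) (commutePrune c (comp 10 c c)))
          (powerTest 10 3 4 (jordanTest 10 [0x5987604321, c] wordsTenCommuting
            (certsTenStart.map Prod.fst))) 10 0 0 0 = true := by decide +kernel
    have hinv : IsCode ζ⁻¹ (comp 10 c c) := by
      rw [inv_eq_of_mul_eq_one_left (show ζ * ζ * ζ = 1 by rw [← pow_two, ← pow_succ, hζ3])]
      exact hc.comp hc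
    obtain ⟨d, hd, hdt⟩ := searchPerm_sound (by norm_num) (hcheck c h) u
      (andPrune_of (maskPrune_of_isNormalFor (isNormalFor_cons (by norm_num)
        (by change Nat.testBit 1 (u 0 : Fin 10) = true; rw [hfix u hu]; rfl)
        (isNormalFor_cons (by norm_num)
          (by change Nat.testBit 4 (u 1 : Fin 10) = true; rw [hu1]; rfl) (isNormalFor_nil _))))
      (commutePrune_of_commute hc hinv (hcomm u hu)))
    replace hdt := of_powerTest (by norm_num) hd
      (pow_eq_one_of_isPGroup Nat.prime_three hPp (by decide) hu) hdt
    rcases alternatingGroup_le_or_mem_of_jordanTest hG'.primitive (by norm_num)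
      (gens := [0x5987604321, c]) (by
        intro e he
        rcases List.mem_cons.1 he with rfl | he
        · exact hσ
        · rw [List.mem_singleton.1 he]; exact ⟨ζ, hP hζ, hc⟩)
      ⟨u, hP hu, hd⟩ hdt with h | h
    · exact Or.inl h
    · exact hend ⟨u, hP hu, hd⟩ h
  · exact hend ⟨ζ, hP hζ, hc⟩ h

/-! ### Verifying the strong universal transversal property -/

/-- Evaluate `f` at the members of `l` before handing the list of values to `cont`. -/
noncomputable def forceList (f : ℕ → ℕ) (l : List ℕ) : (List ℕ → Bool) → Bool :=
  List.rec (fun cont => cont [])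
    (fun a _ r cont => force (f a) fun v => r fun l => cont (v :: l)) l

/-- The largest of the first `k` digits. -/
noncomputable def maxDigit (k s : ℕ) : ℕ :=
  Nat.rec 0 (fun j r => force r fun r' => force (digit s j) fun d => cond (Nat.ble d r') r' d) k

/-- Hand the members of `L` with largest digit `i` to `cont`. -/
noncomputable def bucket (k i : ℕ) (L : List ℕ) : (List ℕ → Bool) → Bool :=
  List.rec (fun cont => cont [])
    (fun s _ r cont => cond (Nat.beq (maxDigit k s) i) (r fun l => cont (s :: l)) (r cont)) L

/-- Hand to `cont` the lists of the members of `L` with largest digits `i, …, i + m - 1`. -/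
noncomputable def buckets (k : ℕ) (L : List ℕ) (m : ℕ) : ℕ → (List (List ℕ) → Bool) → Bool :=
  Nat.rec (fun _ cont => cont [])
    (fun _ r i cont => bucket k i L fun B => r (Nat.succ i) fun Bs => cont (B :: Bs)) m

/-- The set of the colours of the first `k` digits of `s`, if `p` has the colours of the points. -/
noncomputable def colourMask (k p s : ℕ) : ℕ :=
  Nat.rec 0 (fun j r => Nat.lor r (Nat.shiftLeft 1 (digit p (digit s j)))) k

/-- The first `k` digits of `s` have the `k` colours `1, …, k`, and digits `0` and `k` have the same
colour. -/
noncomputable def isSectionCode (k p s : ℕ) : Bool :=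
  cond (Nat.beq (digit p (digit s 0)) (digit p (digit s k)))
    (Nat.beq (colourMask k p s) (Nat.sub (Nat.pow 2 (Nat.succ k)) 2)) false

/-- Search through the colourings of points, up to the names of the colours: `i` points have been
coloured with `m` colours, `p` is the colouring, and branches are cut where `isSectionCode` holds
for some member of the list belonging to the last coloured point. -/
noncomputable def paint (k : ℕ) (Bs : List (List ℕ)) : ℕ → ℕ → ℕ → Bool :=
  List.rec (fun _ _ m => Nat.ble (Nat.succ m) k)
    (fun B _ r i p m => force (Nat.pow 16 i) fun w => force (Nat.succ i) fun i' =>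
      cond (allBelow m fun v => force (Nat.add p (Nat.mul (Nat.succ v) w)) fun p' =>
          cond (B.any fun s => isSectionCode k p' s) true (r i' p' m))
        (cond (Nat.ble (Nat.succ m) k) (force (Nat.succ m) fun m' =>
          force (Nat.add p (Nat.mul m' w)) fun p' =>
            cond (B.any fun s => isSectionCode k p' s) true (r i' p' m')) true) false) Bs

/-- For every tuple of `k + 1` points in normal form and every colouring of the points with `k`
colours such that the first `t` points have the same colour, some member of `elements` maps the
tuple to a section. -/
noncomputable def sectionCheck (n k t : ℕ) (stages : Stages) (elements : List ℕ) : Bool :=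
  searchPerm n (maskPrune stages)
    (fun a => forceList (fun e => comp (Nat.succ k) e a) elements fun L =>
      buckets (Nat.succ k) L (n - t) t fun Bs => paint k Bs t (ofDigits16 (fun _ => 1) t) 1)
    (k + 1) 0 0 0

section

theorem forceList_eq (f : ℕ → ℕ) (l : List ℕ) (cont : List ℕ → Bool) :
    forceList f l cont = cont (l.map f) := by
  induction l generalizing cont with
  | nil => rfl
  | cons a l ih =>
    have : forceList f (a :: l) cont =
      force (f a) fun v => forceList f l fun l => cont (v :: l) := rfl
    rw [this, force_eq, ih]; rfl

/-- Sorting by the largest digit only speeds up the search: the soundness argument uses no more than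
that the members of a bucket come from `L`. -/
theorem exists_of_bucket {k i : ℕ} {L : List ℕ} {cont : List ℕ → Bool}
    (h : bucket k i L cont = true) : ∃ B, (∀ s ∈ B, s ∈ L) ∧ cont B = true := by
  induction L generalizing cont with
  | nil => exact ⟨[], by simp, h⟩
  | cons a L ih =>
    have h0 : bucket k i (a :: L) cont = cond (Nat.beq (maxDigit k a) i)
      (bucket k i L fun l => cont (a :: l)) (bucket k i L cont) := rfl
    rw [h0] at h
    cases hb : Nat.beq (maxDigit k a) i with
    | true =>
      rw [hb, cond_true] at h
      obtain ⟨B, hB, hc⟩ := ih h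
      exact ⟨a :: B, by simpa using fun s hs => Or.inr (hB s hs), hc⟩
    | false =>
      rw [hb, cond_false] at h
      obtain ⟨B, hB, hc⟩ := ih h
      exact ⟨B, fun s hs => List.mem_cons_of_mem _ (hB s hs), hc⟩

theorem exists_of_buckets {k m i : ℕ} {L : List ℕ} {cont : List (List ℕ) → Bool}
    (h : buckets k L m i cont = true) :
    ∃ Bs, Bs.length = m ∧ (∀ B ∈ Bs, ∀ s ∈ B, s ∈ L) ∧ cont Bs = true := by
  induction m generalizing i cont with
  | zero => exact ⟨[], rfl, by simp, h⟩
  | succ m ih =>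
    have h0 : buckets k L (m + 1) i cont =
      bucket k i L fun B => buckets k L m (i + 1) fun Bs => cont (B :: Bs) := rfl
    rw [h0] at h
    obtain ⟨B, hB, h⟩ := exists_of_bucket h
    obtain ⟨Bs, hl, hBs, h⟩ := ih h
    exact ⟨B :: Bs, by simp [hl], by
      intro B' hB'
      rcases List.mem_cons.1 hB' with rfl | hB'
      · exact hB
      · exact hBs B' hB', h⟩

theorem testBit_colourMask {k p s v : ℕ} (h : Nat.testBit (colourMask k p s) v = true) :
    ∃ j < k, digit p (digit s j) = v := by
  induction k with
  | zero => simp [colourMask] at h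
  | succ k ih =>
    have h0 : colourMask (k + 1) p s = colourMask k p s ||| (1 <<< digit p (digit s k)) := rfl
    rw [h0, Nat.testBit_or, Bool.or_eq_true, Nat.one_shiftLeft, Nat.testBit_two_pow] at h
    rcases h with h | h
    · obtain ⟨j, hj, hv⟩ := ih h
      exact ⟨j, by omega, hv⟩
    · exact ⟨k, by omega, by simpa using h⟩

variable {n k : ℕ}

/-- The digits of `s` form a section for `P` whose digits `0` and `k` are in the same part. -/
def IsGoodTuple (P : Fin n → Fin k) (s : ℕ) : Prop :=
  ∃ x : Fin (k + 1) → Fin n, (∀ j : Fin (k + 1), digit s j = x j) ∧ P (x 0) = P (x (Fin.last k)) ∧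
    Function.Injective fun j : Fin k => P (x j.castSucc)

/-- The first `i` digits of `p` are a colouring with the colours `1, …, m` whose colour classes
are those of `P`. -/
structure IsColouring (P : Fin n → Fin k) (i p m : ℕ) : Prop where
  lt : p < 16 ^ i
  iff : ∀ x y : Fin n, (x : ℕ) < i → (y : ℕ) < i → (digit p x = digit p y ↔ P x = P y)
  pos : ∀ x : Fin n, (x : ℕ) < i → 0 < digit p x
  le : ∀ x : Fin n, (x : ℕ) < i → digit p x ≤ m
  exists_eq : ∀ v, 0 < v → v ≤ m → ∃ x : Fin n, (x : ℕ) < i ∧ digit p x = v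

/-- All `k` colours occur among the first `k` entries, so these have different nonzero colours, and
the last entry shares the colour of the first. Uncoloured points have digit zero; hence every entry
is already coloured, and completing the colouring cannot spoil the section. -/
theorem IsColouring.isGoodTuple {P : Fin n → Fin k} {i p m : ℕ} (h : IsColouring P i p m)
    (hk : 0 < k) (hi : i ≤ n) {s : ℕ} (hs : isSectionCode k p s = true) : IsGoodTuple P s := by
  rw [isSectionCode, Bool.cond_false_right, Bool.and_eq_true] at hs
  have h0 := Nat.eq_of_beq_eq_true hs.1
  have hm : colourMask k p s = 2 ^ (k + 1) - 2 := Nat.eq_of_beq_eq_true hs.2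
  have hz : ∀ d, i ≤ d → digit p d = 0 := by
    intro d hd
    rw [digit_eq, Nat.div_eq_of_lt (lt_of_lt_of_le h.lt (Nat.pow_le_pow_right (by norm_num) hd))]
  have hsurj : ∀ v : Fin k, ∃ j : Fin k, digit p (digit s j) = v + 1 := by
    intro v
    have hb : Nat.testBit (colourMask k p s) (v + 1) = true := by
      rw [hm, show 2 ^ (k + 1) - 2 = (2 ^ k - 1) * 2 by rw [pow_succ]; omega,
        Nat.testBit_succ, Nat.mul_div_cancel _ (by norm_num), Nat.testBit_two_pow_sub_one]
      exact decide_eq_true v.2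
    obtain ⟨j, hj, hv⟩ := testBit_colourMask hb
    exact ⟨⟨j, hj⟩, hv⟩
  choose f hf using hsurj
  have hfinj : Function.Injective f := fun v w hvw => by
    have := (hf v).symm.trans ((congrArg (fun j : Fin k => digit p (digit s j)) hvw).trans (hf w))
    exact Fin.ext (by omega)
  have hfsurj := Finite.injective_iff_surjective.1 hfinj
  have hpos : ∀ j : Fin k, 0 < digit p (digit s j) := by
    intro j
    obtain ⟨v, rfl⟩ := hfsurj j
    rw [hf]; omega
  have hlt : ∀ j : Fin (k + 1), digit s j < i := by
    intro j
    by_contra hj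
    have hj0 := hz _ (not_lt.1 hj)
    refine Fin.lastCases (fun hj0 => ?_) (fun j hj0 => ?_) j hj0
    · have := hpos ⟨0, hk⟩
      simp only [Fin.val_last] at hj0
      rw [h0, hj0] at this
      exact absurd this (lt_irrefl _)
    · have := hpos j
      simp only [Fin.val_castSucc] at hj0
      omega
  refine ⟨fun j => ⟨digit s j, (hlt j).trans_le hi⟩, fun j => rfl, ?_, fun j j' hjj => ?_⟩
  · exact (h.iff _ _ (hlt 0) (hlt _)).1 h0
  · have := (h.iff _ _ (hlt j.castSucc) (hlt j'.castSucc)).2 hjj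
    simp only [Fin.val_castSucc] at this
    obtain ⟨v, rfl⟩ := hfsurj j
    obtain ⟨w, rfl⟩ := hfsurj j'
    rw [hf, hf] at this
    rw [Fin.ext (show (v : ℕ) = w by omega)]

/-- Follow the branch belonging to `P`: the next point gets the colour of an earlier point in the
same part or, if there is none, the next new colour. As colours are introduced in order, each
partition is met under only one naming of its parts. -/
theorem IsColouring.paint_sound {P : Fin n → Fin k} (hP : Function.Surjective P)
    {Bs : List (List ℕ)} {i p m : ℕ} (hm : m ≤ k) (hk : k < 16) (hi : i + Bs.length = n)
    (h : IsColouring P i p m) (hpaint : paint k Bs i p m = true) :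
    ∃ B ∈ Bs, ∃ s ∈ B, IsGoodTuple P s := by
  induction Bs generalizing i p m with
  | nil =>
    -- A leaf succeeds only if fewer than `k` colours are used, whereas `P` has `k` nonempty parts.
    exfalso
    have hmk : m < k := Nat.le_of_ble_eq_true hpaint
    have hi' : i = n := by simpa using hi
    choose f hf using hP
    have hmaps : ∀ c ∈ (Finset.univ : Finset (Fin k)), digit p (f c) ∈ Finset.Icc 1 m :=
      fun c _ => Finset.mem_Icc.2 ⟨h.pos _ (hi' ▸ (f c).2), h.le _ (hi' ▸ (f c).2)⟩
    obtain ⟨c, -, d, -, hne, hcd⟩ := Finset.exists_ne_map_eq_of_card_lt_of_maps_to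
      (by rw [Finset.card_univ, Fintype.card_fin, Nat.card_Icc]; omega) hmaps
    have := (h.iff _ _ (hi' ▸ (f c).2) (hi' ▸ (f d).2)).1 hcd
    rw [hf, hf] at this
    exact hne this
  | cons B Bs ih =>
    have h0 : paint k (B :: Bs) i p m =
      force (Nat.pow 16 i) fun w => force (Nat.succ i) fun i' =>
      cond (allBelow m fun v => force (Nat.add p (Nat.mul (Nat.succ v) w)) fun p' =>
          cond (B.any fun s => isSectionCode k p' s) true (paint k Bs i' p' m))
        (cond (Nat.ble (Nat.succ m) k) (force (Nat.succ m) fun m' =>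
          force (Nat.add p (Nat.mul m' w)) fun p' =>
            cond (B.any fun s => isSectionCode k p' s) true (paint k Bs i' p' m')) true) false := rfl
    rw [h0, force_eq, force_eq, Bool.cond_false_right, Bool.and_eq_true, allBelow_iff] at hpaint
    obtain ⟨hold, hnew⟩ := hpaint
    rw [List.length_cons] at hi
    have hin : i < n := by omega
    have hk0 : 0 < k := (Nat.zero_le _).trans_lt (P ⟨i, hin⟩).2
    have hdig : ∀ v < 16, ∀ x : Fin n, (x : ℕ) < i + 1 →
        digit (p + v * 16 ^ i) x = if (x : ℕ) = i then v else digit p x := by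
      intro v hv x hx
      rw [digit_add_mul h.lt hv]
    have hlt : ∀ v < 16, p + v * 16 ^ i < 16 ^ (i + 1) := by
      intro v hv
      have := h.lt
      rw [pow_succ]
      nlinarith [Nat.mul_le_mul_right (16 ^ i) (show v ≤ 15 by omega)]
    have step : ∀ v m', m' ≤ k → v < 16 → IsColouring P (i + 1) (p + v * 16 ^ i) m' →
        (cond (B.any fun s => isSectionCode k (p + v * 16 ^ i) s) true
          (paint k Bs (i + 1) (p + v * 16 ^ i) m')) = true →
        ∃ B' ∈ B :: Bs, ∃ s ∈ B', IsGoodTuple P s := by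
      intro v m' hm' hv hc hcond
      rw [Bool.cond_true_left, Bool.or_eq_true, List.any_eq_true] at hcond
      rcases hcond with ⟨s, hs, hsec⟩ | hcond
      · exact ⟨B, List.mem_cons_self .., s, hs, hc.isGoodTuple hk0 (by omega) hsec⟩
      · obtain ⟨B', hB', s, hs, hg⟩ := ih hm' (by omega) hc hcond
        exact ⟨B', List.mem_cons_of_mem _ hB', s, hs, hg⟩
    by_cases hex : ∃ y : Fin n, (y : ℕ) < i ∧ P y = P ⟨i, hin⟩
    · obtain ⟨y, hy, hPy⟩ := hex
      have hyp := h.pos y hy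
      have hyle := h.le y hy
      have h1 := hold (digit p y - 1) (by omega)
      rw [force_eq, show Nat.succ (digit p y - 1) = digit p y by omega] at h1
      have hlt16 : digit p y < 16 := digit_lt _ _
      refine step (digit p y) m hm hlt16 ⟨hlt _ hlt16, ?_, ?_, ?_, ?_⟩ h1
      · have aux : ∀ x : Fin n, (x : ℕ) < i + 1 →
            ∃ x' : Fin n, (x' : ℕ) < i ∧ digit (p + digit p y * 16 ^ i) x = digit p x' ∧
              P x = P x' := by
          intro x hx
          rw [hdig _ hlt16 x hx]
          by_cases hxi : (x : ℕ) = i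
          · exact ⟨y, hy, by simp [hxi], by rw [hPy]; congr 1; exact Fin.ext hxi⟩
          · exact ⟨x, by omega, by simp [hxi], rfl⟩
        intro x z hx hz
        obtain ⟨x', hx', e1, e2⟩ := aux x hx
        obtain ⟨z', hz', e3, e4⟩ := aux z hz
        rw [e1, e2, e3, e4, h.iff _ _ hx' hz']
      · intro x hx
        rw [hdig _ hlt16 x hx]
        split_ifs with hxi
        · exact hyp
        · exact h.pos x (by omega)
      · intro x hx
        rw [hdig _ hlt16 x hx]
        split_ifs with hxi
        · exact hyle
        · exact h.le x (by omega)
      · intro v hv hvm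
        obtain ⟨x, hx, hxv⟩ := h.exists_eq v hv hvm
        exact ⟨x, by omega, by rw [hdig _ hlt16 x (by omega), if_neg (by omega), hxv]⟩
    · push Not at hex
      -- If all `k` colours were in use, every part would already contain a coloured point,
      -- including the part of the new point.
      have hmk : m < k := by
        by_contra hmk
        have hall : ∀ v : Fin m, ∃ x : Fin n, (x : ℕ) < i ∧ digit p x = v + 1 :=
          fun v => h.exists_eq _ (by omega) (by omega)
        choose f hf1 hf2 using hall
        have hinj : Function.Injective fun v => P (f v) := by
          intro v w hvw
          have := (h.iff _ _ (hf1 v) (hf1 w)).2 hvw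
          rw [hf2, hf2] at this
          exact Fin.ext (by omega)
        have hbij : Function.Bijective fun v => P (f v) :=
          (Fintype.bijective_iff_injective_and_card _).2 ⟨hinj, by simp; omega⟩
        obtain ⟨v, hv⟩ := hbij.2 (P ⟨i, hin⟩)
        exact hex _ (hf1 v) hv
      have hmb : Nat.ble (Nat.succ m) k = true := Nat.ble_eq_true_of_le hmk
      rw [hmb, cond_true, force_eq, force_eq] at hnew
      refine step (m + 1) (m + 1) hmk (by omega) ⟨hlt _ (by omega), ?_, ?_, ?_, ?_⟩ hnew
      · intro x z hx hz
        rw [hdig _ (by omega) x hx, hdig _ (by omega) z hz]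
        by_cases hxi : (x : ℕ) = i <;> by_cases hzi : (z : ℕ) = i
        · simp [hzi, Fin.ext (hxi.trans hzi.symm)]
        · have h1 := h.le z (by omega)
          have h2 := hex z (by omega)
          rw [if_pos hxi, if_neg hzi, show x = ⟨i, hin⟩ from Fin.ext hxi]
          exact ⟨fun e => by omega, fun e => absurd e.symm h2⟩
        · have h1 := h.le x (by omega)
          have h2 := hex x (by omega)
          rw [if_neg hxi, if_pos hzi, show z = ⟨i, hin⟩ from Fin.ext hzi]
          exact ⟨fun e => by omega, fun e => absurd e h2⟩
        · rw [if_neg hxi, if_neg hzi, h.iff _ _ (by omega) (by omega)]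
      · intro x hx
        rw [hdig _ (by omega) x hx]
        split_ifs with hxi
        · omega
        · exact h.pos x (by omega)
      · intro x hx
        rw [hdig _ (by omega) x hx]
        split_ifs with hxi
        · exact le_rfl
        · exact (h.le x (by omega)).trans (by omega)
      · intro v hv hvm
        rcases Nat.lt_or_ge m v with hlt' | hle
        · exact ⟨⟨i, hin⟩, by simp, by
            rw [hdig _ (by omega) ⟨i, hin⟩ (by simp), if_pos rfl]; omega⟩
        · obtain ⟨x, hx, hxv⟩ := h.exists_eq v hv hle
          exact ⟨x, by omega, by rw [hdig _ (by omega) x (by omega), if_neg (by omega), hxv]⟩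

theorem isColouring_initial {P : Fin n → Fin k} {t : ℕ} (ht : 0 < t) (htn : t ≤ n)
    (hP : ∀ x y : Fin n, (x : ℕ) < t → (y : ℕ) < t → P x = P y) :
    IsColouring P t (ofDigits16 (fun _ => 1) t) 1 := by
  have hd : ∀ x : Fin n, (x : ℕ) < t → digit (ofDigits16 (fun _ => 1) t) x = 1 :=
    fun x hx => digit_ofDigits16 (fun _ _ => by norm_num) hx
  refine ⟨?_, fun x y hx hy => ?_, fun x hx => by rw [hd x hx]; norm_num,
    fun x hx => (hd x hx).le, fun v hv hv1 => ⟨⟨0, by omega⟩, ht, ?_⟩⟩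
  · exact ofDigits16_lt (fun _ _ => by norm_num)
  · simp [hd x hx, hd y hy, hP x y hx hy]
  · rw [hd _ ht]; omega

/-- Partition and tuple are normalized independently: `x` moves `t` points of one part to `0, …, t -
1`, and `z` brings the tuple to normal form. If `ε` maps the normalized tuple to a section for the
normalized partition, `x⁻¹ * ε * z` does so for the original data. -/
theorem hasStrongUT_of_sectionCheck {gens : List ℕ} {stages : Stages} {words : List (List ℕ)}
    (t : ℕ) (hn : n ≤ 16) (hkn : k + 1 ≤ n) (hk : 0 < k) (ht : 0 < t) (htn : (t - 1) * k < n)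
    (hprim : MulAction.IsPreprimitive (codeGroup n gens) (Fin n))
    (hv : ∀ c ∈ gens, validCode n c = true) (hs : stagesCheck n gens [] stages = true)
    (hst : ∀ i < t, ∃ s ∈ stages, s.1 = i ∧ s.2.1 = 2 ^ i)
    (h : sectionCheck n k t stages (words.map (wordCode n gens)) = true) :
    HasStrongUT (codeGroup n gens) k := by
  refine ⟨hprim, fun a ha P hP => ?_⟩
  have hgens := hasCode_codeGroup hv
  -- By the pigeonhole principle some part has at least `t` points, because `(t - 1) * k < n`.
  obtain ⟨c, hc⟩ := Fintype.exists_lt_card_fiber_of_mul_lt_card (f := P) (n := t - 1)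
    (by simpa [mul_comm] using htn)
  obtain ⟨T, hT, hTc⟩ := Finset.exists_subset_card_eq
    (show t ≤ (Finset.univ.filter fun x => P x = c).card by omega)
  have htn' : t ≤ n := by
    rw [← hTc]; exact (Finset.card_le_univ T).trans (by simp)
  let y : Fin t → Fin n := T.orderEmbOfFin hTc
  have hy : ∀ i, P (y i) = c := fun i => by
    have := hT (T.orderEmbOfFin_mem hTc i)
    exact (Finset.mem_filter.1 this).2
  obtain ⟨σ, hσ⟩ := Perm.exists_extending_pair (Fin.castLE htn') y (Fin.castLE_injective _)
    (T.orderEmbOfFin hTc).injective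
  obtain ⟨x, hx, -, hxn⟩ := exists_mul_isNormalFor hn hgens hs σ (by simp)
  have hxy : ∀ (i : ℕ) (hi : i < t), x⁻¹ ⟨i, by omega⟩ = y ⟨i, hi⟩ := by
    intro i hi
    obtain ⟨s, hs, h1, h2⟩ := hst i hi
    have := hxn s hs ⟨i, by omega⟩ h1.symm
    rw [h2, Nat.testBit_two_pow] at this
    rw [Perm.inv_eq_iff_eq]
    refine Fin.ext ?_
    have h3 := of_decide_eq_true this
    rw [Perm.mul_apply, show (⟨i, by omega⟩ : Fin n) = Fin.castLE htn' ⟨i, hi⟩ from rfl, hσ] at h3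
    exact h3
  -- The tuple becomes the initial values of a permutation, so that sifting applies to it; only its
  -- first `k + 1` values are searched.
  obtain ⟨τ, hτ⟩ := Perm.exists_extending_pair (Fin.castLE hkn) a (Fin.castLE_injective _) ha
  obtain ⟨z, hz, -, hzn⟩ := exists_mul_isNormalFor hn hgens hs τ (by simp)
  obtain ⟨b, hb, htest⟩ := searchPerm_sound_of_le hn hkn h (z * τ)
    (maskPrune_of_isNormalFor hzn)
  rw [forceList_eq] at htest
  obtain ⟨Bs, hl, hBs, htest⟩ := exists_of_buckets htest
  have hsurj : Function.Surjective fun i => P (x⁻¹ i) := hP.comp (x⁻¹).surjective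
  obtain ⟨B, hB, s, hsB, w, hw, hw0, hwinj⟩ := IsColouring.paint_sound hsurj hk (by omega)
    (by omega) (isColouring_initial ht htn' fun i j hi hj => by
      rw [hxy i hi, hxy j hj, hy, hy]) htest
  obtain ⟨e, he, rfl⟩ := List.mem_map.1 (hBs B hB s hsB)
  obtain ⟨word, -, rfl⟩ := List.mem_map.1 he
  obtain ⟨ε, hε, hεc⟩ := HasCode.word hn hgens word
  have hwa : ∀ j, w j = ε (z (a j)) := by
    intro j
    refine Fin.ext ?_
    have hbj := hb (Fin.castLE hkn j) j.2
    simp only [Fin.val_castLE] at hbj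
    rw [← hw j, comp, digit_ofDigits16 (fun _ _ => digit_lt _ _) j.2, hbj, hεc, Perm.mul_apply, hτ]
  refine ⟨x⁻¹ * ε * z, mul_mem (mul_mem (inv_mem hx) hε) hz, ?_, ?_⟩
  · have hbij := Finite.injective_iff_bijective.1 hwinj
    intro i
    obtain ⟨j, hj⟩ := hbij.2 i
    refine ⟨x⁻¹ (w j.castSucc), ⟨⟨a j.castSucc, ⟨j, rfl⟩, by simp [hwa]⟩, hj⟩, ?_⟩
    rintro _ ⟨⟨_, ⟨j', rfl⟩, rfl⟩, hj'⟩
    have : j' = j := hwinj (by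
      change P (x⁻¹ (w j'.castSucc)) = P (x⁻¹ (w j.castSucc))
      rw [show P (x⁻¹ (w j.castSucc)) = i from hj, ← hj', hwa]; rfl)
    rw [this, hwa]; rfl
  · have := hw0
    simp only [hwa] at this
    exact this

end

/-! ### Groups with the strong universal transversal property -/

section

variable {n k : ℕ}

theorem isPreprimitive_mono {G H : Subgroup (Perm (Fin n))} (hGH : G ≤ H)
    (hG : MulAction.IsPreprimitive G (Fin n)) : MulAction.IsPreprimitive H (Fin n) :=
  MulAction.IsPreprimitive.of_surjective (φ := Subgroup.inclusion hGH)
    (f := ⟨id, fun _ _ => rfl⟩) Function.surjective_id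

theorem HasStrongUT.mono {G H : Subgroup (Perm (Fin n))} (hGH : G ≤ H) (hG : HasStrongUT G k) :
    HasStrongUT H k :=
  ⟨isPreprimitive_mono hGH hG.primitive, fun a ha P hP =>
    (hG.exists_section a ha P hP).imp fun _ h => ⟨hGH h.1, h.2⟩⟩

theorem HasStrongUT.of_elements {gens gens' : List ℕ} (hn : n ≤ 16)
    (hG : HasStrongUT (codeGroup n gens) k) {M : List (ℕ × List ℕ)}
    (hM : wordsCheck n gens' M = true) (h : ∀ c ∈ gens, c ∈ M.map Prod.fst) :
    HasStrongUT (codeGroup n gens') k :=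
  hG.mono (codeGroup_le fun c hc => hasCode_of_wordsCheck hn hM (h c hc))

theorem IsNormalFor.apply_eq {stages : Stages} {x : Perm (Fin n)} (hx : IsNormalFor stages x)
    (i : Fin n) (hi : ∃ s ∈ stages, s.1 = i ∧ s.2.1 = 2 ^ (i : ℕ)) : x i = i := by
  obtain ⟨s, hs, h1, h2⟩ := hi
  have := hx s hs i h1.symm
  rw [h2, Nat.testBit_two_pow] at this
  exact (Fin.ext (of_decide_eq_true this)).symm

/-- Sifting a permutation with prescribed values at `0` and `1` down to one fixing both shows
transitivity on ordered pairs, which implies primitivity. -/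
theorem isPreprimitive_of_stages {gens : List ℕ} {stages : Stages} (hn : n ≤ 16) (hn2 : 2 ≤ n)
    (hv : ∀ c ∈ gens, validCode n c = true) (hs : stagesCheck n gens [] stages = true)
    (hst : ∀ i < 2, ∃ s ∈ stages, s.1 = i ∧ s.2.1 = 2 ^ i) :
    MulAction.IsPreprimitive (codeGroup n gens) (Fin n) := by
  have key : ∀ a b : Fin n, a ≠ b → ∃ x ∈ codeGroup n gens, x a = ⟨0, by omega⟩ ∧
      x b = ⟨1, by omega⟩ := by
    intro a b hab
    obtain ⟨σ, hσ⟩ := Perm.exists_extending_pair (Fin.castLE hn2) ![a, b]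
      (Fin.castLE_injective _) (by
        intro i j hij
        fin_cases i <;> fin_cases j <;> simp_all)
    obtain ⟨x, hx, -, hxn⟩ := exists_mul_isNormalFor hn (hasCode_codeGroup hv) hs σ (by simp)
    refine ⟨x, hx, ?_, ?_⟩
    · have h1 := hxn.apply_eq ⟨0, by omega⟩ (hst 0 (by norm_num))
      rwa [Perm.mul_apply, show (⟨0, by omega⟩ : Fin n) = Fin.castLE hn2 0 from rfl, hσ] at h1
    · have h1 := hxn.apply_eq ⟨1, by omega⟩ (hst 1 (by norm_num))
      rwa [Perm.mul_apply, show (⟨1, by omega⟩ : Fin n) = Fin.castLE hn2 1 from rfl, hσ] at h1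
  refine MulAction.isPreprimitive_of_is_two_pretransitive
    (MulAction.is_two_pretransitive_iff.2 fun {a b c d} hab hcd => ?_)
  obtain ⟨x, hx, h1, h2⟩ := key a b hab
  obtain ⟨y, hy, h3, h4⟩ := key c d hcd
  refine ⟨⟨y⁻¹ * x, mul_mem (inv_mem hy) hx⟩, ?_, ?_⟩
  · change y⁻¹ (x a) = c
    rw [h1, ← h3]; simp
  · change y⁻¹ (x b) = d
    rw [h2, ← h4]; simp

/-- Needed for `7:3`, which is not transitive on ordered pairs: a transitive group of prime degree
is primitive. -/
theorem isPreprimitive_of_prime_of_stages {gens : List ℕ} {stages : Stages} (hn : n ≤ 16)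
    (hp : n.Prime) (hv : ∀ c ∈ gens, validCode n c = true)
    (hs : stagesCheck n gens [] stages = true) (hst : ∃ s ∈ stages, s.1 = 0 ∧ s.2.1 = 1) :
    MulAction.IsPreprimitive (codeGroup n gens) (Fin n) := by
  have key : ∀ a : Fin n, ∃ x ∈ codeGroup n gens, x a = ⟨0, hp.pos⟩ := by
    intro a
    obtain ⟨x, hx, -, hxn⟩ := exists_mul_isNormalFor hn (hasCode_codeGroup hv) hs
      (swap ⟨0, hp.pos⟩ a) (by simp)
    have := hxn.apply_eq ⟨0, hp.pos⟩ hst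
    exact ⟨x, hx, by simpa using this⟩
  have : MulAction.IsPretransitive (codeGroup n gens) (Fin n) := ⟨fun a b => by
    obtain ⟨x, hx, h1⟩ := key a
    obtain ⟨y, hy, h2⟩ := key b
    refine ⟨⟨y⁻¹ * x, mul_mem (inv_mem hy) hx⟩, ?_⟩
    change y⁻¹ (x a) = b
    rw [h1, ← h2]; simp⟩
  exact MulAction.IsPreprimitive.of_prime_card (by simpa using hp)

end

/-! ### The property for the minimal groups, by exhaustive search. -/

/-- Base points, permitted images and reducing words. -/
def stagesPairsAGL15 : Stages :=
  [(0, 1, [[], [0], [0, 0], [0, 1], [0, 1, 0]]), (1, 2, [[], [1], [1, 1], [1, 1, 1]])]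

/-- Words for elements producing sections. -/
def wordsPairsAGL15 : List (List ℕ) :=
  [[0, 1, 1, 1], [0], [0, 1], [1, 1]]

theorem hasStrongUT_pairs_AGL15 : HasStrongUT (codeGroup 5 gensAGL15) 2 :=
  hasStrongUT_of_sectionCheck (stages := stagesPairsAGL15) (words := wordsPairsAGL15) 2 (by norm_num)
    (by norm_num) (by norm_num) (by norm_num) (by norm_num)
    (isPreprimitive_of_stages (stages := stagesPairsAGL15) (by norm_num) (by norm_num) (by decide +kernel)
      (by decide +kernel) (by decide))
    (by decide +kernel) (by decide +kernel) (by decide) (by decide +kernel)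

/-- Base points, permitted images and reducing words. -/
def stagesPairsPSL25 : Stages :=
  [(0, 1, [[], [0], [2], [0, 0], [0, 1], [0, 0, 0]]), (1, 2, [[], [1], [0, 2, 0], [2, 0, 2], [1, 0,
  2, 0]])]

/-- Words for elements producing sections. -/
def wordsPairsPSL25 : List (List ℕ) :=
  [[2, 1, 0, 1], [2, 0, 0, 2], [1, 0, 2, 0, 0, 0], [0], [2, 1]]

theorem hasStrongUT_pairs_PSL25 : HasStrongUT (codeGroup 6 gensPSL25) 2 :=
  hasStrongUT_of_sectionCheck (stages := stagesPairsPSL25) (words := wordsPairsPSL25) 2 (by norm_num)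
    (by norm_num) (by norm_num) (by norm_num) (by norm_num)
    (isPreprimitive_of_stages (stages := stagesPairsPSL25) (by norm_num) (by norm_num) (by decide +kernel)
      (by decide +kernel) (by decide))
    (by decide +kernel) (by decide +kernel) (by decide) (by decide +kernel)

/-- Base points, permitted images and reducing words. -/
def stagesPairsF21 : Stages :=
  [(0, 1, [[], [0], [0, 0], [0, 1], [0, 0, 0], [0, 1, 0], [0, 1, 0, 0]]), (1, 10, [[], [1], [1,
  1]])]

/-- Words for elements producing sections. -/
def wordsPairsF21 : List (List ℕ) :=
  [[], [1], [1, 1], [0, 1, 0], [0, 1], [0, 1, 0, 1], [1, 0, 0], [0, 0], [0], [1, 0], [1, 0, 1, 0]]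

/-- The order `21` is odd, so ordered pairs do not form one orbit. Only `t = 1` is available, and
primitivity comes from the prime degree. -/
theorem hasStrongUT_pairs_F21 : HasStrongUT (codeGroup 7 gensF21) 2 :=
  hasStrongUT_of_sectionCheck (stages := stagesPairsF21) (words := wordsPairsF21) 1 (by norm_num)
    (by norm_num) (by norm_num) (by norm_num) (by norm_num)
    (isPreprimitive_of_prime_of_stages (stages := stagesPairsF21) (by norm_num)
      (by norm_num) (by decide +kernel) (by decide +kernel) (by decide))
    (by decide +kernel) (by decide +kernel) (by decide) (by decide +kernel)

/-- Base points, permitted images and reducing words. -/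
def stagesPairsL32 : Stages :=
  [(0, 1, [[], [0], [0, 0], [0, 0, 1], [0, 0, 1, 0], [0, 0, 1, 0, 0], [0, 0, 1, 0, 0, 1]]), (1, 2,
  [[], [1], [0, 0, 1, 0, 1, 0, 0, 1, 0], [1, 0, 0, 1, 0, 1, 0, 0, 1, 0], [0, 0, 1, 0, 0, 1, 0, 1,
  0, 1, 0], [1, 0, 0, 1, 0, 0, 1, 0, 1, 0, 1, 0]])]

/-- Words for elements producing sections. -/
def wordsPairsL32 : List (List ℕ) :=
  [[0, 0, 1, 0, 0, 1], [1, 0, 0, 1, 0, 1, 0, 1, 0, 1], [1], [0, 1, 0, 1, 0, 0, 1, 0, 1, 0, 1, 0,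
  1], [0], [1, 0, 0, 1, 0, 1, 0, 1]]

theorem hasStrongUT_pairs_L32 : HasStrongUT (codeGroup 7 gensL32) 2 :=
  hasStrongUT_of_sectionCheck (stages := stagesPairsL32) (words := wordsPairsL32) 2 (by norm_num)
    (by norm_num) (by norm_num) (by norm_num) (by norm_num)
    (isPreprimitive_of_stages (stages := stagesPairsL32) (by norm_num) (by norm_num) (by decide +kernel)
      (by decide +kernel) (by decide))
    (by decide +kernel) (by decide +kernel) (by decide) (by decide +kernel)

/-- Base points, permitted images and reducing words. -/
def stagesPairsAGL18 : Stages :=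
  [(0, 1, [[], [0], [0, 1], [0, 1, 0], [0, 1, 1], [0, 1, 1, 0], [0, 1, 0, 1], [0, 1, 0, 1, 0]]),
  (1, 2, [[], [1], [1, 1], [1, 1, 1], [1, 1, 1, 1], [1, 1, 1, 1, 1], [1, 1, 1, 1, 1, 1]])]

/-- Words for elements producing sections. -/
def wordsPairsAGL18 : List (List ℕ) :=
  [[1, 1, 1, 1], [1, 1, 1, 1, 1], [1, 1, 1, 1, 1, 1], [1, 1], [1, 1, 1], [1]]

theorem hasStrongUT_pairs_AGL18 : HasStrongUT (codeGroup 8 gensAGL18) 2 :=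
  hasStrongUT_of_sectionCheck (stages := stagesPairsAGL18) (words := wordsPairsAGL18) 2 (by norm_num)
    (by norm_num) (by norm_num) (by norm_num) (by norm_num)
    (isPreprimitive_of_stages (stages := stagesPairsAGL18) (by norm_num) (by norm_num) (by decide +kernel)
      (by decide +kernel) (by decide))
    (by decide +kernel) (by decide +kernel) (by decide) (by decide +kernel)

/-- Base points, permitted images and reducing words. -/
def stagesPairsPSL27 : Stages :=
  [(0, 1, [[], [0], [2], [0, 0], [0, 1], [0, 2], [0, 0, 0], [0, 1, 0]]), (1, 2, [[], [1], [1, 1],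
  [0, 2, 0], [2, 0, 0, 2], [2, 1, 0, 2], [2, 0, 0, 2, 1]])]

/-- Words for elements producing sections. -/
def wordsPairsPSL27 : List (List ℕ) :=
  [[0, 2, 0, 2], [2, 0, 0, 2], [0, 2, 0, 0, 2, 0], [1, 1], [1], [0, 1]]

theorem hasStrongUT_pairs_PSL27 : HasStrongUT (codeGroup 8 gensPSL27) 2 :=
  hasStrongUT_of_sectionCheck (stages := stagesPairsPSL27) (words := wordsPairsPSL27) 2 (by norm_num)
    (by norm_num) (by norm_num) (by norm_num) (by norm_num)
    (isPreprimitive_of_stages (stages := stagesPairsPSL27) (by norm_num) (by norm_num) (by decide +kernel)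
      (by decide +kernel) (by decide))
    (by decide +kernel) (by decide +kernel) (by decide) (by decide +kernel)

/-- Base points, permitted images and reducing words. -/
def stagesPairsM9 : Stages :=
  [(0, 1, [[], [0], [0, 0], [0, 1], [0, 2], [0, 1, 0], [0, 2, 0], [0, 2, 1], [0, 1, 2]]), (1, 2,
  [[], [1], [2], [1, 1], [2, 1], [1, 2], [1, 1, 1], [2, 1, 1]])]

/-- Words for elements producing sections. -/
def wordsPairsM9 : List (List ℕ) :=
  [[0, 1], [0, 2, 1, 1], [0], [0, 1, 1, 1], [2, 1, 1], [0, 2], [0, 2, 1], [2, 1], [1, 2, 0, 2], [2,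
  0]]

theorem hasStrongUT_pairs_M9 : HasStrongUT (codeGroup 9 gensM9) 2 :=
  hasStrongUT_of_sectionCheck (stages := stagesPairsM9) (words := wordsPairsM9) 2 (by norm_num)
    (by norm_num) (by norm_num) (by norm_num) (by norm_num)
    (isPreprimitive_of_stages (stages := stagesPairsM9) (by norm_num) (by norm_num) (by decide +kernel)
      (by decide +kernel) (by decide))
    (by decide +kernel) (by decide +kernel) (by decide) (by decide +kernel)

/-- Base points, permitted images and reducing words. -/
def stagesPairsAGL19 : Stages :=
  [(0, 1, [[], [0], [0, 0], [0, 1], [0, 1, 0], [0, 0, 1], [0, 1, 0, 0], [0, 0, 1, 0], [0, 0, 1,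
  1]]), (1, 2, [[], [1], [1, 1], [1, 1, 1], [1, 1, 1, 1], [1, 1, 1, 1, 1], [1, 1, 1, 1, 1, 1], [1,
  1, 1, 1, 1, 1, 1]])]

/-- Words for elements producing sections. -/
def wordsPairsAGL19 : List (List ℕ) :=
  [[0, 1, 1], [0, 1], [0, 1, 1, 1], [0], [0, 1, 1, 1, 1, 1, 1, 1], [0, 1, 1, 1, 1, 1, 1], [1, 1],
  [0, 1, 1, 1, 1, 1], [1, 1, 0, 0, 1], [1]]

theorem hasStrongUT_pairs_AGL19 : HasStrongUT (codeGroup 9 gensAGL19) 2 :=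
  hasStrongUT_of_sectionCheck (stages := stagesPairsAGL19) (words := wordsPairsAGL19) 2 (by norm_num)
    (by norm_num) (by norm_num) (by norm_num) (by norm_num)
    (isPreprimitive_of_stages (stages := stagesPairsAGL19) (by norm_num) (by norm_num) (by decide +kernel)
      (by decide +kernel) (by decide))
    (by decide +kernel) (by decide +kernel) (by decide) (by decide +kernel)

/-- Base points, permitted images and reducing words. -/
def stagesPairsPSL28 : Stages :=
  [(0, 1, [[], [0], [2], [0, 1], [0, 1, 0], [0, 1, 1], [0, 1, 2], [0, 1, 1, 0], [0, 1, 2, 0]]), (1,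
  2, [[], [1], [1, 1], [0, 2, 0], [1, 1, 1], [2, 1, 2], [1, 1, 1, 1], [2, 1, 1, 2]])]

/-- Words for elements producing sections. -/
def wordsPairsPSL28 : List (List ℕ) :=
  [[2, 0], [1], [1, 0, 2, 1, 1, 0, 1, 0], [0, 2, 1, 1, 0, 1, 2], [1, 1, 1, 1], [2, 1, 1, 0, 2, 1],
  [1, 1], [0, 1]]

theorem hasStrongUT_pairs_PSL28 : HasStrongUT (codeGroup 9 gensPSL28) 2 :=
  hasStrongUT_of_sectionCheck (stages := stagesPairsPSL28) (words := wordsPairsPSL28) 2 (by norm_num)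
    (by norm_num) (by norm_num) (by norm_num) (by norm_num)
    (isPreprimitive_of_stages (stages := stagesPairsPSL28) (by norm_num) (by norm_num) (by decide +kernel)
      (by decide +kernel) (by decide))
    (by decide +kernel) (by decide +kernel) (by decide) (by decide +kernel)

/-- Base points, permitted images and reducing words. -/
def stagesPairsPSL29 : Stages :=
  [(0, 1, [[], [0], [2], [0, 0], [0, 1], [0, 1, 0], [0, 0, 1], [0, 1, 0, 0], [0, 0, 1, 0], [0, 0,
  1, 0, 0]]), (1, 2, [[], [1], [1, 1], [0, 2, 0], [1, 1, 1], [1, 0, 2, 0], [2, 1, 0, 2], [1, 2, 0,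
  2], [1, 0, 2, 0, 1]])]

/-- Words for elements producing sections. -/
def wordsPairsPSL29 : List (List ℕ) :=
  [[0, 1], [2, 0, 0], [0, 0, 2, 0, 1, 0, 2, 0], [0], [2, 0, 1, 0, 0, 1, 2], [2, 0, 1, 0, 1, 2], [0,
  1, 0, 2, 0], [0, 0, 2, 0, 1]]

theorem hasStrongUT_pairs_PSL29 : HasStrongUT (codeGroup 10 gensPSL29) 2 :=
  hasStrongUT_of_sectionCheck (stages := stagesPairsPSL29) (words := wordsPairsPSL29) 2 (by norm_num)
    (by norm_num) (by norm_num) (by norm_num) (by norm_num)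
    (isPreprimitive_of_stages (stages := stagesPairsPSL29) (by norm_num) (by norm_num) (by decide +kernel)
      (by decide +kernel) (by decide))
    (by decide +kernel) (by decide +kernel) (by decide) (by decide +kernel)

/-- Base points, permitted images and reducing words. -/
def stagesTriplesAGaL18 : Stages :=
  [(0, 1, [[], [0], [0, 1], [0, 1, 0], [0, 1, 1], [0, 1, 2], [0, 1, 1, 0], [0, 1, 2, 0]]), (1, 2,
  [[], [1], [1, 1], [1, 2], [1, 1, 1], [1, 2, 1], [1, 2, 1, 1]]), (2, 12, [[], [2], [2, 2]])]

/-- Words for elements producing sections. -/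
def wordsTriplesAGaL18 : List (List ℕ) :=
  [[1, 1, 1, 1, 1], [1, 2, 1], [1, 1], [1, 1, 1], [1, 2, 2, 1], [1, 2, 2], [0, 1, 1], [1], [2, 1],
  [2, 1, 1], [2, 0, 1, 1, 1], [0, 1], [2, 1, 0, 1, 0, 1], [0, 1, 1, 1, 1, 1], [2, 0, 1, 2, 1, 2],
  [0, 1, 2, 2, 1, 0], [1, 2, 1, 1], [2, 1, 0, 1, 2], [0, 1, 2, 2, 1], [1, 1, 1, 1], [1, 1, 1, 1, 0,
  1, 1], [1, 1, 1, 0, 1], [0, 1, 1, 0, 1, 2], [2, 1, 2], [0, 1, 2], [2, 0, 1, 2, 1], [2, 2, 0, 1],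
  [1, 2, 1, 2], [2, 0, 1, 1], [1, 2, 2, 0], [2, 0, 1, 0, 1], [1, 0]]

/-- The group has order `168` and is not triply transitive; the mask `12` permits the images `2` and
`3` of the third base point, and `t = 2` is the best choice. -/
theorem hasStrongUT_triples_AGaL18 : HasStrongUT (codeGroup 8 gensAGaL18) 3 :=
  hasStrongUT_of_sectionCheck (stages := stagesTriplesAGaL18) (words := wordsTriplesAGaL18) 2 (by norm_num)
    (by norm_num) (by norm_num) (by norm_num) (by norm_num)
    (isPreprimitive_of_stages (stages := stagesTriplesAGaL18) (by norm_num) (by norm_num) (by decide +kernel)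
      (by decide +kernel) (by decide))
    (by decide +kernel) (by decide +kernel) (by decide) (by decide +kernel)

/-- Base points, permitted images and reducing words. -/
def stagesTriplesPSL27 : Stages :=
  [(0, 1, [[], [0], [2], [0, 0], [0, 1], [0, 2], [0, 0, 0], [0, 1, 0]]), (1, 2, [[], [1], [1, 1],
  [0, 2, 0], [2, 0, 0, 2], [2, 1, 0, 2], [2, 0, 0, 2, 1]]), (2, 12, [[], [1, 0, 2, 0], [2, 0, 1,
  2]])]

/-- Words for elements producing sections. -/
def wordsTriplesPSL27 : List (List ℕ) :=
  [[0, 2, 0, 2], [2, 0, 2], [2, 0, 0, 2], [1, 2, 0, 2], [1, 0, 2, 0, 0], [1], [2, 0, 1, 2, 0], [2,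
  1, 0, 1, 0], [0, 1, 1, 0, 2, 0], [1, 1, 0, 2, 0], [0, 2, 0], [2, 1, 0, 0, 0], [0], [2, 0, 0, 2,
  1, 0], [0, 1], [1, 1], [0, 2, 0, 0], [1, 1, 0, 2, 0, 0, 0], [0, 0, 2, 0], [0, 0, 2, 0, 2], [0, 0,
  0, 2, 0], [1, 0, 2, 0, 0, 0], [1, 1, 0], [1, 0, 0, 2, 1, 0], [0, 1, 0, 0], [2, 1, 0, 1], [1, 2,
  0, 1, 2, 0], [0, 2, 1, 0, 1], [2], [1, 0, 0, 0], [0, 1, 0, 1], [2, 1, 0, 2, 0], [0, 2], [2, 0, 2,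
  0]]

theorem hasStrongUT_triples_PSL27 : HasStrongUT (codeGroup 8 gensPSL27) 3 :=
  hasStrongUT_of_sectionCheck (stages := stagesTriplesPSL27) (words := wordsTriplesPSL27) 2 (by norm_num)
    (by norm_num) (by norm_num) (by norm_num) (by norm_num)
    (isPreprimitive_of_stages (stages := stagesTriplesPSL27) (by norm_num) (by norm_num) (by decide +kernel)
      (by decide +kernel) (by decide))
    (by decide +kernel) (by decide +kernel) (by decide) (by decide +kernel)

/-- Base points, permitted images and reducing words. -/
def stagesTriplesPSL28 : Stages :=
  [(0, 1, [[], [0], [2], [0, 1], [0, 1, 0], [0, 1, 1], [0, 1, 2], [0, 1, 1, 0], [0, 1, 2, 0]]), (1,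
  2, [[], [1], [1, 1], [0, 2, 0], [1, 1, 1], [2, 1, 2], [1, 1, 1, 1], [2, 1, 1, 2]]), (2, 4, [[],
  [2, 0, 1, 0, 2], [1, 1, 0, 2, 0, 1], [2, 0, 1, 1, 0, 2], [2, 1, 0, 1, 1, 2], [0, 2, 0, 1, 0, 2,
  0], [1, 1, 1, 2, 0, 1, 2]])]

/-- Words for elements producing sections. -/
def wordsTriplesPSL28 : List (List ℕ) :=
  [[2, 0], [1, 0, 2, 0], [0, 1, 1, 2, 0, 1, 2], [1, 0, 1, 1, 1, 1], [2, 0, 1, 0, 2, 0, 1], [1, 0,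
  1, 0, 2, 0], [0, 2, 0, 1, 1, 2], [0, 1, 1, 1, 1], [1, 2, 0, 1, 2], [0, 1, 2, 0, 1, 1, 2], [0, 2,
  1, 1, 2], [0, 2, 1, 0, 2, 1, 1, 1], [2, 0, 1, 1, 1], [0, 1], [1, 1, 1], [2, 1, 1, 2], [1, 1], [0,
  2, 0, 1, 1], [2, 1, 0, 2], [2, 1]]

/-- `PSL(2,8)` is triply transitive and three parts of nine points include one with three points, so
`t = 3` is possible. -/
theorem hasStrongUT_triples_PSL28 : HasStrongUT (codeGroup 9 gensPSL28) 3 :=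
  hasStrongUT_of_sectionCheck (stages := stagesTriplesPSL28) (words := wordsTriplesPSL28) 3 (by norm_num)
    (by norm_num) (by norm_num) (by norm_num) (by norm_num)
    (isPreprimitive_of_stages (stages := stagesTriplesPSL28) (by norm_num) (by norm_num) (by decide +kernel)
      (by decide +kernel) (by decide))
    (by decide +kernel) (by decide +kernel) (by decide) (by decide +kernel)

/-- Base points, permitted images and reducing words. -/
def stagesTriplesPGL29 : Stages :=
  [(0, 1, [[], [0], [2], [0, 0], [0, 1], [0, 3], [0, 1, 0], [0, 0, 1], [0, 3, 1], [0, 0, 3]]), (1,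
  2, [[], [1], [3], [1, 1], [3, 1], [0, 2, 0], [1, 1, 1], [3, 1, 1], [2, 3, 2]]), (2, 4, [[], [1,
  1, 0, 2, 0], [3, 0, 2, 0, 1], [2, 3, 0, 2, 1], [2, 1, 0, 3, 2], [3, 2, 0, 2, 3], [2, 0, 0, 1, 0,
  2], [2, 0, 0, 3, 0, 2]])]

/-- Words for elements producing sections. -/
def wordsTriplesPGL29 : List (List ℕ) :=
  [[3, 0, 2, 0], [3, 0, 2, 1, 0], [2, 3, 0, 2], [3], [1, 2, 0, 1, 2], [0, 0, 3, 0, 2, 0], [3, 1],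
  [2, 3, 0, 3, 1, 2], [2, 0, 1], [1, 0, 2, 0], [2, 1, 1, 0, 1], [2, 0, 3, 1, 1], [0, 0, 1, 2, 0, 2,
  1], [0, 2, 1, 0, 2], [0, 2, 3, 0, 2, 3], [1], [2, 0, 0, 3, 2], [3, 2, 0, 2, 3, 1], [1, 0, 2, 0,
  1], [0, 3, 0, 2, 0, 3, 1], [2, 0, 2, 3], [2, 0, 1, 0, 2, 1], [0, 0, 2, 0, 3], [0, 3], [0, 3, 0,
  2, 3, 1, 0], [0, 2, 3, 0], [0, 0, 2, 1, 0, 2], [3, 0, 1, 2, 0]]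

theorem hasStrongUT_triples_PGL29 : HasStrongUT (codeGroup 10 gensPGL29) 3 :=
  hasStrongUT_of_sectionCheck (stages := stagesTriplesPGL29) (words := wordsTriplesPGL29) 3 (by norm_num)
    (by norm_num) (by norm_num) (by norm_num) (by norm_num)
    (isPreprimitive_of_stages (stages := stagesTriplesPGL29) (by norm_num) (by norm_num) (by decide +kernel)
      (by decide +kernel) (by decide))
    (by decide +kernel) (by decide +kernel) (by decide) (by decide +kernel)

/-- Base points, permitted images and reducing words. -/
def stagesTriplesM10 : Stages :=
  [(0, 1, [[], [0], [2], [0, 0], [0, 1], [0, 3], [0, 1, 0], [0, 3, 0], [0, 3, 1], [0, 3, 2]]), (1,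
  2, [[], [1], [3], [1, 1], [3, 1], [1, 3], [0, 2, 0], [1, 1, 1], [3, 1, 1]]), (2, 4, [[], [1, 1,
  0, 2, 0], [2, 3, 0, 1, 2], [2, 1, 0, 3, 2], [2, 1, 3, 0, 2, 1], [1, 2, 0, 3, 2, 1], [2, 0, 0, 1,
  0, 2], [3, 2, 0, 2, 1, 3]])]

/-- Words for elements producing sections. -/
def wordsTriplesM10 : List (List ℕ) :=
  [[0, 2, 1, 3, 0, 2], [0, 3, 2, 0, 2], [1, 0, 3, 2, 0], [3], [0, 2, 3, 0, 2], [2, 0, 3, 2], [0, 2,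
  0, 1], [0, 0, 1, 2, 0, 2], [0, 1], [1, 2, 0, 1, 0, 2], [2, 0, 0, 1, 3], [0, 0, 3], [0, 2, 0, 0,
  1, 3], [0, 0, 3, 0, 2, 0], [1, 3], [0, 2, 3, 0, 3, 2], [0, 0, 2, 1, 0, 2, 1], [2, 3, 0, 2, 3, 0,
  1], [2, 0, 1, 3], [0, 2, 0, 0, 1, 2], [1, 0, 2, 0, 1], [0, 3, 2, 1, 0, 3, 2], [1, 0, 1, 2, 0, 0,
  1], [3, 2, 0, 1, 3], [0, 0, 3, 1], [3, 2, 0, 1, 0], [1, 0, 2, 3, 0], [3, 0, 3, 2], [2, 1, 0]]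

theorem hasStrongUT_triples_M10 : HasStrongUT (codeGroup 10 gensM10) 3 :=
  hasStrongUT_of_sectionCheck (stages := stagesTriplesM10) (words := wordsTriplesM10) 3 (by norm_num)
    (by norm_num) (by norm_num) (by norm_num) (by norm_num)
    (isPreprimitive_of_stages (stages := stagesTriplesM10) (by norm_num) (by norm_num) (by decide +kernel)
      (by decide +kernel) (by decide))
    (by decide +kernel) (by decide +kernel) (by decide) (by decide +kernel)

/-- Base points, permitted images and reducing words. -/
def stagesQuadruplesPGaL28 : Stages :=
  [(0, 1, [[], [0], [2], [0, 1], [0, 1, 0], [0, 1, 1], [0, 1, 2], [0, 1, 3], [0, 1, 1, 0]]), (1, 2,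
  [[], [1], [1, 1], [1, 3], [0, 2, 0], [1, 1, 1], [1, 3, 1], [2, 1, 2]]), (2, 4, [[], [3], [3, 3],
  [1, 1, 0, 2, 0, 1], [3, 2, 0, 1, 0, 2], [2, 1, 3, 0, 1, 2], [2, 1, 0, 1, 1, 2]]), (3, 24, [[],
  [2, 0, 1, 3, 3, 0, 2], [3, 0, 2, 0, 1, 0, 2, 0]])]

/-- Words for elements producing sections. -/
def wordsQuadruplesPGaL28 : List (List ℕ) :=
  [[1, 0, 2, 0], [0, 2, 0], [2, 0, 1, 2], [3, 1, 0, 2, 0, 1, 1, 0, 1], [3, 0, 1, 2, 0, 1, 0], [3,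
  3, 1, 2, 0, 1, 2], [1, 0, 2, 0, 1, 3, 1], [3, 3, 2, 0], [2, 1, 0, 1, 0, 2], [0, 2, 1, 0, 2], [2,
  0, 1, 3], [0, 2, 0, 1], [1, 1], [3, 3, 1, 0, 2, 1, 0, 1, 0], [1, 1, 1], [3, 0, 1, 0, 2, 0, 1, 3],
  [3, 1, 1, 0, 2, 1, 0], [2, 0, 1, 3, 3], [1, 3, 0, 2, 1, 3, 0, 2, 1], [1, 1, 0, 1, 1, 2, 0], [1,
  3, 2, 0, 1, 1], [2, 1, 0, 2, 1], [3, 1], [3, 1, 3, 0, 1, 2, 0], [3, 3, 0, 1], [3, 0, 2, 1, 0, 2,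
  1, 3], [0, 2, 1, 0, 1, 0], [1, 1, 1, 1], [3, 3, 0, 2, 1, 0], [2, 1, 0, 2, 1, 3, 1, 0, 1], [3, 3,
  2, 0, 1], [1, 0, 1, 1, 1], [2, 0, 1, 3, 1], [2, 1, 1, 0, 1, 3, 2, 0, 1], [3, 0, 2, 1, 3, 0, 2],
  [1, 3, 0, 1, 3, 1], [0, 1, 0, 2, 0], [1, 3, 0, 2, 1, 1], [2, 0], [2, 1, 0]]

/-- Four parts of nine points still include one with three points, as `2 * 4 < 9`. -/
theorem hasStrongUT_quadruples_PGaL28 : HasStrongUT (codeGroup 9 gensPGaL28) 4 :=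
  hasStrongUT_of_sectionCheck (stages := stagesQuadruplesPGaL28) (words := wordsQuadruplesPGaL28) 3 (by norm_num)
    (by norm_num) (by norm_num) (by norm_num) (by norm_num)
    (isPreprimitive_of_stages (stages := stagesQuadruplesPGaL28) (by norm_num) (by norm_num) (by decide +kernel)
      (by decide +kernel) (by decide))
    (by decide +kernel) (by decide +kernel) (by decide) (by decide +kernel)

/-! ### The property for overgroups. -/

/-- Some elements as words in the generators. -/
def elementsAGaL18ASL32 : List (ℕ × List ℕ) :=
  [(0x67452301, [0]), (0x57136420, [1, 2, 1, 2, 1, 1, 2, 1, 2, 1, 1]), (0x32765410, [1, 2, 1, 2, 1,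
  2, 1, 1, 2, 1, 2])]

theorem hasStrongUT_pairs_PGL25 : HasStrongUT (codeGroup 6 gensPGL25) 2 :=
  hasStrongUT_pairs_PSL25.of_elements (by norm_num) (M := elementsPGL25) (by decide +kernel)
    (by decide)

theorem hasStrongUT_pairs_AGL17 : HasStrongUT (codeGroup 7 gensAGL17) 2 :=
  hasStrongUT_pairs_F21.of_elements (by norm_num) (M := elementsAGL17) (by decide +kernel)
    (by decide)

theorem hasStrongUT_pairs_AGaL18 : HasStrongUT (codeGroup 8 gensAGaL18) 2 :=
  hasStrongUT_pairs_AGL18.of_elements (by norm_num) (M := elementsAGaL18) (by decide +kernel)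
    (by decide)

/-- Multiplications and automorphisms of the field with eight elements are linear over the prime
field, so `AΓL(1,8)` lies in `ASL(3,2)`. -/
theorem hasStrongUT_pairs_ASL32 : HasStrongUT (codeGroup 8 gensASL32) 2 :=
  hasStrongUT_pairs_AGaL18.of_elements (by norm_num) (M := elementsAGaL18ASL32) (by decide +kernel)
    (by decide)

theorem hasStrongUT_pairs_PGL27 : HasStrongUT (codeGroup 8 gensPGL27) 2 :=
  hasStrongUT_pairs_PSL27.of_elements (by norm_num) (M := elementsPGL27) (by decide +kernel)
    (by decide)

theorem hasStrongUT_pairs_AGaL19 : HasStrongUT (codeGroup 9 gensAGaL19) 2 :=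
  hasStrongUT_pairs_AGL19.of_elements (by norm_num) (M := elementsAGaL19) (by decide +kernel)
    (by decide)

theorem hasStrongUT_pairs_ASL23 : HasStrongUT (codeGroup 9 gensASL23) 2 :=
  hasStrongUT_pairs_M9.of_elements (by norm_num) (M := elementsASL23) (by decide +kernel)
    (by decide)

theorem hasStrongUT_pairs_AGL23 : HasStrongUT (codeGroup 9 gensAGL23) 2 :=
  hasStrongUT_pairs_M9.of_elements (by norm_num) (M := elementsAGL23) (by decide +kernel)
    (by decide)

theorem hasStrongUT_pairs_PGaL28 : HasStrongUT (codeGroup 9 gensPGaL28) 2 :=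
  hasStrongUT_pairs_PSL28.of_elements (by norm_num) (M := elementsPGaL28) (by decide +kernel)
    (by decide)

theorem hasStrongUT_pairs_PGL29 : HasStrongUT (codeGroup 10 gensPGL29) 2 :=
  hasStrongUT_pairs_PSL29.of_elements (by norm_num) (M := elementsPGL29) (by decide +kernel)
    (by decide)

theorem hasStrongUT_pairs_PSiL29 : HasStrongUT (codeGroup 10 gensPSiL29) 2 :=
  hasStrongUT_pairs_PSL29.of_elements (by norm_num) (M := elementsPSiL29) (by decide +kernel)
    (by decide)

theorem hasStrongUT_pairs_M10 : HasStrongUT (codeGroup 10 gensM10) 2 :=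
  hasStrongUT_pairs_PSL29.of_elements (by norm_num) (M := elementsM10) (by decide +kernel)
    (by decide)

theorem hasStrongUT_pairs_PGaL29 : HasStrongUT (codeGroup 10 gensPGaL29) 2 :=
  hasStrongUT_pairs_PSL29.of_elements (by norm_num) (M := elementsPGaL29) (by decide +kernel)
    (by decide)

theorem hasStrongUT_triples_ASL32 : HasStrongUT (codeGroup 8 gensASL32) 3 :=
  hasStrongUT_triples_AGaL18.of_elements (by norm_num) (M := elementsAGaL18ASL32) (by decide +kernel)
    (by decide)

theorem hasStrongUT_triples_PGL27 : HasStrongUT (codeGroup 8 gensPGL27) 3 :=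
  hasStrongUT_triples_PSL27.of_elements (by norm_num) (M := elementsPGL27) (by decide +kernel)
    (by decide)

theorem hasStrongUT_triples_PGaL28 : HasStrongUT (codeGroup 9 gensPGaL28) 3 :=
  hasStrongUT_triples_PSL28.of_elements (by norm_num) (M := elementsPGaL28) (by decide +kernel)
    (by decide)

theorem hasStrongUT_triples_PGaL29 : HasStrongUT (codeGroup 10 gensPGaL29) 3 :=
  hasStrongUT_triples_PGL29.of_elements (by norm_num) (M := elementsPGaL29) (by decide +kernel)
    (by decide)

/-! ### Groups without the strong universal transversal property -/

/-- For points `i ≠ j` with labels `1`, the colours agree; for points with labels `2` and `1` or `2`,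
they differ. -/
noncomputable def isCompatible (n p o : ℕ) : Bool :=
  allBelow n fun i => allBelow n fun j => cond (Nat.beq i j) true
    (force (digit o i) fun u => force (digit o j) fun v =>
      cond (Nat.beq u 1) (cond (Nat.beq v 1) (Nat.beq (digit p i) (digit p j)) true)
        (cond (Nat.beq u 2) (cond (Nat.beq v 0) true
          (cond (Nat.beq (digit p i) (digit p j)) false true)) true))

/-- The list `O` of labellings is closed under `gens`, and none is compatible with `p`. -/
noncomputable def orbitCheck (n : ℕ) (gens O : List ℕ) (p : ℕ) : Bool :=
  O.all fun o => (gens.all fun c => force (comp n o c) fun d => listMem d O) &&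
    cond (isCompatible n p o) false true

section

variable {n k : ℕ}

/-- A finite group is generated as a monoid by its generators, so closure under composition with
generators suffices, without their inverses. -/
theorem exists_label_of_orbitCheck {gens O : List ℕ} {p s : ℕ}
    (h : orbitCheck n gens O p = true) (hs : s ∈ O) {x : Perm (Fin n)} (hx : x ∈ codeGroup n gens) :
    ∃ o ∈ O, ∀ i : Fin n, digit o i = digit s (x i) := by
  simp only [orbitCheck, List.all_eq_true, Bool.and_eq_true, force_eq, listMem_iff] at h
  rw [codeGroup, ← Subgroup.mem_toSubmonoid, Subgroup.closure_toSubmonoid_of_finite] at hx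
  induction hx using Submonoid.closure_induction_right with
  | one => exact ⟨s, hs, fun i => rfl⟩
  | mul_right x hx y hy ih =>
    obtain ⟨o, ho, hoi⟩ := ih
    obtain ⟨c, hc, hyc⟩ := hy
    refine ⟨_, (h o ho).1 c hc, fun i => ?_⟩
    rw [comp, digit_ofDigits16 (fun _ _ => digit_lt _ _) i.2, hyc, hoi, Perm.mul_apply]

/-- Label `1` marks `a 0` and the last entry, which must land in the same part; label `2` marks
entries of the section, which must be separated from all other labelled points. Unlabelled points
are ignored, so part of the tuple may be left out. The entry `a 0` may carry label `2` only if label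
`1` does not occur. -/
theorem not_hasStrongUT_of_orbitCheck {gens O : List ℕ} {p : ℕ} (s : ℕ) (a : Fin (k + 1) → Fin n)
    (P : Fin n → Fin k) (ha : Function.Injective a) (hP : Function.Surjective P)
    (hp : ∀ i : Fin n, digit p i = P i) (hs : s ∈ O)
    (hs1 : ∀ x : Fin n, digit s x = 1 → x = a 0 ∨ x = a (Fin.last k))
    (hs2 : ∀ x : Fin n, digit s x = 2 → ∃ i : Fin k, x = a i.castSucc ∧
      ((i : ℕ) = 0 → ∀ y : Fin n, digit s y ≠ 1))
    (hs3 : ∀ x : Fin n, digit s x ≤ 2)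
    (h : orbitCheck n gens O p = true) : ¬ HasStrongUT (codeGroup n gens) k := by
  intro hG
  obtain ⟨g, hg, hsec, heq⟩ := hG.exists_section a ha P hP
  -- The moved labelling gives the point `i` the label of `g⁻¹ i`, whence the inverse.
  obtain ⟨o, ho, hoi⟩ := exists_label_of_orbitCheck h hs (inv_mem hg)
  have hinj : ∀ i j : Fin k, P (g (a i.castSucc)) = P (g (a j.castSucc)) →
      a i.castSucc = a j.castSucc := by
    intro i j hij
    obtain ⟨w, -, hw⟩ := hsec (P (g (a i.castSucc)))
    exact g.injective ((hw _ ⟨⟨_, ⟨i, rfl⟩, rfl⟩, rfl⟩).trans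
      (hw _ ⟨⟨_, ⟨j, rfl⟩, rfl⟩, hij.symm⟩).symm)
  have hcomp : isCompatible n p o = true := by
    simp only [isCompatible, allBelow_iff, force_eq]
    intro i hi j hj
    cases hij : Nat.beq i j with
    | true => rfl
    | false =>
      have hne : (⟨i, hi⟩ : Fin n) ≠ ⟨j, hj⟩ := fun e => by
        have : i = j := congrArg Fin.val e
        simp [this] at hij
      obtain ⟨x, hx⟩ := g.surjective ⟨i, hi⟩
      obtain ⟨y, hy⟩ := g.surjective ⟨j, hj⟩
      have hxy : x ≠ y := by rintro rfl; exact hne (hx.symm.trans hy)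
      have h1 : digit o i = digit s x := by
        rw [show digit o i = digit o ((⟨i, hi⟩ : Fin n) : ℕ) from rfl, hoi, ← hx]; simp
      have h2 : digit o j = digit s y := by
        rw [show digit o j = digit o ((⟨j, hj⟩ : Fin n) : ℕ) from rfl, hoi, ← hy]; simp
      have h3 : digit p i = P (g x) := by
        rw [hx, ← hp]
      have h4 : digit p j = P (g y) := by
        rw [hy, ← hp]
      have hbeq : Nat.beq (P (g x)) (P (g y)) = true ↔ P (g x) = P (g y) := by
        rw [Fin.ext_iff]
        exact ⟨Nat.eq_of_beq_eq_true, fun e => by simp [e]⟩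
      rw [h1, h2, h3, h4, cond_false]
      have hdiff : digit s x = 2 → (digit s y = 1 ∨ digit s y = 2) → P (g x) ≠ P (g y) := by
        intro hsx hsy he
        obtain ⟨u, rfl, hu⟩ := hs2 x hsx
        rcases hsy with hsy | hsy
        · have h0 : (u : ℕ) ≠ 0 := fun e => hu e y hsy
          have hk : 0 < k := by omega
          have key : P (g (a u.castSucc)) = P (g (a (Fin.castSucc ⟨0, hk⟩))) := by
            rcases hs1 y hsy with rfl | rfl
            · exact he
            · exact he.trans heq.symm
          have := ha (hinj _ _ key)
          exact h0 (congrArg Fin.val this)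
        · obtain ⟨v, rfl, -⟩ := hs2 y hsy
          exact hxy (hinj _ _ he)
      have h5 := hs3 x
      have h6 := hs3 y
      have h7 : digit s x = 0 ∨ digit s x = 1 ∨ digit s x = 2 := by omega
      have h8 : digit s y = 0 ∨ digit s y = 1 ∨ digit s y = 2 := by omega
      rcases h7 with e | e | e
      · rw [e]; rfl
      · rcases h8 with e' | e' | e'
        · rw [e, e']; rfl
        · rw [e, e']
          refine hbeq.2 ?_
          rcases hs1 x e with rfl | rfl <;> rcases hs1 y e' with rfl | rfl <;>
            first | exact absurd rfl hxy | exact heq | exact heq.symm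
        · rw [e, e']; rfl
      · rcases h8 with e' | e' | e'
        · rw [e, e']; rfl
        all_goals
          have hb : Nat.beq (P (g x)) (P (g y)) = false := by
            have := hdiff e (by simp [e'])
            exact Bool.eq_false_iff.2 fun h => this (hbeq.1 h)
          rw [e, e', hb]; rfl
  simp only [orbitCheck, List.all_eq_true, Bool.and_eq_true] at h
  have := (h o ho).2
  rw [hcomp] at this
  exact absurd this (by simp)

end

/-! ### A partition defeating each group and excluded value of `k`. -/

/-- Codes of an orbit of labellings of the points. -/
def orbitTriplesPGL25 : List ℕ :=
  [0x1221, 0x10122, 0x12021, 0x121200, 0x21012, 0x2112, 0x220110, 0x11202, 0x22101, 0x122010,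
  0x102120, 0x110220, 0x211020, 0x20211, 0x212100, 0x202011, 0x201210, 0x21120, 0x12210, 0x102201,
  0x100212, 0x101022, 0x201102, 0x210201, 0x221001, 0x112002, 0x200121, 0x120021, 0x120102,
  0x210012]

theorem not_hasStrongUT_triples_PGL25 : ∀ gens ∈ [gensPSL25, gensPGL25],
    ¬ HasStrongUT (codeGroup 6 gens) 3 := by
  have h : ∀ gens ∈ [gensPSL25, gensPGL25],
      orbitCheck 6 gens orbitTriplesPGL25 0x212100 = true := by decide +kernel
  exact fun gens hgens => not_hasStrongUT_of_orbitCheck 0x1221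
    ![0, 1, 2, 3] ![0, 0, 1, 2, 1, 2] (by decide) (by decide) (by decide) (by decide)
    (by decide) (by decide) (by decide) (h gens hgens)

/-- Codes of an orbit of labellings of the points. -/
def orbitTriplesAGL17 : List ℕ :=
  [0x1221, 0x1000122, 0x202011, 0x2100012, 0x201102, 0x1020201, 0x120021, 0x2210001, 0x110202,
  0x2020110, 0x21012, 0x1102020, 0x2002101, 0x1012002, 0x1221000, 0x2011020, 0x2101200, 0x210120,
  0x1200210, 0x122100, 0x12210]

theorem not_hasStrongUT_triples_AGL17 : ∀ gens ∈ [gensF21, gensAGL17],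
    ¬ HasStrongUT (codeGroup 7 gens) 3 := by
  have h : ∀ gens ∈ [gensF21, gensAGL17],
      orbitCheck 7 gens orbitTriplesAGL17 0x1210000 = true := by decide +kernel
  exact fun gens hgens => not_hasStrongUT_of_orbitCheck 0x1221
    ![0, 1, 2, 3] ![0, 0, 0, 0, 1, 2, 1] (by decide) (by decide) (by decide) (by decide)
    (by decide) (by decide) (by decide) (h gens hgens)

/-- Codes of an orbit of labellings of the points. -/
def orbitTriplesL32 : List ℕ :=
  [0x222, 0x22002, 0x202020, 0x2002200, 0x2020020, 0x2200002, 0x220200]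

/-- The labellings are the seven lines of the projective plane. The parts are `{5}`, `{2, 4}` and
the rest, and no line is transversal because `{2, 4, 5}` is itself a line. -/
theorem not_hasStrongUT_triples_L32 : ¬ HasStrongUT (codeGroup 7 gensL32) 3 :=
  not_hasStrongUT_of_orbitCheck (O := orbitTriplesL32) (p := 0x210100) 0x222
    ![0, 1, 2, 3] ![0, 0, 1, 0, 1, 2, 0] (by decide) (by decide) (by decide) (by decide)
    (by decide) (by decide) (by decide) (by decide +kernel)

/-- Codes of an orbit of labellings of the points. -/
def orbitTriplesAGL18 : List ℕ :=
  [0x1221, 0x2112, 0x210021, 0x120012, 0x20200101, 0x10100202, 0x2021010, 0x22000011, 0x1012020,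
  0x11000022, 0x112200, 0x2102001, 0x221100, 0x1201002, 0x10020120, 0x20010210, 0x10022001,
  0x20011002, 0x1200210, 0x2100120, 0x1020201, 0x2010102, 0x20101020, 0x10202010, 0x12210000,
  0x21120000, 0x21002100, 0x12001200]

theorem not_hasStrongUT_triples_AGL18 : ¬ HasStrongUT (codeGroup 8 gensAGL18) 3 :=
  not_hasStrongUT_of_orbitCheck (O := orbitTriplesAGL18) (p := 0x22201000) 0x1221
    ![0, 1, 2, 3] ![0, 0, 0, 1, 0, 2, 2, 2] (by decide) (by decide) (by decide) (by decide)
    (by decide) (by decide) (by decide) (by decide +kernel)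

/-- Codes of an orbit of labellings of the points. -/
def orbitQuadruplesASL32 : List ℕ :=
  [0x2222, 0x220022, 0x2020202, 0x20202020, 0x20022002, 0x22220000, 0x2200220, 0x20200202,
  0x22002200, 0x2022020, 0x22000022, 0x2202002, 0x222200, 0x20020220]

/-- The labellings are the fourteen affine planes. A transversal plane would contain `6`, `7` and
one of `4`, `5`; but `4, 5, 6, 7` form a plane. -/
theorem not_hasStrongUT_quadruples_ASL32 : ∀ gens ∈ [gensAGL18, gensAGaL18, gensASL32],
    ¬ HasStrongUT (codeGroup 8 gens) 4 := by
  have h : ∀ gens ∈ [gensAGL18, gensAGaL18, gensASL32],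
      orbitCheck 8 gens orbitQuadruplesASL32 0x32110000 = true := by decide +kernel
  exact fun gens hgens => not_hasStrongUT_of_orbitCheck 0x2222
    ![0, 1, 2, 3, 4] ![0, 0, 0, 0, 1, 1, 2, 3] (by decide) (by decide) (by decide) (by decide)
    (by decide) (by decide) (by decide) (h gens hgens)

/-- Codes of an orbit of labellings of the points. -/
def orbitQuadruplesPGL27 : List ℕ :=
  [0x10020221, 0x11002022, 0x12202001, 0x12100202, 0x10200122, 0x22000211, 0x11220200, 0x12210020,
  0x10012202, 0x20012021, 0x12020012, 0x10221002, 0x22021001, 0x21200021, 0x20102201, 0x10122020,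
  0x12022100, 0x222011, 0x2120021, 0x12001220, 0x21001202, 0x20220101, 0x21202100, 0x21120002,
  0x21010220, 0x2210201, 0x10202210, 0x201221, 0x1022201, 0x1212002, 0x2002121, 0x22100120,
  0x20002112, 0x21022010, 0x20120210, 0x20021120, 0x21212, 0x22112000, 0x22010102, 0x20210012,
  0x20101022, 0x2102012, 0x1221020, 0x1020122, 0x1102220, 0x2121200, 0x1200212, 0x20211200,
  0x2011022, 0x22201010, 0x2201102, 0x110222, 0x122102, 0x2220110, 0x212120, 0x2012210]

theorem not_hasStrongUT_quadruples_PGL27 : ∀ gens ∈ [gensPSL27, gensPGL27],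
    ¬ HasStrongUT (codeGroup 8 gens) 4 := by
  have h : ∀ gens ∈ [gensPSL27, gensPGL27],
      orbitCheck 8 gens orbitQuadruplesPGL27 0x32101000 = true := by decide +kernel
  exact fun gens hgens => not_hasStrongUT_of_orbitCheck 0x10020221
    ![0, 1, 2, 4, 7] ![0, 0, 0, 1, 0, 1, 2, 3] (by decide) (by decide) (by decide) (by decide)
    (by decide) (by decide) (by decide) (h gens hgens)

/-- Codes of an orbit of labellings of the points. -/
def orbitTriplesAGL23 : List ℕ :=
  [0x222, 0x2002002, 0x200200200, 0x20200002, 0x20020020, 0x2020200, 0x222000, 0x200020002,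
  0x200002020, 0x222000000, 0x20002200, 0x2200020]

/-- The labellings are the twelve affine lines. A transversal would contain `8` and one of `6`, `7`,
but `{6, 7, 8}` is a line. -/
theorem not_hasStrongUT_triples_AGL23 : ∀ gens ∈ [gensM9, gensAGL19, gensAGaL19, gensASL23, gensAGL23],
    ¬ HasStrongUT (codeGroup 9 gens) 3 := by
  have h : ∀ gens ∈ [gensM9, gensAGL19, gensAGaL19, gensASL23, gensAGL23],
      orbitCheck 9 gens orbitTriplesAGL23 0x211000000 = true := by decide +kernel
  exact fun gens hgens => not_hasStrongUT_of_orbitCheck 0x222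
    ![0, 1, 2, 3] ![0, 0, 0, 0, 0, 0, 1, 1, 2] (by decide) (by decide) (by decide) (by decide)
    (by decide) (by decide) (by decide) (h gens hgens)

/-- Codes of an orbit of labellings of the points. -/
def orbitQuadruplesAGL23 : List ℕ :=
  [0x22022, 0x202202, 0x202022, 0x22000022, 0x220220, 0x220202, 0x220022, 0x2020022, 0x22202,
  0x202000202, 0x220000022, 0x22220, 0x22022000, 0x20022002, 0x22020002, 0x200002202, 0x20002022,
  0x22000202, 0x2200202, 0x202220, 0x220000220, 0x202000022, 0x202200002, 0x220000202, 0x22002020,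
  0x202202000, 0x220202000, 0x2202200, 0x200202002, 0x202002200, 0x220002002, 0x20200220,
  0x200200022, 0x202000220, 0x200020220, 0x20020202, 0x2022020, 0x220020200, 0x22000220,
  0x220200020, 0x220220000, 0x22220000, 0x202220000, 0x200220020, 0x220022000, 0x20220200,
  0x2220002, 0x22200200, 0x202022000, 0x2002220, 0x22202000, 0x20202020, 0x202020020, 0x200022200]

/-- The labellings are the quadrangles, four points with no three on a line. Every transversal
contains the line `{6, 7, 8}`. -/
theorem not_hasStrongUT_quadruples_AGL23 : ∀ gens ∈ [gensM9, gensAGL19, gensAGaL19, gensASL23, gensAGL23],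
    ¬ HasStrongUT (codeGroup 9 gens) 4 := by
  have h : ∀ gens ∈ [gensM9, gensAGL19, gensAGaL19, gensASL23, gensAGL23],
      orbitCheck 9 gens orbitQuadruplesAGL23 0x321000000 = true := by decide +kernel
  exact fun gens hgens => not_hasStrongUT_of_orbitCheck 0x22022
    ![0, 1, 3, 4, 2] ![0, 0, 0, 0, 0, 0, 1, 2, 3] (by decide) (by decide) (by decide) (by decide)
    (by decide) (by decide) (by decide) (h gens hgens)

/-- Codes of an orbit of labellings of the points. -/
def orbitQuadruplesPSL28 : List ℕ :=
  [0x12221, 0x102212, 0x220121, 0x112200020, 0x10120022, 0x202200110, 0x221012, 0x20200211,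
  0x120100220, 0x121020002, 0x121202000, 0x1210022, 0x11200202, 0x220010120, 0x220021001,
  0x220102010, 0x20110202, 0x221000210, 0x2022011, 0x22100021, 0x100220210, 0x102012002,
  0x102001202, 0x112020200, 0x122021000, 0x2021201, 0x20201102, 0x210001220, 0x11022020,
  0x21001022, 0x200211200, 0x202101002, 0x202010201, 0x212120000, 0x2020112, 0x2112020, 0x12000122,
  0x210220100, 0x212002001, 0x202101020, 0x122201, 0x122002010, 0x22010012, 0x12202001,
  0x100022120, 0x100222001, 0x100022102, 0x120002120, 0x100012022, 0x201202001, 0x101002220,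
  0x20212001, 0x122200100, 0x102012200, 0x21022001, 0x20202110, 0x2021120, 0x201120200,
  0x201002102, 0x201210020, 0x1221200, 0x22011020, 0x2211002, 0x201021020, 0x200122100,
  0x210012002, 0x200002121, 0x110202002, 0x221210000, 0x211002200, 0x20012102, 0x20201021,
  0x10222100, 0x12002120, 0x1202012, 0x200112020, 0x201221000, 0x201022001, 0x220010102,
  0x210212000, 0x1002122, 0x212210, 0x10020221, 0x122000201, 0x102122000, 0x2102102, 0x210022010,
  0x21020210, 0x100201202, 0x120020201, 0x100201220, 0x100020212, 0x222100001, 0x102220010,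
  0x2120021, 0x100100222, 0x100220102, 0x212000021, 0x210020210, 0x110002202, 0x100221020,
  0x2201021, 0x2120210, 0x22020101, 0x120102200, 0x12200210, 0x22120010, 0x21102020, 0x200021012,
  0x210120002, 0x220201100, 0x10001222, 0x20011220, 0x21201200, 0x22100102, 0x2212100, 0x20120120,
  0x210200102, 0x201100220, 0x201020102, 0x212010002, 0x200001212, 0x200220011, 0x102100022,
  0x101020220, 0x222001100, 0x10021202, 0x2101220, 0x22210001, 0x22110200, 0x21001202, 0x1222010,
  0x20121002, 0x202001210, 0x200110202, 0x220011200, 0x210200210, 0x200021201, 0x122001002,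
  0x202000112, 0x221020100, 0x12010202, 0x1200221, 0x120210020, 0x102002021, 0x120210200,
  0x110022200, 0x22002101, 0x10022012, 0x202102100, 0x201200201, 0x20221010, 0x120010022,
  0x102202010, 0x102000221, 0x120220001, 0x100202021, 0x220200011, 0x222010010, 0x20002211,
  0x20210012, 0x10202201, 0x110200022, 0x200200121, 0x120000212, 0x220100201, 0x221000012,
  0x101020022, 0x202210001, 0x21000221, 0x20020112, 0x10102220, 0x22201010, 0x2002211, 0x120122000,
  0x112020020, 0x2220101, 0x12102200, 0x20022110, 0x12221000, 0x211000202, 0x202021100, 0x1120202,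
  0x2210120, 0x11220020, 0x12022100, 0x12002012, 0x20121200, 0x210201020, 0x201122, 0x220101002,
  0x221100020, 0x200110022, 0x201200012, 0x202012010, 0x1122002, 0x1202120, 0x1010222, 0x10212020,
  0x22112000, 0x2011022, 0x10220201, 0x22001210, 0x220002101, 0x210000122, 0x202010120, 0x11220002,
  0x210212, 0x200202110, 0x200010221, 0x121200002, 0x122000120, 0x220001021, 0x200102012,
  0x212201000, 0x102120002, 0x101202200, 0x102200102, 0x210020021, 0x120002012, 0x202020011,
  0x1022210, 0x21020021, 0x102210200, 0x220120010, 0x2100212, 0x1012202, 0x122021, 0x20012021,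
  0x21012200, 0x2201201, 0x21220100, 0x211002020, 0x201001022, 0x200211002, 0x200012210,
  0x21102002, 0x12010220, 0x21122, 0x10210220, 0x10102022, 0x20100122, 0x212102, 0x221012000,
  0x120021020, 0x200102201, 0x121220, 0x12200012, 0x212100200, 0x200120120, 0x12021002, 0x21200120]

theorem not_hasStrongUT_quadruples_PSL28 : ¬ HasStrongUT (codeGroup 9 gensPSL28) 4 :=
  not_hasStrongUT_of_orbitCheck (O := orbitQuadruplesPSL28) (p := 0x312321000) 0x12221
    ![0, 1, 2, 3, 4] ![0, 0, 0, 1, 2, 3, 2, 1, 3] (by decide) (by decide) (by decide) (by decide)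
    (by decide) (by decide) (by decide) (by decide +kernel)

/-- Codes of an orbit of labellings of the points. -/
def orbitTriplesPSiL29 : List ℕ :=
  [0x1221, 0x100122, 0x2002101, 0x1000001220, 0x1000221, 0x10212, 0x101002002, 0x2100000210,
  0x100000122, 0x200200110, 0x1002002010, 0x1000100022, 0x1002002100, 0x1001000220, 0x2002011,
  0x2101002, 0x2010000120, 0x10000212, 0x110200200, 0x2001102000, 0x2010000021, 0x2012001000,
  0x2000100210, 0x11002002, 0x20020011, 0x221001000, 0x1200200001, 0x1000010202, 0x1100002002,
  0x2100000201, 0x1100000022, 0x1200200010, 0x200200101, 0x200110200, 0x2102001000, 0x2001000012,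
  0x2001012000, 0x2000010120, 0x2011002, 0x11020020, 0x212010000, 0x200110020, 0x2100210000,
  0x2001000102, 0x2000012001, 0x2000010021, 0x2201100000, 0x101200200, 0x221001, 0x1020020100,
  0x122100000, 0x20020110, 0x1221000, 0x1220000001, 0x1002100002, 0x1010000202, 0x1010200200,
  0x2000102001, 0x2012000001, 0x2000100201, 0x1010002002, 0x1020020001, 0x1220001000, 0x221000001,
  0x20011020, 0x110200020, 0x2210100000, 0x2000001012, 0x2100201000, 0x200101200, 0x212010,
  0x21010200, 0x20110020, 0x12210000, 0x10212000, 0x20011002, 0x120102000, 0x2010021000,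
  0x210100002, 0x2000001102, 0x2000201100, 0x2120010000, 0x2120000010, 0x101200002, 0x110020020,
  0x212000010, 0x201100020, 0x122100, 0x1001220000, 0x102120000, 0x100122000, 0x1022000100,
  0x1000220001, 0x1200010200, 0x2102000001, 0x1002010002, 0x1001020020, 0x1202010000, 0x200010021,
  0x2000210100, 0x2201000100, 0x1001200200, 0x1022100000, 0x122000100, 0x10021200, 0x11020002,
  0x210012000, 0x2021010000, 0x100210002, 0x2010120000, 0x2210000100, 0x200101002, 0x100201020,
  0x210002100, 0x102001020, 0x2120010, 0x110020200, 0x201021000, 0x2101200, 0x120102, 0x120010002,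
  0x2000120010, 0x200001012, 0x10120002, 0x210000012, 0x20110200, 0x2210100, 0x120002010,
  0x1100022000, 0x1202000010, 0x2020011, 0x1000022100, 0x1020001020, 0x10200021, 0x1200001200,
  0x1000202010, 0x21000201, 0x1020100020, 0x12200001, 0x1010202000, 0x20001102, 0x20102001,
  0x2000021010, 0x2021000010, 0x1200012, 0x1100020020, 0x201000021, 0x102020001, 0x1102020,
  0x101002200, 0x210012, 0x21201000, 0x120000102, 0x21200010, 0x10002120, 0x200012001, 0x11002020,
  0x20200110, 0x102000120, 0x12210, 0x12001200, 0x20100201, 0x1012200, 0x2011020, 0x200021010,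
  0x2200101, 0x200002101, 0x201021, 0x20002011, 0x21201, 0x1020102, 0x100020201, 0x201020100,
  0x2100210, 0x100002210, 0x12000210, 0x200020110, 0x2010120, 0x20201100, 0x102120]

theorem not_hasStrongUT_triples_PSiL29 : ∀ gens ∈ [gensPSL29, gensPSiL29],
    ¬ HasStrongUT (codeGroup 10 gens) 3 := by
  have h : ∀ gens ∈ [gensPSL29, gensPSiL29],
      orbitCheck 10 gens orbitTriplesPSiL29 0x2111000000 = true := by decide +kernel
  exact fun gens hgens => not_hasStrongUT_of_orbitCheck 0x1221
    ![0, 1, 2, 3] ![0, 0, 0, 0, 0, 0, 1, 1, 1, 2] (by decide) (by decide) (by decide) (by decide)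
    (by decide) (by decide) (by decide) (h gens hgens)

/-- Codes of an orbit of labellings of the points. -/
def orbitQuadruplesPGaL29 : List ℕ :=
  [0x2000000222, 0x2002002002, 0x2020200002, 0x2200200200, 0x2200020002, 0x2002020200,
  0x2020020020, 0x2222000000, 0x200200022, 0x2020002200, 0x2200002020, 0x2002200020, 0x22000022,
  0x2000222000, 0x20020202, 0x2220002, 0x220002002, 0x202202, 0x22022, 0x202000202, 0x2002220,
  0x200022200, 0x22200200, 0x220220, 0x220000220, 0x220220000, 0x20202020, 0x202020020, 0x22022000,
  0x202202000]

/-- The labellings are the thirty images of `GF(3) ∪ {∞}`, the circles of an inversive plane, in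
which three points lie on one circle. As `{6, 7, 8, 9}` is a circle, none contains `8`, `9` and just
one of `6`, `7`. -/
theorem not_hasStrongUT_quadruples_PGaL29 : ∀ gens ∈ [gensPSL29, gensPGL29, gensPSiL29, gensM10, gensPGaL29],
    ¬ HasStrongUT (codeGroup 10 gens) 4 := by
  have h : ∀ gens ∈ [gensPSL29, gensPGL29, gensPSiL29, gensM10, gensPGaL29],
      orbitCheck 10 gens orbitQuadruplesPGaL29 0x3211000000 = true := by decide +kernel
  exact fun gens hgens => not_hasStrongUT_of_orbitCheck 0x2000000222
    ![0, 1, 2, 9, 3] ![0, 0, 0, 0, 0, 0, 1, 1, 2, 3] (by decide) (by decide) (by decide) (by decide)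
    (by decide) (by decide) (by decide) (h gens hgens)

/-- Codes of an orbit of labellings of the points. -/
def orbitQuintuplesPGaL29 : List ℕ :=
  [0x20002222, 0x2200222, 0x2022202, 0x2000022220, 0x222200002, 0x2020222, 0x200020222,
  0x202002022, 0x2202000220, 0x20222002, 0x200002222, 0x200202220, 0x2022002020, 0x220020022,
  0x22002202, 0x2000202022, 0x2002202200, 0x2220200020, 0x2022000220, 0x222020200, 0x2202220000,
  0x200222002, 0x2202022, 0x20220022, 0x22202002, 0x2020200220, 0x20200222, 0x220200202,
  0x200220202, 0x2220000022, 0x2020220200, 0x2000202220, 0x2222200, 0x2220022000, 0x222020002,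
  0x222002200, 0x220202200, 0x202200220, 0x2202200002, 0x2002022020, 0x2000220202, 0x2200002202,
  0x2200202002, 0x2202000022, 0x2200220020, 0x2202002200, 0x2022020002, 0x2022220000, 0x222002020,
  0x22220020, 0x22020220, 0x20222200, 0x2220202000, 0x2220020200, 0x202220200, 0x2202022000,
  0x202022002, 0x2002020022, 0x2022202000, 0x2200020220, 0x20022220, 0x2022000202, 0x2020022002,
  0x2002200202, 0x2000220022, 0x200222020, 0x220022020, 0x222200020, 0x2222020, 0x2000022202,
  0x2020002022, 0x2220000202]

/-- The labellings are five-point sets containing no circle, whereas every transversal contains the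
circle `{6, 7, 8, 9}`. -/
theorem not_hasStrongUT_quintuples_PGaL29 : ∀ gens ∈ [gensPSL29, gensPGL29, gensPSiL29, gensM10, gensPGaL29],
    ¬ HasStrongUT (codeGroup 10 gens) 5 := by
  have h : ∀ gens ∈ [gensPSL29, gensPGL29, gensPSiL29, gensM10, gensPGaL29],
      orbitCheck 10 gens orbitQuintuplesPGaL29 0x4321000000 = true := by decide +kernel
  exact fun gens hgens => not_hasStrongUT_of_orbitCheck 0x20002222
    ![0, 1, 2, 3, 7, 4] ![0, 0, 0, 0, 0, 0, 1, 2, 3, 4] (by decide) (by decide) (by decide) (by decide)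
    (by decide) (by decide) (by decide) (h gens hgens)

/-! ### Permutation isomorphisms onto groups generated by codes -/

section

variable {n : ℕ}

theorem exists_of_forall₂_left {α β : Type*} {R : α → β → Prop} {l : List α} {l' : List β}
    (h : List.Forall₂ R l l') {a : α} (ha : a ∈ l) : ∃ b ∈ l', R a b := by
  obtain ⟨i, hi, rfl⟩ := List.getElem_of_mem ha
  exact ⟨_, List.getElem_mem (h.length_eq ▸ hi), h.get hi (h.length_eq ▸ hi)⟩

theorem exists_of_forall₂_right {α β : Type*} {R : α → β → Prop} {l : List α} {l' : List β}
    (h : List.Forall₂ R l l') {b : β} (hb : b ∈ l') : ∃ a ∈ l, R a b :=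
  exists_of_forall₂_left h.flip hb

/-- The second hypothesis expresses that `T` is generated by the permutations with the given codes,
without assuming any form of their description inside `T`. -/
theorem permIso_codeGroup {X : Type*} {T : Subgroup (Perm X)} (e : X ≃ Fin n) {gens : List ℕ}
    (hT : ∀ c ∈ gens, ∃ t ∈ T, ∀ x, digit c (e x) = e (t x))
    (hH : ∀ H : Subgroup (Perm X),
      (∀ c ∈ gens, ∀ t : Perm X, (∀ x, digit c (e x) = e (t x)) → t ∈ H) → T ≤ H) :
    PermIso T (codeGroup n gens) := by
  refine ⟨e, le_antisymm ?_ ?_⟩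
  · rw [Subgroup.map_le_iff_le_comap]
    refine hH _ fun c hc t ht => Subgroup.subset_closure ⟨c, hc, fun i => ?_⟩
    have := ht (e.symm i)
    rw [apply_symm_apply] at this
    exact this
  · refine (Subgroup.closure_le _).2 ?_
    rintro g ⟨c, hc, hg⟩
    obtain ⟨t, ht, htc⟩ := hT c hc
    refine ⟨t, ht, Equiv.ext fun i => Fin.ext ?_⟩
    have h1 := htc (e.symm i)
    rw [apply_symm_apply, hg i] at h1
    exact h1.symm

variable {K : Type*} [Field K]

theorem affinePerm_pow_mem {H : Subgroup (Perm K)} {m : Kˣ} (hm : affinePerm m 1 0 ∈ H) (i : ℕ) :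
    affinePerm (m ^ i) 1 0 ∈ H := by
  induction i with
  | zero => rw [pow_zero, affinePerm_one]; exact H.one_mem
  | succ i ih =>
    have := H.mul_mem ih hm
    rw [affinePerm_mul] at this
    have h1 : m ^ i * Units.map ((1 : RingAut K) : K →* K) m = m ^ (i + 1) := by
      ext; simp [pow_succ]
    rw [h1] at this
    simpa using this

/-- Conjugating the translation by `1` with multiplications gives translations by all powers of `m`,
and every element of the field is zero, such a power, or a sum of two of them. -/
theorem affinePerm_translation_mem {H : Subgroup (Perm K)} {m : Kˣ} (hm : affinePerm m 1 0 ∈ H)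
    (h1 : affinePerm 1 1 (1 : K) ∈ H)
    (hspan : ∀ b : K, b = 0 ∨ ∃ i j : Fin 8, b = (m : K) ^ (i : ℕ) ∨
      b = (m : K) ^ (i : ℕ) + (m : K) ^ (j : ℕ)) (b : K) : affinePerm 1 1 b ∈ H := by
  have hadd : ∀ b d : K, affinePerm 1 1 b * affinePerm 1 1 d = affinePerm 1 1 (b + d) := by
    intro b d
    ext x
    simp [affinePerm_apply]
    ring
  have hpow : ∀ i : ℕ, affinePerm 1 1 ((m : K) ^ i) ∈ H := by
    intro i
    have h2 := affinePerm_pow_mem hm i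
    have h3 := H.mul_mem (H.mul_mem h2 h1) (H.inv_mem h2)
    have h4 : affinePerm (m ^ i) 1 0 * affinePerm 1 1 (1 : K) =
        affinePerm 1 1 ((m : K) ^ i) * affinePerm (m ^ i) 1 0 := by
      ext x
      simp [affinePerm_apply]
      ring
    rwa [h4, mul_inv_cancel_right] at h3
  rcases hspan b with rfl | ⟨i, j, rfl | rfl⟩
  · rw [affinePerm_one]; exact H.one_mem
  · exact hpow i
  · rw [← hadd]; exact H.mul_mem (hpow i) (hpow j)

theorem affinePerm_mem_of_translation_mem {H : Subgroup (Perm K)}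
    (hb : ∀ b : K, affinePerm 1 1 b ∈ H) {a : Kˣ} {σ : RingAut K} (ha : affinePerm a σ 0 ∈ H)
    (b : K) : affinePerm a σ b ∈ H := by
  have : affinePerm a σ b = affinePerm 1 1 b * affinePerm a σ 0 := by
    ext x
    simp [affinePerm_apply]
  rw [this]
  exact H.mul_mem (hb b) ha

/-- If the elements of `D` satisfy `C`, and generate together with translations all pairs
satisfying `C`. -/
structure GeneratesPairs (m : Kˣ) (D : List (Kˣ × RingAut K)) (C : Kˣ → RingAut K → Prop) :
    Prop where
  one_mem : C m 1
  mem : ∀ d ∈ D, C d.1 d.2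
  translation : ∀ b : K, b = 0 ∨ ∃ i j : Fin 8, b = (m : K) ^ (i : ℕ) ∨
      b = (m : K) ^ (i : ℕ) + (m : K) ^ (j : ℕ)
  generates : ∀ H : Subgroup (Perm K), affinePerm m 1 0 ∈ H →
    (∀ d ∈ D, affinePerm d.1 d.2 0 ∈ H) → ∀ a σ, C a σ → affinePerm a σ 0 ∈ H

theorem permIso_affineLineGroup (e : K ≃ Fin n) {C : Kˣ → RingAut K → Prop} {one mul inv}
    {m : Kˣ} {D : List (Kˣ × RingAut K)} (hD : GeneratesPairs m D C) {c₀ c₁ : ℕ} {cs : List ℕ}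
    (h0 : ∀ x, digit c₀ (e x) = e (x + 1)) (h1 : ∀ x, digit c₁ (e x) = e (m * x))
    (hcs : List.Forall₂ (fun c d => ∀ x, digit c (e x) = e (d.1 * d.2 x)) cs D) :
    PermIso (affineLineGroup C one mul inv) (codeGroup n (c₀ :: c₁ :: cs)) := by
  refine permIso_codeGroup e ?_ ?_
  · intro c hc
    rw [List.mem_cons, List.mem_cons] at hc
    rcases hc with rfl | rfl | hc
    · exact ⟨affinePerm 1 1 1, ⟨1, 1, 1, one, rfl⟩, fun x => by simp [h0, affinePerm_apply]⟩
    · exact ⟨affinePerm m 1 0, ⟨m, 1, 0, hD.one_mem, rfl⟩,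
        fun x => by simp [h1, affinePerm_apply]⟩
    · obtain ⟨d, hd, hcd⟩ := exists_of_forall₂_left hcs hc
      exact ⟨affinePerm d.1 d.2 0, ⟨d.1, d.2, 0, hD.mem d hd, rfl⟩,
        fun x => by simp [hcd, affinePerm_apply]⟩
  · intro H hH
    have hm : affinePerm m 1 0 ∈ H :=
      hH c₁ (by simp) _ fun x => by simp [h1, affinePerm_apply]
    have ht := affinePerm_translation_mem hm
      (hH c₀ (by simp) _ fun x => by simp [h0, affinePerm_apply]) hD.translation
    have hds : ∀ d ∈ D, affinePerm d.1 d.2 0 ∈ H := by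
      intro d hd
      obtain ⟨c, hc, hcd⟩ := exists_of_forall₂_right hcs hd
      exact hH c (by simp [hc]) _ fun x => by simp [hcd, affinePerm_apply]
    rintro _ ⟨a, σ, b, hC, rfl⟩
    exact affinePerm_mem_of_translation_mem ht (hD.generates H hm hds a σ hC) b

/-! ### The projective line -/

/-- The permutation of `X ∪ {∞}` that fixes `∞` and is the given one on `X`. -/
def extendPerm (X : Type*) : Perm X →* Perm (OnePoint X) where
  toFun f := optionCongr f
  map_one' := optionCongr_refl
  map_mul' f g := by ext z; cases z <;> rfl

@[simp] theorem extendPerm_infty {X : Type*} (f : Perm X) :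
    extendPerm X f OnePoint.infty = OnePoint.infty := rfl

@[simp] theorem extendPerm_coe {X : Type*} (f : Perm X) (x : X) :
    extendPerm X f (x : OnePoint X) = (f x : X) := rfl

/-- A numbering of `X ∪ {∞}` extending a numbering of `X`, with `∞` as the last point. -/
def extendEquiv {X : Type*} (e : X ≃ Fin n) : OnePoint X ≃ Fin (n + 1) :=
  (optionCongr e).trans finSuccEquivLast.symm

@[simp] theorem extendEquiv_infty {X : Type*} (e : X ≃ Fin n) :
    extendEquiv e OnePoint.infty = Fin.last n := by
  exact finSuccEquivLast_symm_none

@[simp] theorem extendEquiv_coe {X : Type*} (e : X ≃ Fin n) (x : X) :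
    extendEquiv e (x : OnePoint X) = (e x).castSucc := by
  exact finSuccEquivLast_symm_some (e x)

theorem isCode_extendPerm {X : Type*} (e : X ≃ Fin n) {f : Perm X} {c : ℕ} (hn : digit c n = n)
    (h : ∀ x, digit c (e x) = e (f x)) (z : OnePoint X) :
    digit c (extendEquiv e z) = extendEquiv e (extendPerm X f z) := by
  cases z with
  | infty => simpa using hn
  | coe x => simpa using h x

variable [DecidableEq K]

/-- The permutation `z ↦ - 1 / z`. -/
def negInvPerm (K : Type*) [Field K] [DecidableEq K] : Perm (OnePoint K) :=
  moebiusPerm (Matrix.GeneralLinearGroup.mkOfDetNeZero !![0, -1; 1, 0] (by simp)) 1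

theorem negInvPerm_infty : negInvPerm K OnePoint.infty = ((0 : K) : OnePoint K) := by
  simp [negInvPerm, moebiusPerm_apply, OnePoint.smul_infty_eq_ite,
    Matrix.GeneralLinearGroup.mkOfDetNeZero]

theorem negInvPerm_coe (x : K) : negInvPerm K (x : OnePoint K) =
    if x = 0 then OnePoint.infty else ((-x⁻¹ : K) : OnePoint K) := by
  simp [negInvPerm, moebiusPerm_apply, OnePoint.smul_some_eq_ite,
    Matrix.GeneralLinearGroup.mkOfDetNeZero, neg_div]

/-- The matrix of an affine map is determined only up to a scalar `v`, so its determinant is `a * v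
^ 2`: conditions on the determinant matter only modulo squares. -/
theorem extendPerm_affinePerm (a v : Kˣ) (σ : RingAut K) (b : K) :
    extendPerm K (affinePerm a σ b) =
      moebiusPerm (Matrix.GeneralLinearGroup.mkOfDetNeZero !![(v * a : K), v * b; 0, v] (by simp))
        σ := by
  ext1 z
  cases z with
  | infty =>
    simp [moebiusPerm_apply, OnePoint.smul_infty_eq_ite,
      Matrix.GeneralLinearGroup.mkOfDetNeZero]
  | coe x =>
    simp [moebiusPerm_apply, OnePoint.smul_some_eq_ite, affinePerm_apply,
      Matrix.GeneralLinearGroup.mkOfDetNeZero]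
    field_simp

theorem moebiusPerm_eq_of_apply_one_zero_eq_zero {A : GL (Fin 2) K} (h : A 1 0 = 0)
    (σ : RingAut K) : ∃ a b, moebiusPerm A σ = extendPerm K (affinePerm a σ b) ∧
      ∃ v : Kˣ, a * v ^ 2 = Matrix.GeneralLinearGroup.det A := by
  have hdet : A 0 0 * A 1 1 ≠ 0 := by
    have := A.det_ne_zero
    rwa [Matrix.det_fin_two, h, mul_zero, sub_zero] at this
  have ha := left_ne_zero_of_mul hdet
  have hd := right_ne_zero_of_mul hdet
  refine ⟨Units.mk0 (A 0 0 / A 1 1) (div_ne_zero ha hd), A 0 1 / A 1 1, ?_,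
    Units.mk0 _ hd, ?_⟩
  · ext1 z
    cases z with
    | infty => simp [moebiusPerm_apply, OnePoint.smul_infty_eq_ite, h]
    | coe x =>
      simp [moebiusPerm_apply, OnePoint.smul_some_eq_ite, affinePerm_apply, h, hd]
      field_simp
  · ext
    simp [Matrix.det_fin_two, h]
    field_simp

/-- Bruhat decomposition: with lower left entry `c ≠ 0`, the map is a translation, followed by `-1 /
z`, followed by a semilinear affine map with coefficient `det A / c ^ 2`. -/
theorem moebiusPerm_eq_of_apply_one_zero_ne_zero {A : GL (Fin 2) K} (h : A 1 0 ≠ 0)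
    (σ : RingAut K) : ∃ a b d, moebiusPerm A σ =
      extendPerm K (affinePerm a σ b) * negInvPerm K * extendPerm K (affinePerm 1 1 d) ∧
      ∃ v : Kˣ, a * v ^ 2 = Matrix.GeneralLinearGroup.det A := by
  have hdet := A.det_ne_zero
  refine ⟨Units.mk0 (A.val.det / A 1 0 ^ 2) (div_ne_zero hdet (pow_ne_zero 2 h)), A 0 0 / A 1 0,
    σ⁻¹ (A 1 1 / A 1 0), ?_, Units.mk0 _ h, ?_⟩
  · ext1 z
    cases z with
    | infty =>
      simp [moebiusPerm_apply, OnePoint.smul_infty_eq_ite, h, negInvPerm_infty, affinePerm_apply]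
    | coe x =>
      have h2 : x + σ⁻¹ (A 1 1 / A 1 0) = 0 ↔ A 1 0 * σ x + A 1 1 = 0 := by
        rw [← map_eq_zero_iff σ σ.injective, map_add]
        have : σ (σ⁻¹ (A 1 1 / A 1 0)) = A 1 1 / A 1 0 := by simp
        rw [this, show σ x + A 1 1 / A 1 0 = (A 1 0 * σ x + A 1 1) / A 1 0 by field_simp,
          div_eq_zero_iff, or_iff_left h]
      have h3 : σ (x + σ⁻¹ (A 1 1 / A 1 0)) = σ x + A 1 1 / A 1 0 := by simp
      simp only [moebiusPerm_apply, OnePoint.smul_some_eq_ite, Perm.mul_apply, extendPerm_coe,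
        OnePoint.map_some, affinePerm_apply, negInvPerm_coe]
      simp only [Units.val_one, one_mul, RingAut.one_apply, h2]
      split_ifs with h4
      · rfl
      · rw [extendPerm_coe, affinePerm_apply]
        congr 1
        rw [map_neg, map_inv₀, h3, Units.val_mk0, Matrix.det_fin_two]
        have h5 : σ x + A 1 1 / A 1 0 = (A 1 0 * σ x + A 1 1) / A 1 0 := by field_simp
        rw [h5]
        generalize σ x = y at h4
        have h6 : y * A 1 0 + A 1 1 ≠ 0 := by rwa [mul_comm]
        field_simp
        ring
  · ext
    simp
    field_simp

theorem permIso_projLineGroup (e : K ≃ Fin n) {C : Kˣ → RingAut K → Prop} {one mul inv}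
    {m : Kˣ} {D : List (Kˣ × RingAut K)}
    (hD : GeneratesPairs m D fun a σ => ∃ v : Kˣ, C (a * v ^ 2) σ) {c₀ c₁ c₂ : ℕ} {cs : List ℕ}
    (hn : ∀ c ∈ c₀ :: c₁ :: cs, digit c n = n)
    (h0 : ∀ x, digit c₀ (e x) = e (x + 1)) (h1 : ∀ x, digit c₁ (e x) = e (m * x))
    (h2 : digit c₂ n = e 0) (h3 : ∀ x, digit c₂ (e x) = if x = 0 then n else e (-x⁻¹))
    (hcs : List.Forall₂ (fun c d => ∀ x, digit c (e x) = e (d.1 * d.2 x)) cs D) :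
    PermIso (projLineGroup C one mul inv) (codeGroup (n + 1) (c₀ :: c₁ :: c₂ :: cs)) := by
  have hw : ∀ z, digit c₂ (extendEquiv e z) = extendEquiv e (negInvPerm K z) := by
    intro z
    cases z with
    | infty => simpa [negInvPerm_infty] using h2
    | coe x =>
      rw [extendEquiv_coe, Fin.val_castSucc, h3, negInvPerm_coe]
      split_ifs <;> simp
  have haff : ∀ a σ b, (∃ v : Kˣ, C (a * v ^ 2) σ) →
      extendPerm K (affinePerm a σ b) ∈ projLineGroup C one mul inv := by
    rintro a σ b ⟨v, hv⟩
    refine ⟨_, _, ?_, extendPerm_affinePerm a v σ b⟩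
    convert hv
    ext
    simp [Matrix.GeneralLinearGroup.mkOfDetNeZero]
    ring
  refine permIso_codeGroup (extendEquiv e) ?_ ?_
  · intro c hc
    rw [List.mem_cons, List.mem_cons, List.mem_cons] at hc
    rcases hc with rfl | rfl | rfl | hc
    · exact ⟨_, haff 1 1 1 ⟨1, by simpa using one⟩, isCode_extendPerm e (hn _ (by simp))
        fun x => by simp [h0, affinePerm_apply]⟩
    · exact ⟨_, haff m 1 0 hD.one_mem, isCode_extendPerm e (hn _ (by simp))
        fun x => by simp [h1, affinePerm_apply]⟩
    · refine ⟨_, ⟨_, _, ?_, rfl⟩, hw⟩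
      convert one
      ext
      simp [Matrix.GeneralLinearGroup.mkOfDetNeZero]
    · obtain ⟨d, hd, hcd⟩ := exists_of_forall₂_left hcs hc
      exact ⟨_, haff d.1 d.2 0 (hD.mem d hd), isCode_extendPerm e (hn _ (by simp [hc]))
        fun x => by simp [hcd, affinePerm_apply]⟩
  · intro H hH
    have hwH : negInvPerm K ∈ H := hH c₂ (by simp) _ hw
    have hm : affinePerm m 1 0 ∈ H.comap (extendPerm K) :=
      hH c₁ (by simp) _ (isCode_extendPerm e (hn _ (by simp))
        fun x => by simp [h1, affinePerm_apply])
    have ht := affinePerm_translation_mem hm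
      (hH c₀ (by simp) _ (isCode_extendPerm e (hn _ (by simp))
        fun x => by simp [h0, affinePerm_apply])) hD.translation
    have hds : ∀ d ∈ D, affinePerm d.1 d.2 0 ∈ H.comap (extendPerm K) := by
      intro d hd
      obtain ⟨c, hc, hcd⟩ := exists_of_forall₂_right hcs hd
      exact hH c (by simp [hc]) _ (isCode_extendPerm e (hn _ (by simp [hc]))
        fun x => by simp [hcd, affinePerm_apply])
    have key : ∀ (a : Kˣ) σ b d, (∃ v : Kˣ, a * v ^ 2 = d) → C d σ →
        extendPerm K (affinePerm a σ b) ∈ H := by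
      rintro a σ b _ ⟨v, rfl⟩ hC
      exact affinePerm_mem_of_translation_mem ht (hD.generates _ hm hds a σ ⟨v, hC⟩) b
    rintro _ ⟨A, σ, hC, rfl⟩
    by_cases h : A 1 0 = 0
    · obtain ⟨a, b, hab, hv⟩ := moebiusPerm_eq_of_apply_one_zero_eq_zero h σ
      rw [hab]
      exact key _ _ _ _ hv hC
    · obtain ⟨a, b, d, hab, hv⟩ := moebiusPerm_eq_of_apply_one_zero_ne_zero h σ
      rw [hab]
      exact H.mul_mem (H.mul_mem (key _ _ _ _ hv hC) hwH) (ht d)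

end

/-! ### Fields with `8` and `9` elements with explicit tables -/

/-- The binary operation on `Fin n` whose table has the given codes as rows. -/
noncomputable def tableOp {n : ℕ} [NeZero n] (rows : List ℕ) (x y : Fin n) : Fin n :=
  Fin.ofNat n (digit (lookup 0 rows x) y)

/-- The vectors of length `3` over the field with `2` elements, with the multiplication in which
`2` is a root of `t ^ 3 = t + 1`. -/
def F8 : Type := Fin 8

instance : DecidableEq F8 := inferInstanceAs (DecidableEq (Fin 8))

instance : Fintype F8 := inferInstanceAs (Fintype (Fin 8))

noncomputable instance : Add F8 := ⟨tableOp [0x76543210, 0x67452301, 0x54761032, 0x45670123, 0x32107654,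
  0x23016745, 0x10325476, 0x1234567]⟩

noncomputable instance : Mul F8 := ⟨tableOp [0x0, 0x76543210, 0x57136420, 0x21475630, 0x15267340, 0x63724150,
  0x42351760, 0x34612570]⟩

instance : Zero F8 := ⟨(0 : Fin 8)⟩

instance : One F8 := ⟨(1 : Fin 8)⟩

instance : Neg F8 := ⟨fun x => x⟩

noncomputable instance : Field F8 where
  inv := tableOp [0x43276510] (0 : Fin 8)
  nsmul := nsmulRec
  zsmul := zsmulRec
  nnqsmul := _
  qsmul := _
  add_assoc := by decide +kernel
  zero_add := by decide +kernel
  add_zero := by decide +kernel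
  neg_add_cancel := by decide +kernel
  add_comm := by decide +kernel
  mul_assoc := by decide +kernel
  one_mul := by decide +kernel
  mul_one := by decide +kernel
  zero_mul := by decide +kernel
  mul_zero := by decide +kernel
  left_distrib := by decide +kernel
  right_distrib := by decide +kernel
  mul_comm := by decide +kernel
  exists_pair_ne := by decide +kernel
  mul_inv_cancel := by decide +kernel
  inv_zero := by rfl

/-- The vectors of length `2` over the field with `3` elements, with the multiplication in which
`3` is a root of `t ^ 2 = - 1`. -/
def F9 : Type := Fin 9

instance : DecidableEq F9 := inferInstanceAs (DecidableEq (Fin 9))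

instance : Fintype F9 := inferInstanceAs (Fintype (Fin 9))

noncomputable instance : Add F9 := ⟨tableOp [0x876543210, 0x687354021, 0x768435102, 0x210876543, 0x21687354,
  0x102768435, 0x543210876, 0x354021687, 0x435102768]⟩

noncomputable instance : Mul F9 := ⟨tableOp [0x0, 0x876543210, 0x453786120, 0x741852630, 0x327165840, 0x264318750,
  0x582471360, 0x138624570, 0x615237480]⟩

instance : Zero F9 := ⟨(0 : Fin 9)⟩

instance : One F9 := ⟨(1 : Fin 9)⟩

noncomputable instance : Neg F9 := ⟨tableOp [0x453786120] (0 : Fin 9)⟩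

noncomputable instance : Field F9 where
  inv := tableOp [0x783456210] (0 : Fin 9)
  nsmul := nsmulRec
  zsmul := zsmulRec
  nnqsmul := _
  qsmul := _
  add_assoc := by decide +kernel
  zero_add := by decide +kernel
  add_zero := by decide +kernel
  neg_add_cancel := by decide +kernel
  add_comm := by decide +kernel
  mul_assoc := by decide +kernel
  one_mul := by decide +kernel
  mul_one := by decide +kernel
  zero_mul := by decide +kernel
  mul_zero := by decide +kernel
  left_distrib := by decide +kernel
  right_distrib := by decide +kernel
  mul_comm := by decide +kernel
  exists_pair_ne := by decide +kernel
  mul_inv_cancel := by decide +kernel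
  inv_zero := by rfl

theorem nonempty_ringEquiv_of_natCard_eq {K K' : Type*} [Field K] [Field K'] [Finite K] [Finite K']
    (h : Nat.card K = Nat.card K') : Nonempty (K ≃+* K') := by
  have := Fintype.ofFinite K
  have := Fintype.ofFinite K'
  exact ⟨FiniteField.ringEquivOfCardEq (by simpa [Nat.card_eq_fintype_card] using h)⟩

/-- Finite fields of equal order are isomorphic. Statements on the field with eight elements can
thus be decided by its table. -/
theorem nonempty_GF8_ringEquiv : Nonempty (GF8 ≃+* F8) := by
  refine nonempty_ringEquiv_of_natCard_eq ?_
  rw [GaloisField.card 2 3 (by norm_num), Nat.card_eq_fintype_card]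
  rfl

theorem nonempty_GF9_ringEquiv : Nonempty (GF9 ≃+* F9) := by
  refine nonempty_ringEquiv_of_natCard_eq ?_
  rw [card_GF9, Nat.card_eq_fintype_card]
  rfl

/-- The automorphism `x ↦ x ^ p` of a field with `p ^ m` elements. -/
noncomputable def frobeniusAut (p m : ℕ) [Fact p.Prime] : RingAut (GaloisField p m) :=
  (FiniteField.frobeniusAlgEquivOfAlgebraic (ZMod p) (GaloisField p m)).toRingEquiv

theorem frobeniusAut_apply (p m : ℕ) [Fact p.Prime] (x : GaloisField p m) :
    frobeniusAut p m x = x ^ p := by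
  have := congrFun (FiniteField.coe_frobeniusAlgEquivOfAlgebraic (ZMod p) (GaloisField p m)) x
  simp only [ZMod.card] at this
  exact this

/-- A ring automorphism fixes the prime field, so it belongs to the Galois group, which is generated
by the Frobenius map. -/
theorem exists_eq_frobeniusAut_pow (p m : ℕ) [Fact p.Prime] (σ : RingAut (GaloisField p m)) :
    ∃ j : ℕ, σ = frobeniusAut p m ^ j := by
  let s : GaloisField p m ≃ₐ[ZMod p] GaloisField p m :=
    AlgEquiv.ofRingEquiv (f := σ) fun x => by
      obtain ⟨k, rfl⟩ := ZMod.intCast_surjective x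
      simp
  obtain ⟨j, hj⟩ :=
    (FiniteField.bijective_frobeniusAlgEquivOfAlgebraic_pow (ZMod p) (GaloisField p m)).2 s
  refine ⟨j, RingEquiv.ext fun x => ?_⟩
  have h1 : σ x = s x := rfl
  have h2 : ∀ i : ℕ, (frobeniusAut p m ^ i) x =
      (FiniteField.frobeniusAlgEquivOfAlgebraic (ZMod p) (GaloisField p m) ^ i) x := by
    intro i
    induction i with
    | zero => rfl
    | succ i ih => rw [pow_succ', pow_succ', RingAut.mul_apply, AlgEquiv.mul_apply, ih]; rfl
  rw [h1, h2, ← hj]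

/-! ### Groups over fields with explicit tables -/

section

variable {n : ℕ} {K F : Type*} [Field K] [Field F]

/-- The unit corresponding to `u` under an isomorphism of fields. -/
noncomputable def symmUnit (φ : K ≃+* F) {u : F} (hu : u ≠ 0) : Kˣ :=
  Units.mk0 (φ.symm u) (by simpa using hu)

@[simp] theorem coe_symmUnit (φ : K ≃+* F) {u : F} (hu : u ≠ 0) :
    (symmUnit φ hu : K) = φ.symm u := rfl

theorem exists_pow_symmUnit (φ : K ≃+* F) {u : F} (hu : u ≠ 0)
    (h : ∀ y : F, y ≠ 0 → ∃ i : Fin 8, y = u ^ (i : ℕ)) (a : Kˣ) :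
    ∃ i : ℕ, a = symmUnit φ hu ^ i := by
  obtain ⟨i, hi⟩ := h (φ a) (by simp)
  refine ⟨i, Units.ext (φ.injective ?_)⟩
  simp [hi]

theorem exists_pow_symmUnit_of_square (φ : K ≃+* F) {u : F} (hu : u ≠ 0)
    (h : ∀ y : F, y ≠ 0 → ∃ i : Fin 8, y * y = u ^ (i : ℕ)) {a v : Kˣ} (hav : a * v ^ 2 = 1) :
    ∃ i : ℕ, a = symmUnit φ hu ^ i := by
  obtain ⟨i, hi⟩ := h (φ v⁻¹) (by simp)
  refine ⟨i, Units.ext (φ.injective ?_)⟩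
  rw [eq_inv_of_mul_eq_one_left hav]
  simpa [sq] using hi

theorem translation_symmUnit (φ : K ≃+* F) {u : F} (hu : u ≠ 0)
    (h : ∀ y : F, y = 0 ∨ ∃ i j : Fin 8, y = u ^ (i : ℕ) ∨ y = u ^ (i : ℕ) + u ^ (j : ℕ)) (b : K) :
    b = 0 ∨ ∃ i j : Fin 8, b = (symmUnit φ hu : K) ^ (i : ℕ) ∨
      b = (symmUnit φ hu : K) ^ (i : ℕ) + (symmUnit φ hu : K) ^ (j : ℕ) := by
  rcases h (φ b) with h | ⟨i, j, h | h⟩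
  · exact Or.inl (by simpa using h)
  · exact Or.inr ⟨i, j, Or.inl (φ.injective (by simp [h]))⟩
  · exact Or.inr ⟨i, j, Or.inr (φ.injective (by simp [h]))⟩

theorem affinePerm_mul_mem {H : Subgroup (Perm K)} {a c : Kˣ} {σ : RingAut K}
    (ha : affinePerm a 1 0 ∈ H) (hc : affinePerm c σ 0 ∈ H) : affinePerm (a * c) σ 0 ∈ H := by
  have := H.mul_mem ha hc
  rw [affinePerm_mul] at this
  have h : a * Units.map ((1 : RingAut K) : K →* K) c = a * c := by ext; simp
  simpa [h] using this

theorem affinePerm_one_pow_mem {H : Subgroup (Perm K)} {τ : RingAut K}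
    (hτ : affinePerm 1 τ 0 ∈ H) (j : ℕ) : affinePerm 1 (τ ^ j) 0 ∈ H := by
  induction j with
  | zero => rw [pow_zero, affinePerm_one]; exact H.one_mem
  | succ j ih =>
    have := H.mul_mem ih hτ
    rw [affinePerm_mul] at this
    simpa [pow_succ] using this

variable {u : F} {C : Kˣ → RingAut K → Prop}

theorem generatesPairs_nil (φ : K ≃+* F) (hu : u ≠ 0)
    (ht : ∀ y : F, y = 0 ∨ ∃ i j : Fin 8, y = u ^ (i : ℕ) ∨ y = u ^ (i : ℕ) + u ^ (j : ℕ))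
    (h1 : C (symmUnit φ hu) 1) (h : ∀ a σ, C a σ → σ = 1 ∧ ∃ i : ℕ, a = symmUnit φ hu ^ i) :
    GeneratesPairs (symmUnit φ hu) [] C := by
  refine ⟨h1, by simp, translation_symmUnit φ hu ht, fun H hm _ a σ hC => ?_⟩
  obtain ⟨rfl, i, rfl⟩ := h a σ hC
  exact affinePerm_pow_mem hm i

theorem generatesPairs_frobenius (φ : K ≃+* F) (hu : u ≠ 0)
    (ht : ∀ y : F, y = 0 ∨ ∃ i j : Fin 8, y = u ^ (i : ℕ) ∨ y = u ^ (i : ℕ) + u ^ (j : ℕ))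
    {τ : RingAut K} (hτ : ∀ σ : RingAut K, ∃ j : ℕ, σ = τ ^ j)
    (h1 : C (symmUnit φ hu) 1) (h2 : C 1 τ)
    (h : ∀ a σ, C a σ → ∃ i : ℕ, a = symmUnit φ hu ^ i) :
    GeneratesPairs (symmUnit φ hu) [(1, τ)] C := by
  refine ⟨h1, by simpa using h2, translation_symmUnit φ hu ht, fun H hm hD a σ hC => ?_⟩
  obtain ⟨i, rfl⟩ := h a σ hC
  obtain ⟨j, rfl⟩ := hτ σ
  have := affinePerm_mul_mem (affinePerm_pow_mem hm i)
    (affinePerm_one_pow_mem (hD (1, τ) (by simp)) j)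
  rwa [mul_one] at this

section affine

variable {c₀ c₁ c₂ : ℕ}

theorem permIso_AGL1 (φ : K ≃+* F) (code : F ≃ Fin n) (hu : u ≠ 0)
    (h0 : ∀ y, digit c₀ (code y) = code (y + 1)) (h1 : ∀ y, digit c₁ (code y) = code (u * y))
    (h : ∀ y : F, y ≠ 0 → ∃ i : Fin 8, y = u ^ (i : ℕ)) :
    PermIso (AGL1 K) (codeGroup n [c₀, c₁]) := by
  refine permIso_affineLineGroup (φ.toEquiv.trans code) (generatesPairs_nil φ hu ?_ rfl
    fun a σ hσ => ⟨hσ, exists_pow_symmUnit φ hu h a⟩) (fun x => by simpa using h0 (φ x))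
    (fun x => by simpa using h1 (φ x)) .nil
  intro y
  by_cases hy : y = 0
  · exact Or.inl hy
  · obtain ⟨i, hi⟩ := h y hy
    exact Or.inr ⟨i, i, Or.inl hi⟩

theorem permIso_AGammaL1 (φ : K ≃+* F) (code : F ≃ Fin n) (hu : u ≠ 0)
    (h0 : ∀ y, digit c₀ (code y) = code (y + 1)) (h1 : ∀ y, digit c₁ (code y) = code (u * y))
    {p : ℕ} {τ : RingAut K} (hτ : ∀ x, τ x = x ^ p)
    (hτ' : ∀ σ : RingAut K, ∃ j : ℕ, σ = τ ^ j)
    (h2 : ∀ y, digit c₂ (code y) = code (y ^ p))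
    (h : ∀ y : F, y ≠ 0 → ∃ i : Fin 8, y = u ^ (i : ℕ)) :
    PermIso (AGammaL1 K) (codeGroup n [c₀, c₁, c₂]) := by
  refine permIso_affineLineGroup (φ.toEquiv.trans code) (generatesPairs_frobenius φ hu ?_ hτ'
    trivial trivial fun a σ _ => exists_pow_symmUnit φ hu h a) (fun x => by simpa using h0 (φ x))
    (fun x => by simpa using h1 (φ x)) (.cons (fun x => by simpa [hτ] using h2 (φ x)) .nil)
  intro y
  by_cases hy : y = 0
  · exact Or.inl hy
  · obtain ⟨i, hi⟩ := h y hy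
    exact Or.inr ⟨i, i, Or.inl hi⟩

end affine

section projective

variable [DecidableEq K] [DecidableEq F]

theorem PGL2_eq : PGL2 K = projLineGroup (fun _ σ => σ = 1) rfl
    (by rintro _ _ _ _ rfl rfl; simp) (by rintro _ _ rfl; simp) := by
  ext f
  constructor
  · rintro ⟨A, rfl⟩
    exact ⟨A, 1, rfl, by ext z; cases z <;> simp [moebiusPerm_apply]⟩
  · rintro ⟨A, _, rfl, rfl⟩
    exact ⟨A, by ext z; cases z <;> simp [moebiusPerm_apply]⟩

theorem PSL2_eq : PSL2 K = projLineGroup (fun d σ => d = 1 ∧ σ = 1) ⟨rfl, rfl⟩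
    (by rintro _ _ _ _ ⟨rfl, rfl⟩ ⟨rfl, rfl⟩; simp) (by rintro _ _ ⟨rfl, rfl⟩; simp) := by
  ext f
  constructor
  · rintro ⟨A, rfl⟩
    exact ⟨A, 1, ⟨by ext; simp, rfl⟩, by ext z; cases z <;> simp [moebiusPerm_apply]⟩
  · rintro ⟨A, _, ⟨hA, rfl⟩, rfl⟩
    obtain ⟨B, rfl⟩ : ∃ B : SL(2, K), Matrix.SpecialLinearGroup.toGL B = A :=
      ⟨⟨A.val, by simpa using congrArg Units.val hA⟩, by ext i j; rfl⟩
    refine ⟨B, ?_⟩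
    rw [MonoidHom.comp_apply]
    ext z
    cases z <;> simp [moebiusPerm_apply]

/-- The codes describe `x ↦ x + 1`, `x ↦ u x` and `x ↦ - 1 / x`. -/
def IsProjCode (code : F ≃ Fin n) (u : F) (c₀ c₁ c₂ : ℕ) : Prop :=
  (digit c₀ n = n ∧ digit c₁ n = n ∧ digit c₂ n = code 0) ∧
    ∀ y, digit c₀ (code y) = code (y + 1) ∧ digit c₁ (code y) = code (u * y) ∧
      digit c₂ (code y) = if y = 0 then n else code (-y⁻¹)

theorem permIso_projLineGroup_of_isProjCode (φ : K ≃+* F) (code : F ≃ Fin n) (hu : u ≠ 0)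
    {one mul inv} {c₀ c₁ c₂ : ℕ}
    (hc : IsProjCode code u c₀ c₁ c₂) {cs : List ℕ} {D : List (Kˣ × RingAut K)}
    (hD : GeneratesPairs (symmUnit φ hu) D fun a σ => ∃ v : Kˣ, C (a * v ^ 2) σ)
    (hn : ∀ c ∈ cs, digit c n = n)
    (hcs : List.Forall₂ (fun c d => ∀ x : K, digit c (code (φ x)) = code (φ (d.1 * d.2 x))) cs D) :
    PermIso (projLineGroup C one mul inv) (codeGroup (n + 1) (c₀ :: c₁ :: c₂ :: cs)) := by
  obtain ⟨⟨h0, h1, h2⟩, h⟩ := hc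
  refine permIso_projLineGroup (φ.toEquiv.trans code) hD ?_
    (fun x => by simpa using (h (φ x)).1) (fun x => by simpa using (h (φ x)).2.1)
    (by simpa using h2) (fun x => by simpa using (h (φ x)).2.2) (by simpa using hcs)
  intro c hc
  rw [List.mem_cons, List.mem_cons] at hc
  rcases hc with rfl | rfl | hc
  exacts [h0, h1, hn c hc]

variable {c₀ c₁ c₂ c₃ : ℕ}

/-- The unit `u` has to be a square whose powers exhaust the nonzero squares, for instance `4`
modulo `5`, `2` modulo `7` and `squareF9`. -/
theorem permIso_PSL2 (φ : K ≃+* F) (code : F ≃ Fin n) (hu : u ≠ 0)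
    (hc : IsProjCode code u c₀ c₁ c₂)
    (ht : ∀ y : F, y = 0 ∨ ∃ i j : Fin 8, y = u ^ (i : ℕ) ∨ y = u ^ (i : ℕ) + u ^ (j : ℕ))
    (h : ∀ y : F, y ≠ 0 → ∃ i : Fin 8, y * y = u ^ (i : ℕ)) (h1 : ∃ v : F, u * v ^ 2 = 1) :
    PermIso (PSL2 K) (codeGroup (n + 1) [c₀, c₁, c₂]) := by
  rw [PSL2_eq]
  refine permIso_projLineGroup_of_isProjCode φ code hu hc (generatesPairs_nil φ hu ht ?_ ?_)
    (by simp) .nil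
  · obtain ⟨v, hv⟩ := h1
    have hv0 : v ≠ 0 := by rintro rfl; simp at hv
    refine ⟨symmUnit φ hv0, ?_, rfl⟩
    ext
    simp [← map_pow, ← map_mul, hv]
  · rintro a σ ⟨v, hv, rfl⟩
    exact ⟨rfl, exists_pow_symmUnit_of_square φ hu h hv⟩

theorem permIso_PGL2 (φ : K ≃+* F) (code : F ≃ Fin n) (hu : u ≠ 0)
    (hc : IsProjCode code u c₀ c₁ c₂)
    (ht : ∀ y : F, y = 0 ∨ ∃ i j : Fin 8, y = u ^ (i : ℕ) ∨ y = u ^ (i : ℕ) + u ^ (j : ℕ))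
    (h : ∀ y : F, y ≠ 0 → ∃ i : Fin 8, y = u ^ (i : ℕ)) :
    PermIso (PGL2 K) (codeGroup (n + 1) [c₀, c₁, c₂]) := by
  rw [PGL2_eq]
  refine permIso_projLineGroup_of_isProjCode φ code hu hc (generatesPairs_nil φ hu ht ⟨1, rfl⟩ ?_)
    (by simp) .nil
  rintro a σ ⟨v, rfl⟩
  exact ⟨rfl, exists_pow_symmUnit φ hu h a⟩

theorem permIso_PGammaL2_of_generator (φ : K ≃+* F) (code : F ≃ Fin n) (hu : u ≠ 0)
    {p : ℕ} {τ : RingAut K} (hτ : ∀ x, τ x = x ^ p)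
    (hτ' : ∀ σ : RingAut K, ∃ j : ℕ, σ = τ ^ j) (hc : IsProjCode code u c₀ c₁ c₂)
    (h3 : digit c₃ n = n ∧ ∀ y, digit c₃ (code y) = code (y ^ p))
    (ht : ∀ y : F, y = 0 ∨ ∃ i j : Fin 8, y = u ^ (i : ℕ) ∨ y = u ^ (i : ℕ) + u ^ (j : ℕ))
    (h : ∀ y : F, y ≠ 0 → ∃ i : Fin 8, y = u ^ (i : ℕ)) :
    PermIso (PGammaL2 K) (codeGroup (n + 1) [c₀, c₁, c₂, c₃]) := by
  refine permIso_projLineGroup_of_isProjCode φ code hu hc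
    (generatesPairs_frobenius φ hu ht hτ' ⟨1, trivial⟩ ⟨1, trivial⟩
      fun a σ _ => exists_pow_symmUnit φ hu h a) (by simpa using h3.1)
    (.cons (fun x => by simpa [hτ] using h3.2 (φ x)) .nil)

theorem permIso_PSigmaL2 (φ : K ≃+* F) (code : F ≃ Fin n) (hu : u ≠ 0)
    {p : ℕ} {τ : RingAut K} (hτ : ∀ x, τ x = x ^ p)
    (hτ' : ∀ σ : RingAut K, ∃ j : ℕ, σ = τ ^ j) (hc : IsProjCode code u c₀ c₁ c₂)
    (h3 : digit c₃ n = n ∧ ∀ y, digit c₃ (code y) = code (y ^ p))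
    (ht : ∀ y : F, y = 0 ∨ ∃ i j : Fin 8, y = u ^ (i : ℕ) ∨ y = u ^ (i : ℕ) + u ^ (j : ℕ))
    (h : ∀ y : F, y ≠ 0 → ∃ i : Fin 8, y * y = u ^ (i : ℕ)) (h1 : ∃ v : F, u * v ^ 2 = 1) :
    PermIso (PSigmaL2 K) (codeGroup (n + 1) [c₀, c₁, c₂, c₃]) := by
  refine permIso_projLineGroup_of_isProjCode φ code hu hc
    (generatesPairs_frobenius φ hu ht hτ' ?_ ⟨1, by simp⟩ ?_) (by simpa using h3.1)
    (.cons (fun x => by simpa [hτ] using h3.2 (φ x)) .nil)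
  · obtain ⟨v, hv⟩ := h1
    have hv0 : v ≠ 0 := by rintro rfl; simp at hv
    refine ⟨symmUnit φ hv0, ?_⟩
    ext
    simp [← map_pow, ← map_mul, hv]
  · rintro a σ ⟨v, hv⟩
    exact exists_pow_symmUnit_of_square φ hu h hv

end projective

end

/-! ### The groups over the fields with `5`, `7`, `8` and `9` elements -/

theorem permIso_AGL1_five : PermIso (AGL1 (ZMod 5)) (codeGroup 5 gensAGL15) :=
  permIso_AGL1 (RingEquiv.refl (ZMod 5)) (Equiv.refl (Fin 5)) (u := 2) (by decide)
    (by decide +kernel) (by decide +kernel) (by decide +kernel)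

theorem permIso_PSL2_five : PermIso (PSL2 (ZMod 5)) (codeGroup 6 gensPSL25) :=
  permIso_PSL2 (RingEquiv.refl (ZMod 5)) (Equiv.refl (Fin 5)) (u := 4) (by decide)
    (by unfold IsProjCode; decide +kernel) (by decide +kernel) (by decide +kernel)
    (by decide +kernel)

theorem permIso_PGL2_five : PermIso (PGL2 (ZMod 5)) (codeGroup 6 gensPGL25) :=
  permIso_PGL2 (RingEquiv.refl (ZMod 5)) (Equiv.refl (Fin 5)) (u := 2) (by decide)
    (by unfold IsProjCode; decide +kernel) (by decide +kernel) (by decide +kernel)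

theorem permIso_Frobenius21 : PermIso Frobenius21 (codeGroup 7 gensF21) := by
  have h : ∀ y : ZMod 7, y ^ 3 = 1 → ∃ i : Fin 8, y = 2 ^ (i : ℕ) := by decide +kernel
  refine permIso_affineLineGroup (n := 7) (K := ZMod 7) (Equiv.refl (Fin 7)) (generatesPairs_nil
    (RingEquiv.refl (ZMod 7)) (u := 2) (by decide) (by decide +kernel) ⟨?_, rfl⟩ ?_)
    (by decide +kernel) (by unfold symmUnit; decide +kernel) .nil
  rotate_left
  · exact Units.ext (show (2 : ZMod 7) ^ 3 = 1 by decide +kernel)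
  · rintro a σ ⟨ha, rfl⟩
    obtain ⟨i, hi⟩ := h a (by rw [← Units.val_pow_eq_pow_val, ha, Units.val_one])
    exact ⟨rfl, i, Units.ext (by simpa using hi)⟩

theorem permIso_AGL1_seven : PermIso (AGL1 (ZMod 7)) (codeGroup 7 gensAGL17) :=
  permIso_AGL1 (RingEquiv.refl (ZMod 7)) (Equiv.refl (Fin 7)) (u := 3) (by decide)
    (by decide +kernel) (by decide +kernel) (by decide +kernel)

theorem permIso_PSL2_seven : PermIso (PSL2 (ZMod 7)) (codeGroup 8 gensPSL27) :=
  permIso_PSL2 (RingEquiv.refl (ZMod 7)) (Equiv.refl (Fin 7)) (u := 2) (by decide)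
    (by unfold IsProjCode; decide +kernel) (by decide +kernel) (by decide +kernel)
    (by decide +kernel)

theorem permIso_PGL2_seven : PermIso (PGL2 (ZMod 7)) (codeGroup 8 gensPGL27) :=
  permIso_PGL2 (RingEquiv.refl (ZMod 7)) (Equiv.refl (Fin 7)) (u := 3) (by decide)
    (by unfold IsProjCode; decide +kernel) (by decide +kernel) (by decide +kernel)

/-- A primitive element of the field with `8` elements. -/
def generatorF8 : F8 := (2 : Fin 8)

theorem generatorF8_ne_zero : generatorF8 ≠ 0 := by decide +kernel

theorem exists_pow_generatorF8 : ∀ y : F8, y ≠ 0 → ∃ i : Fin 8, y = generatorF8 ^ (i : ℕ) := by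
  decide +kernel

theorem translation_generatorF8 : ∀ y : F8, y = 0 ∨ ∃ i j : Fin 8,
    y = generatorF8 ^ (i : ℕ) ∨ y = generatorF8 ^ (i : ℕ) + generatorF8 ^ (j : ℕ) := by
  decide +kernel

theorem permIso_AGL1_eight : PermIso (AGL1 GF8) (codeGroup 8 gensAGL18) := by
  obtain ⟨φ⟩ := nonempty_GF8_ringEquiv
  exact permIso_AGL1 φ (Equiv.refl (Fin 8)) generatorF8_ne_zero (by decide +kernel)
    (by decide +kernel) exists_pow_generatorF8

theorem permIso_AGammaL1_eight : PermIso (AGammaL1 GF8) (codeGroup 8 gensAGaL18) := by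
  obtain ⟨φ⟩ := nonempty_GF8_ringEquiv
  exact permIso_AGammaL1 φ (Equiv.refl (Fin 8)) generatorF8_ne_zero (by decide +kernel)
    (by decide +kernel) (frobeniusAut_apply 2 3) (exists_eq_frobeniusAut_pow 2 3)
    (by decide +kernel) exists_pow_generatorF8

/-- In characteristic two every element is a square, so a primitive element serves as `u`. -/
theorem permIso_PSL2_eight : PermIso (PSL2 GF8) (codeGroup 9 gensPSL28) := by
  obtain ⟨φ⟩ := nonempty_GF8_ringEquiv
  exact permIso_PSL2 φ (Equiv.refl (Fin 8)) generatorF8_ne_zero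
    (by unfold IsProjCode; decide +kernel) translation_generatorF8 (by decide +kernel)
    (by decide +kernel)

theorem permIso_PGammaL2_eight : PermIso (PGammaL2 GF8) (codeGroup 9 gensPGaL28) := by
  obtain ⟨φ⟩ := nonempty_GF8_ringEquiv
  exact permIso_PGammaL2_of_generator φ (Equiv.refl (Fin 8)) generatorF8_ne_zero
    (frobeniusAut_apply 2 3) (exists_eq_frobeniusAut_pow 2 3)
    (by unfold IsProjCode; decide +kernel) (by decide +kernel) translation_generatorF8
    exists_pow_generatorF8

/-- The numbering of the field with `9` elements. -/
def codeF9 : F9 ≃ Fin 9 := Equiv.refl (Fin 9)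

/-- A primitive element of the field with `9` elements. -/
def generatorF9 : F9 := (4 : Fin 9)

theorem generatorF9_ne_zero : generatorF9 ≠ 0 := by decide +kernel

theorem exists_pow_generatorF9 : ∀ y : F9, y ≠ 0 → ∃ i : Fin 8, y = generatorF9 ^ (i : ℕ) := by
  decide +kernel

/-- The square of `generatorF9`, a square root of `-1`. -/
def squareF9 : F9 := (6 : Fin 9)

theorem squareF9_ne_zero : squareF9 ≠ 0 := by decide +kernel

theorem squareF9_eq : squareF9 = generatorF9 * generatorF9 := by decide +kernel

theorem translation_squareF9 : ∀ y : F9, y = 0 ∨ ∃ i j : Fin 8,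
    y = squareF9 ^ (i : ℕ) ∨ y = squareF9 ^ (i : ℕ) + squareF9 ^ (j : ℕ) := by
  decide +kernel

theorem mul_self_eq_pow_squareF9 : ∀ y : F9, y ≠ 0 → ∃ i : Fin 8, y * y = squareF9 ^ (i : ℕ) := by
  decide +kernel

theorem eq_pow_squareF9 : ∀ y : F9, y ≠ 0 → ∃ i : Fin 8, y = squareF9 ^ (i : ℕ) ∨
    y = squareF9 ^ (i : ℕ) * generatorF9 := by
  decide +kernel

theorem permIso_AGL1_nine : PermIso (AGL1 GF9) (codeGroup 9 gensAGL19) := by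
  obtain ⟨φ⟩ := nonempty_GF9_ringEquiv
  exact permIso_AGL1 φ codeF9 generatorF9_ne_zero (by decide +kernel)
    (by decide +kernel) exists_pow_generatorF9

theorem permIso_AGammaL1_nine : PermIso (AGammaL1 GF9) (codeGroup 9 gensAGaL19) := by
  obtain ⟨φ⟩ := nonempty_GF9_ringEquiv
  exact permIso_AGammaL1 φ codeF9 generatorF9_ne_zero (by decide +kernel)
    (by decide +kernel) (frobeniusAut_apply 3 2) (exists_eq_frobeniusAut_pow 3 2)
    (by decide +kernel) exists_pow_generatorF9

theorem isProjCode_nine : IsProjCode (F := F9) codeF9 squareF9 0x9687354021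
    0x9582471360 0x546873129 := by
  unfold IsProjCode
  decide +kernel

theorem permIso_PSL2_nine : PermIso (PSL2 GF9) (codeGroup 10 gensPSL29) := by
  obtain ⟨φ⟩ := nonempty_GF9_ringEquiv
  exact permIso_PSL2 φ codeF9 squareF9_ne_zero isProjCode_nine
    translation_squareF9 mul_self_eq_pow_squareF9 (by decide +kernel)

theorem permIso_PSigmaL2_nine : PermIso (PSigmaL2 GF9) (codeGroup 10 gensPSiL29) := by
  obtain ⟨φ⟩ := nonempty_GF9_ringEquiv
  exact permIso_PSigmaL2 φ codeF9 squareF9_ne_zero (frobeniusAut_apply 3 2)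
    (exists_eq_frobeniusAut_pow 3 2) isProjCode_nine (by decide +kernel)
    translation_squareF9 mul_self_eq_pow_squareF9 (by decide +kernel)

section

variable (φ : GF9 ≃+* F9)

theorem eq_pow_symmUnit_squareF9 (a : GF9ˣ) :
    ∃ i : ℕ, a = symmUnit φ squareF9_ne_zero ^ i ∨
      a = symmUnit φ squareF9_ne_zero ^ i * symmUnit φ generatorF9_ne_zero := by
  obtain ⟨i, h | h⟩ := eq_pow_squareF9 (φ a) (by simp)
  · exact ⟨i, Or.inl (Units.ext (φ.injective (by simp [h])))⟩
  · exact ⟨i, Or.inr (Units.ext (φ.injective (by simp [h])))⟩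

theorem isSquare_symmUnit_squareF9_pow (i : ℕ) :
    IsSquare ((symmUnit φ squareF9_ne_zero ^ i : GF9ˣ) : GF9) := by
  refine ⟨φ.symm generatorF9 ^ i, ?_⟩
  rw [← mul_pow, ← map_mul, ← squareF9_eq]
  simp

theorem not_isSquare_symmUnit_generatorF9 :
    ¬ IsSquare (symmUnit φ generatorF9_ne_zero : GF9) := by
  rintro ⟨y, hy⟩
  have h : ∀ y : F9, generatorF9 ≠ y * y := by decide +kernel
  refine h (φ y) ?_
  rw [← map_mul, ← hy]
  simp

theorem generatesPairs_mathieuTwist : GeneratesPairs (symmUnit φ squareF9_ne_zero)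
    [(symmUnit φ generatorF9_ne_zero, frobeniusAut 3 2)] MathieuTwist := by
  refine ⟨Or.inl ⟨by simpa using isSquare_symmUnit_squareF9_pow φ 1, rfl⟩, ?_,
    translation_symmUnit φ _ translation_squareF9, ?_⟩
  · rintro _ h
    rw [List.mem_singleton.1 h]
    exact Or.inr ⟨not_isSquare_symmUnit_generatorF9 φ, frobeniusAut_apply 3 2⟩
  · intro H hm hD a σ hC
    obtain ⟨i, rfl | rfl⟩ := eq_pow_symmUnit_squareF9 φ a
    · rcases hC with ⟨-, rfl⟩ | ⟨h, -⟩
      · exact affinePerm_pow_mem hm i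
      · exact absurd (isSquare_symmUnit_squareF9_pow φ i) h
    · rcases hC with ⟨h, -⟩ | ⟨-, h⟩
      · rw [Units.val_mul, isSquare_mul_GF9] at h
        exact absurd (h.1 (isSquare_symmUnit_squareF9_pow φ i))
          (not_isSquare_symmUnit_generatorF9 φ)
      · obtain rfl : σ = frobeniusAut 3 2 := RingEquiv.ext fun x => by rw [h, frobeniusAut_apply]
        exact affinePerm_mul_mem (affinePerm_pow_mem hm i) (hD _ (List.mem_singleton_self _))

/-- Multiplying by a square does not change being a square, so the twist is well defined on
determinants modulo squares. -/
theorem exists_mathieuTwist_mul_sq_iff :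
    (fun a σ => ∃ v : GF9ˣ, MathieuTwist (a * v ^ 2) σ) = MathieuTwist := by
  ext a σ
  have h : ∀ v : GF9ˣ, IsSquare ((a * v ^ 2 : GF9ˣ) : GF9) ↔ IsSquare (a : GF9) := by
    intro v
    rw [Units.val_mul, isSquare_mul_GF9]
    have : IsSquare ((v ^ 2 : GF9ˣ) : GF9) := ⟨v, by simp [sq]⟩
    exact ⟨fun h => h.2 this, fun h => ⟨fun _ => this, fun _ => h⟩⟩
  simp only [MathieuTwist, h, exists_const]

/-- Generators are chosen to extend those of `PSL(2,9)`, so translations come from powers of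
`squareF9`, and the primitive element enters separately to reach the nonsquares. -/
theorem generatesPairs_generatorF9 {C : GF9ˣ → RingAut GF9 → Prop} (h1 : ∀ a, C a 1)
    (h : ∀ a σ, C a σ → σ = 1) : GeneratesPairs (symmUnit φ squareF9_ne_zero)
    [(symmUnit φ generatorF9_ne_zero, 1)] C := by
  refine ⟨h1 _, by simpa using h1 _, translation_symmUnit φ _ translation_squareF9, ?_⟩
  intro H hm hD a σ hC
  obtain rfl := h a σ hC
  obtain ⟨i, rfl | rfl⟩ := eq_pow_symmUnit_squareF9 φ a
  · exact affinePerm_pow_mem hm i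
  · exact affinePerm_mul_mem (affinePerm_pow_mem hm i) (hD _ (List.mem_singleton_self _))

theorem generatesPairs_generatorF9_frobenius {C : GF9ˣ → RingAut GF9 → Prop}
    (h1 : ∀ a σ, C a σ) : GeneratesPairs (symmUnit φ squareF9_ne_zero)
    [(symmUnit φ generatorF9_ne_zero, 1), (1, frobeniusAut 3 2)] C := by
  refine ⟨h1 _ _, by simp [h1], translation_symmUnit φ _ translation_squareF9, ?_⟩
  intro H hm hD a σ hC
  have ha := (generatesPairs_generatorF9 φ (C := fun _ σ => σ = 1) (fun _ => rfl)
    fun _ _ h => h).generates H hm (fun d hd => hD d (by simp_all)) a 1 rfl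
  obtain ⟨j, rfl⟩ := exists_eq_frobeniusAut_pow 3 2 σ
  have := affinePerm_mul_mem ha (affinePerm_one_pow_mem (hD (1, frobeniusAut 3 2) (by simp)) j)
  rwa [mul_one] at this

end

theorem permIso_M9 : PermIso M9 (codeGroup 9 gensM9) := by
  obtain ⟨φ⟩ := nonempty_GF9_ringEquiv
  have h0 : ∀ y : F9, digit 0x687354021 (codeF9 y).val =
    (codeF9 (y + 1)).val := by decide +kernel
  have h1 : ∀ y : F9, digit 0x582471360 (codeF9 y).val =
    (codeF9 (squareF9 * y)).val := by decide +kernel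
  have h2 : ∀ y : F9, digit 0x165327840 (codeF9 y).val =
    (codeF9 (generatorF9 * y ^ 3)).val := by decide +kernel
  exact permIso_affineLineGroup (φ.toEquiv.trans codeF9)
    (generatesPairs_mathieuTwist φ) (fun x => by simpa using h0 (φ x))
    (fun x => by simpa using h1 (φ x))
    (.cons (fun x => by simpa [frobeniusAut_apply] using h2 (φ x)) .nil)

theorem permIso_M10 : PermIso M10 (codeGroup 10 gensM10) := by
  obtain ⟨φ⟩ := nonempty_GF9_ringEquiv
  have h2 : ∀ y : F9, digit 0x9165327840 (codeF9 y).val =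
    (codeF9 (generatorF9 * y ^ 3)).val := by decide +kernel
  refine permIso_projLineGroup_of_isProjCode φ codeF9 squareF9_ne_zero
    isProjCode_nine (exists_mathieuTwist_mul_sq_iff ▸ generatesPairs_mathieuTwist φ)
    (by decide +kernel) (.cons (fun x => by simpa [frobeniusAut_apply] using h2 (φ x)) .nil)

theorem permIso_PGL2_nine : PermIso (PGL2 GF9) (codeGroup 10 gensPGL29) := by
  obtain ⟨φ⟩ := nonempty_GF9_ringEquiv
  have h2 : ∀ y : F9, digit 0x9327165840 (codeF9 y).val =
    (codeF9 (generatorF9 * y)).val := by decide +kernel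
  rw [PGL2_eq]
  refine permIso_projLineGroup_of_isProjCode φ codeF9 squareF9_ne_zero
    isProjCode_nine (generatesPairs_generatorF9 φ (fun a => ⟨1, rfl⟩) ?_)
    (by decide +kernel) (.cons (fun x => by simpa using h2 (φ x)) .nil)
  rintro a σ ⟨v, rfl⟩
  rfl

theorem permIso_PGammaL2_nine : PermIso (PGammaL2 GF9) (codeGroup 10 gensPGaL29) := by
  obtain ⟨φ⟩ := nonempty_GF9_ringEquiv
  have h2 : ∀ y : F9, digit 0x9327165840 (codeF9 y).val =
    (codeF9 (generatorF9 * y)).val := by decide +kernel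
  have h3 : ∀ y : F9, digit 0x9543876210 (codeF9 y).val =
    (codeF9 (y ^ 3)).val := by decide +kernel
  exact permIso_projLineGroup_of_isProjCode φ codeF9 squareF9_ne_zero
    isProjCode_nine (generatesPairs_generatorF9_frobenius φ fun a σ => ⟨1, trivial⟩)
    (by decide +kernel) (.cons (fun x => by simpa using h2 (φ x))
      (.cons (fun x => by simpa [frobeniusAut_apply] using h3 (φ x)) .nil))

/-! ### Affine groups of vector spaces and the group `L(3, 2)` -/

section

variable {n : ℕ}

/-- For groups of matrices it is easier to find every element of `T` inside the group of codes than
to show that particular elements generate `T`. -/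
theorem permIso_codeGroup_of_hasCode {X : Type*} {T : Subgroup (Perm X)} (e : X ≃ Fin n)
    {gens : List ℕ} (hT : ∀ c ∈ gens, ∃ t ∈ T, ∀ x, digit c (e x) = e (t x))
    (hT' : ∀ t ∈ T, ∃ c, HasCode (codeGroup n gens) c ∧ ∀ x, digit c (e x) = e (t x)) :
    PermIso T (codeGroup n gens) := by
  refine permIso_codeGroup e hT fun H hH t ht => ?_
  obtain ⟨c, ⟨g, hg, hgc⟩, hc⟩ := hT' t ht
  have hle : codeGroup n gens ≤ H.comap (e.symm.permCongrHom.toMonoidHom) := by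
    refine (Subgroup.closure_le _).2 ?_
    rintro f ⟨d, hd, hf⟩
    refine hH d hd _ fun x => ?_
    rw [hf]
    simp
  have h : e.symm.permCongrHom g = t := by
    ext x
    apply e.injective
    apply Fin.ext
    rw [← hc, hgc]
    simp
  rw [← h]
  exact hle hg

/-- Some element of `G` acts like `f` on the points of `S`, numbered by `ν`. -/
def Represents (G : Subgroup (Perm (Fin n))) {X : Type*} (S : Set X) (ν : X → ℕ) (f : X → X) :
    Prop :=
  ∃ c, HasCode G c ∧ ∀ x ∈ S, digit c (ν x) = ν (f x)

variable {G : Subgroup (Perm (Fin n))} {X : Type*} {S : Set X} {ν : X → ℕ}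

theorem Represents.comp (hν : ∀ x ∈ S, ν x < n) {f g : X → X} (hf : Represents G S ν f)
    (hg : Represents G S ν g) (hgS : Set.MapsTo g S S) : Represents G S ν (f ∘ g) := by
  obtain ⟨c, hc, hcf⟩ := hf
  obtain ⟨d, hd, hdg⟩ := hg
  refine ⟨_, hc.comp hd, fun x hx => ?_⟩
  rw [_root_.comp, digit_ofDigits16 (fun _ _ => digit_lt _ _) (hν x hx), hdg x hx,
    hcf _ (hgS hx), Function.comp_apply]

theorem represents_of_words (hn : n ≤ 16) {gens : List ℕ} (hv : ∀ c ∈ gens, validCode n c = true)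
    {ws : List (List ℕ)} {f : X → X}
    (h : ∃ w ∈ ws, ∀ x ∈ S, digit (wordCode n gens w) (ν x) = ν (f x)) :
    Represents (codeGroup n gens) S ν f := by
  obtain ⟨w, -, hw⟩ := h
  exact ⟨_, HasCode.word hn (hasCode_codeGroup hv) w, hw⟩

open Matrix

variable {K ι : Type*} [Field K] [Fintype ι] [DecidableEq ι]

/-- Gaussian elimination: a matrix is a product of transvections and one diagonal matrix with the
same determinant, which keeps the argument inside the special linear group when the determinant is
one. -/
theorem represents_mulVec {ν : (ι → K) → ℕ} (hν : ∀ x, ν x < n) (M : Matrix ι ι K)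
    (htr : ∀ i j, i ≠ j → ∀ c : K, Represents G Set.univ ν (transvection i j c *ᵥ ·))
    (hd : ∀ D : ι → K, ∏ i, D i = M.det → Represents G Set.univ ν (diagonal D *ᵥ ·)) :
    Represents G Set.univ ν (M *ᵥ ·) := by
  refine diagonal_transvection_induction (fun M => Represents G Set.univ ν (M *ᵥ ·)) M ?_ ?_ ?_
  · intro D hD
    exact hd D (by rw [← hD, det_diagonal])
  · rintro ⟨i, j, hij, c⟩
    exact htr i j hij c
  · intro A B hA hB
    convert hA.comp (fun x _ => hν x) hB (fun x _ => trivial) using 1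
    ext1 x
    simp [mulVec_mulVec]

/-- On nonzero vectors every factor must be invertible, so that it maps nonzero vectors to nonzero
vectors. -/
theorem represents_mulVec_nonzero {ν : (ι → K) → ℕ} (hν : ∀ x ∈ {x : ι → K | x ≠ 0}, ν x < n)
    (M : Matrix ι ι K) (hM : M.det ≠ 0)
    (htr : ∀ i j, i ≠ j → ∀ c : K, Represents G {x | x ≠ 0} ν (transvection i j c *ᵥ ·))
    (hd : ∀ D : ι → K, ∏ i, D i ≠ 0 → Represents G {x | x ≠ 0} ν (diagonal D *ᵥ ·)) :
    Represents G {x | x ≠ 0} ν (M *ᵥ ·) := by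
  refine diagonal_transvection_induction_of_det_ne_zero
    (fun M => Represents G {x | x ≠ 0} ν (M *ᵥ ·)) M hM ?_ ?_ ?_
  · intro D hD
    exact hd D (by rwa [det_diagonal] at hD)
  · rintro ⟨i, j, hij, c⟩
    exact htr i j hij c
  · intro A B _ hdB hA hB
    convert hA.comp hν hB ?_ using 1
    · ext1 x
      simp [mulVec_mulVec]
    · intro x hx h
      exact hx (eq_zero_of_mulVec_eq_zero hdB h)

theorem exists_mem_ASL (M : Matrix ι ι K) (hM : M.det = 1) (b : ι → K) :
    ∃ t ∈ ASL K (ι → K), ∀ x, t x = M *ᵥ x + b := by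
  let l : (ι → K) ≃ₗ[K] (ι → K) := SpecialLinearGroup.toLin' ⟨M, hM⟩
  refine ⟨_, ⟨l.toAffineEquiv.trans (AffineEquiv.constVAdd K (ι → K) b), ?_, rfl⟩, fun x => ?_⟩
  · ext
    rw [LinearEquiv.coe_det, Units.val_one, ← hM, ← LinearMap.det_toLin']
    rfl
  · exact add_comm _ _

theorem exists_mem_AGL (M : Matrix ι ι K) (hM : M.det ≠ 0) (b : ι → K) :
    ∃ t ∈ AGL K (ι → K), ∀ x, t x = M *ᵥ x + b := by
  have := invertibleOfIsUnitDet M (isUnit_iff_ne_zero.2 hM)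
  refine ⟨_, ⟨(M.toLinearEquiv' this).toAffineEquiv.trans (AffineEquiv.constVAdd K (ι → K) b),
    rfl⟩, fun x => ?_⟩
  exact add_comm _ _

theorem exists_matrix_of_affineEquiv (e : (ι → K) ≃ᵃ[K] (ι → K)) :
    ∃ (M : Matrix ι ι K) (b : ι → K), M.det = (LinearEquiv.det e.linear : K) ∧
      ∀ x, e x = M *ᵥ x + b := by
  refine ⟨LinearMap.toMatrix' (e.linear : (ι → K) →ₗ[K] (ι → K)), e 0, ?_, fun x => ?_⟩
  · rw [LinearEquiv.coe_det, LinearMap.det_toMatrix']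
  · have h := e.map_vadd 0 x
    rw [vadd_eq_add, vadd_eq_add, add_zero] at h
    rw [h]
    congr 1
    exact (LinearMap.toMatrix'_mulVec _ _).symm

theorem represents_affineEquiv {ν : (ι → K) → ℕ} (hν : ∀ x, ν x < n)
    (e : (ι → K) ≃ᵃ[K] (ι → K))
    (htr : ∀ i j, i ≠ j → ∀ c : K, Represents G Set.univ ν (transvection i j c *ᵥ ·))
    (hd : ∀ D : ι → K, ∏ i, D i = (LinearEquiv.det e.linear : K) →
      Represents G Set.univ ν (diagonal D *ᵥ ·))
    (hb : ∀ b, Represents G Set.univ ν (· + b)) : Represents G Set.univ ν e := by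
  obtain ⟨M, b, hM, h⟩ := exists_matrix_of_affineEquiv e
  convert (hb b).comp (fun x _ => hν x) (represents_mulVec hν M htr (hM ▸ hd)) fun x _ => trivial
    using 1
  ext1 x
  simp [h]

end

open Matrix

/-- The numbering of vectors over the field with `2` elements. -/
def vectorCodeTwo : (Fin 3 → ZMod 2) ≃ Fin 8 :=
  (finFunctionFinEquiv : (Fin 3 → Fin 2) ≃ Fin (2 ^ 3))

/-- Some elements as words in the generators. -/
def wordsAffineASL32 : List (List ℕ) :=
  [[], [2], [2, 1, 2, 1, 1, 2, 1, 2, 1, 1], [1, 2, 1, 2, 1, 1, 2, 1, 2, 1], [1, 2, 1, 1],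
  [1, 1, 2, 1], [2, 1, 1, 2, 1, 2, 1, 1, 2, 1], [0], [1, 0, 1, 1], [1, 0, 1, 1, 0], [1, 1, 0, 1],
  [1, 1, 0, 1, 0], [1, 0, 1, 0, 1], [1, 0, 1, 0, 1, 0]]

theorem permIso_ASL_two : PermIso (ASL (ZMod 2) (Fin 3 → ZMod 2)) (codeGroup 8 gensASL32) := by
  have hv : ∀ c ∈ gensASL32, validCode 8 c = true := by decide +kernel
  refine permIso_codeGroup_of_hasCode vectorCodeTwo ?_ ?_
  · have key : ∀ c ∈ gensASL32, ∃ M ∈ [1, !![0, 0, 1; 1, 0, 0; 0, 1, 0],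
        !![1, 1, 0; 0, 1, 0; 0, 0, 1]], ∃ b : Fin 3 → ZMod 2, M.det = 1 ∧
        ∀ x, digit c (vectorCodeTwo x) = vectorCodeTwo (M *ᵥ x + b) := by decide +kernel
    intro c hc
    obtain ⟨M, -, b, hM, h⟩ := key c hc
    obtain ⟨t, ht, htx⟩ := exists_mem_ASL M hM b
    exact ⟨t, ht, fun x => by rw [h, htx]⟩
  · rintro _ ⟨e, he, rfl⟩
    have h1 : ∀ i j : Fin 3, i ≠ j → ∀ c : ZMod 2, ∃ w ∈ wordsAffineASL32, ∀ x ∈ Set.univ,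
        digit (wordCode 8 gensASL32 w) (vectorCodeTwo x) =
          vectorCodeTwo (transvection i j c *ᵥ x) := by decide +kernel
    have h2 : ∀ D : Fin 3 → ZMod 2, ∏ i, D i = 1 → ∃ w ∈ wordsAffineASL32, ∀ x ∈ Set.univ,
        digit (wordCode 8 gensASL32 w) (vectorCodeTwo x) =
          vectorCodeTwo (diagonal D *ᵥ x) := by decide +kernel
    have h3 : ∀ b : Fin 3 → ZMod 2, ∃ w ∈ wordsAffineASL32, ∀ x ∈ Set.univ,
        digit (wordCode 8 gensASL32 w) (vectorCodeTwo x) = vectorCodeTwo (x + b) := by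
      decide +kernel
    obtain ⟨c, hc, h⟩ := represents_affineEquiv (G := codeGroup 8 gensASL32)
      (ν := fun x => vectorCodeTwo x) (fun x => (vectorCodeTwo x).2) e
      (fun i j hij c => represents_of_words (by norm_num) hv (h1 i j hij c))
      (fun D hD => represents_of_words (by norm_num) hv (h2 D (by rw [hD, he, Units.val_one])))
      (fun b => represents_of_words (by norm_num) hv (h3 b))
    exact ⟨c, hc, fun x => h x trivial⟩

/-- The numbering of vectors over the field with `3` elements. -/
def vectorCodeThree : (Fin 2 → ZMod 3) ≃ Fin 9 :=
  (finFunctionFinEquiv : (Fin 2 → Fin 3) ≃ Fin (3 ^ 2))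

/-- Some elements as words in the generators. -/
def wordsAGL23 : List (List ℕ) :=
  [[], [1], [1, 1], [1, 2, 1], [2, 2, 2, 1, 2], [2, 2], [3, 2, 2], [3], [0], [0, 0],
  [2, 0, 2, 2, 2], [2, 0, 2, 2, 2, 0], [2, 0, 2, 0, 2, 2], [2, 2, 2, 0, 2], [2, 2, 2, 0, 2, 0],
  [2, 2, 0, 2, 0, 2]]

theorem permIso_ASL_three : PermIso (ASL (ZMod 3) (Fin 2 → ZMod 3)) (codeGroup 9 gensASL23) := by
  have hv : ∀ c ∈ gensASL23, validCode 9 c = true := by decide +kernel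
  refine permIso_codeGroup_of_hasCode vectorCodeThree ?_ ?_
  · have key : ∀ c ∈ gensASL23, ∃ M ∈ [1, !![1, 1; 0, 1], !![0, 2; 1, 0]],
        ∃ b : Fin 2 → ZMod 3, M.det = 1 ∧
        ∀ x, digit c (vectorCodeThree x) = vectorCodeThree (M *ᵥ x + b) := by decide +kernel
    intro c hc
    obtain ⟨M, -, b, hM, h⟩ := key c hc
    obtain ⟨t, ht, htx⟩ := exists_mem_ASL M hM b
    exact ⟨t, ht, fun x => by rw [h, htx]⟩
  · rintro _ ⟨e, he, rfl⟩
    have h1 : ∀ i j : Fin 2, i ≠ j → ∀ c : ZMod 3, ∃ w ∈ wordsAGL23, ∀ x ∈ Set.univ,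
        digit (wordCode 9 gensASL23 w) (vectorCodeThree x) =
          vectorCodeThree (transvection i j c *ᵥ x) := by decide +kernel
    have h2 : ∀ D : Fin 2 → ZMod 3, ∏ i, D i = 1 → ∃ w ∈ wordsAGL23, ∀ x ∈ Set.univ,
        digit (wordCode 9 gensASL23 w) (vectorCodeThree x) =
          vectorCodeThree (diagonal D *ᵥ x) := by decide +kernel
    have h3 : ∀ b : Fin 2 → ZMod 3, ∃ w ∈ wordsAGL23, ∀ x ∈ Set.univ,
        digit (wordCode 9 gensASL23 w) (vectorCodeThree x) = vectorCodeThree (x + b) := by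
      decide +kernel
    obtain ⟨c, hc, h⟩ := represents_affineEquiv (G := codeGroup 9 gensASL23)
      (ν := fun x => vectorCodeThree x) (fun x => (vectorCodeThree x).2) e
      (fun i j hij c => represents_of_words (by norm_num) hv (h1 i j hij c))
      (fun D hD => represents_of_words (by norm_num) hv (h2 D (by rw [hD, he, Units.val_one])))
      (fun b => represents_of_words (by norm_num) hv (h3 b))
    exact ⟨c, hc, fun x => h x trivial⟩

theorem permIso_AGL_three : PermIso (AGL (ZMod 3) (Fin 2 → ZMod 3)) (codeGroup 9 gensAGL23) := by
  have hv : ∀ c ∈ gensAGL23, validCode 9 c = true := by decide +kernel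
  refine permIso_codeGroup_of_hasCode vectorCodeThree ?_ ?_
  · have key : ∀ c ∈ gensAGL23, ∃ M ∈ [1, !![1, 1; 0, 1], !![0, 2; 1, 0], !![2, 0; 0, 1]],
        ∃ b : Fin 2 → ZMod 3, M.det ≠ 0 ∧
        ∀ x, digit c (vectorCodeThree x) = vectorCodeThree (M *ᵥ x + b) := by decide +kernel
    intro c hc
    obtain ⟨M, -, b, hM, h⟩ := key c hc
    obtain ⟨t, ht, htx⟩ := exists_mem_AGL M hM b
    exact ⟨t, ht, fun x => by rw [h, htx]⟩
  · rintro _ ⟨e, rfl⟩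
    have h1 : ∀ i j : Fin 2, i ≠ j → ∀ c : ZMod 3, ∃ w ∈ wordsAGL23, ∀ x ∈ Set.univ,
        digit (wordCode 9 gensAGL23 w) (vectorCodeThree x) =
          vectorCodeThree (transvection i j c *ᵥ x) := by decide +kernel
    have h2 : ∀ D : Fin 2 → ZMod 3, ∏ i, D i ≠ 0 → ∃ w ∈ wordsAGL23, ∀ x ∈ Set.univ,
        digit (wordCode 9 gensAGL23 w) (vectorCodeThree x) =
          vectorCodeThree (diagonal D *ᵥ x) := by decide +kernel
    have h3 : ∀ b : Fin 2 → ZMod 3, ∃ w ∈ wordsAGL23, ∀ x ∈ Set.univ,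
        digit (wordCode 9 gensAGL23 w) (vectorCodeThree x) = vectorCodeThree (x + b) := by
      decide +kernel
    obtain ⟨c, hc, h⟩ := represents_affineEquiv (G := codeGroup 9 gensAGL23)
      (ν := fun x => vectorCodeThree x) (fun x => (vectorCodeThree x).2) e
      (fun i j hij c => represents_of_words (by norm_num) hv (h1 i j hij c))
      (fun D hD => represents_of_words (by norm_num) hv (h2 D (by rw [hD]; exact Units.ne_zero _)))
      (fun b => represents_of_words (by norm_num) hv (h3 b))
    exact ⟨c, hc, fun x => h x trivial⟩

/-- The point with a given number in the projective plane of order `2`. -/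
def projectivePoint (i : Fin 7) : ℙ (ZMod 2) (Fin 3 → ZMod 2) :=
  Projectivization.mk (ZMod 2) (vectorCodeTwo.symm i.succ) fun h => by
    have h1 : i.succ = vectorCodeTwo 0 := by rw [← h, apply_symm_apply]
    have h2 : vectorCodeTwo 0 = 0 := by decide +kernel
    exact Fin.succ_ne_zero i (h1.trans h2)

theorem projectivization_mk_eq_mk_iff_eq {v w : Fin 3 → ZMod 2} (hv : v ≠ 0) (hw : w ≠ 0) :
    Projectivization.mk (ZMod 2) v hv = Projectivization.mk (ZMod 2) w hw ↔ v = w := by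
  rw [Projectivization.mk_eq_mk_iff]
  have h : ∀ a : (ZMod 2)ˣ, a = 1 := by decide +kernel
  constructor
  · rintro ⟨a, ha⟩
    rw [← ha, h a, one_smul]
  · rintro rfl
    exact ⟨1, one_smul _ _⟩

/-- Over the field with two elements points are nonzero vectors. The zero vector has number `0`, so
all numbers are shifted down by one. -/
theorem exists_projectivePoint_eq (v : Fin 3 → ZMod 2) (hv : v ≠ 0) :
    ∃ i : Fin 7, (i : ℕ) = vectorCodeTwo v - 1 ∧
      projectivePoint i = Projectivization.mk (ZMod 2) v hv := by
  have h0 : vectorCodeTwo 0 = 0 := by decide +kernel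
  have h : vectorCodeTwo v ≠ 0 := fun h => hv (vectorCodeTwo.injective (h.trans h0.symm))
  obtain ⟨i, hi⟩ := Fin.exists_succ_eq.2 h
  refine ⟨i, by rw [← hi]; simp, ?_⟩
  rw [projectivePoint, projectivization_mk_eq_mk_iff_eq, hi, symm_apply_apply]

theorem bijective_projectivePoint : Function.Bijective projectivePoint := by
  constructor
  · intro i j h
    rw [projectivePoint, projectivePoint, projectivization_mk_eq_mk_iff_eq] at h
    exact Fin.succ_injective _ (vectorCodeTwo.symm.injective h)
  · intro p
    obtain ⟨i, -, hi⟩ := exists_projectivePoint_eq p.rep p.rep_nonzero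
    exact ⟨i, hi.trans p.mk_rep⟩

/-- The numbering of the points of the projective plane of order `2`. -/
noncomputable def projectiveCode : ℙ (ZMod 2) (Fin 3 → ZMod 2) ≃ Fin 7 :=
  (Equiv.ofBijective _ bijective_projectivePoint).symm

theorem projectiveCode_mk (v : Fin 3 → ZMod 2) (hv : v ≠ 0) :
    (projectiveCode (Projectivization.mk (ZMod 2) v hv) : ℕ) = vectorCodeTwo v - 1 := by
  obtain ⟨i, hi, h⟩ := exists_projectivePoint_eq v hv
  rw [← h, ← hi]
  exact congrArg Fin.val ((Equiv.ofBijective _ bijective_projectivePoint).symm_apply_apply i)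

theorem digit_projectiveCode (A : SL(3, ZMod 2)) {c : ℕ}
    (h : ∀ x : Fin 3 → ZMod 2, x ≠ 0 →
      digit c (vectorCodeTwo x - 1) = vectorCodeTwo (A.val *ᵥ x) - 1)
    (p : ℙ (ZMod 2) (Fin 3 → ZMod 2)) :
    digit c (projectiveCode p) =
      projectiveCode (MulAction.toPermHom SL(3, ZMod 2) (ℙ (ZMod 2) (Fin 3 → ZMod 2)) A p) := by
  induction p using Projectivization.ind with | h v hv =>
  rw [MulAction.toPermHom_apply, MulAction.toPerm_apply, Projectivization.smul_mk,
    projectiveCode_mk, projectiveCode_mk, h v hv]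
  rfl

/-- Some elements as words in the generators. -/
def wordsTransvectionsL32 : List (List ℕ) :=
  [[], [1], [1, 0, 1, 0, 0, 1, 0, 1, 0, 0], [0, 1, 0, 1, 0, 0, 1, 0, 1, 0], [0, 1, 0, 0],
  [0, 0, 1, 0], [1, 0, 0, 1, 0, 1, 0, 0, 1, 0]]

theorem permIso_L32 : PermIso L32 (codeGroup 7 gensL32) := by
  have hv : ∀ c ∈ gensL32, validCode 7 c = true := by decide +kernel
  refine permIso_codeGroup_of_hasCode projectiveCode ?_ ?_
  · have key : ∀ c ∈ gensL32, ∃ M ∈ [!![0, 0, 1; 1, 0, 0; 0, 1, 0],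
        !![1, 1, 0; 0, 1, 0; 0, 0, 1]], M.det = (1 : ZMod 2) ∧ ∀ x : Fin 3 → ZMod 2, x ≠ 0 →
        digit c (vectorCodeTwo x - 1) = vectorCodeTwo (M *ᵥ x) - 1 := by decide +kernel
    intro c hc
    obtain ⟨M, -, hM, h⟩ := key c hc
    exact ⟨_, ⟨⟨M, hM⟩, rfl⟩, digit_projectiveCode ⟨M, hM⟩ h⟩
  · rintro _ ⟨A, rfl⟩
    have h0 : ∀ x ∈ {x : Fin 3 → ZMod 2 | x ≠ 0}, (vectorCodeTwo x : ℕ) - 1 < 7 := by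
      intro x _
      omega
    have h1 : ∀ i j : Fin 3, i ≠ j → ∀ c : ZMod 2, ∃ w ∈ wordsTransvectionsL32,
        ∀ x : Fin 3 → ZMod 2, x ≠ 0 → digit (wordCode 7 gensL32 w) (vectorCodeTwo x - 1) =
          vectorCodeTwo (transvection i j c *ᵥ x) - 1 := by decide +kernel
    have h2 : ∀ D : Fin 3 → ZMod 2, ∏ i, D i ≠ 0 → ∃ w ∈ wordsTransvectionsL32,
        ∀ x : Fin 3 → ZMod 2, x ≠ 0 → digit (wordCode 7 gensL32 w) (vectorCodeTwo x - 1) =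
          vectorCodeTwo (diagonal D *ᵥ x) - 1 := by decide +kernel
    obtain ⟨c, hc, h⟩ := represents_mulVec_nonzero (G := codeGroup 7 gensL32)
      (ν := fun x => vectorCodeTwo x - 1) h0 A.val (by rw [A.2]; exact one_ne_zero)
      (fun i j hij c => represents_of_words (by norm_num) hv (h1 i j hij c))
      (fun D hD => represents_of_words (by norm_num) hv (h2 D hD))
    exact ⟨c, hc, digit_projectiveCode A h⟩

/-! ### The alternating group -/

/-- As `k < n`, some part contains distinct points `x` and `y`. Map the tuple to a section through
`x`, with `x` first and `y` last, by a permutation `g`. If `g` is odd, compose it with the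
transposition of `x` and `y`, which preserves all parts. -/
theorem hasStrongUT_alternatingGroup {n k : ℕ} (hk : 2 ≤ k) (hkn : 2 * k ≤ n) :
    HasStrongUT (alternatingGroup (Fin n)) k := by
  have hn : 3 ≤ Nat.card (Fin n) := by simp; omega
  refine ⟨alternatingGroup.isPreprimitive_of_three_le_card (Fin n) hn, fun a ha P hP => ?_⟩
  obtain ⟨x, y, hxy, hne⟩ : ∃ x y, P x = P y ∧ x ≠ y := by
    by_contra! h
    have := Fintype.card_le_of_injective P h
    simp at this
    omega
  let z : Fin k := ⟨0, by omega⟩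
  obtain ⟨s, hs⟩ := hP.hasRightInverse
  let t := Function.update s (P x) x
  have ht : ∀ i, P (t i) = i := by
    intro i
    by_cases h : i = P x
    · simp [t, h]
    · simp [t, h, hs i]
  -- The transposition of indices puts the part of `x` first, so that `b 0 = x`; the last entry is
  -- `y`.
  let b : Fin (k + 1) → Fin n := Fin.snoc (fun i => t (swap z (P x) i)) y
  have hb1 : ∀ i : Fin k, b i.castSucc = t (swap z (P x) i) := fun i => by simp [b]
  have hb2 : b (Fin.last k) = y := by simp [b]
  have hb : Function.Injective b := by
    have hy : ∀ i : Fin k, b i.castSucc ≠ y := by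
      intro i h
      have h1 : swap z (P x) i = P x := by rw [← ht (swap z (P x) i), ← hb1, h, hxy]
      rw [hb1, h1] at h
      exact hne (by simpa [t] using h)
    intro i j
    induction i using Fin.lastCases with
    | last =>
      induction j using Fin.lastCases with
      | last => exact fun _ => rfl
      | cast j => exact fun h => absurd (h.symm.trans hb2) (hy j)
    | cast i =>
      induction j using Fin.lastCases with
      | last => exact fun h => absurd (h.trans hb2) (hy i)
      | cast j =>
        intro h
        rw [hb1, hb1] at h
        have := congrArg P h
        rw [ht, ht] at this
        rw [(swap z (P x)).injective this]
  have key : ∀ g : Perm (Fin n), (∀ i, P (g (a i)) = P (b i)) →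
      IsSectionFor (g '' {x | ∃ i : Fin k, x = a i.castSucc}) P ∧
        P (g (a 0)) = P (g (a (Fin.last k))) := by
    intro g hg
    have hg' : ∀ i : Fin k, P (g (a i.castSucc)) = swap z (P x) i := fun i => by
      rw [hg, hb1, ht]
    refine ⟨fun i => ⟨g (a (Fin.castSucc (swap z (P x) i))), ⟨⟨_, ⟨_, rfl⟩, rfl⟩, ?_⟩, ?_⟩, ?_⟩
    · rw [hg', swap_apply_self]
    · rintro _ ⟨⟨_, ⟨j, rfl⟩, rfl⟩, hj⟩
      rw [← hj, hg', swap_apply_self]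
    · have h0 : (0 : Fin (k + 1)) = z.castSucc := rfl
      rw [hg, hg, hb2, h0, hb1, ht, swap_apply_left, hxy]
  obtain ⟨g, hg⟩ := (Perm.isMultiplyPretransitive (Fin n) (k + 1)).exists_smul_eq ⟨a, ha⟩ ⟨b, hb⟩
  have hgab : ∀ i, g (a i) = b i := fun i => DFunLike.congr_fun hg i
  have hP' : ∀ v, P (swap x y v) = P v := by
    intro v
    rw [swap_apply_def]
    split_ifs with h1 h2
    · rw [h1, hxy]
    · rw [h2, hxy]
    · rfl
  rcases Int.units_eq_one_or (Perm.sign g) with h | h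
  · exact ⟨g, h, key g fun i => by rw [hgab]⟩
  · refine ⟨swap x y * g, ?_, key _ fun i => by rw [Perm.mul_apply, hP', hgab]⟩
    rw [Perm.mem_alternatingGroup, Perm.sign_mul, Perm.sign_swap hne, h]
    rfl

/-! ### The classification by degree -/

theorem HasStrongUT.of_permIso_model {X : Type*} {n m k : ℕ} {G : Subgroup (Perm (Fin n))}
    {M : Subgroup (Perm X)} {H : Subgroup (Perm (Fin m))} (hH : HasStrongUT H k)
    (hM : PermIso M H) (hG : PermIso G M) : HasStrongUT G k :=
  HasStrongUT.of_permIso (hG.trans hM).symm hH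

section

variable {n k : ℕ} {G : Subgroup (Perm (Fin n))}

/-- The property is also transported to the listed group, so that the excluded values of `k` can be
removed there. -/
theorem HasStrongUT.alternatingGroup_le_or_exists_permIso (hn : n < 11) (hk : 2 ≤ k)
    (hkn : 2 * k ≤ n) (hG : HasStrongUT G k) {L : List (List ℕ)}
    (hL : IsGood G → IsClassified L G) :
    alternatingGroup (Fin n) ≤ G ∨
      ∃ gens ∈ L, PermIso G (codeGroup n gens) ∧ HasStrongUT (codeGroup n gens) k := by
  rcases hG.alternatingGroup_le_or_twoHomogeneous hn hk hkn with h | h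
  · exact Or.inl h
  · rcases hL ⟨hG.primitive, h⟩ with h | ⟨gens, hgens, h⟩
    · exact Or.inl h
    · exact Or.inr ⟨gens, hgens, h, hG.of_permIso h⟩

end

theorem HasStrongUT.classification_four {k : ℕ} {G : Subgroup (Perm (Fin 4))} (hk : 2 ≤ k)
    (hkn : 2 * k ≤ 4) (hG : HasStrongUT G k) : alternatingGroup (Fin 4) ≤ G := by
  rcases hG.alternatingGroup_le_or_exists_permIso (by norm_num) hk hkn isClassified_four with
    h | ⟨gens, hgens, -⟩
  · exact h
  · simp at hgens

theorem HasStrongUT.classification_five {k : ℕ} {G : Subgroup (Perm (Fin 5))} (hk : 2 ≤ k)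
    (hkn : 2 * k ≤ 5) (hG : HasStrongUT G k) :
    alternatingGroup (Fin 5) ≤ G ∨ (k = 2 ∧ PermIso G (AGL1 (ZMod 5))) := by
  rcases hG.alternatingGroup_le_or_exists_permIso (by norm_num) hk hkn isClassified_five with
    h | ⟨gens, hgens, h, -⟩
  · exact Or.inl h
  · rw [List.mem_singleton.1 hgens] at h
    exact Or.inr ⟨by omega, h.trans permIso_AGL1_five.symm⟩

theorem HasStrongUT.classification_six {k : ℕ} {G : Subgroup (Perm (Fin 6))} (hk : 2 ≤ k)
    (hkn : 2 * k ≤ 6) (hG : HasStrongUT G k) :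
    alternatingGroup (Fin 6) ≤ G ∨
      (k = 2 ∧ (PermIso G (PSL2 (ZMod 5)) ∨ PermIso G (PGL2 (ZMod 5)))) := by
  rcases hG.alternatingGroup_le_or_exists_permIso (by norm_num) hk hkn isClassified_six with
    h | ⟨gens, hgens, h, hut⟩
  · exact Or.inl h
  · refine Or.inr ⟨?_, ?_⟩
    · obtain rfl | rfl : k = 2 ∨ k = 3 := by omega
      · rfl
      · exact absurd hut (not_hasStrongUT_triples_PGL25 _ hgens)
    · simp only [List.mem_cons, List.not_mem_nil, or_false] at hgens
      rcases hgens with rfl | rfl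
      · exact Or.inl (h.trans permIso_PSL2_five.symm)
      · exact Or.inr (h.trans permIso_PGL2_five.symm)

theorem HasStrongUT.classification_seven {k : ℕ} {G : Subgroup (Perm (Fin 7))} (hk : 2 ≤ k)
    (hkn : 2 * k ≤ 7) (hG : HasStrongUT G k) :
    alternatingGroup (Fin 7) ≤ G ∨
      (k = 2 ∧ (PermIso G Frobenius21 ∨ PermIso G (AGL1 (ZMod 7)) ∨ PermIso G L32)) := by
  rcases hG.alternatingGroup_le_or_exists_permIso (by norm_num) hk hkn isClassified_seven with
    h | ⟨gens, hgens, h, hut⟩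
  · exact Or.inl h
  · simp only [List.mem_cons, List.not_mem_nil, or_false] at hgens
    refine Or.inr ⟨?_, ?_⟩
    · obtain rfl | rfl : k = 2 ∨ k = 3 := by omega
      · rfl
      · rcases hgens with rfl | rfl | rfl
        · exact absurd hut (not_hasStrongUT_triples_AGL17 _ (by simp))
        · exact absurd hut (not_hasStrongUT_triples_AGL17 _ (by simp))
        · exact absurd hut not_hasStrongUT_triples_L32
    · rcases hgens with rfl | rfl | rfl
      · exact Or.inl (h.trans permIso_Frobenius21.symm)
      · exact Or.inr (Or.inl (h.trans permIso_AGL1_seven.symm))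
      · exact Or.inr (Or.inr (h.trans permIso_L32.symm))

theorem HasStrongUT.classification_eight {k : ℕ} {G : Subgroup (Perm (Fin 8))} (hk : 2 ≤ k)
    (hkn : 2 * k ≤ 8) (hG : HasStrongUT G k) :
    alternatingGroup (Fin 8) ≤ G ∨ (k = 2 ∧ PermIso G (AGL1 GF8)) ∨
      ((k = 2 ∨ k = 3) ∧ (PermIso G (AGammaL1 GF8) ∨ PermIso G (ASL (ZMod 2) (Fin 3 → ZMod 2)) ∨
          PermIso G (PSL2 (ZMod 7)) ∨ PermIso G (PGL2 (ZMod 7)))) := by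
  rcases hG.alternatingGroup_le_or_exists_permIso (by norm_num) hk hkn isClassified_eight with
    h | ⟨gens, hgens, h, hut⟩
  · exact Or.inl h
  · refine Or.inr ?_
    simp only [List.mem_cons, List.not_mem_nil, or_false] at hgens
    have hk4 : k ≠ 4 := by
      rintro rfl
      rcases hgens with rfl | rfl | rfl | rfl | rfl
      iterate 3 exact not_hasStrongUT_quadruples_ASL32 _ (by simp) hut
      iterate 2 exact not_hasStrongUT_quadruples_PGL27 _ (by simp) hut
    have hk23 : k = 2 ∨ k = 3 := by omega
    rcases hgens with rfl | rfl | rfl | rfl | rfl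
    · refine Or.inl ⟨hk23.resolve_right ?_, h.trans permIso_AGL1_eight.symm⟩
      rintro rfl
      exact not_hasStrongUT_triples_AGL18 hut
    · exact Or.inr ⟨hk23, Or.inl (h.trans permIso_AGammaL1_eight.symm)⟩
    · exact Or.inr ⟨hk23, Or.inr (Or.inl (h.trans permIso_ASL_two.symm))⟩
    · exact Or.inr ⟨hk23, Or.inr (Or.inr (Or.inl (h.trans permIso_PSL2_seven.symm)))⟩
    · exact Or.inr ⟨hk23, Or.inr (Or.inr (Or.inr (h.trans permIso_PGL2_seven.symm)))⟩

theorem HasStrongUT.classification_nine {k : ℕ} {G : Subgroup (Perm (Fin 9))} (hk : 2 ≤ k)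
    (hkn : 2 * k ≤ 9) (hG : HasStrongUT G k) :
    alternatingGroup (Fin 9) ≤ G ∨
      (k = 2 ∧ (PermIso G M9 ∨ PermIso G (AGL1 GF9) ∨ PermIso G (AGammaL1 GF9) ∨
        PermIso G (ASL (ZMod 3) (Fin 2 → ZMod 3)) ∨ PermIso G (AGL (ZMod 3) (Fin 2 → ZMod 3)))) ∨
      ((k = 2 ∨ k = 3) ∧ PermIso G (PSL2 GF8)) ∨
      ((k = 2 ∨ k = 3 ∨ k = 4) ∧ PermIso G (PGammaL2 GF8)) := by
  rcases hG.alternatingGroup_le_or_exists_permIso (by norm_num) hk hkn isClassified_nine with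
    h | ⟨gens, hgens, h, hut⟩
  · exact Or.inl h
  · refine Or.inr ?_
    have hk234 : k = 2 ∨ k = 3 ∨ k = 4 := by omega
    have haff : gens ∈ [gensM9, gensAGL19, gensAGaL19, gensASL23, gensAGL23] → k = 2 := by
      intro hm
      rcases hk234 with rfl | rfl | rfl
      · rfl
      · exact absurd hut (not_hasStrongUT_triples_AGL23 _ hm)
      · exact absurd hut (not_hasStrongUT_quadruples_AGL23 _ hm)
    simp only [gensNine, List.mem_cons, List.not_mem_nil, or_false] at hgens
    rcases hgens with rfl | rfl | rfl | rfl | rfl | rfl | rfl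
    · exact Or.inl ⟨haff (by simp), Or.inr (Or.inl (h.trans permIso_AGL1_nine.symm))⟩
    · exact Or.inl ⟨haff (by simp),
        Or.inr (Or.inr (Or.inl (h.trans permIso_AGammaL1_nine.symm)))⟩
    · exact Or.inl ⟨haff (by simp), Or.inl (h.trans permIso_M9.symm)⟩
    · exact Or.inl ⟨haff (by simp),
        Or.inr (Or.inr (Or.inr (Or.inl (h.trans permIso_ASL_three.symm))))⟩
    · exact Or.inl ⟨haff (by simp),
        Or.inr (Or.inr (Or.inr (Or.inr (h.trans permIso_AGL_three.symm))))⟩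
    · refine Or.inr (Or.inl ⟨?_, h.trans permIso_PSL2_eight.symm⟩)
      rcases hk234 with h | h | rfl
      · exact Or.inl h
      · exact Or.inr h
      · exact absurd hut not_hasStrongUT_quadruples_PSL28
    · exact Or.inr (Or.inr ⟨hk234, h.trans permIso_PGammaL2_eight.symm⟩)

theorem HasStrongUT.classification_ten {k : ℕ} {G : Subgroup (Perm (Fin 10))} (hk : 2 ≤ k)
    (hkn : 2 * k ≤ 10) (hG : HasStrongUT G k) :
    alternatingGroup (Fin 10) ≤ G ∨
      (k = 2 ∧ (PermIso G (PSL2 GF9) ∨ PermIso G (PSigmaL2 GF9))) ∨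
      ((k = 2 ∨ k = 3) ∧
        (PermIso G (PGL2 GF9) ∨ PermIso G M10 ∨ PermIso G (PGammaL2 GF9))) := by
  rcases hG.alternatingGroup_le_or_exists_permIso (by norm_num) hk hkn isClassified_ten with
    h | ⟨gens, hgens, h, hut⟩
  · exact Or.inl h
  · refine Or.inr ?_
    have hk23 : k = 2 ∨ k = 3 := by
      obtain h | h | rfl | rfl : k = 2 ∨ k = 3 ∨ k = 4 ∨ k = 5 := by omega
      · exact Or.inl h
      · exact Or.inr h
      · exact absurd hut (not_hasStrongUT_quadruples_PGaL29 _ hgens)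
      · exact absurd hut (not_hasStrongUT_quintuples_PGaL29 _ hgens)
    have hk2 : gens ∈ [gensPSL29, gensPSiL29] → k = 2 := by
      intro hm
      refine hk23.resolve_right ?_
      rintro rfl
      exact not_hasStrongUT_triples_PSiL29 _ hm hut
    simp only [gensTen, List.mem_cons, List.not_mem_nil, or_false] at hgens
    rcases hgens with rfl | rfl | rfl | rfl | rfl
    · exact Or.inl ⟨hk2 (by simp), Or.inl (h.trans permIso_PSL2_nine.symm)⟩
    · exact Or.inr ⟨hk23, Or.inl (h.trans permIso_PGL2_nine.symm)⟩
    · exact Or.inl ⟨hk2 (by simp), Or.inr (h.trans permIso_PSigmaL2_nine.symm)⟩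
    · exact Or.inr ⟨hk23, Or.inr (Or.inl (h.trans permIso_M10.symm))⟩
    · exact Or.inr ⟨hk23, Or.inr (Or.inr (h.trans permIso_PGammaL2_nine.symm))⟩

theorem mainTheorem12 (n k : ℕ) (hn : n < 11) (hk : 2 ≤ k) (hkn : 2 * k ≤ n)
    (G : Subgroup (Equiv.Perm (Fin n))) :
    HasStrongUT G k ↔
      alternatingGroup (Fin n) ≤ G ∨
      (n = 5 ∧ k = 2 ∧ PermIso G (AGL1 (ZMod 5))) ∨
      (n = 6 ∧ k = 2 ∧ (PermIso G (PSL2 (ZMod 5)) ∨ PermIso G (PGL2 (ZMod 5)))) ∨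
      (n = 7 ∧ k = 2 ∧
        (PermIso G Frobenius21 ∨ PermIso G (AGL1 (ZMod 7)) ∨ PermIso G L32)) ∨
      (n = 8 ∧ k = 2 ∧
        (PermIso G (AGL1 GF8) ∨ PermIso G (AGammaL1 GF8) ∨
          PermIso G (ASL (ZMod 2) (Fin 3 → ZMod 2)) ∨
          PermIso G (PSL2 (ZMod 7)) ∨ PermIso G (PGL2 (ZMod 7)))) ∨
      (n = 8 ∧ k = 3 ∧
        (PermIso G (AGammaL1 GF8) ∨ PermIso G (ASL (ZMod 2) (Fin 3 → ZMod 2)) ∨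
          PermIso G (PSL2 (ZMod 7)) ∨ PermIso G (PGL2 (ZMod 7)))) ∨
      (n = 9 ∧ k = 2 ∧
        (PermIso G M9 ∨ PermIso G (AGL1 GF9) ∨ PermIso G (AGammaL1 GF9) ∨
          PermIso G (ASL (ZMod 3) (Fin 2 → ZMod 3)) ∨
          PermIso G (AGL (ZMod 3) (Fin 2 → ZMod 3)) ∨
          PermIso G (PSL2 GF8) ∨ PermIso G (PGammaL2 GF8))) ∨
      (n = 9 ∧ ((k = 3 ∧ PermIso G (PSL2 GF8)) ∨
        ((k = 3 ∨ k = 4) ∧ PermIso G (PGammaL2 GF8)))) ∨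
      (n = 10 ∧ k = 2 ∧
        (PermIso G (PSL2 GF9) ∨ PermIso G (PGL2 GF9) ∨ PermIso G (PSigmaL2 GF9) ∨
          PermIso G M10 ∨ PermIso G (PGammaL2 GF9))) ∨
      (n = 10 ∧ k = 3 ∧
        (PermIso G (PGL2 GF9) ∨ PermIso G M10 ∨ PermIso G (PGammaL2 GF9))) := by
  constructor
  · intro hG
    have hn4 : 4 ≤ n := by omega
    interval_cases n
    · exact Or.inl (hG.classification_four hk hkn)
    · rcases hG.classification_five hk hkn with h | ⟨rfl, h⟩ <;> simp [h]
    · rcases hG.classification_six hk hkn with h | ⟨rfl, h⟩ <;> simp [h]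
    · rcases hG.classification_seven hk hkn with h | ⟨rfl, h⟩ <;> simp [h]
    · rcases hG.classification_eight hk hkn with h | ⟨rfl, h⟩ | ⟨rfl | rfl, h⟩ <;> simp [h]
    · rcases hG.classification_nine hk hkn with h | ⟨rfl, h | h | h | h | h⟩ | ⟨rfl | rfl, h⟩ |
        ⟨rfl | rfl | rfl, h⟩ <;> simp [h]
    · rcases hG.classification_ten hk hkn with h | ⟨rfl, h | h⟩ | ⟨rfl | rfl, h | h | h⟩ <;> simp [h]
  · rintro (h | ⟨rfl, rfl, h⟩ | ⟨rfl, rfl, h | h⟩ | ⟨rfl, rfl, h | h | h⟩ |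
      ⟨rfl, rfl, h | h | h | h | h⟩ | ⟨rfl, rfl, h | h | h | h⟩ |
      ⟨rfl, rfl, h | h | h | h | h | h | h⟩ | ⟨rfl, ⟨rfl, h⟩ | ⟨rfl | rfl, h⟩⟩ |
      ⟨rfl, rfl, h | h | h | h | h⟩ | ⟨rfl, rfl, h | h | h⟩)
    · exact (hasStrongUT_alternatingGroup hk hkn).mono h
    · exact hasStrongUT_pairs_AGL15.of_permIso_model permIso_AGL1_five h
    · exact hasStrongUT_pairs_PSL25.of_permIso_model permIso_PSL2_five h
    · exact hasStrongUT_pairs_PGL25.of_permIso_model permIso_PGL2_five h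
    · exact hasStrongUT_pairs_F21.of_permIso_model permIso_Frobenius21 h
    · exact hasStrongUT_pairs_AGL17.of_permIso_model permIso_AGL1_seven h
    · exact hasStrongUT_pairs_L32.of_permIso_model permIso_L32 h
    · exact hasStrongUT_pairs_AGL18.of_permIso_model permIso_AGL1_eight h
    · exact hasStrongUT_pairs_AGaL18.of_permIso_model permIso_AGammaL1_eight h
    · exact hasStrongUT_pairs_ASL32.of_permIso_model permIso_ASL_two h
    · exact hasStrongUT_pairs_PSL27.of_permIso_model permIso_PSL2_seven h
    · exact hasStrongUT_pairs_PGL27.of_permIso_model permIso_PGL2_seven h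
    · exact hasStrongUT_triples_AGaL18.of_permIso_model permIso_AGammaL1_eight h
    · exact hasStrongUT_triples_ASL32.of_permIso_model permIso_ASL_two h
    · exact hasStrongUT_triples_PSL27.of_permIso_model permIso_PSL2_seven h
    · exact hasStrongUT_triples_PGL27.of_permIso_model permIso_PGL2_seven h
    · exact hasStrongUT_pairs_M9.of_permIso_model permIso_M9 h
    · exact hasStrongUT_pairs_AGL19.of_permIso_model permIso_AGL1_nine h
    · exact hasStrongUT_pairs_AGaL19.of_permIso_model permIso_AGammaL1_nine h
    · exact hasStrongUT_pairs_ASL23.of_permIso_model permIso_ASL_three h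
    · exact hasStrongUT_pairs_AGL23.of_permIso_model permIso_AGL_three h
    · exact hasStrongUT_pairs_PSL28.of_permIso_model permIso_PSL2_eight h
    · exact hasStrongUT_pairs_PGaL28.of_permIso_model permIso_PGammaL2_eight h
    · exact hasStrongUT_triples_PSL28.of_permIso_model permIso_PSL2_eight h
    · exact hasStrongUT_triples_PGaL28.of_permIso_model permIso_PGammaL2_eight h
    · exact hasStrongUT_quadruples_PGaL28.of_permIso_model permIso_PGammaL2_eight h
    · exact hasStrongUT_pairs_PSL29.of_permIso_model permIso_PSL2_nine h
    · exact hasStrongUT_pairs_PGL29.of_permIso_model permIso_PGL2_nine h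
    · exact hasStrongUT_pairs_PSiL29.of_permIso_model permIso_PSigmaL2_nine h
    · exact hasStrongUT_pairs_M10.of_permIso_model permIso_M10 h
    · exact hasStrongUT_pairs_PGaL29.of_permIso_model permIso_PGammaL2_nine h
    · exact hasStrongUT_triples_PGL29.of_permIso_model permIso_PGL2_nine h
    · exact hasStrongUT_triples_M10.of_permIso_model permIso_M10 h
    · exact hasStrongUT_triples_PGaL29.of_permIso_model permIso_PGammaL2_nine h
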